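/- Let $0<a<b$ and $\Upsilon_0\in\mathbb R$, let $H(t)=1$ for $t>0$, $H(t)=0$ for $t\le 0$, and $\Upsilon=\Upsilon_0H$. Let ${}_0D_t^\alpha y(t)=\frac1{\Gamma(1-\alpha)}\frac{d}{dt}\int_0^t\frac{y(\tau)}{(t-\tau)^\alpha}d\tau$ $(0\le\alpha<1)$ and $(f*g)(t)=\int_0^tf(\tau)g(t-\tau)\,d\tau$. For $s\in D=\mathbb C\setminus(-\infty,0]$ put $$M(s)=\sqrt{\frac{\ln(bs)}{\ln(as)}\,\frac{as-1}{bs-1}},\qquad \tilde P(x,s)=\frac{\sinh(xsM(s))}{\sinh(sM(s))}$$ (principal branches, removable singularities of $M$ at $s=1/a,1/b$ removed), and let $M(qe^{\pm i\pi})$, $q>0$, be the boundary values of $M$ at $-q$ from above and below. Consider real functions $u,\sigma,\mathcal E$ of $(x,t)\in[0,1]\times\mathbb R$ with $$\partial_x\sigma=\partial_t^2u,\qquad \int_0^1a^\alpha\,{}_0D_t^\alpha\sigma\,d\alpha=\int_0^1b^\alpha\,{}_0D_t^\alpha\mathcal E\,d\alpha,\qquad \mathcal E=\partial_xu\qquad(t>0),$$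 $u=\partial_tu=\sigma=\mathcal E=0$ at $t=0$, and $u(0,t)=0$, $u(1,t)=\Upsilon(t)$ for $t\in\mathbb R$. A *solution* is a triple vanishing for $t<0$ which satisfies the first and third equations for $x\in[0,1]$ (one-sided $x$-derivatives at the end points), and the second equation and the initial conditions for $x\in[0,1)$; such that for $x\in[0,1)$ the functions $u(x,\cdot)$, $\sigma(x,\cdot)$, $\mathcal E(x,\cdot)$ are respectively $C^2,C^1,C^1$ on $[0,\infty)$; and such that for some $c>0$ the functions $\partial_t^2u,\partial_t\sigma,\partial_t\mathcal E$ are bounded for $t>0$ by $C_{x_0}e^{ct}$ uniformly in $x\in[0,x_0]$, for every $x_0<1$, and $\int_0^\infty|u(x,t)-\Upsilon(t)|e^{-ct}dt\to0$ as $x\to1^-$. **Theorem.** (1) For every $n\ge1$ each of the equations $sM(s)=n\mathrm i\pi$ and $sM(s)=-n\mathrm i\pi$ has exactly one solution in $D$, denoted $s_n^{(+)}$ and $s_n^{(-)}=\overline{s_n^{(+)}}$ respectively, and these are simple zeros of $\sinh(sM(s))$. For $x\in[0,1]$ and $t>0$, $$\operatorname{Res}\big(\tilde P(x,s)e^{st},s_n^{(\pm)}\big)=\left[\frac{\sinh(xsM(s))}{\frac{d}{ds}\sinh(sM(s))}e^{st}\right]_{s=s_n^{(\pm)}}.$$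 (2) There is a real-valued function $P$ on $[0,1]\times\mathbb R$ with $P(x,t)=0$ for $t<0$ and, for $x\in[0,1]$, $t>0$, $$P(x,t)=\frac1{2\pi\mathrm i}\int_0^\infty J(x,q)e^{-qt}dq+\sum_{n=1}^\infty R_n(x,t),$$ $$J(x,q)=\frac{\sinh(xqM(qe^{-\mathrm i\pi}))}{\sinh(qM(qe^{-\mathrm i\pi}))}-\frac{\sinh(xqM(qe^{\mathrm i\pi}))}{\sinh(qM(qe^{\mathrm i\pi}))},\quad R_n(x,t)=\operatorname{Res}\big(\tilde P(x,s)e^{st},s_n^{(+)}\big)+\operatorname{Res}\big(\tilde P(x,s)e^{st},s_n^{(-)}\big),$$ where the integral and the series converge absolutely. For every $x\in[0,1]$, $P(x,\cdot)$ is locally integrable on $\mathbb R$ and $C^\infty$ on $(0,\infty)$. For $x\in[0,1)$ the Laplace transform of $P(x,\cdot)$ converges absolutely for $\operatorname{Re}s>0$ and equals $\tilde P(x,s)$. (3) The problem above with $\Upsilon=\Upsilon_0H$ has a solution $(u_H,\sigma_H,\mathcal E_H)$, and the displacement of every solution equals $u_H$ on $[0,1]\times\mathbb R$. For $x\in[0,1)$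 one has $u_H(x,\cdot)=\Upsilon_0H*P(x,\cdot)$, and for $t>0$ $$u_H(x,t)=\frac{\Upsilon_0}{2\pi\mathrm i}\int_0^\infty J(x,q)\frac{1-e^{-qt}}q\,dq+\Upsilon_0\int_0^t\Big(\sum_{n=1}^\infty R_n(x,\tau)\Big)d\tau,$$ where both integrals converge absolutely; $u_H(x,t)=0$ for $x\in[0,1]$, $t<0$; and $u_H(x,\cdot)$ is continuous at $t=0$ for $x\in[0,1)$. -/

import Mathlib

open scoped ContDiff Topology
open MeasureTheory Set Filter

noncomputable section

namespace DistributedOrderRod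

/-! ### The initial-boundary value problem -/

/-- The Heaviside function. -/
def heaviside (t : ℝ) : ℝ := if 0 < t then 1 else 0

/-- The left Riemann-Liouville fractional derivative of order `α ∈ [0, 1)`:
`(1 / Γ(1 - α)) d/dt ∫₀ᵗ y(τ) / (t - τ)^α dτ`. -/
def rlDeriv (α : ℝ) (y : ℝ → ℝ) (t : ℝ) : ℝ :=
  (1 / Real.Gamma (1 - α)) * deriv (fun r : ℝ => ∫ τ in (0 : ℝ)..r, y τ / (r - τ) ^ α) t

/-- Convolution of functions supported in `[0, ∞)`: `(f ∗ g)(t) = ∫₀ᵗ f(τ) g(t - τ) dτ`. -/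
def causalConv (f g : ℝ → ℝ) (t : ℝ) : ℝ := ∫ τ in (0 : ℝ)..t, f τ * g (t - τ)

/-- `(u, σ, ε)` (displacement, stress, strain on the rod `0 ≤ x ≤ 1`) is a causal,
Laplace-transformable solution of the dimensionless distributed-order wave system
`∂ₓσ = ∂ₜ²u`, `∫₀¹ a^α D^α σ dα = ∫₀¹ b^α D^α ε dα`, `ε = ∂ₓu`, with zero initial data
and with boundary data `u(0, t) = 0`, `u(1, t) = Υ(t)`.

At `x = 1` stress and strain are in general not functions of time (a jump of `Υ` makes them
contain a Dirac mass at `t = 0`), so the initial conditions and the hereditary constitutive law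
are imposed for `0 ≤ x < 1`, and the datum `Υ` is in addition attained as `x → 1⁻`.
The regularity in time makes all the Riemann-Liouville derivatives below exist. -/
structure IsSolution (a b : ℝ) (Υ : ℝ → ℝ) (u σ ε : ℝ → ℝ → ℝ) : Prop where
  causal : ∀ x ∈ Icc (0 : ℝ) 1, ∀ t : ℝ, t < 0 → u x t = 0 ∧ σ x t = 0 ∧ ε x t = 0
  /- classical regularity in time, up to `t = 0` -/
  regular : ∀ x ∈ Ico (0 : ℝ) 1,
    ContDiffOn ℝ 2 (u x) (Ici 0) ∧ ContDiffOn ℝ 1 (σ x) (Ici 0) ∧ ContDiffOn ℝ 1 (ε x) (Ici 0)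
  /- `∂ₓσ = ∂ₜ²u` -/
  momentum : ∀ x ∈ Icc (0 : ℝ) 1, ∀ t : ℝ, 0 < t →
    HasDerivWithinAt (fun y => σ y t) (iteratedDeriv 2 (u x) t) (Icc 0 1) x
  /- the distributed-order constitutive equation, with weights `a^α` and `b^α` -/
  constitutive : ∀ x ∈ Ico (0 : ℝ) 1, ∀ t : ℝ, 0 < t →
    ∫ α in (0 : ℝ)..1, a ^ α * rlDeriv α (σ x) t = ∫ α in (0 : ℝ)..1, b ^ α * rlDeriv α (ε x) t
  /- `ε = ∂ₓu` -/
  strain : ∀ x ∈ Icc (0 : ℝ) 1, ∀ t : ℝ, 0 < t →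
    HasDerivWithinAt (fun y => u y t) (ε x t) (Icc 0 1) x
  /- `u = ∂ₜu = σ = ε = 0` at `t = 0` -/
  initial : ∀ x ∈ Ico (0 : ℝ) 1,
    u x 0 = 0 ∧ HasDerivWithinAt (u x) 0 (Ici 0) 0 ∧ σ x 0 = 0 ∧ ε x 0 = 0
  boundary_left : ∀ t : ℝ, u 0 t = 0
  boundary_right : ∀ t : ℝ, u 1 t = Υ t
  /- exponential growth in time, locally uniformly in `0 ≤ x < 1`, and attainment of the
  boundary datum at `x = 1` in the corresponding weighted `L¹` space -/
  growth : ∃ c > (0 : ℝ),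
    (∀ x₀ ∈ Ico (0 : ℝ) 1, ∃ C : ℝ, ∀ x ∈ Icc 0 x₀, ∀ t : ℝ, 0 < t →
      |iteratedDeriv 2 (u x) t| ≤ C * Real.exp (c * t) ∧
      |deriv (σ x) t| ≤ C * Real.exp (c * t) ∧
      |deriv (ε x) t| ≤ C * Real.exp (c * t)) ∧
    Tendsto (fun x => ∫⁻ t in Ioi (0 : ℝ), ENNReal.ofReal (|u x t - Υ t| * Real.exp (-c * t)))
      (𝓝[<] 1) (𝓝 0)

/-! ### The kernel in the Laplace domain -/

/-- `ln z / (z - 1)` as a function of `w = ln z`, with its value `1` at the removable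
singularity `z = 1`. -/
def logQuot (w : ℂ) : ℂ := if w = 0 then 1 else w / (Complex.exp w - 1)

/-- `M = √( (ln (b s) / ln (a s)) ((a s - 1) / (b s - 1)) )` (principal root) as a function of
`w = ln s`, where `|Im w| ≤ π`; thus `Mlog a b (ln q ± i π)` is `M (q e^{± i π})`. -/
def Mlog (a b : ℝ) (w : ℂ) : ℂ :=
  (logQuot (Real.log b + w) / logQuot (Real.log a + w)) ^ (1 / 2 : ℂ)

/-- `M (s)` on the plane cut along `(-∞, 0]`. -/
def M (a b : ℝ) (s : ℂ) : ℂ := Mlog a b (Complex.log s)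

/-- `P̃ (x, s) = sinh (x s M (s)) / sinh (s M (s))`. -/
def Ptilde (a b x : ℝ) (s : ℂ) : ℂ :=
  Complex.sinh (x * s * M a b s) / Complex.sinh (s * M a b s)

/-- `sinh (x q M (q e^{iθ})) / sinh (q M (q e^{iθ}))`, used with `θ = ± π`. -/
def cutRatio (a b x θ q : ℝ) : ℂ :=
  Complex.sinh (x * q * Mlog a b (Real.log q + θ * Complex.I)) /
    Complex.sinh (q * Mlog a b (Real.log q + θ * Complex.I))

/-- The jump of `P̃` across the cut, lower value minus upper value. -/
def cutJump (a b x q : ℝ) : ℂ :=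
  cutRatio a b x (-Real.pi) q - cutRatio a b x Real.pi q

/-- The residue of `f` at an isolated singularity `z₀`, through integrals over small circles. -/
def residueAt (f : ℂ → ℂ) (z₀ : ℂ) : ℂ :=
  limUnder (𝓝[>] (0 : ℝ)) fun r => (2 * Real.pi * Complex.I)⁻¹ * ∮ z in C(z₀, r), f z

/-- `Res (P̃ (x, s) e^{st}, z₀)`. -/
def residueP (a b x t : ℝ) (z₀ : ℂ) : ℂ :=
  residueAt (fun s => Ptilde a b x s * Complex.exp (s * t)) z₀

/-- The sum over `n ≥ 1` of the residues of `P̃ (x, s) e^{st}` at `sp n` and `sm n`. -/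
def residueSeries (a b : ℝ) (sp sm : ℕ → ℂ) (x t : ℝ) : ℂ :=
  ∑' n : ℕ, (residueP a b x t (sp (n + 1)) + residueP a b x t (sm (n + 1)))

end DistributedOrderRod

end

open DistributedOrderRod

noncomputable section

namespace DistributedOrderRod

/-! Put `s = e^w`. Under the Laplace transform the operator `∫₀¹ m^α D^α dα` becomes multiplication
by `∫₀¹ m^α s^α dα = expMean (log m + w)`. The constitutive law therefore reads `Ê = M² σ̂` with `M²
= expMean (log a + w) / expMean (log b + w)`, the rod reduces to `U'' = (s M)² U`, and the boundary
data force `U = Υ₀ P̃ / s`. Everything else depends on where `s ↦ s M(s)` sends the cut plane.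

This is read off `φ = logSM`, the logarithm of `s M(s)` as a function of `w` on the closed strip
`|Im w| ≤ π`. The logarithmic derivative of `expMean` has real part within `4/5` of `1/2`, whence
`Re φ' ∈ [1/5, 9/5]` (`logSMDeriv_re_mem`): `φ` is injective, `Im φ` increases along vertical lines,
and `Re φ - Re w` is bounded. On `Im w = π/2` the value `Im φ` is below `π/2` by at least `c / (1 +
x²)` (`exists_im_logSM_pi_div_two_le`), on `Im w = π` it is above `π/2` by a fixed amount
(`exists_im_logSM_pi_ge`). The curve `Im φ = π/2` thus runs strictly between the imaginary axis and
the cut and meets each level of `Re φ` exactly once, which gives one root of `s M(s) = nπi` and, by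
conjugation, one of `s M(s) = -nπi`. Quantitatively, `Re (s M) ≥ c |s|^{3/4}` away from `0` in the
right half plane, `Re (s M) ≤ -c q` on the cut, and `Re s_n ≤ -c n^{3/4}`; the power `3/4` is what
remains of `|s| / (1 + log² |s|)`.

For `0 ≤ x < 1` the transform is therefore `O(exp(-c (1 - x) |s|^{3/4}))`. Bromwich integrals of
such functions (`RootDecay`) are smooth on the whole line, vanish for `t ≤ 0` and have the expected
Laplace transforms (`RootDecay.laplace_bromwich`). `P` is such an integral. Moving the line to the
imaginary axis and, in the upper quadrant, on to the cut turns it into the cut integral plus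
residues (`axis_integral_add_cut_integral`, `impulse_eq`); in the variable `w` the region swept is a
rectangle, and its right side is placed between consecutive poles.

Existence: displacement, stress and strain are Bromwich integrals, on which the distributed-order
operator acts by its symbol (`RootDecay.distributed_bromwich`). The delicate point is the end `x =
1`, where the decay in `s` is lost. There the explicit form of `P` gives bounds `O(1 - x)` at the
price of negative powers of `t`, and these are made integrable at `t = 0` by comparing the unit step
with exponentials, whose pairings with `P` are values of `P̃` (`unitDisp_eq_stepKernel`).

Uniqueness: the growth conditions allow the Laplace transform of any solution to be taken, it solves
the transformed system, hence equals `Υ₀ P̃ / s` (`IsSolution.laplace_eq`), and the transform is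
injective on continuous functions (`IsSolution.unique`). -/

/-! ### The mean `(e^w - 1) / w = ∫₀¹ e^{αw} dα` of the exponential and its logarithmic derivative -/

/-- The entire function `(e^w - 1) / w`. -/
def expMean : ℂ → ℂ := dslope Complex.exp 0

lemma expMean_of_ne {w : ℂ} (hw : w ≠ 0) : expMean w = (Complex.exp w - 1) / w := by
  rw [expMean, dslope_of_ne _ hw, slope_def_field]
  simp

@[simp] lemma expMean_zero : expMean 0 = 1 := by
  simp [expMean]

lemma logQuot_eq_inv (w : ℂ) : logQuot w = (expMean w)⁻¹ := by
  unfold logQuot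
  split_ifs with h
  · simp [h]
  · rw [expMean_of_ne h, inv_div]

lemma differentiable_expMean : Differentiable ℂ expMean := by
  rw [← differentiableOn_univ]
  exact (Complex.differentiableOn_dslope univ_mem).2 Complex.differentiable_exp.differentiableOn

lemma expMean_eq_integral (w : ℂ) :
    expMean w = ∫ α in (0 : ℝ)..1, Complex.exp (α * w) := by
  rcases eq_or_ne w 0 with rfl | hw
  · simp
  · rw [expMean_of_ne hw]
    have := integral_exp_mul_complex (a := 0) (b := 1) hw
    simp only [mul_comm _ w]
    rw [this]
    simp

lemma expMean_conj (w : ℂ) :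
    expMean ((starRingEnd ℂ) w) = (starRingEnd ℂ) (expMean w) := by
  rcases eq_or_ne w 0 with rfl | hw
  · simp
  · rw [expMean_of_ne hw, expMean_of_ne (by simpa using hw)]
    simp [Complex.exp_conj]

/-- In the mean `∫₀¹ e^{αw} dα` every factor with `0 < α < 1` has argument `α Im w` in `(0, π)`, so
the integrand has positive imaginary part. -/
lemma expMean_im_pos {w : ℂ} (h0 : 0 < w.im) (hpi : w.im ≤ Real.pi) : 0 < (expMean w).im := by
  have hi : IntervalIntegrable (fun α : ℝ => Complex.exp (α * w)) volume 0 1 :=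
    (by fun_prop : Continuous fun α : ℝ => Complex.exp (α * w)).intervalIntegrable _ _
  have h1 : (expMean w).im = ∫ α in (0 : ℝ)..1, (Complex.exp (α * w)).im := by
    rw [expMean_eq_integral]
    have := Complex.imCLM.intervalIntegral_comp_comm hi
    simpa using this.symm
  rw [h1]
  apply intervalIntegral.intervalIntegral_pos_of_pos_on _ _ zero_lt_one
  · exact (by fun_prop : Continuous fun α : ℝ => (Complex.exp (α * w)).im).intervalIntegrable _ _
  · intro α hα
    rw [Complex.exp_im]
    apply mul_pos (Real.exp_pos _)
    apply Real.sin_pos_of_pos_of_lt_pi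
    · simpa using mul_pos hα.1 h0
    · simp only [Complex.mul_im, Complex.ofReal_re, Complex.ofReal_im, zero_mul, add_zero]
      nlinarith [hα.1, hα.2]

lemma expMean_ofReal_pos (x : ℝ) : 0 < (expMean x).re ∧ (expMean x).im = 0 := by
  rcases eq_or_ne x 0 with rfl | hx
  · simp
  · have : expMean x = ((Real.exp x - 1) / x : ℝ) := by
      rw [expMean_of_ne (by exact_mod_cast hx)]
      push_cast
      rfl
    rw [this]
    refine ⟨?_, Complex.ofReal_im _⟩
    rw [Complex.ofReal_re]
    rcases lt_or_gt_of_ne hx with h | h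
    · exact div_pos_of_neg_of_neg (by simpa using h) h
    · exact div_pos (by simpa using h) h

/-- This makes the principal logarithm of `expMean` holomorphic on the closed strip, both sides of
the cut of `s` included. -/
lemma expMean_mem_slitPlane {w : ℂ} (hw : |w.im| ≤ Real.pi) : expMean w ∈ Complex.slitPlane := by
  rw [abs_le] at hw
  rcases lt_trichotomy w.im 0 with h | h | h
  · right
    have := expMean_im_pos (w := (starRingEnd ℂ) w) (by simpa using h) (by simpa using by linarith)
    rw [expMean_conj, Complex.conj_im] at this
    linarith
  · left
    have := (expMean_ofReal_pos w.re).1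
    rwa [show ((w.re : ℝ) : ℂ) = w from Complex.ext rfl (by simpa using h.symm)] at this
  · right
    exact (expMean_im_pos h hw.2).ne'

lemma expMean_ne_zero {w : ℂ} (hw : |w.im| ≤ Real.pi) : expMean w ≠ 0 :=
  Complex.slitPlane_ne_zero (expMean_mem_slitPlane hw)

/-- The logarithmic derivative of `expMean`. -/
def expMeanLD (w : ℂ) : ℂ := deriv expMean w / expMean w

lemma expMeanLD_eq {w : ℂ} (hw : w ≠ 0) (hpi : |w.im| ≤ Real.pi) :
    expMeanLD w = Complex.exp w / (Complex.exp w - 1) - 1 / w := by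
  have h1 : HasDerivAt expMean ((Complex.exp w * w - (Complex.exp w - 1) * 1) / w ^ 2) w := by
    have : HasDerivAt (fun w => (Complex.exp w - 1) / w)
        ((Complex.exp w * w - (Complex.exp w - 1) * 1) / w ^ 2) w :=
      ((Complex.hasDerivAt_exp w).sub_const 1).div (hasDerivAt_id w) hw
    refine this.congr_of_eventuallyEq ?_
    filter_upwards [isOpen_ne.mem_nhds hw] with z hz using expMean_of_ne hz
  have h2 := expMean_ne_zero hpi
  rw [expMean_of_ne hw] at h2
  have h3 : Complex.exp w - 1 ≠ 0 := fun h => h2 (by simp [h])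
  rw [expMeanLD, h1.deriv, expMean_of_ne hw]
  field_simp

lemma normSq_exp_sub_one (w : ℂ) : Complex.normSq (Complex.exp w - 1) =
    2 * Real.exp w.re * (Real.cosh w.re - Real.cos w.im) := by
  rw [Complex.normSq_apply]
  simp only [Complex.sub_re, Complex.exp_re, Complex.one_re, Complex.sub_im, Complex.exp_im,
    Complex.one_im, sub_zero]
  rw [Real.cosh_eq, Real.exp_neg]
  have := Real.exp_pos w.re
  field_simp
  nlinarith [Real.sin_sq_add_cos_sq w.im]

lemma cosh_sub_cos_pos {x y : ℝ} (hy : |y| ≤ Real.pi) (h : x ≠ 0 ∨ y ≠ 0) :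
    0 < Real.cosh x - Real.cos y := by
  rcases h with h | h
  · linarith [Real.one_lt_cosh.2 h, Real.cos_le_one y]
  · have : Real.cos y < 1 := by
      rw [← Real.cos_abs]
      have := Real.strictAntiOn_cos ⟨le_rfl, Real.pi_pos.le⟩ ⟨abs_nonneg y, hy⟩ (abs_pos.2 h)
      simpa using this
    linarith [Real.one_le_cosh x]

lemma expMeanLD_re_im {w : ℂ} (hw : w ≠ 0) (hpi : |w.im| ≤ Real.pi) :
    (expMeanLD w).re = 1 / 2 + (Real.sinh w.re / (2 * (Real.cosh w.re - Real.cos w.im)) -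
      w.re / (w.re ^ 2 + w.im ^ 2)) ∧
    (expMeanLD w).im = w.im / (w.re ^ 2 + w.im ^ 2) -
      Real.sin w.im / (2 * (Real.cosh w.re - Real.cos w.im)) := by
  have hD : 0 < Real.cosh w.re - Real.cos w.im := by
    apply cosh_sub_cos_pos hpi
    by_contra! h
    exact hw (Complex.ext h.1 h.2)
  have he := Real.exp_pos w.re
  have hs := Real.sin_sq_add_cos_sq w.im
  rw [expMeanLD_eq hw hpi]
  rw [Complex.sub_re, Complex.sub_im, Complex.div_re, Complex.div_im, Complex.div_re,
    Complex.div_im, normSq_exp_sub_one]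
  simp only [Complex.sub_re, Complex.exp_re, Complex.one_re, Complex.sub_im, Complex.exp_im,
    Complex.one_im, sub_zero, Complex.normSq_apply, one_mul, zero_mul, zero_div, add_zero, zero_sub]
  set D := Real.cosh w.re - Real.cos w.im with hDdef
  have hsinh : Real.sinh w.re = Real.exp w.re - Real.cosh w.re := by
    linarith [Real.cosh_add_sinh w.re]
  have hcosh : Real.cosh w.re = D + Real.cos w.im := by rw [hDdef]; ring
  rw [hsinh, hcosh]
  constructor
  · have : Real.exp w.re * Real.cos w.im * (Real.exp w.re * Real.cos w.im - 1) /
        (2 * Real.exp w.re * D) + Real.exp w.re * Real.sin w.im * (Real.exp w.re * Real.sin w.im) /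
        (2 * Real.exp w.re * D) = (Real.exp w.re - Real.cos w.im) / (2 * D) := by
      field_simp
      linear_combination (Real.exp w.re) * hs
    rw [this, ← pow_two, ← pow_two]
    field_simp
    ring
  · have : Real.exp w.re * Real.sin w.im * (Real.exp w.re * Real.cos w.im - 1) /
        (2 * Real.exp w.re * D) - Real.exp w.re * Real.cos w.im * (Real.exp w.re * Real.sin w.im) /
        (2 * Real.exp w.re * D) = - Real.sin w.im / (2 * D) := by
      field_simp
      ring
    rw [this, ← pow_two, ← pow_two]
    ring

lemma sinh_le_mul_cosh {x : ℝ} (hx : 0 ≤ x) : Real.sinh x ≤ x * Real.cosh x := by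
  have hd : ∀ y, HasDerivAt (fun x => x * Real.cosh x - Real.sinh x) (y * Real.sinh y) y := by
    intro y
    exact (((hasDerivAt_id' y).mul (Real.hasDerivAt_cosh y)).sub
      (Real.hasDerivAt_sinh y)).congr_deriv (by ring)
  have hm : MonotoneOn (fun x => x * Real.cosh x - Real.sinh x) (Ici 0) := by
    apply monotoneOn_of_deriv_nonneg (convex_Ici 0)
    · exact fun y _ => (hd y).continuousAt.continuousWithinAt
    · exact fun y _ => (hd y).differentiableAt.differentiableWithinAt
    · intro y hy
      rw [interior_Ici] at hy
      rw [(hd y).deriv]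
      exact mul_nonneg (le_of_lt hy) (Real.sinh_nonneg_iff.2 (le_of_lt hy))
  have := hm (mem_Ici.2 le_rfl) (mem_Ici.2 hx) hx
  simp only [zero_mul, Real.sinh_zero, sub_self] at this
  linarith

lemma two_mul_cosh_sub_one_le {x : ℝ} (hx : 0 ≤ x) : 2 * (Real.cosh x - 1) ≤ x * Real.sinh x := by
  have h1 : Real.cosh x = Real.cosh (x / 2) ^ 2 + Real.sinh (x / 2) ^ 2 := by
    rw [← Real.cosh_two_mul]; ring_nf
  have h2 : Real.sinh x = 2 * Real.sinh (x / 2) * Real.cosh (x / 2) := by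
    rw [← Real.sinh_two_mul]; ring_nf
  have h3 := Real.cosh_sq (x / 2)
  have h4 := sinh_le_mul_cosh (x := x / 2) (by positivity)
  have h5 : 0 ≤ Real.sinh (x / 2) := Real.sinh_nonneg_iff.2 (by positivity)
  rw [h1, h2]
  nlinarith

lemma one_add_sq_div_two_le_cosh (x : ℝ) : 1 + x ^ 2 / 2 ≤ Real.cosh x := by
  wlog hx : 0 ≤ x
  · have := this (-x) (by linarith)
    simpa using this
  have h1 : Real.cosh x = Real.cosh (x / 2) ^ 2 + Real.sinh (x / 2) ^ 2 := by
    rw [← Real.cosh_two_mul]; ring_nf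
  have h3 := Real.cosh_sq (x / 2)
  have h4 := Real.self_le_sinh_iff.2 (show 0 ≤ x / 2 by positivity)
  nlinarith

lemma mul_sin_le {y : ℝ} (h0 : 0 ≤ y) (hpi : y ≤ Real.pi) :
    y * Real.sin y ≤ 2 * (1 - Real.cos y) := by
  have h1 : Real.cos y = 1 - 2 * Real.sin (y / 2) ^ 2 := by
    rw [← Real.cos_two_mul_eq_one_sub, mul_div_cancel₀ y two_ne_zero]
  have h2 : Real.sin y = 2 * Real.sin (y / 2) * Real.cos (y / 2) := by
    rw [← Real.sin_two_mul]; ring_nf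
  have h3 : 0 ≤ Real.sin (y / 2) := Real.sin_nonneg_of_nonneg_of_le_pi (by linarith) (by linarith)
  have h4 : y / 2 * Real.cos (y / 2) ≤ Real.sin (y / 2) := by
    rcases lt_or_ge (y / 2) (Real.pi / 2) with h | h
    · have hc : 0 < Real.cos (y / 2) := Real.cos_pos_of_mem_Ioo ⟨by linarith, h⟩
      have := Real.le_tan (by linarith) h
      rw [Real.tan_eq_sin_div_cos] at this
      rwa [le_div_iff₀ hc] at this
    · have : y / 2 = Real.pi / 2 := by linarith
      rw [this]; simp
  rw [h1, h2]
  nlinarith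

lemma one_sub_cos_ge {y : ℝ} (hy : |y| ≤ 2) : y ^ 2 / 2 - y ^ 4 / 16 ≤ 1 - Real.cos y := by
  wlog h0 : 0 ≤ y
  · have := this (y := -y) (by simpa using hy) (by linarith)
    rwa [Real.cos_neg, neg_pow_two, Even.neg_pow (by decide)] at this
  rcases h0.eq_or_lt with rfl | h0
  · simp
  rw [abs_of_pos h0] at hy
  have h1 : Real.cos y = 1 - 2 * Real.sin (y / 2) ^ 2 := by
    rw [← Real.cos_two_mul_eq_one_sub, mul_div_cancel₀ y two_ne_zero]
  have h2 := Real.sin_gt_sub_cube (x := y / 2) (by linarith)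
  have h3 : 0 ≤ y / 2 - (y / 2) ^ 3 / 6 := by nlinarith [mul_nonneg h0.le h0.le]
  have h4 : (y / 2 - (y / 2) ^ 3 / 6) ^ 2 ≤ Real.sin (y / 2) ^ 2 := by gcongr
  rw [h1]
  nlinarith [sq_nonneg (y ^ 3)]

/-- The expression is the deviation of `Re expMeanLD` from `1/2`. What matters is a bound below `1`:
two such deviations then differ by less than `2`, which keeps `Re logSMDeriv` positive. For `x ≥ 0`
the deviation is nonnegative because `2 x (cosh x - cos y) ≤ sinh x (x² + y²)`, the `cosh` part
being paid by `x²` and the `cos` part by `y²`. -/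
lemma abs_sinh_div_sub_le {x y : ℝ} (hy : |y| ≤ Real.pi) (h : x ≠ 0 ∨ y ≠ 0) :
    |Real.sinh x / (2 * (Real.cosh x - Real.cos y)) - x / (x ^ 2 + y ^ 2)| ≤ 4 / 5 := by
  wlog hx : 0 ≤ x generalizing x
  · have := this (x := -x) (by simpa using h) (by linarith)
    rw [← abs_neg]
    convert this using 2
    simp only [Real.sinh_neg, Real.cosh_neg, even_two, Even.neg_pow]
    ring
  have hD := cosh_sub_cos_pos hy h
  have hN : 0 < x ^ 2 + y ^ 2 := by
    rcases h with h | h <;> positivity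
  set D := Real.cosh x - Real.cos y with hDdef
  set N := x ^ 2 + y ^ 2 with hNdef
  have hlow : 0 ≤ Real.sinh x / (2 * D) - x / N := by
    rw [sub_nonneg, div_le_div_iff₀ hN (by positivity)]
    have h1 := two_mul_cosh_sub_one_le hx
    have h2 := Real.one_sub_sq_div_two_le_cos (x := y)
    have h3 := Real.self_le_sinh_iff.2 hx
    have h4 : x * (2 * (1 - Real.cos y)) ≤ Real.sinh x * y ^ 2 := by
      calc x * (2 * (1 - Real.cos y)) ≤ x * y ^ 2 := by
            apply mul_le_mul_of_nonneg_left _ hx; linarith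
        _ ≤ _ := by gcongr
    have h5 : x * (2 * (Real.cosh x - 1)) ≤ Real.sinh x * x ^ 2 := by
      calc _ ≤ x * (x * Real.sinh x) := by gcongr
        _ = _ := by ring
    calc x * (2 * D) = x * (2 * (1 - Real.cos y)) + x * (2 * (Real.cosh x - 1)) := by
          rw [hDdef]; ring
      _ ≤ _ := by rw [hNdef, mul_add]; linarith
  rw [abs_of_nonneg hlow]
  have hsinh : Real.sinh x = D + (Real.cos y - Real.exp (-x)) := by
    rw [hDdef, ← Real.cosh_sub_sinh]; ring
  rw [hsinh]
  -- With `sinh x = D + (cos y - e^{-x})` the first quotient is `1/2` plus half of this one, so the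
  -- `2x/N` here cancels `x/N` and leaves `1/2 + 3/10 = 4/5`. The case `cos y ≤ e^{-x}` is trivial;
  -- otherwise `|y| < π/2`, and Taylor bounds give numerator at most `x` and `D ≥ N/2 - y⁴/16`.
  have key : (Real.cos y - Real.exp (-x)) / D ≤ 2 * x / N + 3 / 5 := by
    rcases le_or_gt (Real.cos y) (Real.exp (-x)) with hc | hc
    · calc _ ≤ 0 := div_nonpos_of_nonpos_of_nonneg (by linarith) hD.le
        _ ≤ _ := by positivity
    · have hy2 : |y| < 1.571 := by
        have : |y| < Real.pi / 2 := by
          by_contra! hcon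
          have : Real.cos |y| ≤ 0 :=
            Real.cos_nonpos_of_pi_div_two_le_of_le hcon (by linarith [Real.pi_pos])
          rw [Real.cos_abs] at this
          linarith [Real.exp_pos (-x)]
        linarith [Real.pi_lt_d4]
      have h1 := one_sub_cos_ge (y := y) (by linarith)
      have h2 := one_add_sq_div_two_le_cosh x
      have h3 := Real.add_one_le_exp (-x)
      have hy4 : y ^ 2 ≤ 2.47 := by
        rw [← sq_abs]; nlinarith [abs_nonneg y]
      have hyN : y ^ 2 ≤ N := by rw [hNdef]; nlinarith
      have hy40 : y ^ 4 ≤ N * 2.47 := by nlinarith [sq_nonneg y]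
      have hD0 : 0 < N / 2 - y ^ 4 / 16 := by nlinarith
      have hDD0 : N / 2 - y ^ 4 / 16 ≤ D := by rw [hDdef, hNdef]; linarith
      have hxy : x * |y| ≤ N / 2 := by
        rw [hNdef, ← sq_abs y]; nlinarith [sq_nonneg (x - |y|)]
      have hxy4 : x * y ^ 4 ≤ N ^ 2 * 0.7855 := by
        have e : x * y ^ 4 = (x * |y|) * |y| * y ^ 2 := by
          rw [show y ^ 4 = (y ^ 2) * y ^ 2 by ring, ← sq_abs y]; ring
        rw [e]
        calc _ ≤ (N / 2) * 1.571 * N := by gcongr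
          _ = _ := by ring
      calc (Real.cos y - Real.exp (-x)) / D ≤ x / D := by gcongr; linarith [Real.cos_le_one y]
        _ ≤ x / (N / 2 - y ^ 4 / 16) := by gcongr
        _ ≤ (2 * x + 3 / 5 * N) / N := by
          rw [div_le_div_iff₀ hD0 hN]
          nlinarith
        _ = _ := by field_simp
  have e : (D + (Real.cos y - Real.exp (-x))) / (2 * D) =
      1 / 2 + (Real.cos y - Real.exp (-x)) / D / 2 := by
    field_simp
  rw [e]
  have : 2 * x / N = 2 * (x / N) := by ring
  linarith

/-- After clearing denominators the `x²` part follows from `sin y ≤ y` and `x² ≤ 2 (cosh x - 1)`,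
the `y²` part from `y sin y ≤ 2 (1 - cos y)`. It is the sign of `Im expMeanLD` in the upper half
strip. -/
lemma sin_div_le {x y : ℝ} (h0 : 0 ≤ y) (hy : y ≤ Real.pi) (h : x ≠ 0 ∨ y ≠ 0) :
    Real.sin y / (2 * (Real.cosh x - Real.cos y)) ≤ y / (x ^ 2 + y ^ 2) := by
  have hD := cosh_sub_cos_pos (by rwa [abs_of_nonneg h0]) h
  have hN : 0 < x ^ 2 + y ^ 2 := by
    rcases h with h | h <;> positivity
  rw [div_le_div_iff₀ (by positivity) hN]
  have h1 := one_add_sq_div_two_le_cosh x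
  have h2 := mul_sin_le h0 hy
  have h3 := Real.sin_le h0
  nlinarith [mul_nonneg h0 (sub_nonneg.2 h2), mul_nonneg (sq_nonneg x) (sub_nonneg.2 h3),
    mul_nonneg h0 (sub_nonneg.2 h1)]

lemma differentiableAt_expMeanLD {w : ℂ} (hw : |w.im| ≤ Real.pi) :
    DifferentiableAt ℂ expMeanLD w :=
  (differentiable_expMean.deriv w).div (differentiable_expMean w) (expMean_ne_zero hw)

lemma abs_expMeanLD_re_sub_le {w : ℂ} (hw : |w.im| ≤ Real.pi) :
    |(expMeanLD w).re - 1 / 2| ≤ 4 / 5 := by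
  have main : ∀ w : ℂ, w ≠ 0 → |w.im| ≤ Real.pi → |(expMeanLD w).re - 1 / 2| ≤ 4 / 5 := by
    intro w h hw
    rw [(expMeanLD_re_im h hw).1, add_sub_cancel_left]
    apply abs_sinh_div_sub_le hw
    by_contra! hc
    exact h (Complex.ext hc.1 hc.2)
  rcases eq_or_ne w 0 with rfl | h
  -- The explicit formula is meaningless at `w = 0`; the bound passes to `0` by continuity along the
  -- real axis.
  · have hc : Tendsto (fun x : ℝ => |(expMeanLD x).re - 1 / 2|) (𝓝[≠] 0)
        (𝓝 |(expMeanLD (0 : ℝ)).re - 1 / 2|) := by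
      have h1 : ContinuousAt (fun x : ℝ => |(expMeanLD x).re - 1 / 2|) 0 := by
        have h2 : ContinuousAt expMeanLD ((0 : ℝ) : ℂ) :=
          (differentiableAt_expMeanLD (by simpa using Real.pi_pos.le)).continuousAt
        have h3 : ContinuousAt (fun x : ℝ => expMeanLD x) 0 :=
          ContinuousAt.comp h2 Complex.continuous_ofReal.continuousAt
        exact ((Complex.continuous_re.continuousAt.comp h3).sub continuousAt_const).abs
      exact h1.tendsto.mono_left nhdsWithin_le_nhds
    refine le_of_tendsto hc ?_
    filter_upwards [self_mem_nhdsWithin] with x hx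
    exact main x (by exact_mod_cast hx) (by simpa using Real.pi_pos.le)
  · exact main w h hw

lemma expMeanLD_im_nonneg {w : ℂ} (h0 : 0 ≤ w.im) (hw : w.im ≤ Real.pi) (h : w ≠ 0) :
    0 ≤ (expMeanLD w).im := by
  rw [(expMeanLD_re_im h (by rwa [abs_of_nonneg h0])).2, sub_nonneg]
  apply sin_div_le h0 hw
  by_contra! hc
  exact h (Complex.ext hc.1 hc.2)

/-- At `y = π/2` the formula becomes `(π/2) / (x² + π²/4) - 1 / (2 cosh x)`, and `cosh x ≥ 1 + x²/2`
leaves a multiple of `1 / (1 + x²)`. This strict positivity is what pushes `s M(s)` off the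
imaginary axis into the right half plane. -/
lemma expMeanLD_im_pi_div_two (x : ℝ) :
    1 / (10 * (1 + x ^ 2)) ≤ (expMeanLD (x + (Real.pi / 2 : ℝ) * Complex.I)).im := by
  set w : ℂ := x + (Real.pi / 2 : ℝ) * Complex.I with hwdef
  have hre : w.re = x := by simp [hwdef]
  have him : w.im = Real.pi / 2 := by simp [hwdef]
  have hpi := Real.pi_gt_d2
  have hpi' := Real.pi_lt_d2
  have h0 : w ≠ 0 := fun h => by
    rw [h] at him; simp at him; linarith
  rw [(expMeanLD_re_im h0 (by rw [him, abs_of_pos] <;> linarith)).2, hre, him]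
  rw [Real.sin_pi_div_two, Real.cos_pi_div_two, sub_zero]
  have h2 := one_add_sq_div_two_le_cosh x
  have h3 : 1 / (2 * Real.cosh x) ≤ 1 / (2 + x ^ 2) := by gcongr; linarith
  have h4 : 1 / (10 * (1 + x ^ 2)) ≤
      Real.pi / 2 / (x ^ 2 + (Real.pi / 2) ^ 2) - 1 / (2 + x ^ 2) := by
    rw [div_sub_div _ _ (by positivity) (by positivity), div_le_div_iff₀ (by positivity)
      (by positivity)]
    nlinarith [sq_nonneg x, sq_nonneg (x ^ 2), mul_nonneg (sq_nonneg x) (sub_nonneg.2 hpi.le), mul_nonneg (sq_nonneg (x^2)) (sub_nonneg.2 hpi.le), mul_nonneg (sq_nonneg x) (sub_nonneg.2 hpi'.le)]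
  linarith

lemma exists_norm_expMeanLD_le :
    ∃ H : ℝ, 0 < H ∧ ∀ w : ℂ, |w.im| ≤ Real.pi → ‖expMeanLD w‖ ≤ H := by
  -- The formulas are singular at `w = 0`, so a compact rectangle around it is handled by continuity
  -- and they are used only for `|Re w| > 1`.
  have hK : IsCompact (Icc (-1 : ℝ) 1 ×ℂ Icc (-Real.pi) Real.pi) :=
    isCompact_Icc.reProdIm isCompact_Icc
  obtain ⟨C, hC⟩ := hK.exists_bound_of_continuousOn (f := expMeanLD) (by
    intro w hw
    exact (differentiableAt_expMeanLD (abs_le.2 hw.2)).continuousAt.continuousWithinAt)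
  refine ⟨max C (1.3 + 2 * Real.pi), lt_max_of_lt_right (by positivity), fun w hw => ?_⟩
  by_cases hx : |w.re| ≤ 1
  · exact le_max_of_le_left (hC w ⟨abs_le.1 hx, abs_le.1 hw⟩)
  apply le_max_of_le_right
  push Not at hx
  refine (Complex.norm_le_abs_re_add_abs_im _).trans ?_
  have h1 := abs_expMeanLD_re_sub_le hw
  have h1' : |(expMeanLD w).re| ≤ 1.3 := by
    rw [abs_le] at h1 ⊢; constructor <;> linarith
  have hx0 : w.re ≠ 0 := by rintro h; rw [h] at hx; norm_num at hx
  have h2 : |(expMeanLD w).im| ≤ 2 * Real.pi := by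
    rw [(expMeanLD_re_im (fun h => hx0 (by simp [h])) hw).2]
    have hx2 : 1 ≤ w.re ^ 2 := by rw [← sq_abs]; nlinarith
    have h3 : |w.im / (w.re ^ 2 + w.im ^ 2)| ≤ Real.pi := by
      rw [abs_div, abs_of_pos (show 0 < w.re ^ 2 + w.im ^ 2 by positivity)]
      exact (div_le_self (abs_nonneg _) (by nlinarith)).trans hw
    have h4 : |Real.sin w.im / (2 * (Real.cosh w.re - Real.cos w.im))| ≤ 1 := by
      have h5 := one_add_sq_div_two_le_cosh w.re
      have h6 : 1 ≤ 2 * (Real.cosh w.re - Real.cos w.im) := by linarith [Real.cos_le_one w.im]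
      rw [abs_div, abs_of_pos (by linarith : 0 < 2 * (Real.cosh w.re - Real.cos w.im))]
      exact (div_le_self (abs_nonneg _) h6).trans (Real.abs_sin_le_one _)
    have := abs_sub (w.im / (w.re ^ 2 + w.im ^ 2)) (Real.sin w.im / (2 * (Real.cosh w.re - Real.cos w.im)))
    linarith [Real.pi_gt_three]
  linarith

/-! ### Difference quotients as means of the derivative -/

/-- The mean of `f` over the segment from `z` to `w`. -/
def segMean (f : ℂ → ℂ) (z w : ℂ) : ℂ := ∫ t in (0 : ℝ)..1, f (z + t * (w - z))

lemma abs_im_segment_le {z w : ℂ} {c t : ℝ} (hz : |z.im| ≤ c) (hw : |w.im| ≤ c)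
    (ht : t ∈ Icc (0 : ℝ) 1) : |(z + t * (w - z)).im| ≤ c := by
  have : (z + t * (w - z)).im = (1 - t) * z.im + t * w.im := by simp; ring
  rw [this]
  calc _ ≤ |(1 - t) * z.im| + |t * w.im| := abs_add_le _ _
    _ = (1 - t) * |z.im| + t * |w.im| := by
      rw [abs_mul, abs_mul, abs_of_nonneg ht.1, abs_of_nonneg (sub_nonneg.2 ht.2)]
    _ ≤ (1 - t) * c + t * c := by
      have := ht.1; have := sub_nonneg.2 ht.2; gcongr
    _ = c := by ring

section Strip

variable {f f' : ℂ → ℂ} {c : ℝ} {z w : ℂ}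

lemma continuousOn_segment (hf : ∀ v : ℂ, |v.im| ≤ c → ContinuousAt f v)
    (hz : |z.im| ≤ c) (hw : |w.im| ≤ c) :
    ContinuousOn (fun t : ℝ => f (z + t * (w - z))) (uIcc 0 1) := by
  intro t ht
  rw [uIcc_of_le zero_le_one] at ht
  have h1 : ContinuousAt (fun t : ℝ => z + t * (w - z)) t := by fun_prop
  exact (ContinuousAt.comp (f := fun t : ℝ => z + t * (w - z))
    (hf _ (abs_im_segment_le hz hw ht)) h1).continuousWithinAt

/-- Keeping the complex mean of the derivative, instead of a norm estimate, lets bounds on its real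
part alone control differences; injectivity and monotonicity of `logSM` come from this. -/
lemma sub_eq_mul_segMean (hf : ∀ v : ℂ, |v.im| ≤ c → HasDerivAt f (f' v) v)
    (hf' : ∀ v : ℂ, |v.im| ≤ c → ContinuousAt f' v) (hz : |z.im| ≤ c) (hw : |w.im| ≤ c) :
    f w - f z = (w - z) * segMean f' z w := by
  have h1 := intervalIntegral.integral_eq_sub_of_hasDerivAt (a := 0) (b := 1)
    (f := fun t : ℝ => f (z + t * (w - z))) (f' := fun t : ℝ => f' (z + t * (w - z)) * (w - z))
    (by
      intro t ht
      rw [uIcc_of_le zero_le_one] at ht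
      have h2 : HasDerivAt (fun t : ℝ => z + t * (w - z)) (w - z) t := by
        simpa using ((Complex.ofRealCLM.hasDerivAt (x := t)).mul_const (w - z)).const_add z
      exact (hf _ (abs_im_segment_le hz hw ht)).comp t h2)
    ((continuousOn_segment hf' hz hw).mul continuousOn_const).intervalIntegrable
  rw [intervalIntegral.integral_mul_const] at h1
  simp only [Complex.ofReal_one, one_mul, add_sub_cancel, Complex.ofReal_zero, zero_mul,
    add_zero] at h1
  rw [← h1, segMean, mul_comm]

lemma segMean_re (hf : ∀ v : ℂ, |v.im| ≤ c → ContinuousAt f v) (hz : |z.im| ≤ c)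
    (hw : |w.im| ≤ c) :
    (segMean f z w).re = ∫ t in (0 : ℝ)..1, (f (z + t * (w - z))).re := by
  have := Complex.reCLM.intervalIntegral_comp_comm
    (continuousOn_segment hf hz hw).intervalIntegrable (μ := volume)
  simpa [segMean] using this.symm

lemma segMean_im (hf : ∀ v : ℂ, |v.im| ≤ c → ContinuousAt f v) (hz : |z.im| ≤ c)
    (hw : |w.im| ≤ c) :
    (segMean f z w).im = ∫ t in (0 : ℝ)..1, (f (z + t * (w - z))).im := by
  have := Complex.imCLM.intervalIntegral_comp_comm
    (continuousOn_segment hf hz hw).intervalIntegrable (μ := volume)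
  simpa [segMean] using this.symm

lemma const_le_integral_zero_one {g : ℝ → ℝ} {m : ℝ} (hg : ContinuousOn g (uIcc 0 1))
    (h : ∀ t ∈ Icc (0 : ℝ) 1, m ≤ g t) : m ≤ ∫ t in (0 : ℝ)..1, g t := by
  have := intervalIntegral.integral_mono_on zero_le_one
    (intervalIntegrable_const (μ := volume) (c := m)) hg.intervalIntegrable h
  simpa using this

lemma integral_zero_one_le_const {g : ℝ → ℝ} {m : ℝ} (hg : ContinuousOn g (uIcc 0 1))
    (h : ∀ t ∈ Icc (0 : ℝ) 1, g t ≤ m) : ∫ t in (0 : ℝ)..1, g t ≤ m := by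
  have := intervalIntegral.integral_mono_on zero_le_one (hg.intervalIntegrable (μ := volume))
    (intervalIntegrable_const (c := m)) h
  simpa using this

lemma segMean_re_mem (hf : ∀ v : ℂ, |v.im| ≤ c → ContinuousAt f v) (hz : |z.im| ≤ c)
    (hw : |w.im| ≤ c) {m M : ℝ} (h : ∀ v : ℂ, |v.im| ≤ c → (f v).re ∈ Icc m M) :
    (segMean f z w).re ∈ Icc m M := by
  have hc : ContinuousOn (fun t : ℝ => (f (z + t * (w - z))).re) (uIcc 0 1) :=
    Complex.continuous_re.comp_continuousOn (continuousOn_segment hf hz hw)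
  rw [segMean_re hf hz hw]
  exact ⟨const_le_integral_zero_one hc fun t ht => (h _ (abs_im_segment_le hz hw ht)).1,
    integral_zero_one_le_const hc fun t ht => (h _ (abs_im_segment_le hz hw ht)).2⟩

lemma norm_segMean_le (hz : |z.im| ≤ c)
    (hw : |w.im| ≤ c) {M : ℝ} (h : ∀ v : ℂ, |v.im| ≤ c → ‖f v‖ ≤ M) :
    ‖segMean f z w‖ ≤ M := by
  have := intervalIntegral.norm_integral_le_of_norm_le_const (a := 0) (b := 1) (C := M)
    (f := fun t : ℝ => f (z + t * (w - z))) (by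
      intro t ht
      rw [uIoc_of_le zero_le_one] at ht
      exact h _ (abs_im_segment_le hz hw ⟨ht.1.le, ht.2⟩))
  simpa [segMean] using this

end Strip

/-! ### The logarithm of `s M(s)` as a function of `w = ln s` -/

lemma hasDerivAt_log_expMean {w : ℂ} (hw : |w.im| ≤ Real.pi) :
    HasDerivAt (fun w => Complex.log (expMean w)) (expMeanLD w) w :=
  (differentiable_expMean w).hasDerivAt.clog (expMean_mem_slitPlane hw)

lemma continuousAt_expMeanLD {w : ℂ} (hw : |w.im| ≤ Real.pi) : ContinuousAt expMeanLD w :=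
  (differentiableAt_expMeanLD hw).continuousAt

lemma expMeanLD_re_mem {w : ℂ} (hw : |w.im| ≤ Real.pi) :
    (expMeanLD w).re ∈ Icc (-(3 / 10) : ℝ) (13 / 10) := by
  have := abs_le.1 (abs_expMeanLD_re_sub_le hw)
  constructor <;> linarith

/-- `log (s M(s))` as a function of `w = ln s`, holomorphic on the closed strip `|Im w| ≤ π`. -/
def logSM (a b : ℝ) (w : ℂ) : ℂ :=
  w - (Complex.log (expMean (Real.log b + w)) - Complex.log (expMean (Real.log a + w))) / 2

/-- The derivative of `logSM`. -/
def logSMDeriv (a b : ℝ) (w : ℂ) : ℂ :=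
  1 - (expMeanLD (Real.log b + w) - expMeanLD (Real.log a + w)) / 2

lemma hasDerivAt_logSM (a b : ℝ) {w : ℂ} (hw : |w.im| ≤ Real.pi) :
    HasDerivAt (logSM a b) (logSMDeriv a b w) w := by
  have h : ∀ r : ℝ, HasDerivAt (fun w => Complex.log (expMean (r + w))) (expMeanLD (r + w)) w :=
    fun r => (hasDerivAt_log_expMean (w := r + w) (by simpa using hw)).comp_const_add (r : ℂ) w
  exact (hasDerivAt_id w).sub (((h _).sub (h _)).div_const 2)

lemma continuousAt_logSMDeriv (a b : ℝ) {w : ℂ} (hw : |w.im| ≤ Real.pi) :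
    ContinuousAt (logSMDeriv a b) w := by
  have h : ∀ r : ℝ, ContinuousAt (fun w => expMeanLD (r + w)) w := fun r =>
    ContinuousAt.comp (f := fun w : ℂ => (r : ℂ) + w)
      (continuousAt_expMeanLD (by simpa using hw)) (by fun_prop)
  exact continuousAt_const.sub (((h _).sub (h _)).div_const 2)

/-- Two values of `Re expMeanLD` in an interval of length `8/5` enter with weight `1/2`, so they
move `1` by at most `4/5`. -/
lemma logSMDeriv_re_mem (a b : ℝ) {w : ℂ} (hw : |w.im| ≤ Real.pi) :
    (logSMDeriv a b w).re ∈ Icc (1 / 5 : ℝ) (9 / 5) := by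
  have h1 := expMeanLD_re_mem (w := Real.log b + w) (by simpa using hw)
  have h2 := expMeanLD_re_mem (w := Real.log a + w) (by simpa using hw)
  have : (logSMDeriv a b w).re =
      1 - ((expMeanLD (Real.log b + w)).re - (expMeanLD (Real.log a + w)).re) / 2 := by
    simp [logSMDeriv]
  rw [this]
  constructor <;> linarith [h1.1, h1.2, h2.1, h2.2]

lemma exists_norm_logSMDeriv_le :
    ∃ H : ℝ, 1 < H ∧ ∀ a b : ℝ, ∀ w : ℂ, |w.im| ≤ Real.pi → ‖logSMDeriv a b w‖ ≤ H := by
  obtain ⟨H, hH, h⟩ := exists_norm_expMeanLD_le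
  refine ⟨1 + H, by linarith, fun a b w hw => ?_⟩
  have h1 := h (Real.log b + w) (by simpa using hw)
  have h2 := h (Real.log a + w) (by simpa using hw)
  unfold logSMDeriv
  calc _ ≤ ‖(1 : ℂ)‖ + ‖(expMeanLD (Real.log b + w) - expMeanLD (Real.log a + w)) / 2‖ :=
        norm_sub_le _ _
    _ ≤ 1 + (H + H) / 2 := by
      rw [norm_one, norm_div, Complex.norm_ofNat]
      gcongr
      exact (norm_sub_le _ _).trans (add_le_add h1 h2)
    _ = _ := by ring

lemma logSM_sub (a b : ℝ) {z w : ℂ} (hz : |z.im| ≤ Real.pi) (hw : |w.im| ≤ Real.pi) :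
    logSM a b w - logSM a b z = (w - z) * segMean (logSMDeriv a b) z w :=
  sub_eq_mul_segMean (fun _ hv => hasDerivAt_logSM a b hv)
    (fun _ hv => continuousAt_logSMDeriv a b hv) hz hw

lemma segMean_logSMDeriv_re_mem (a b : ℝ) {z w : ℂ} (hz : |z.im| ≤ Real.pi)
    (hw : |w.im| ≤ Real.pi) : (segMean (logSMDeriv a b) z w).re ∈ Icc (1 / 5 : ℝ) (9 / 5) :=
  segMean_re_mem (fun _ hv => continuousAt_logSMDeriv a b hv) hz hw
    fun _ hv => logSMDeriv_re_mem a b hv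

/-- The strip is convex and the derivative has positive real part, so no mean of the derivative over
a segment vanishes. -/
lemma logSM_injOn (a b : ℝ) : InjOn (logSM a b) {w : ℂ | |w.im| ≤ Real.pi} := by
  intro z hz w hw h
  have h1 := logSM_sub a b hz hw
  have h2 := (segMean_logSMDeriv_re_mem a b hz hw).1
  rw [h, sub_self, zero_eq_mul, sub_eq_zero] at h1
  rcases h1 with h1 | h1
  · exact h1.symm
  · rw [h1] at h2; norm_num at h2

lemma im_logSM_sub_mem (a b x : ℝ) {y₁ y₂ : ℝ} (h₁ : |y₁| ≤ Real.pi) (h₂ : |y₂| ≤ Real.pi)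
    (h : y₁ ≤ y₂) :
    (logSM a b (x + y₂ * Complex.I)).im - (logSM a b (x + y₁ * Complex.I)).im ∈
      Icc ((y₂ - y₁) / 5) (9 / 5 * (y₂ - y₁)) := by
  have hz : |((x : ℂ) + y₁ * Complex.I).im| ≤ Real.pi := by simpa using h₁
  have hw : |((x : ℂ) + y₂ * Complex.I).im| ≤ Real.pi := by simpa using h₂
  have h1 := logSM_sub a b hz hw
  have h2 := segMean_logSMDeriv_re_mem a b hz hw
  rw [← Complex.sub_im, h1, Complex.mul_im]
  simp only [Complex.sub_re, Complex.add_re, Complex.ofReal_re, Complex.mul_re, Complex.I_re,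
    mul_zero, Complex.ofReal_im, Complex.I_im, mul_one, sub_self, add_zero, zero_mul,
    Complex.sub_im, Complex.add_im, Complex.mul_im, zero_add]
  constructor <;> nlinarith [h2.1, h2.2, sub_nonneg.2 h]

lemma log_expMean_conj {w : ℂ} (hw : |w.im| ≤ Real.pi) :
    Complex.log (expMean ((starRingEnd ℂ) w)) = (starRingEnd ℂ) (Complex.log (expMean w)) := by
  rw [expMean_conj, Complex.log_conj _ (Complex.slitPlane_arg_ne_pi (expMean_mem_slitPlane hw))]

lemma logSM_conj (a b : ℝ) {w : ℂ} (hw : |w.im| ≤ Real.pi) :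
    logSM a b ((starRingEnd ℂ) w) = (starRingEnd ℂ) (logSM a b w) := by
  have h : ∀ r : ℝ, Complex.log (expMean (r + (starRingEnd ℂ) w)) =
      (starRingEnd ℂ) (Complex.log (expMean (r + w))) := by
    intro r
    rw [← log_expMean_conj (by simpa using hw)]
    simp
  have h2 : (starRingEnd ℂ) 2 = 2 := Complex.conj_ofNat 2
  simp [logSM, h, h2]

lemma arg_expMean_mem {w : ℂ} (h0 : 0 ≤ w.im) (hw : w.im ≤ Real.pi) :
    (expMean w).arg ∈ Ico 0 Real.pi := by
  have hs := expMean_mem_slitPlane (w := w) (by rwa [abs_of_nonneg h0])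
  refine ⟨?_, lt_of_le_of_ne (Complex.arg_le_pi _) (Complex.slitPlane_arg_ne_pi hs)⟩
  rw [Complex.arg_nonneg_iff]
  rcases h0.eq_or_lt with h | h
  · have := (expMean_ofReal_pos w.re).2
    rw [show ((w.re : ℝ) : ℂ) = w from Complex.ext rfl (by simpa using h)] at this
    exact this.ge
  · exact (expMean_im_pos h hw).le

/-- In the upper half of the strip both arguments lie in `[0, π)`. Hence the principal logarithm of
the quotient is the difference of the logarithms, and `logSM` is a logarithm of `s M(s)` with the
principal square root. -/
lemma abs_arg_expMean_sub_lt (r₁ r₂ : ℝ) {w : ℂ} (hw : |w.im| ≤ Real.pi) :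
    |(expMean (r₁ + w)).arg - (expMean (r₂ + w)).arg| < Real.pi := by
  wlog h0 : 0 ≤ w.im generalizing w
  · have := this (w := (starRingEnd ℂ) w) (by simpa using hw) (by simp; linarith)
    have h : ∀ r : ℝ, (expMean (r + (starRingEnd ℂ) w)).arg = - (expMean (r + w)).arg := by
      intro r
      have := congrArg Complex.im (log_expMean_conj (w := r + w) (by simpa using hw))
      simpa [Complex.log_im] using this
    rw [h, h, ← abs_neg] at this
    convert this using 2
    ring
  have h1 := arg_expMean_mem (w := r₁ + w) (by simpa using h0)
    (by simpa using (le_abs_self _).trans hw)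
  have h2 := arg_expMean_mem (w := r₂ + w) (by simpa using h0)
    (by simpa using (le_abs_self _).trans hw)
  rw [abs_lt]
  constructor <;> linarith [h1.1, h1.2, h2.1, h2.2]

lemma log_expMean_div (r₁ r₂ : ℝ) {w : ℂ} (hw : |w.im| ≤ Real.pi) :
    Complex.log (expMean (r₁ + w) / expMean (r₂ + w)) =
      Complex.log (expMean (r₁ + w)) - Complex.log (expMean (r₂ + w)) := by
  have h := abs_lt.1 (abs_arg_expMean_sub_lt r₁ r₂ hw)
  have h1 : expMean (r₁ + w) ≠ 0 := expMean_ne_zero (by simpa using hw)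
  have h2 : expMean (r₂ + w) ≠ 0 := expMean_ne_zero (by simpa using hw)
  rw [← Complex.log_exp (x := Complex.log (expMean (r₁ + w)) - Complex.log (expMean (r₂ + w))),
    Complex.exp_sub, Complex.exp_log h1, Complex.exp_log h2]
  · simpa [Complex.log_im] using h.1
  · simpa [Complex.log_im] using h.2.le

lemma exp_logSM (a b : ℝ) {w : ℂ} (hw : |w.im| ≤ Real.pi) :
    Complex.exp (logSM a b w) = Complex.exp w * Mlog a b w := by
  have h1 : expMean (Real.log a + w) ≠ 0 := expMean_ne_zero (by simpa using hw)
  have h2 : expMean (Real.log b + w) ≠ 0 := expMean_ne_zero (by simpa using hw)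
  have h3 : Mlog a b w = (expMean (Real.log a + w) / expMean (Real.log b + w)) ^ (1 / 2 : ℂ) := by
    rw [Mlog, logQuot_eq_inv, logQuot_eq_inv, inv_div_inv]
  rw [h3, Complex.cpow_def_of_ne_zero (div_ne_zero h1 h2), log_expMean_div _ _ hw, ← Complex.exp_add,
    logSM]
  congr 1
  ring

lemma im_logSM (a b : ℝ) (w : ℂ) : (logSM a b w).im =
    w.im - ((expMean (Real.log b + w)).arg - (expMean (Real.log a + w)).arg) / 2 := by
  simp [logSM, Complex.log_im]

lemma abs_im_logSM_sub_lt (a b : ℝ) {w : ℂ} (hw : |w.im| ≤ Real.pi) :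
    |(logSM a b w).im - w.im| < Real.pi / 2 := by
  have := abs_arg_expMean_sub_lt (Real.log b) (Real.log a) hw
  rw [im_logSM]
  rw [abs_lt] at this ⊢
  constructor <;> linarith

variable {a b : ℝ}

lemma log_expMean_sub (r₁ r₂ : ℝ) {w : ℂ} (hw : |w.im| ≤ Real.pi) :
    Complex.log (expMean (r₂ + w)) - Complex.log (expMean (r₁ + w)) =
      ((r₂ - r₁ : ℝ) : ℂ) * segMean expMeanLD (r₁ + w) (r₂ + w) := by
  have := sub_eq_mul_segMean (fun _ hv => hasDerivAt_log_expMean hv)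
    (fun _ hv => continuousAt_expMeanLD hv) (z := r₁ + w) (w := r₂ + w) (c := Real.pi)
    (by simpa using hw) (by simpa using hw)
  rw [this]
  push_cast
  ring

lemma abs_re_logSM_sub_le (ha : 0 < a) (hab : a < b) {w : ℂ} (hw : |w.im| ≤ Real.pi) :
    |(logSM a b w).re - w.re| ≤ Real.log b - Real.log a := by
  have hL : 0 < Real.log b - Real.log a := sub_pos.2 (Real.log_lt_log ha hab)
  have h1 := segMean_re_mem (fun _ hv => continuousAt_expMeanLD hv) (z := Real.log a + w)
    (w := Real.log b + w) (c := Real.pi) (by simpa using hw) (by simpa using hw)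
    (fun _ hv => expMeanLD_re_mem hv)
  have : (logSM a b w).re - w.re = - (Real.log b - Real.log a) *
      (segMean expMeanLD (Real.log a + w) (Real.log b + w)).re / 2 := by
    rw [logSM, log_expMean_sub _ _ hw, Complex.sub_re, Complex.div_ofNat_re, Complex.re_ofReal_mul]
    ring
  rw [this, abs_le]
  constructor <;> nlinarith [h1.1, h1.2]

lemma im_logSM_sub (a b : ℝ) {w : ℂ} (hw : |w.im| ≤ Real.pi) :
    (logSM a b w).im = w.im - (Real.log b - Real.log a) *
      (segMean expMeanLD (Real.log a + w) (Real.log b + w)).im / 2 := by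
  rw [logSM, log_expMean_sub _ _ hw, Complex.sub_im, Complex.div_ofNat_im, Complex.im_ofReal_mul]

lemma im_logSM_ofReal (a b x : ℝ) : (logSM a b x).im = 0 := by
  have h := logSM_conj a b (w := x) (by simpa using Real.pi_pos.le)
  rw [Complex.conj_ofReal] at h
  exact Complex.conj_eq_iff_im.1 h.symm

lemma im_logSM_ge {w : ℂ} (h0 : 0 ≤ w.im) (hw : w.im ≤ Real.pi) :
    w.im / 5 ≤ (logSM a b w).im := by
  have := (im_logSM_sub_mem a b w.re (y₁ := 0) (y₂ := w.im) (by simpa using Real.pi_pos.le)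
    (by rwa [abs_of_nonneg h0]) h0).1
  rw [Complex.re_add_im, Complex.ofReal_zero, zero_mul, add_zero, im_logSM_ofReal] at this
  simpa using this

lemma segment_eq (w : ℂ) (r₁ r₂ t : ℝ) :
    (r₁ + w : ℂ) + t * ((r₂ + w) - (r₁ + w)) = ((r₁ + t * (r₂ - r₁) : ℝ) : ℂ) + w := by
  push_cast; ring

lemma continuousOn_expMeanLD_segment {w : ℂ} (hw : |w.im| ≤ Real.pi) (r₁ r₂ : ℝ) :
    ContinuousOn (fun t : ℝ => (expMeanLD ((r₁ + w : ℂ) + t * ((r₂ + w) - (r₁ + w)))).im)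
      (uIcc 0 1) :=
  Complex.continuous_im.comp_continuousOn
    (continuousOn_segment (fun _ hv => continuousAt_expMeanLD hv) (c := Real.pi)
      (by simpa using hw) (by simpa using hw))

lemma im_logSM_le (ha : 0 < a) (hab : a < b) {w : ℂ} (h0 : 0 < w.im) (hw : w.im ≤ Real.pi) :
    (logSM a b w).im ≤ w.im := by
  have hw' : |w.im| ≤ Real.pi := by rwa [abs_of_pos h0]
  have hL : 0 < Real.log b - Real.log a := sub_pos.2 (Real.log_lt_log ha hab)
  have : 0 ≤ (segMean expMeanLD (Real.log a + w) (Real.log b + w)).im := by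
    rw [segMean_im (fun _ hv => continuousAt_expMeanLD hv) (c := Real.pi) (by simpa using hw')
      (by simpa using hw')]
    apply const_le_integral_zero_one (continuousOn_expMeanLD_segment hw' _ _)
    intro t _
    rw [segment_eq]
    apply expMeanLD_im_nonneg (by simpa using h0.le) (by simpa using hw)
    intro h
    have := congrArg Complex.im h
    simp at this
    exact h0.ne' this
  rw [im_logSM_sub a b hw']
  nlinarith

/-- On the line `Im w = π/2` the lag `Im w - Im logSM` is half of `log b - log a` times a mean of
`Im expMeanLD` over the same line, which is at least of order `1 / (1 + x²)`. The hypothesis `a < b`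
is what makes it positive. -/
lemma exists_im_logSM_pi_div_two_le (ha : 0 < a) (hab : a < b) : ∃ c : ℝ, 0 < c ∧
    ∀ x : ℝ, (logSM a b (x + (Real.pi / 2 : ℝ) * Complex.I)).im ≤
      Real.pi / 2 - c / (1 + x ^ 2) := by
  have hL : 0 < Real.log b - Real.log a := sub_pos.2 (Real.log_lt_log ha hab)
  -- This absorbs the shift of the real part by a point `v` between `log a` and `log b`: `1 + (v +
  -- x)² ≤ 2 K (1 + x²)`.
  set K := 1 + 2 * (Real.log a) ^ 2 + 2 * (Real.log b) ^ 2 with hK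
  have hK1 : 1 ≤ K := by nlinarith [sq_nonneg (Real.log a), sq_nonneg (Real.log b)]
  refine ⟨(Real.log b - Real.log a) / (40 * K), by positivity, fun x => ?_⟩
  set w : ℂ := x + (Real.pi / 2 : ℝ) * Complex.I with hwdef
  have him : w.im = Real.pi / 2 := by simp [hwdef]
  have hw' : |w.im| ≤ Real.pi := by rw [him, abs_of_pos] <;> linarith [Real.pi_pos]
  have : 1 / (20 * K * (1 + x ^ 2)) ≤
      (segMean expMeanLD (Real.log a + w) (Real.log b + w)).im := by
    rw [segMean_im (fun _ hv => continuousAt_expMeanLD hv) (c := Real.pi) (by simpa using hw')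
      (by simpa using hw')]
    apply const_le_integral_zero_one (continuousOn_expMeanLD_segment hw' _ _)
    intro t ht
    rw [segment_eq, hwdef, ← add_assoc, ← Complex.ofReal_add]
    refine le_trans ?_ (expMeanLD_im_pi_div_two _)
    apply one_div_le_one_div_of_le (by positivity)
    set v := Real.log a + t * (Real.log b - Real.log a) with hv
    have h1 : v ^ 2 ≤ (Real.log a) ^ 2 + (Real.log b) ^ 2 := by
      have : v = (1 - t) * Real.log a + t * Real.log b := by rw [hv]; ring
      rw [this]
      nlinarith [ht.1, ht.2, mul_nonneg ht.1 (sub_nonneg.2 ht.2),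
        sq_nonneg (Real.log a - Real.log b), mul_nonneg (mul_nonneg ht.1 (sub_nonneg.2 ht.2))
        (sq_nonneg (Real.log a - Real.log b)), sq_nonneg (Real.log a), sq_nonneg (Real.log b),
        mul_nonneg ht.1 (sq_nonneg (Real.log a)), mul_nonneg (sub_nonneg.2 ht.2) (sq_nonneg (Real.log b))]
    have h2 : (v + x) ^ 2 ≤ 2 * v ^ 2 + 2 * x ^ 2 := by nlinarith [sq_nonneg (v - x)]
    nlinarith [sq_nonneg x, sq_nonneg (Real.log a), sq_nonneg (Real.log b)]
  rw [im_logSM_sub a b hw', him]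
  have e : (Real.log b - Real.log a) / (40 * K) / (1 + x ^ 2) =
      (Real.log b - Real.log a) * (1 / (20 * K * (1 + x ^ 2))) / 2 := by
    field_simp
    norm_num
  rw [e]
  gcongr

/-- On the cut `e^{r+w}` is real and negative, so `expMean (r + w)` is a negative number over `r + x
+ iπ`. With `X = log a + x` and `L = log b - log a`, the quotient whose argument is `-θ` is then a
positive multiple of `(X + L + iπ)(X - iπ) = X (X + L) + π² - iLπ`. Its argument stays away from
`-π`, so `Im logSM = π - θ/2` stays above `π/2` uniformly. -/
lemma exists_im_logSM_pi_ge (ha : 0 < a) (hab : a < b) : ∃ γ : ℝ, 0 < γ ∧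
    ∀ x : ℝ, Real.pi / 2 + γ ≤ (logSM a b (x + Real.pi * Complex.I)).im := by
  set L := Real.log b - Real.log a with hLdef
  have hL : 0 < L := sub_pos.2 (Real.log_lt_log ha hab)
  have hpi := Real.pi_pos
  set κ := min (L * Real.pi / (L ^ 2 + Real.pi ^ 2)) (Real.pi / 2) with hκ
  have hκ0 : 0 < κ := lt_min (by positivity) (by positivity)
  refine ⟨κ / 2, by positivity, fun x => ?_⟩
  set w : ℂ := x + Real.pi * Complex.I with hwdef
  have him : w.im = Real.pi := by simp [hwdef]
  have hw' : |w.im| ≤ Real.pi := by rw [him, abs_of_pos hpi]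
  have hdiv := congrArg Complex.im (log_expMean_div (Real.log a) (Real.log b) hw')
  rw [Complex.sub_im, Complex.log_im, Complex.log_im, Complex.log_im] at hdiv
  have hform : ∀ r : ℝ, expMean (r + w) = ((-(1 + Real.exp (r + x)) : ℝ) : ℂ) / (r + w) := by
    intro r
    have h0 : (r + w : ℂ) ≠ 0 := fun h => by
      have := congrArg Complex.im h
      simp [him] at this
    rw [expMean_of_ne h0, hwdef, ← add_assoc, Complex.exp_add, Complex.exp_pi_mul_I]
    push_cast
    ring
  set X := Real.log a + x with hX
  have hquot : expMean (Real.log a + w) / expMean (Real.log b + w) =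
      (((1 + Real.exp X) / (1 + Real.exp (X + L)) / (X ^ 2 + Real.pi ^ 2) : ℝ) : ℂ) *
        ((X * (X + L) + Real.pi ^ 2 : ℝ) + (-(L * Real.pi) : ℝ) * Complex.I) := by
    rw [hform, hform]
    have e1 : (Real.log a + w : ℂ) = X + Real.pi * Complex.I := by
      rw [hwdef, hX]; push_cast; ring
    have e2 : (Real.log b + w : ℂ) = (X + L : ℝ) + Real.pi * Complex.I := by
      rw [hwdef, hX, hLdef]; push_cast; ring
    have e3 : Real.log b + x = X + L := by rw [hX, hLdef]; ring
    rw [e1, e2, e3, ← hX]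
    have n1 : ((X : ℂ) + Real.pi * Complex.I) ≠ 0 := fun h => by
      have := congrArg Complex.im h
      simp at this
    have n2 : ((X + L : ℝ) : ℂ) + Real.pi * Complex.I ≠ 0 := fun h => by
      have := congrArg Complex.im h
      simp at this
    have n3 : ((-(1 + Real.exp (X + L)) : ℝ) : ℂ) ≠ 0 := by
      have := Real.exp_pos (X + L)
      exact_mod_cast (by linarith : -(1 + Real.exp (X + L)) < 0).ne
    have n4 : (((X ^ 2 + Real.pi ^ 2) : ℝ) : ℂ) = (X + Real.pi * Complex.I) *
        (X - Real.pi * Complex.I) := by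
      push_cast
      linear_combination ((Real.pi : ℂ) ^ 2) * Complex.I_sq
    have n5 : ((X : ℂ) - Real.pi * Complex.I) ≠ 0 := fun h => by
      have := congrArg Complex.im h
      simp at this
    have n6 : ((1 + Real.exp (X + L) : ℝ) : ℂ) ≠ 0 := by
      have := Real.exp_pos (X + L)
      exact_mod_cast (by linarith : 0 < (1 + Real.exp (X + L))).ne'
    rw [Complex.ofReal_div, Complex.ofReal_div, n4, Complex.ofReal_neg, Complex.ofReal_neg (1 + Real.exp (X + L))]
    field_simp
    push_cast
    linear_combination -(1 + Complex.exp X) * (Real.pi : ℂ) ^ 2 * Complex.I_sq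
  set θ := (expMean (Real.log b + w)).arg - (expMean (Real.log a + w)).arg with hθ
  have harg : (expMean (Real.log a + w) / expMean (Real.log b + w)).arg = -θ := by
    rw [hdiv, hθ]; ring
  have hθlt := abs_lt.1 (abs_arg_expMean_sub_lt (Real.log b) (Real.log a) hw')
  rw [← hθ] at hθlt
  rw [hquot, Complex.arg_real_mul _ (by positivity)] at harg
  have hθκ : θ ≤ Real.pi - κ := by
    -- If `X (X + L) ≥ 0` the real part is positive and `θ ≤ π/2`. Otherwise `X` and `X + L` have
    -- opposite signs, both are at most `L` in size, and the modulus is bounded by `L² + π²`, which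
    -- bounds `sin θ` from below.
    rcases le_or_gt 0 (X * (X + L)) with hXL | hXL
    · have h1 : |(((X * (X + L) + Real.pi ^ 2 : ℝ) : ℂ) + (-(L * Real.pi) : ℝ) *
          Complex.I).arg| ≤ Real.pi / 2 := by
        rw [Complex.abs_arg_le_pi_div_two_iff]
        simp only [Complex.add_re, Complex.ofReal_re, Complex.re_ofReal_mul, Complex.I_re, mul_zero,
          add_zero]
        positivity
      rw [harg, abs_neg] at h1
      have := (le_abs_self θ).trans h1
      linarith [min_le_right (L * Real.pi / (L ^ 2 + Real.pi ^ 2)) (Real.pi / 2)]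
    · have hs := Complex.sin_arg (((X * (X + L) + Real.pi ^ 2 : ℝ) : ℂ) + (-(L * Real.pi) : ℝ) *
          Complex.I)
      rw [harg, Real.sin_neg] at hs
      simp only [Complex.add_im, Complex.ofReal_im, Complex.im_ofReal_mul, Complex.I_im, mul_one,
        zero_add] at hs
      rw [neg_div, neg_inj] at hs
      have hX0 : X < 0 ∧ 0 < X + L := by
        rcases mul_neg_iff.1 hXL with h | h
        · exact absurd h.2 (by linarith [h.1])
        · exact h
      have hnorm : ‖((X * (X + L) + Real.pi ^ 2 : ℝ) : ℂ) + (-(L * Real.pi) : ℝ) *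
          Complex.I‖ ≤ L ^ 2 + Real.pi ^ 2 := by
        have h2 : ((X * (X + L) + Real.pi ^ 2 : ℝ) : ℂ) + (-(L * Real.pi) : ℝ) * Complex.I =
            (((X + L : ℝ) : ℂ) + Real.pi * Complex.I) * ((X : ℂ) - Real.pi * Complex.I) := by
          push_cast
          linear_combination (Real.pi : ℂ) ^ 2 * Complex.I_sq
        rw [h2, norm_mul]
        have h3 : ‖((X + L : ℝ) : ℂ) + Real.pi * Complex.I‖ ≤ Real.sqrt (L ^ 2 + Real.pi ^ 2) := by
          rw [Complex.norm_add_mul_I]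
          apply Real.sqrt_le_sqrt
          nlinarith [hX0.1, hX0.2]
        have h4 : ‖((X : ℂ) - Real.pi * Complex.I)‖ ≤ Real.sqrt (L ^ 2 + Real.pi ^ 2) := by
          rw [show (X : ℂ) - Real.pi * Complex.I = X + (-Real.pi : ℝ) * Complex.I by
            push_cast; ring, Complex.norm_add_mul_I]
          apply Real.sqrt_le_sqrt
          nlinarith [hX0.1, hX0.2]
        calc _ ≤ Real.sqrt (L ^ 2 + Real.pi ^ 2) * Real.sqrt (L ^ 2 + Real.pi ^ 2) := by gcongr
          _ = _ := Real.mul_self_sqrt (by positivity)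
      have hn0 : 0 < ‖((X * (X + L) + Real.pi ^ 2 : ℝ) : ℂ) + (-(L * Real.pi) : ℝ) *
          Complex.I‖ := by
        rw [norm_pos_iff]
        intro h
        have := congrArg Complex.im h
        simp only [Complex.add_im, Complex.ofReal_im, Complex.im_ofReal_mul, Complex.I_im, mul_one,
          zero_add, Complex.zero_im] at this
        linarith [mul_pos hL hpi]
      have h5 : L * Real.pi / (L ^ 2 + Real.pi ^ 2) ≤ Real.sin θ := by
        rw [hs]
        gcongr
      have h6 : Real.sin θ ≤ Real.pi - θ := by
        rw [← Real.sin_pi_sub]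
        exact Real.sin_le (by linarith)
      linarith [min_le_left (L * Real.pi / (L ^ 2 + Real.pi ^ 2)) (Real.pi / 2)]
  rw [im_logSM, ← hθ, him]
  linarith

/-! ### Size and position of `s M(s)` -/

lemma norm_exp_logSM_mem (ha : 0 < a) (hab : a < b) {w : ℂ} (hw : |w.im| ≤ Real.pi) :
    ‖Complex.exp (logSM a b w)‖ ∈ Icc (a / b * Real.exp w.re) (b / a * Real.exp w.re) := by
  have hb := ha.trans hab
  have h := abs_le.1 (abs_re_logSM_sub_le ha hab hw)
  have e : ∀ x y : ℝ, 0 < x → 0 < y → x / y = Real.exp (Real.log x - Real.log y) := by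
    intro x y hx hy
    rw [Real.exp_sub, Real.exp_log hx, Real.exp_log hy]
  rw [Complex.norm_exp, e a b ha hb, e b a hb ha, ← Real.exp_add, ← Real.exp_add]
  constructor <;> apply Real.exp_le_exp.2 <;> linarith

/-- By monotonicity in `Im w` the gap to the imaginary axis is smallest on `Im w = π/2`, where it is
known; the cosine of the angle is bounded below by this gap, and the modulus is comparable with
`e^{Re w}`. -/
lemma exists_re_exp_logSM_ge (ha : 0 < a) (hab : a < b) : ∃ c : ℝ, 0 < c ∧
    ∀ w : ℂ, |w.im| ≤ Real.pi / 2 →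
      c * (Real.exp w.re / (1 + w.re ^ 2)) ≤ (Complex.exp (logSM a b w)).re := by
  obtain ⟨c, hc, h⟩ := exists_im_logSM_pi_div_two_le ha hab
  have hb := ha.trans hab
  have hpi := Real.pi_pos
  refine ⟨a / b * (2 / Real.pi * c), by positivity, fun w hw => ?_⟩
  wlog h0 : 0 ≤ w.im generalizing w
  · have := this ((starRingEnd ℂ) w) (by simpa using hw) (by simp; linarith)
    rwa [logSM_conj a b (by linarith), Complex.exp_conj, Complex.conj_re, Complex.conj_re] at this
  rw [abs_of_nonneg h0] at hw
  have hw' : |w.im| ≤ Real.pi := by rw [abs_of_nonneg h0]; linarith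
  have h1 := (im_logSM_sub_mem a b w.re (y₁ := w.im) (y₂ := Real.pi / 2)
    hw' (by rw [abs_of_pos] <;> linarith) hw).1
  rw [Complex.re_add_im] at h1
  have h2 := im_logSM_ge (a := a) (b := b) h0 (by linarith)
  have h3 := h w.re
  set δ := c / (1 + w.re ^ 2) with hδ
  have hδ0 : 0 < δ := by positivity
  have h4 : (logSM a b w).im ≤ Real.pi / 2 - δ := by linarith
  have hcos : 2 / Real.pi * δ ≤ Real.cos (logSM a b w).im := by
    calc _ ≤ Real.sin δ := Real.mul_le_sin hδ0.le (by linarith)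
      _ = Real.cos (Real.pi / 2 - δ) := (Real.cos_pi_div_two_sub δ).symm
      _ ≤ _ := Real.cos_le_cos_of_nonneg_of_le_pi (by linarith) (by linarith) h4
  have hn := (norm_exp_logSM_mem ha hab hw').1
  rw [Complex.norm_exp] at hn
  rw [Complex.exp_re]
  calc _ = (a / b * Real.exp w.re) * (2 / Real.pi * δ) := by rw [hδ]; ring
    _ ≤ _ := by gcongr

lemma exists_re_exp_logSM_pi_le (ha : 0 < a) (hab : a < b) : ∃ c : ℝ, 0 < c ∧
    ∀ x : ℝ, (Complex.exp (logSM a b (x + Real.pi * Complex.I))).re ≤ - (c * Real.exp x) := by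
  obtain ⟨γ, hγ, h⟩ := exists_im_logSM_pi_ge ha hab
  have hb := ha.trans hab
  have hpi := Real.pi_pos
  refine ⟨a / b * (2 / Real.pi * γ), by positivity, fun x => ?_⟩
  have him : ((x : ℂ) + Real.pi * Complex.I).im = Real.pi := by simp
  have hre : ((x : ℂ) + Real.pi * Complex.I).re = x := by simp
  have h1 := h x
  have h2 := im_logSM_le ha hab (w := x + Real.pi * Complex.I) (by rw [him]; exact hpi)
    (by rw [him])
  rw [him] at h2
  have hn := (norm_exp_logSM_mem ha hab (w := x + Real.pi * Complex.I)
    (by rw [him, abs_of_pos hpi])).1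
  rw [Complex.norm_exp, hre] at hn
  rw [Complex.exp_re]
  set θ := (logSM a b (x + Real.pi * Complex.I)).im
  have hcos : 2 / Real.pi * γ ≤ - Real.cos θ := by
    rw [← Real.cos_pi_sub]
    calc _ ≤ Real.sin γ := Real.mul_le_sin hγ.le (by linarith)
      _ = Real.cos (Real.pi / 2 - γ) := (Real.cos_pi_div_two_sub γ).symm
      _ ≤ _ := Real.cos_le_cos_of_nonneg_of_le_pi (by linarith) (by linarith) (by linarith)
  have : (a / b * Real.exp x) * (2 / Real.pi * γ) ≤
      Real.exp (logSM a b (x + Real.pi * Complex.I)).re * (- Real.cos θ) := by gcongr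
  linarith

/-! ### The points where `s M(s)` is a given positive multiple of `i` -/

lemma exists_im_logSM_eq (ha : 0 < a) (hab : a < b) (x : ℝ) :
    ∃ y ∈ Ioo (Real.pi / 2) Real.pi, (logSM a b (x + y * Complex.I)).im = Real.pi / 2 := by
  obtain ⟨c, hc, h⟩ := exists_im_logSM_pi_div_two_le ha hab
  obtain ⟨γ, hγ, h'⟩ := exists_im_logSM_pi_ge ha hab
  have hpi := Real.pi_pos
  have hcont : ContinuousOn (fun y : ℝ => (logSM a b (x + y * Complex.I)).im)
      (Icc (Real.pi / 2) Real.pi) := by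
    intro y hy
    have h1 : ContinuousAt (logSM a b) (x + y * Complex.I) :=
      (hasDerivAt_logSM a b (by
        simp only [Complex.add_im, Complex.ofReal_im, Complex.im_ofReal_mul, Complex.I_im, mul_one,
          zero_add]
        rw [abs_of_nonneg] <;> linarith [hy.1, hy.2])).continuousAt
    have h2 : ContinuousAt (fun y : ℝ => (x + y * Complex.I : ℂ)) y := by fun_prop
    exact (Complex.continuous_im.continuousAt.comp
      (ContinuousAt.comp (f := fun y : ℝ => (x + y * Complex.I : ℂ)) h1 h2)).continuousWithinAt
  have := intermediate_value_Ioo (by linarith : Real.pi / 2 ≤ Real.pi) hcont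
  obtain ⟨y, hy, h3⟩ := this (show Real.pi / 2 ∈ _ from
    ⟨by have := h x; have : 0 < c / (1 + x ^ 2) := by positivity
        linarith, by linarith [h' x]⟩)
  exact ⟨y, hy, h3⟩

/-- Along each vertical line `Im logSM` crosses `π/2` at some height `y x`. The resulting curve is
continuous, and `Re logSM` on it differs from `x` by a bounded amount, so it takes every real value.
-/
lemma exists_logSM_eq (ha : 0 < a) (hab : a < b) (r : ℝ) :
    ∃ w : ℂ, w.im ∈ Ioo (Real.pi / 2) Real.pi ∧ logSM a b w = r + (Real.pi / 2 : ℝ) * Complex.I := by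
  choose y hy h using exists_im_logSM_eq ha hab
  obtain ⟨H, hH, hbd⟩ := exists_norm_logSMDeriv_le
  have hpi := Real.pi_pos
  set p : ℝ → ℂ := fun x => x + y x * Complex.I with hp
  have hpim : ∀ x, (p x).im = y x := by simp [hp]
  have hpre : ∀ x, (p x).re = x := by simp [hp]
  have hyabs : ∀ x, |y x| ≤ Real.pi := fun x => by
    rw [abs_of_nonneg] <;> linarith [(hy x).1, (hy x).2]
  -- An implicit function estimate done by hand: vertically `Im logSM` grows with slope at least
  -- `1/5`, horizontally it changes with slope at most `H`, so the level curve is Lipschitz with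
  -- constant `5 H`.
  have hcoord : ∀ x₁ x₂ : ℝ, y x₁ ≤ y x₂ → y x₂ - y x₁ ≤ 5 * H * |x₁ - x₂| := by
    intro x₁ x₂ hle
    have h1 := (im_logSM_sub_mem a b x₁ (hyabs x₁) (hyabs x₂) hle).1
    have h2 := logSM_sub a b (z := x₂ + y x₂ * Complex.I) (w := x₁ + y x₂ * Complex.I)
      (by simpa using hyabs x₂) (by simpa using hyabs x₂)
    have h3 := norm_segMean_le (z := x₂ + y x₂ * Complex.I) (w := x₁ + y x₂ * Complex.I)
      (by simpa using hyabs x₂) (by simpa using hyabs x₂) (hbd a b)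
    have h4 : (logSM a b (x₁ + y x₂ * Complex.I)).im - (logSM a b (x₂ + y x₂ * Complex.I)).im ≤
        |x₁ - x₂| * H := by
      rw [← Complex.sub_im, h2]
      refine (Complex.im_le_norm _).trans ?_
      rw [norm_mul, add_sub_add_right_eq_sub, ← Complex.ofReal_sub, Complex.norm_real,
        Real.norm_eq_abs]
      gcongr
    rw [h x₁] at h1
    rw [h x₂] at h4
    linarith
  have hlip : ∀ x₁ x₂ : ℝ, |y x₁ - y x₂| ≤ 5 * H * |x₁ - x₂| := by
    intro x₁ x₂
    rcases le_total (y x₁) (y x₂) with hle | hle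
    · rw [abs_sub_comm, abs_of_nonneg (sub_nonneg.2 hle)]
      exact hcoord _ _ hle
    · rw [abs_of_nonneg (sub_nonneg.2 hle), abs_sub_comm x₁]
      exact hcoord _ _ hle
  have hycont : Continuous y := by
    have : LipschitzWith (5 * H).toNNReal y := by
      apply LipschitzWith.of_dist_le_mul
      intro x₁ x₂
      rw [Real.dist_eq, Real.dist_eq, Real.coe_toNNReal _ (by positivity)]
      exact hlip _ _
    exact this.continuous
  have hpcont : Continuous p := by fun_prop
  have hcont : Continuous fun x => (logSM a b (p x)).re := by
    rw [continuous_iff_continuousAt]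
    intro x
    exact Complex.continuous_re.continuousAt.comp (ContinuousAt.comp
      (hasDerivAt_logSM a b (by rw [hpim]; exact hyabs x)).continuousAt hpcont.continuousAt)
  have hb : ∀ x, |(logSM a b (p x)).re - x| ≤ Real.log b - Real.log a := fun x => by
    simpa only [hpre] using abs_re_logSM_sub_le ha hab (w := p x) (by rw [hpim]; exact hyabs x)
  obtain ⟨x, hx⟩ := mem_range_of_exists_le_of_exists_ge hcont
    (c := r) ⟨r - (Real.log b - Real.log a), by linarith [(abs_le.1 (hb (r - (Real.log b - Real.log a)))).2]⟩
    ⟨r + (Real.log b - Real.log a), by linarith [(abs_le.1 (hb (r + (Real.log b - Real.log a)))).1]⟩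
  refine ⟨p x, by rw [hpim]; exact hy x, Complex.ext ?_ ?_⟩
  · simpa using hx
  · simpa [hp] using h x

/-- The point `w` of the strip `π/2 < Im w < π` at which `e^w M(e^w) = e^r i`. -/
def critPt (a b r : ℝ) : ℂ :=
  Classical.epsilon fun w : ℂ => w.im ∈ Ioo (Real.pi / 2) Real.pi ∧
    logSM a b w = r + (Real.pi / 2 : ℝ) * Complex.I

lemma critPt_spec (ha : 0 < a) (hab : a < b) (r : ℝ) :
    (critPt a b r).im ∈ Ioo (Real.pi / 2) Real.pi ∧
      logSM a b (critPt a b r) = r + (Real.pi / 2 : ℝ) * Complex.I :=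
  Classical.epsilon_spec (exists_logSM_eq ha hab r)

lemma abs_im_critPt_lt (ha : 0 < a) (hab : a < b) (r : ℝ) : |(critPt a b r).im| < Real.pi := by
  have h := (critPt_spec ha hab r).1
  rw [abs_of_pos (by linarith [h.1, Real.pi_pos])]
  exact h.2

lemma abs_re_critPt_sub_le (ha : 0 < a) (hab : a < b) (r : ℝ) :
    |(critPt a b r).re - r| ≤ Real.log b - Real.log a := by
  have h := abs_re_logSM_sub_le ha hab (abs_im_critPt_lt ha hab r).le
  rw [(critPt_spec ha hab r).2] at h
  rw [abs_sub_comm]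
  simpa using h

/-- From `r₂ - r₁ = (w₂ - w₁) κ` with `Re κ > 0` the real part of `w₂ - w₁` is `(r₂ - r₁) Re κ /
|κ|²`. Thus the moduli of the poles increase, and a circle through the critical point at a
half-integer level separates consecutive ones. -/
lemma critPt_re_lt (ha : 0 < a) (hab : a < b) {r₁ r₂ : ℝ} (h : r₁ < r₂) :
    (critPt a b r₁).re < (critPt a b r₂).re := by
  have h1 := logSM_sub a b (abs_im_critPt_lt ha hab r₁).le (abs_im_critPt_lt ha hab r₂).le
  have h2 := (segMean_logSMDeriv_re_mem a b (abs_im_critPt_lt ha hab r₁).le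
    (abs_im_critPt_lt ha hab r₂).le).1
  rw [(critPt_spec ha hab r₁).2, (critPt_spec ha hab r₂).2, add_sub_add_right_eq_sub] at h1
  set κ := segMean (logSMDeriv a b) (critPt a b r₁) (critPt a b r₂)
  have h3 := congrArg Complex.re h1
  have h4 := congrArg Complex.im h1
  simp only [Complex.sub_re, Complex.ofReal_re, Complex.mul_re, Complex.sub_im, Complex.ofReal_im,
    Complex.mul_im, sub_self] at h3 h4
  set p := (critPt a b r₂).re - (critPt a b r₁).re
  set q := (critPt a b r₂).im - (critPt a b r₁).im
  have h5 : κ.re * (r₂ - r₁) = p * (κ.re ^ 2 + κ.im ^ 2) := by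
    rw [h3]; linear_combination κ.im * h4
  have h6 : 0 < κ.re * (r₂ - r₁) := mul_pos (by linarith) (by linarith)
  rw [h5] at h6
  have := pos_of_mul_pos_left h6 (by positivity)
  simpa [p] using this

lemma exp_critPt_mul_Mlog (ha : 0 < a) (hab : a < b) (r : ℝ) :
    Complex.exp (critPt a b r) * Mlog a b (critPt a b r) = Real.exp r * Complex.I := by
  rw [← exp_logSM a b (abs_im_critPt_lt ha hab r).le, (critPt_spec ha hab r).2, Complex.exp_add,
    Complex.ofReal_exp]
  congr 1
  push_cast
  exact Complex.exp_pi_div_two_mul_I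

/-- The only solution of `e^w M(e^w) = e^r i` in the closed strip `|Im w| ≤ π`. -/
lemma eq_critPt (ha : 0 < a) (hab : a < b) {w : ℂ} (hw : |w.im| ≤ Real.pi) {r : ℝ}
    (h : Complex.exp (logSM a b w) = Real.exp r * Complex.I) : w = critPt a b r := by
  apply logSM_injOn a b hw (abs_im_critPt_lt ha hab r).le
  rw [(critPt_spec ha hab r).2]
  rw [← exp_critPt_mul_Mlog ha hab r, ← exp_logSM a b (abs_im_critPt_lt ha hab r).le,
    (critPt_spec ha hab r).2, Complex.exp_eq_exp_iff_exists_int] at h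
  obtain ⟨n, hn⟩ := h
  have him := congrArg Complex.im hn
  have hpi := Real.pi_pos
  simp only [Complex.add_im, Complex.ofReal_im, Complex.I_im, mul_one,
    zero_add, Complex.mul_im, Complex.intCast_re, Complex.intCast_im, zero_mul, add_zero,
    Complex.re_ofNat, Complex.im_ofNat, Complex.mul_re, Complex.ofReal_re, mul_zero, sub_zero,
    Complex.I_re] at him
  -- Since `Im logSM` lies strictly within `π/2` of `Im w ∈ [-π, π]`, of the values `π/2 + 2πn` only
  -- the one with `n = 0` is possible.
  have h1 := abs_lt.1 (abs_im_logSM_sub_lt a b hw)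
  have h2 := abs_le.1 hw
  have h3 : (-2 : ℝ) < n := by
    by_contra! hc
    nlinarith
  have h4 : (n : ℝ) < 1 := by
    by_contra! hc
    nlinarith
  have h5 : -2 < n := by exact_mod_cast h3
  have h6 : n < 1 := by exact_mod_cast h4
  have h7 : n ≠ -1 := by
    rintro rfl
    have h0 : w.im < 0 := by push_cast at him; linarith
    have h8 := im_logSM_ge (a := a) (b := b) (w := (starRingEnd ℂ) w) (by simp; linarith)
      (by simp; linarith)
    rw [logSM_conj a b hw] at h8
    push_cast at him
    linarith
  have h8 : n = 0 := by omega
  rw [hn, h8]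
  simp

/-- Here the upper slope `9/5` is used: from the line `Im w = π/2`, where `Im logSM` is still `δ`
short of `π/2`, the point must climb at least `5δ/9` to reach it. So it lies in the open left half
plane with a quantified angle. -/
lemma exists_re_exp_critPt_le (ha : 0 < a) (hab : a < b) : ∃ c : ℝ, 0 < c ∧
    ∀ r : ℝ, (Complex.exp (critPt a b r)).re ≤
      - (c * (Real.exp (critPt a b r).re / (1 + (critPt a b r).re ^ 2))) := by
  obtain ⟨c, hc, h⟩ := exists_im_logSM_pi_div_two_le ha hab
  have hpi := Real.pi_pos
  refine ⟨2 / Real.pi * (5 / 9 * c), by positivity, fun r => ?_⟩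
  obtain ⟨h1, h2⟩ := critPt_spec ha hab r
  set w := critPt a b r
  have h3 := (im_logSM_sub_mem a b w.re (y₁ := Real.pi / 2) (y₂ := w.im)
    (by rw [abs_of_pos] <;> linarith) (abs_im_critPt_lt ha hab r).le h1.1.le).2
  rw [Complex.re_add_im, h2] at h3
  simp only [Complex.add_im, Complex.ofReal_im, Complex.im_ofReal_mul, Complex.I_im, mul_one,
    zero_add] at h3
  have h4 := h w.re
  set δ := c / (1 + w.re ^ 2) with hδ
  have hδ0 : 0 < δ := by positivity
  have h5 : 5 / 9 * δ ≤ w.im - Real.pi / 2 := by linarith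
  have hcos : 2 / Real.pi * (5 / 9 * δ) ≤ - Real.cos w.im := by
    rw [← Real.sin_sub_pi_div_two]
    calc _ ≤ 2 / Real.pi * (w.im - Real.pi / 2) := by gcongr
      _ ≤ _ := Real.mul_le_sin (by linarith [h1.1]) (by linarith [h1.2])
  rw [Complex.exp_re]
  have : Real.exp w.re * (2 / Real.pi * (5 / 9 * δ)) ≤ Real.exp w.re * (- Real.cos w.im) := by
    gcongr
  calc _ ≤ - (Real.exp w.re * (2 / Real.pi * (5 / 9 * δ))) := by linarith
    _ = _ := by rw [hδ]; ring

/-! ### Quotients of hyperbolic functions -/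

/-- `sinh (x z) / sinh z`. -/
def sinhRatio (x : ℝ) (z : ℂ) : ℂ := Complex.sinh (x * z) / Complex.sinh z

/-- `cosh (x z) / sinh z`. -/
def coshRatio (x : ℝ) (z : ℂ) : ℂ := Complex.cosh (x * z) / Complex.sinh z

lemma norm_sinh_le (z : ℂ) : ‖Complex.sinh z‖ ≤ Real.exp |z.re| := by
  rw [Complex.sinh, norm_div, Complex.norm_ofNat, div_le_iff₀ two_pos]
  refine (norm_sub_le _ _).trans ?_
  rw [Complex.norm_exp, Complex.norm_exp, Complex.neg_re]
  have := Real.exp_le_exp.2 (le_abs_self z.re)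
  have := Real.exp_le_exp.2 (neg_le_abs z.re)
  linarith

lemma norm_cosh_le (z : ℂ) : ‖Complex.cosh z‖ ≤ Real.exp |z.re| := by
  rw [Complex.cosh, norm_div, Complex.norm_ofNat, div_le_iff₀ two_pos]
  refine (norm_add_le _ _).trans ?_
  rw [Complex.norm_exp, Complex.norm_exp, Complex.neg_re]
  have := Real.exp_le_exp.2 (le_abs_self z.re)
  have := Real.exp_le_exp.2 (neg_le_abs z.re)
  linarith

lemma normSq_sinh (z : ℂ) :
    ‖Complex.sinh z‖ ^ 2 = Real.sinh z.re ^ 2 + Real.sin z.im ^ 2 := by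
  have h : Complex.sinh z = (Real.sinh z.re * Real.cos z.im : ℝ) +
      (Real.cosh z.re * Real.sin z.im : ℝ) * Complex.I := by
    conv_lhs => rw [← Complex.re_add_im z, Complex.sinh_add, Complex.cosh_mul_I, Complex.sinh_mul_I]
    push_cast
    ring
  rw [← Complex.normSq_eq_norm_sq, h, Complex.normSq_add_mul_I]
  have h1 := Real.cosh_sq z.re
  have h2 := Real.sin_sq_add_cos_sq z.im
  linear_combination Real.sin z.im ^ 2 * h1 + Real.sinh z.re ^ 2 * h2

/-- By `|sinh z|² = sinh² Re z + sin² Im z`, the zeros `kπi` are the only places where `sinh` is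
small compared with `e^{|Re z|}`; either alternative keeps `z` away from them. -/
lemma exists_exp_le_norm_sinh {η : ℝ} (hη : 0 < η) : ∃ κ : ℝ, 0 < κ ∧ κ ≤ 1 ∧ ∀ z : ℂ,
    η ≤ |z.re| ∨ 1 / 2 ≤ |Real.sin z.im| → κ * Real.exp |z.re| ≤ ‖Complex.sinh z‖ := by
  set κ₁ := (1 - Real.exp (-(2 * η))) / 2 with h1
  have hκ₁ : 0 < κ₁ := by
    have : Real.exp (-(2 * η)) < 1 := Real.exp_lt_one_iff.2 (by linarith)
    rw [h1]; linarith
  set κ₂ := Real.exp (-η) / 2 with h2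
  refine ⟨min κ₁ κ₂, lt_min hκ₁ (by positivity), (min_le_right _ _).trans ?_, ?_⟩
  · have : Real.exp (-η) ≤ 1 := Real.exp_le_one_iff.2 (by linarith)
    rw [h2]; linarith
  intro z hz
  have hsq := normSq_sinh z
  by_cases hz' : η ≤ |z.re|
  · have h3 : Real.sinh |z.re| ≤ ‖Complex.sinh z‖ := by
      apply le_of_sq_le_sq _ (norm_nonneg _)
      rw [hsq]
      have : Real.sinh |z.re| ^ 2 = Real.sinh z.re ^ 2 := by
        rcases abs_choice z.re with h | h <;> rw [h]
        rw [Real.sinh_neg, neg_sq]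
      rw [this]
      nlinarith [sq_nonneg (Real.sin z.im)]
    refine le_trans ?_ h3
    calc _ ≤ κ₁ * Real.exp |z.re| := by gcongr; exact min_le_left _ _
      _ ≤ _ := by
        rw [h1, Real.sinh_eq]
        have : Real.exp (-|z.re|) ≤ Real.exp (-(2 * η)) * Real.exp |z.re| := by
          rw [← Real.exp_add]; apply Real.exp_le_exp.2; linarith
        linarith
  · have h4 := hz.resolve_left hz'
    push Not at hz'
    have h3 : 1 / 2 ≤ ‖Complex.sinh z‖ := by
      apply le_of_sq_le_sq _ (norm_nonneg _)
      rw [hsq, ← sq_abs (Real.sin z.im)]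
      nlinarith [sq_nonneg (Real.sinh z.re)]
    calc _ ≤ κ₂ * Real.exp |z.re| := by gcongr; exact min_le_right _ _
      _ ≤ κ₂ * Real.exp η := by gcongr
      _ = 1 / 2 := by rw [h2, div_mul_eq_mul_div, ← Real.exp_add]; simp
      _ ≤ _ := h3

lemma exists_norm_ratio_le {η : ℝ} (hη : 0 < η) : ∃ C : ℝ, 1 ≤ C ∧ ∀ z : ℂ,
    η ≤ |z.re| ∨ 1 / 2 ≤ |Real.sin z.im| → ∀ x : ℝ,
      ‖sinhRatio x z‖ ≤ C * Real.exp (-((1 - |x|) * |z.re|)) ∧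
      ‖coshRatio x z‖ ≤ C * Real.exp (-((1 - |x|) * |z.re|)) := by
  obtain ⟨κ, hκ, hκ1, h⟩ := exists_exp_le_norm_sinh hη
  refine ⟨κ⁻¹, (one_le_inv₀ hκ).2 hκ1, fun z hz x => ?_⟩
  have h1 := h z hz
  have key : ∀ v : ℂ, ‖v‖ ≤ Real.exp |(x * z : ℂ).re| →
      ‖v / Complex.sinh z‖ ≤ κ⁻¹ * Real.exp (-((1 - |x|) * |z.re|)) := by
    intro v hv
    rw [norm_div, Complex.re_ofReal_mul, abs_mul] at *
    calc ‖v‖ / ‖Complex.sinh z‖ ≤ Real.exp (|x| * |z.re|) / (κ * Real.exp |z.re|) := by gcongr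
      _ = κ⁻¹ * (Real.exp (|x| * |z.re|) / Real.exp |z.re|) := by field_simp
      _ = _ := by rw [← Real.exp_sub]; ring_nf
  exact ⟨key _ (norm_sinh_le _), key _ (norm_cosh_le _)⟩

/-- Both terms of `sinh² Re z + sin² Im z` decrease when `z` is scaled by `|x| ≤ 1`, as long as `|Im
z| ≤ π/2`. This covers small `s`, where `sinh (s M)` has no useful lower bound. -/
lemma norm_sinhRatio_le_one {z : ℂ} (hz : |z.im| ≤ Real.pi / 2) {x : ℝ} (hx : |x| ≤ 1) :
    ‖sinhRatio x z‖ ≤ 1 := by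
  rw [sinhRatio, norm_div]
  apply div_le_one_of_le₀ _ (norm_nonneg _)
  apply le_of_sq_le_sq _ (norm_nonneg _)
  rw [normSq_sinh, normSq_sinh, Complex.re_ofReal_mul, Complex.im_ofReal_mul]
  have h1 : ∀ r : ℝ, |x * r| ≤ |r| := fun r => by
    rw [abs_mul]; exact mul_le_of_le_one_left (abs_nonneg r) hx
  apply add_le_add
  · rw [sq_le_sq, Real.abs_sinh, Real.abs_sinh]
    exact Real.sinh_le_sinh.2 (h1 _)
  · have h2 : ∀ r : ℝ, Real.sin r ^ 2 = Real.sin |r| ^ 2 := fun r => by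
      rcases abs_choice r with h | h <;> rw [h]
      rw [Real.sin_neg, neg_sq]
    rw [h2, h2 z.im]
    have h3 : 0 ≤ Real.sin |x * z.im| := Real.sin_nonneg_of_nonneg_of_le_pi (abs_nonneg _)
      ((h1 _).trans (hz.trans (by linarith [Real.pi_pos])))
    gcongr 1
    exact Real.sin_le_sin_of_le_of_le_pi_div_two (by linarith [abs_nonneg (x * z.im), Real.pi_pos])
      hz (h1 _)

/-- A quarter of the exponential is spent on the factor `1 + log² |s|`; hence the exponent `3/4`
everywhere below. A lower bound on `u` is needed because `e^{u/4}` tends to `0` at `-∞`. -/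
lemma exists_one_add_sq_le_exp (u₀ : ℝ) :
    ∃ K : ℝ, 0 < K ∧ ∀ u : ℝ, u₀ ≤ u → 1 + u ^ 2 ≤ K * Real.exp (u / 4) := by
  refine ⟨33 + (1 + u₀ ^ 2) * Real.exp (-(u₀ / 4)), by positivity, fun u hu => ?_⟩
  rw [add_mul]
  rcases le_or_gt 0 u with h | h
  · have h1 := Real.quadratic_le_exp_of_nonneg (show 0 ≤ u / 4 by positivity)
    have : 0 ≤ (1 + u₀ ^ 2) * Real.exp (-(u₀ / 4)) * Real.exp (u / 4) := by positivity
    nlinarith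
  · have h1 : 1 ≤ Real.exp (-(u₀ / 4)) * Real.exp (u / 4) := by
      rw [← Real.exp_add]
      exact Real.one_le_exp (by linarith)
    have h2 : u ^ 2 ≤ u₀ ^ 2 := by nlinarith
    have h3 := Real.exp_pos (u / 4)
    calc 1 + u ^ 2 ≤ (1 + u₀ ^ 2) * 1 := by linarith
      _ ≤ (1 + u₀ ^ 2) * (Real.exp (-(u₀ / 4)) * Real.exp (u / 4)) := by gcongr
      _ ≤ _ := by rw [← mul_assoc]; linarith

/-! ### Bounds for the transform in the closed right half plane and on the cut -/

/-- `s M(s)` as a function of `w = ln s`. -/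
def expSM (a b : ℝ) (w : ℂ) : ℂ := Complex.exp (logSM a b w)

lemma mul_M_eq {s : ℂ} (hs : s ≠ 0) : s * M a b s = expSM a b (Complex.log s) := by
  rw [expSM, exp_logSM a b (by rw [Complex.log_im]; exact Complex.abs_arg_le_pi s),
    Complex.exp_log hs, M]

lemma Ptilde_eq {s : ℂ} (hs : s ≠ 0) (x : ℝ) :
    Ptilde a b x s = sinhRatio x (expSM a b (Complex.log s)) := by
  rw [Ptilde, sinhRatio, mul_assoc, mul_M_eq hs]

lemma expSM_conj (a b : ℝ) {w : ℂ} (hw : |w.im| ≤ Real.pi) :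
    expSM a b ((starRingEnd ℂ) w) = (starRingEnd ℂ) (expSM a b w) := by
  rw [expSM, logSM_conj a b hw, Complex.exp_conj, expSM]

lemma sinhRatio_conj (x : ℝ) (z : ℂ) :
    sinhRatio x ((starRingEnd ℂ) z) = (starRingEnd ℂ) (sinhRatio x z) := by
  rw [sinhRatio, sinhRatio, map_div₀, ← Complex.sinh_conj, ← Complex.sinh_conj, map_mul,
    Complex.conj_ofReal]

lemma cutRatio_eq {q : ℝ} (hq : 0 < q) (x : ℝ) {θ : ℝ} (hθ : |θ| = Real.pi) :
    cutRatio a b x θ q = sinhRatio x (expSM a b (Real.log q + θ * Complex.I)) := by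
  have him : |((Real.log q : ℂ) + θ * Complex.I).im| ≤ Real.pi := by simp [hθ]
  have h1 : Complex.exp (θ * Complex.I) = -1 := by
    rcases abs_eq Real.pi_pos.le |>.1 hθ with h | h
    · rw [h, Complex.exp_pi_mul_I]
    · rw [h, Complex.ofReal_neg, neg_mul, Complex.exp_neg, Complex.exp_pi_mul_I]; norm_num
  rw [expSM, exp_logSM a b him, Complex.exp_add, h1, ← Complex.ofReal_exp, Real.exp_log hq,
    cutRatio, sinhRatio]
  simp only [mul_neg, neg_mul, mul_one, Complex.sinh_neg, neg_div_neg_eq, mul_assoc]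

/-- For `Re w ≥ u₀` the real part of `s M` dominates `e^{3u/4}` and the general estimate applies.
The bound for `cosh` is asked only for `Re w ≥ 0`, since `cosh (x z) / sinh z` blows up as `s → 0`.
-/
lemma exists_norm_sinhRatio_right_le (ha : 0 < a) (hab : a < b) : ∃ c C : ℝ, 0 < c ∧ 1 ≤ C ∧
    (∀ w : ℂ, |w.im| ≤ Real.pi / 2 → ∀ x : ℝ, |x| ≤ 1 →
      ‖sinhRatio x (expSM a b w)‖ ≤ C * Real.exp (-((1 - |x|) * (c * Real.exp (3 / 4 * w.re))))) ∧
    (∀ w : ℂ, |w.im| ≤ Real.pi / 2 → 0 ≤ w.re → ∀ x : ℝ, |x| ≤ 1 →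
      ‖coshRatio x (expSM a b w)‖ ≤
        C * Real.exp (-((1 - |x|) * (c * Real.exp (3 / 4 * w.re))))) := by
  obtain ⟨c₁, hc₁, h₁⟩ := exists_re_exp_logSM_ge ha hab
  have hb := ha.trans hab
  have hpi := Real.pi_pos
  -- Below `log (a/b)` one has `|s M(s)| ≤ (b/a) |s| ≤ 1`, where the ratio is at most `1`; there the
  -- exponent is at most `c`, so the factor `e^c` in the constant pays for it.
  set u₀ := min 0 (Real.log (a / b)) with hu₀
  obtain ⟨K, hK, hK'⟩ := exists_one_add_sq_le_exp u₀
  set c := c₁ / K with hc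
  have hc0 : 0 < c := by positivity
  have hre : ∀ w : ℂ, |w.im| ≤ Real.pi / 2 → u₀ ≤ w.re →
      c * Real.exp (3 / 4 * w.re) ≤ (expSM a b w).re := by
    intro w hw hu
    refine le_trans ?_ (h₁ w hw)
    rw [hc, div_mul_eq_mul_div, mul_div_assoc]
    gcongr ?_ * ?_
    rw [div_le_div_iff₀ hK (by positivity)]
    calc _ ≤ Real.exp (3 / 4 * w.re) * (K * Real.exp (w.re / 4)) := by gcongr; exact hK' _ hu
      _ = K * (Real.exp (3 / 4 * w.re) * Real.exp (w.re / 4)) := by ring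
      _ = _ := by rw [← Real.exp_add, mul_comm]; ring_nf
  obtain ⟨C, hC, hC'⟩ := exists_norm_ratio_le (η := c * Real.exp (3 / 4 * u₀)) (by positivity)
  have hlarge : ∀ w : ℂ, |w.im| ≤ Real.pi / 2 → u₀ ≤ w.re → ∀ x : ℝ, |x| ≤ 1 →
      ‖sinhRatio x (expSM a b w)‖ ≤ C * Real.exp (-((1 - |x|) * (c * Real.exp (3 / 4 * w.re)))) ∧
      ‖coshRatio x (expSM a b w)‖ ≤
        C * Real.exp (-((1 - |x|) * (c * Real.exp (3 / 4 * w.re)))) := by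
    intro w hw hu x hx
    have h2 := (hre w hw hu).trans (le_abs_self _)
    have h3 := hC' (expSM a b w) (Or.inl (le_trans (by gcongr) h2)) x
    have h4 : C * Real.exp (-((1 - |x|) * |(expSM a b w).re|)) ≤
        C * Real.exp (-((1 - |x|) * (c * Real.exp (3 / 4 * w.re)))) := by
      have := sub_nonneg.2 hx
      gcongr
    exact ⟨h3.1.trans h4, h3.2.trans h4⟩
  refine ⟨c, max C (Real.exp c), hc0, le_max_of_le_left hC, fun w hw x hx => ?_,
    fun w hw h0 x hx => ?_⟩
  · rcases le_or_gt u₀ w.re with hu | hu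
    · exact (hlarge w hw hu x hx).1.trans (by gcongr; exact le_max_left _ _)
    · have h5 : ‖expSM a b w‖ ≤ Real.pi / 2 := by
        refine (norm_exp_logSM_mem ha hab (by linarith)).2.trans ?_
        have : Real.exp w.re ≤ a / b := by
          rw [← Real.exp_log (show 0 < a / b by positivity)]
          exact Real.exp_le_exp.2 (hu.le.trans (min_le_right _ _))
        calc b / a * Real.exp w.re ≤ b / a * (a / b) := by gcongr
          _ = 1 := by field_simp
          _ ≤ _ := by linarith [Real.pi_gt_three]
      refine (norm_sinhRatio_le_one ((Complex.abs_im_le_norm _).trans h5) hx).trans ?_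
      have h6 : Real.exp (3 / 4 * w.re) ≤ 1 :=
        Real.exp_le_one_iff.2 (by linarith [min_le_left 0 (Real.log (a / b))])
      have h7 : (1 - |x|) * (c * Real.exp (3 / 4 * w.re)) ≤ 1 * (c * 1) := by
        have := sub_nonneg.2 hx
        gcongr
        linarith [abs_nonneg x]
      calc 1 = Real.exp c * Real.exp (-c) := by rw [← Real.exp_add]; simp
        _ ≤ _ := by gcongr
                    · exact le_max_right _ _
                    · linarith
  · exact (hlarge w hw ((min_le_left _ _).trans h0) x hx).2.trans (by gcongr; exact le_max_left _ _)

/-- Same argument as in the right half plane, but on the cut `|Re (s M)|` is at least `c q`, with no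
logarithmic loss, so the decay is purely exponential in `q`. -/
lemma exists_norm_cutRatio_le (ha : 0 < a) (hab : a < b) : ∃ c C : ℝ, 0 < c ∧ 1 ≤ C ∧
    (∀ u : ℝ, ∀ x : ℝ, |x| ≤ 1 → ‖sinhRatio x (expSM a b (u + Real.pi * Complex.I))‖ ≤
      C * Real.exp (-((1 - |x|) * (c * Real.exp u)))) ∧
    (∀ u : ℝ, Real.log (a / b) ≤ u → ∀ x : ℝ, |x| ≤ 1 →
      ‖coshRatio x (expSM a b (u + Real.pi * Complex.I))‖ ≤ C) := by
  obtain ⟨c, hc, h₁⟩ := exists_re_exp_logSM_pi_le ha hab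
  have hb := ha.trans hab
  have hpi := Real.pi_pos
  obtain ⟨C, hC, hC'⟩ := exists_norm_ratio_le (η := c * (a / b)) (by positivity)
  have hre : ∀ u : ℝ, c * Real.exp u ≤ |(expSM a b (u + Real.pi * Complex.I)).re| := by
    intro u
    have := h₁ u
    exact (le_neg_of_le_neg this).trans (neg_le_abs _)
  have hlarge : ∀ u : ℝ, Real.log (a / b) ≤ u → c * (a / b) ≤ c * Real.exp u := by
    intro u hu
    gcongr
    rwa [← Real.log_le_iff_le_exp (by positivity)]
  refine ⟨c, max C (Real.exp (c * (a / b))), hc, le_max_of_le_left hC, fun u x hx => ?_,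
    fun u hu x hx => ?_⟩
  · have hx' := sub_nonneg.2 hx
    rcases le_or_gt (Real.log (a / b)) u with hu | hu
    · refine (hC' _ (Or.inl ((hlarge u hu).trans (hre u))) x).1.trans ?_
      gcongr
      · exact le_max_left _ _
      · exact hre u
    · have h6 : Real.exp u ≤ a / b := by
        rw [← Real.exp_log (show 0 < a / b by positivity)]
        exact Real.exp_le_exp.2 hu.le
      have h5 : ‖expSM a b (u + Real.pi * Complex.I)‖ ≤ Real.pi / 2 := by
        refine (norm_exp_logSM_mem ha hab (by simp [abs_of_pos hpi])).2.trans ?_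
        have : ((u : ℂ) + Real.pi * Complex.I).re = u := by simp
        rw [this]
        calc b / a * Real.exp u ≤ b / a * (a / b) := by gcongr
          _ = 1 := by field_simp
          _ ≤ _ := by linarith [Real.pi_gt_three]
      refine (norm_sinhRatio_le_one ((Complex.abs_im_le_norm _).trans h5) hx).trans ?_
      have h7 : (1 - |x|) * (c * Real.exp u) ≤ 1 * (c * (a / b)) := by
        gcongr
        linarith [abs_nonneg x]
      calc 1 = Real.exp (c * (a / b)) * Real.exp (-(c * (a / b))) := by rw [← Real.exp_add]; simp
        _ ≤ _ := mul_le_mul (le_max_right _ _) (Real.exp_le_exp.2 (by linarith))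
            (Real.exp_pos _).le (by positivity)
  · refine (hC' _ (Or.inl ((hlarge u hu).trans (hre u))) x).2.trans ?_
    calc _ ≤ C * 1 := by
          gcongr
          apply Real.exp_le_one_iff.2
          have := sub_nonneg.2 hx
          have : 0 ≤ (1 - |x|) * |(expSM a b (u + Real.pi * Complex.I)).re| := by positivity
          linarith
      _ ≤ _ := by rw [mul_one]; exact le_max_left _ _

/-! ### Simple poles and the residue theorem for rectangles -/

/-- `f` has at most a simple pole at `p`, with residue `c`. -/
def HasSimplePole (f : ℂ → ℂ) (p c : ℂ) : Prop :=
  ∃ h : ℂ → ℂ, AnalyticAt ℂ h p ∧ h p = c ∧ ∀ᶠ ξ in 𝓝[≠] p, f ξ = h ξ / (ξ - p)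

lemma analyticAt_dslope {h : ℂ → ℂ} {p : ℂ} (hh : AnalyticAt ℂ h p) :
    AnalyticAt ℂ (dslope h p) p := by
  obtain ⟨U, hU, hUo, hpU⟩ := eventually_nhds_iff.1 hh.eventually_analyticAt
  have h1 : DifferentiableOn ℂ (dslope h p) U :=
    (Complex.differentiableOn_dslope (hUo.mem_nhds hpU)).2
      fun y hy => (hU y hy).differentiableAt.differentiableWithinAt
  exact h1.analyticAt (hUo.mem_nhds hpU)

lemma hasSimplePole_div {N D : ℂ → ℂ} {p : ℂ} (hN : AnalyticAt ℂ N p) (hD : AnalyticAt ℂ D p)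
    (h0 : D p = 0) (h1 : deriv D p ≠ 0) :
    HasSimplePole (fun ξ => N ξ / D ξ) p (N p / deriv D p) := by
  refine ⟨fun ξ => N ξ / dslope D p ξ, hN.div (analyticAt_dslope hD) (by simpa using h1),
    by simp, ?_⟩
  filter_upwards [self_mem_nhdsWithin] with ξ hξ
  have hξ' : ξ - p ≠ 0 := sub_ne_zero.2 hξ
  have : D ξ = dslope D p ξ * (ξ - p) := by
    rw [dslope_of_ne _ hξ, slope_def_field, h0, sub_zero, div_mul_cancel₀ _ hξ']
  rw [this, div_div]

lemma HasSimplePole.residueAt_eq {f : ℂ → ℂ} {p c : ℂ} (hf : HasSimplePole f p c) :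
    residueAt f p = c := by
  obtain ⟨h, hh, rfl, hfh⟩ := hf
  apply Tendsto.limUnder_eq
  apply tendsto_const_nhds.congr'
  obtain ⟨ε, hε, hε'⟩ := Metric.eventually_nhds_iff.1 (hh.eventually_analyticAt.and
    (eventually_nhdsWithin_iff.1 hfh))
  filter_upwards [Ioo_mem_nhdsGT hε] with r hr
  have h1 : (∮ ξ in C(p, r), f ξ) = ∮ ξ in C(p, r), (ξ - p)⁻¹ • h ξ := by
    apply circleIntegral.integral_congr hr.1.le
    intro ξ hξ
    rw [Metric.mem_sphere] at hξ
    have := (hε' (y := ξ) (by rw [hξ]; exact hr.2)).2 (by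
      rintro rfl
      rw [dist_self] at hξ
      exact hr.1.ne hξ)
    simp only [this, smul_eq_mul, div_eq_inv_mul]
  have h2 : DifferentiableOn ℂ h (Metric.closedBall p r) := fun ξ hξ =>
    ((hε' (lt_of_le_of_lt hξ hr.2)).1).differentiableAt.differentiableWithinAt
  rw [h1, h2.circleIntegral_sub_inv_smul (Metric.mem_ball_self hr.1), smul_eq_mul, ← mul_assoc,
    inv_mul_cancel₀ Complex.two_pi_I_ne_zero, one_mul]

/-- The integral over the boundary of the rectangle with corners `z` (lower left) and `w`
(upper right), counterclockwise. -/
def rectIntegral (f : ℂ → ℂ) (z w : ℂ) : ℂ :=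
  (∫ x : ℝ in z.re..w.re, f (x + z.im * Complex.I)) -
    (∫ x : ℝ in z.re..w.re, f (x + w.im * Complex.I)) +
    Complex.I • (∫ y : ℝ in z.im..w.im, f (w.re + y * Complex.I)) -
    Complex.I • ∫ y : ℝ in z.im..w.im, f (z.re + y * Complex.I)

/-- The boundary of a rectangle. -/
def rectBoundary (z w : ℂ) : Set ℂ :=
  {ξ | ξ ∈ Icc z.re w.re ×ℂ Icc z.im w.im ∧
    (ξ.re = z.re ∨ ξ.re = w.re ∨ ξ.im = z.im ∨ ξ.im = w.im)}

section Rect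

variable {f g : ℂ → ℂ} {z w : ℂ}

lemma mem_rectBoundary_sides (hre : z.re < w.re) (him : z.im < w.im) :
    (∀ x ∈ uIcc z.re w.re, (x + z.im * Complex.I : ℂ) ∈ rectBoundary z w ∧
      (x + w.im * Complex.I : ℂ) ∈ rectBoundary z w) ∧
    (∀ y ∈ uIcc z.im w.im, (w.re + y * Complex.I : ℂ) ∈ rectBoundary z w ∧
      (z.re + y * Complex.I : ℂ) ∈ rectBoundary z w) := by
  rw [uIcc_of_le hre.le, uIcc_of_le him.le]
  refine ⟨fun x hx => ⟨?_, ?_⟩, fun y hy => ⟨?_, ?_⟩⟩ <;>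
    simp only [rectBoundary, mem_ofPred_eq, Complex.mem_reProdIm, Complex.add_re, Complex.ofReal_re,
      Complex.re_ofReal_mul, Complex.I_re, mul_zero, add_zero, Complex.add_im, Complex.ofReal_im,
      Complex.im_ofReal_mul, Complex.I_im, mul_one, zero_add, true_or, or_true, and_true]
  · exact ⟨hx, le_rfl, him.le⟩
  · exact ⟨hx, him.le, le_rfl⟩
  · exact ⟨⟨hre.le, le_rfl⟩, hy⟩
  · exact ⟨⟨le_rfl, hre.le⟩, hy⟩

lemma rectIntegral_congr (hre : z.re < w.re) (him : z.im < w.im)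
    (h : ∀ ξ ∈ rectBoundary z w, f ξ = g ξ) : rectIntegral f z w = rectIntegral g z w := by
  obtain ⟨h1, h2⟩ := mem_rectBoundary_sides hre him
  unfold rectIntegral
  rw [intervalIntegral.integral_congr fun x hx => h _ (h1 x hx).1,
    intervalIntegral.integral_congr fun x hx => h _ (h1 x hx).2,
    intervalIntegral.integral_congr fun x hx => h _ (h2 x hx).1,
    intervalIntegral.integral_congr fun x hx => h _ (h2 x hx).2]

lemma intervalIntegrable_sides (hre : z.re < w.re) (him : z.im < w.im)
    (h : ∀ ξ ∈ rectBoundary z w, ContinuousAt f ξ) :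
    (IntervalIntegrable (fun x : ℝ => f (x + z.im * Complex.I)) volume z.re w.re ∧
      IntervalIntegrable (fun x : ℝ => f (x + w.im * Complex.I)) volume z.re w.re) ∧
    (IntervalIntegrable (fun y : ℝ => f (w.re + y * Complex.I)) volume z.im w.im ∧
      IntervalIntegrable (fun y : ℝ => f (z.re + y * Complex.I)) volume z.im w.im) := by
  obtain ⟨h1, h2⟩ := mem_rectBoundary_sides hre him
  refine ⟨⟨?_, ?_⟩, ?_, ?_⟩ <;> apply ContinuousOn.intervalIntegrable <;> intro t ht
  · exact (ContinuousAt.comp (f := fun x : ℝ => (x + z.im * Complex.I : ℂ))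
      (h _ (h1 t ht).1) (by fun_prop)).continuousWithinAt
  · exact (ContinuousAt.comp (f := fun x : ℝ => (x + w.im * Complex.I : ℂ))
      (h _ (h1 t ht).2) (by fun_prop)).continuousWithinAt
  · exact (ContinuousAt.comp (f := fun y : ℝ => (w.re + y * Complex.I : ℂ))
      (h _ (h2 t ht).1) (by fun_prop)).continuousWithinAt
  · exact (ContinuousAt.comp (f := fun y : ℝ => (z.re + y * Complex.I : ℂ))
      (h _ (h2 t ht).2) (by fun_prop)).continuousWithinAt

lemma rectIntegral_add (hre : z.re < w.re) (him : z.im < w.im)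
    (hf : ∀ ξ ∈ rectBoundary z w, ContinuousAt f ξ)
    (hg : ∀ ξ ∈ rectBoundary z w, ContinuousAt g ξ) :
    rectIntegral (fun ξ => f ξ + g ξ) z w = rectIntegral f z w + rectIntegral g z w := by
  obtain ⟨⟨f1, f2⟩, f3, f4⟩ := intervalIntegrable_sides hre him hf
  obtain ⟨⟨g1, g2⟩, g3, g4⟩ := intervalIntegrable_sides hre him hg
  simp only [rectIntegral]
  rw [intervalIntegral.integral_add f1 g1, intervalIntegral.integral_add f2 g2,
    intervalIntegral.integral_add f3 g3, intervalIntegral.integral_add f4 g4]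
  simp only [smul_eq_mul]
  ring

lemma rectIntegral_const_mul (c : ℂ) :
    rectIntegral (fun ξ => c * f ξ) z w = c * rectIntegral f z w := by
  simp only [rectIntegral, intervalIntegral.integral_const_mul, smul_eq_mul]
  ring

lemma arg_lt_of_re_pos {v : ℂ} (hv : 0 < v.re) : |v.arg| < Real.pi / 2 :=
  Complex.abs_arg_lt_pi_div_two_iff.2 (Or.inl hv)

lemma log_I_mul_of_re_pos {v : ℂ} (hv : 0 < v.re) :
    Complex.log (Complex.I * v) = Complex.log v + Real.pi / 2 * Complex.I := by
  have h := abs_lt.1 (arg_lt_of_re_pos hv)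
  have := Real.pi_pos
  rw [Complex.log_mul Complex.I_ne_zero (by rintro rfl; simp at hv)
    (by rw [Complex.arg_I]; constructor <;> linarith), Complex.log_I, add_comm]

lemma log_neg_I_mul_of_re_pos {v : ℂ} (hv : 0 < v.re) :
    Complex.log (-Complex.I * v) = Complex.log v - Real.pi / 2 * Complex.I := by
  have h := abs_lt.1 (arg_lt_of_re_pos hv)
  have := Real.pi_pos
  rw [Complex.log_mul (neg_ne_zero.2 Complex.I_ne_zero) (by rintro rfl; simp at hv)
    (by rw [Complex.arg_neg_I]; constructor <;> linarith), Complex.log_neg_I]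
  ring

lemma integral_line_inv {ξ₀ d e : ℂ} {s t : ℝ}
    (h : ∀ x ∈ uIcc s t, 0 < (e * (ξ₀ + x * d)).re) :
    d * ∫ x in s..t, (ξ₀ + x * d)⁻¹ =
      Complex.log (e * (ξ₀ + t * d)) - Complex.log (e * (ξ₀ + s * d)) := by
  have he : ∀ x ∈ uIcc s t, e ≠ 0 ∧ ξ₀ + x * d ≠ 0 := fun x hx => by
    have := h x hx
    constructor
    · rintro rfl; simp at this
    · intro h0; rw [h0] at this; simp at this
  rw [← intervalIntegral.integral_const_mul]
  apply intervalIntegral.integral_eq_sub_of_hasDerivAt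
  · intro x hx
    have h1 : HasDerivAt (fun x : ℝ => e * (ξ₀ + x * d)) (e * d) x := by
      simpa using (((Complex.ofRealCLM.hasDerivAt (x := x)).mul_const d).const_add ξ₀).const_mul e
    refine (h1.clog_real (Or.inl (h x hx))).congr_deriv ?_
    rw [mul_div_mul_left _ _ (he x hx).1, div_eq_mul_inv]
  · apply ContinuousOn.intervalIntegrable
    intro x hx
    have h2 : ContinuousAt (fun x : ℝ => (ξ₀ + x * d)) x := by fun_prop
    exact (continuousAt_const.mul (h2.inv₀ (he x hx).2)).continuousWithinAt

/-- Each side lies in an open half plane with respect to `p`. After multiplication by `i`, `-i`, `1`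
or `-1` that half plane becomes the right one, where the principal logarithm is a primitive; at the
four corners the branches differ by `±iπ/2`, and these jumps add up to `2πi`. -/
lemma rectIntegral_inv_sub {p : ℂ} (hre : p.re ∈ Ioo z.re w.re) (him : p.im ∈ Ioo z.im w.im) :
    rectIntegral (fun ξ => (ξ - p)⁻¹) z w = 2 * Real.pi * Complex.I := by
  have e1 : ∀ (x y : ℝ), ((x : ℂ) + y * Complex.I - p) =
      ((y - p.im : ℝ) * Complex.I - p.re : ℂ) + x * 1 := by
    intro x y
    conv_lhs => rw [← Complex.re_add_im p]
    push_cast; ring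
  have e2 : ∀ (x y : ℝ), ((x : ℂ) + y * Complex.I - p) =
      ((x - p.re : ℝ) - p.im * Complex.I : ℂ) + y * Complex.I := by
    intro x y
    conv_lhs => rw [← Complex.re_add_im p]
    push_cast; ring
  have hb := integral_line_inv (ξ₀ := ((z.im - p.im : ℝ) * Complex.I - p.re : ℂ)) (d := 1)
    (e := Complex.I) (s := z.re) (t := w.re) (by
      intro x _; rw [← e1]; simpa using him.1)
  have ht := integral_line_inv (ξ₀ := ((w.im - p.im : ℝ) * Complex.I - p.re : ℂ)) (d := 1)
    (e := -Complex.I) (s := z.re) (t := w.re) (by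
      intro x _; rw [← e1]; simpa using him.2)
  have hr := integral_line_inv (ξ₀ := ((w.re - p.re : ℝ) - p.im * Complex.I : ℂ)) (d := Complex.I)
    (e := 1) (s := z.im) (t := w.im) (by
      intro x _; rw [← e2]; simpa using hre.2)
  have hl := integral_line_inv (ξ₀ := ((z.re - p.re : ℝ) - p.im * Complex.I : ℂ)) (d := Complex.I)
    (e := -1) (s := z.im) (t := w.im) (by
      intro x _; rw [← e2]; simpa using hre.1)
  simp only [← e1] at hb ht
  simp only [← e2] at hr hl
  simp only [one_mul] at hb ht hr
  rw [rectIntegral, hb, ht, smul_eq_mul, smul_eq_mul, hr, hl]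
  have r1 : 0 < ((w.re : ℂ) + z.im * Complex.I - p).re := by simpa using hre.2
  have r2 : 0 < ((w.re : ℂ) + w.im * Complex.I - p).re := by simpa using hre.2
  have r3 : 0 < (-1 * ((z.re : ℂ) + w.im * Complex.I - p)).re := by simpa using hre.1
  have r4 : 0 < (-1 * ((z.re : ℂ) + z.im * Complex.I - p)).re := by simpa using hre.1
  have l3 := log_I_mul_of_re_pos r3
  have l4 := log_neg_I_mul_of_re_pos r4
  rw [← mul_assoc, mul_neg_one] at l3 l4
  rw [neg_neg] at l4
  rw [log_I_mul_of_re_pos r1, log_neg_I_mul_of_re_pos r2, l3, l4]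
  ring

/-- Induction on the set of poles. Subtracting the principal part `c / (ξ - p)` at one pole leaves a
removable singularity, filled by the divided difference of the numerator; the subtracted part
contributes `2πi c`. -/
theorem rectIntegral_eq_sum_residues (hre : z.re < w.re) (him : z.im < w.im) (S : Finset ℂ)
    (c : ℂ → ℂ) (hS : ∀ p ∈ S, p.re ∈ Ioo z.re w.re ∧ p.im ∈ Ioo z.im w.im)
    (hf : ∀ ξ ∈ Icc z.re w.re ×ℂ Icc z.im w.im, ξ ∉ S → DifferentiableAt ℂ f ξ)
    (hp : ∀ p ∈ S, HasSimplePole f p (c p)) :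
    rectIntegral f z w = 2 * Real.pi * Complex.I * ∑ p ∈ S, c p := by
  classical
  induction S using Finset.induction_on generalizing f with
  | empty =>
    rw [Finset.sum_empty, mul_zero]
    apply Complex.integral_boundary_rect_eq_zero_of_differentiableOn
    rw [uIcc_of_le hre.le, uIcc_of_le him.le]
    exact fun ξ hξ => (hf ξ hξ (by simp)).differentiableWithinAt
  | insert p S hpS ih =>
    obtain ⟨h, hh, hc, hfh⟩ := hp p (Finset.mem_insert_self _ _)
    have hpm := hS p (Finset.mem_insert_self _ _)
    set g : ℂ → ℂ := fun ξ => f ξ - c p / (ξ - p) with hg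
    set f₁ : ℂ → ℂ := Function.update g p (dslope h p p) with hf₁
    have hf₁g : ∀ ξ, ξ ≠ p → f₁ =ᶠ[𝓝 ξ] g := fun ξ hξ => by
      filter_upwards [isOpen_ne.mem_nhds hξ] with v hv
      rw [hf₁, Function.update_of_ne hv]
    have hf₁p : DifferentiableAt ℂ f₁ p := by
      have : f₁ =ᶠ[𝓝 p] dslope h p := by
        filter_upwards [eventually_nhdsWithin_iff.1 hfh] with v hv
        by_cases hvp : v = p
        · rw [hvp, hf₁, Function.update_self]
        · rw [hf₁, Function.update_of_ne hvp, dslope_of_ne _ hvp, slope_def_field, hg]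
          simp only
          rw [hv hvp, hc, sub_div]
      exact (analyticAt_dslope hh).differentiableAt.congr_of_eventuallyEq this
    have hsub : ∀ ξ, ξ ≠ p → AnalyticAt ℂ (fun ξ => c p / (ξ - p)) ξ := fun ξ hξ =>
      analyticAt_const.div (analyticAt_id.sub analyticAt_const) (sub_ne_zero.2 hξ)
    have ih' := ih (f := f₁) (fun q hq => hS q (Finset.mem_insert_of_mem hq)) (by
        intro ξ hξ hξS
        by_cases hξp : ξ = p
        · rw [hξp]; exact hf₁p
        · exact ((hf ξ hξ (by simp [hξp, hξS])).sub
            (hsub ξ hξp).differentiableAt).congr_of_eventuallyEq (hf₁g ξ hξp)) (by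
        intro q hq
        have hqp : q ≠ p := fun h => hpS (h ▸ hq)
        obtain ⟨k, hk, hkc, hfk⟩ := hp q (Finset.mem_insert_of_mem hq)
        refine ⟨fun ξ => k ξ - (ξ - q) * (c p / (ξ - p)),
          hk.sub ((analyticAt_id.sub analyticAt_const).mul (hsub q hqp)), by simp [hkc], ?_⟩
        filter_upwards [hfk, self_mem_nhdsWithin, (hf₁g q hqp).filter_mono nhdsWithin_le_nhds]
          with ξ h1 h2 h3
        have h4 : ξ - q ≠ 0 := sub_ne_zero.2 h2
        rw [h3, hg]
        simp only
        rw [h1, sub_div, mul_div_cancel_left₀ _ h4])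
    have hbd : ∀ ξ ∈ rectBoundary z w, ξ ∉ insert p S := by
      intro ξ hξ hmem
      obtain ⟨h1, h2⟩ := hS ξ hmem
      rcases hξ.2 with h | h | h | h
      · exact h1.1.ne' h
      · exact h1.2.ne h
      · exact h2.1.ne' h
      · exact h2.2.ne h
    have hbp : ∀ ξ ∈ rectBoundary z w, ξ ≠ p := fun ξ hξ h =>
      hbd ξ hξ (h ▸ Finset.mem_insert_self _ _)
    have hsplit : rectIntegral f z w =
        rectIntegral (fun ξ => f₁ ξ + c p * (ξ - p)⁻¹) z w := by
      apply rectIntegral_congr hre him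
      intro ξ hξ
      rw [(hf₁g ξ (hbp ξ hξ)).eq_of_nhds, hg]
      simp only [div_eq_mul_inv, sub_add_cancel]
    rw [hsplit, rectIntegral_add hre him, rectIntegral_const_mul, rectIntegral_inv_sub hpm.1 hpm.2,
      ih', Finset.sum_insert hpS]
    · ring
    · intro ξ hξ
      exact (((hf ξ hξ.1 (hbd ξ hξ)).sub
        (hsub ξ (hbp ξ hξ)).differentiableAt).congr_of_eventuallyEq
          (hf₁g ξ (hbp ξ hξ))).continuousAt
    · intro ξ hξ
      have := (hsub ξ (hbp ξ hξ)).continuousAt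
      simpa only [div_eq_mul_inv] using this

end Rect

/-! ### The zeros of `sinh (s M(s))` -/

/-- The logarithm of the `n`-th pole in the upper half plane. -/
def poleLog (a b : ℝ) (n : ℕ) : ℂ := critPt a b (Real.log (n * Real.pi))

/-- The `n`-th pole of the transform in the upper half plane. -/
def pole (a b : ℝ) (n : ℕ) : ℂ := Complex.exp (poleLog a b n)

lemma pole_ne_zero (a b : ℝ) (n : ℕ) : pole a b n ≠ 0 := Complex.exp_ne_zero _

lemma natCast_mul_pi_pos {n : ℕ} (hn : 1 ≤ n) : 0 < (n : ℝ) * Real.pi :=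
  mul_pos (by exact_mod_cast hn) Real.pi_pos

lemma poleLog_im_mem (ha : 0 < a) (hab : a < b) (n : ℕ) :
    (poleLog a b n).im ∈ Ioo (Real.pi / 2) Real.pi := (critPt_spec ha hab _).1

lemma abs_im_poleLog_lt (ha : 0 < a) (hab : a < b) (n : ℕ) : |(poleLog a b n).im| < Real.pi :=
  abs_im_critPt_lt ha hab _

lemma log_pole (ha : 0 < a) (hab : a < b) (n : ℕ) : Complex.log (pole a b n) = poleLog a b n := by
  have h := abs_lt.1 (abs_im_poleLog_lt ha hab n)
  exact Complex.log_exp h.1 h.2.le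

lemma pole_mem_slitPlane (ha : 0 < a) (hab : a < b) (n : ℕ) : pole a b n ∈ Complex.slitPlane := by
  rw [Complex.mem_slitPlane_iff_arg]
  refine ⟨?_, Complex.exp_ne_zero _⟩
  rw [← Complex.log_im, log_pole ha hab]
  exact (poleLog_im_mem ha hab n).2.ne

lemma expSM_poleLog (ha : 0 < a) (hab : a < b) {n : ℕ} (hn : 1 ≤ n) :
    expSM a b (poleLog a b n) = n * Real.pi * Complex.I := by
  rw [expSM, exp_logSM a b (abs_im_poleLog_lt ha hab n).le, poleLog, exp_critPt_mul_Mlog ha hab,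
    Real.exp_log (natCast_mul_pi_pos hn)]
  push_cast
  rfl

lemma eq_poleLog (ha : 0 < a) (hab : a < b) {w : ℂ} (hw : |w.im| ≤ Real.pi) {n : ℕ} (hn : 1 ≤ n)
    (h : expSM a b w = n * Real.pi * Complex.I) : w = poleLog a b n := by
  apply eq_critPt ha hab hw
  rw [Real.exp_log (natCast_mul_pi_pos hn)]
  push_cast
  exact h

lemma pole_mul_M (ha : 0 < a) (hab : a < b) {n : ℕ} (hn : 1 ≤ n) :
    pole a b n * M a b (pole a b n) = n * Real.pi * Complex.I := by
  rw [mul_M_eq (pole_ne_zero a b n), log_pole ha hab, expSM_poleLog ha hab hn]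

lemma eq_pole (ha : 0 < a) (hab : a < b) {s : ℂ} (hs : s ∈ Complex.slitPlane) {n : ℕ} (hn : 1 ≤ n)
    (h : s * M a b s = n * Real.pi * Complex.I) : s = pole a b n := by
  have h0 := Complex.slitPlane_ne_zero hs
  rw [mul_M_eq h0] at h
  rw [pole, ← eq_poleLog ha hab (by rw [Complex.log_im]; exact Complex.abs_arg_le_pi s) hn h,
    Complex.exp_log h0]

lemma M_conj {s : ℂ} (hs : s ∈ Complex.slitPlane) :
    (starRingEnd ℂ) s * M a b ((starRingEnd ℂ) s) = (starRingEnd ℂ) (s * M a b s) := by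
  have h0 := Complex.slitPlane_ne_zero hs
  rw [mul_M_eq h0, mul_M_eq (by simpa using h0),
    Complex.log_conj _ (Complex.slitPlane_arg_ne_pi hs),
    expSM_conj a b (by rw [Complex.log_im]; exact Complex.abs_arg_le_pi s)]

lemma conj_mem_slitPlane {s : ℂ} (hs : s ∈ Complex.slitPlane) :
    (starRingEnd ℂ) s ∈ Complex.slitPlane := by
  rcases hs with h | h
  · exact Or.inl (by simpa using h)
  · exact Or.inr (by simpa using h)

lemma eq_conj_pole (ha : 0 < a) (hab : a < b) {s : ℂ} (hs : s ∈ Complex.slitPlane) {n : ℕ}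
    (hn : 1 ≤ n) (h : s * M a b s = -(n * Real.pi * Complex.I)) :
    s = (starRingEnd ℂ) (pole a b n) := by
  rw [← eq_pole ha hab (conj_mem_slitPlane hs) hn (by rw [M_conj hs, h]; simp), Complex.conj_conj]

/-- A zero of `sinh` is `kπi`, and `k ≠ 0` because `s M(s)` is an exponential. Positive `k` gives a
pole in the upper half plane, negative `k` its conjugate. -/
lemma exists_eq_of_sinh_expSM_eq_zero (ha : 0 < a) (hab : a < b) {w : ℂ} (hw : |w.im| ≤ Real.pi)
    (h : Complex.sinh (expSM a b w) = 0) :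
    ∃ n : ℕ, 1 ≤ n ∧ (w = poleLog a b n ∨ (starRingEnd ℂ) w = poleLog a b n) := by
  have h1 := normSq_sinh (expSM a b w)
  rw [h, norm_zero] at h1
  have h2 : (expSM a b w).re = 0 := by
    rw [← Real.sinh_eq_zero]
    nlinarith [sq_nonneg (Real.sinh (expSM a b w).re), sq_nonneg (Real.sin (expSM a b w).im)]
  have h3 : Real.sin (expSM a b w).im = 0 := by
    nlinarith [sq_nonneg (Real.sinh (expSM a b w).re), sq_nonneg (Real.sin (expSM a b w).im)]
  obtain ⟨k, hk⟩ := Real.sin_eq_zero_iff.1 h3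
  have h4 : expSM a b w = k * Real.pi * Complex.I := by
    apply Complex.ext
    · simp [h2]
    · simp [← hk]
  have hk0 : k ≠ 0 := by
    rintro rfl
    exact Complex.exp_ne_zero (logSM a b w) (by rw [← expSM, h4]; simp)
  rcases lt_or_gt_of_ne hk0 with hneg | hpos
  · refine ⟨(-k).toNat, by omega, Or.inr (eq_poleLog ha hab (by simpa using hw) (by omega) ?_)⟩
    rw [expSM_conj a b hw, h4]
    have : (((-k).toNat : ℕ) : ℂ) = -(k : ℂ) := by
      have := Int.toNat_of_nonneg (show 0 ≤ -k by omega)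
      exact_mod_cast congrArg (Int.cast (R := ℂ)) this
    rw [this]
    simp
  · refine ⟨k.toNat, by omega, Or.inl (eq_poleLog ha hab hw (by omega) ?_)⟩
    rw [h4]
    have : ((k.toNat : ℕ) : ℂ) = (k : ℂ) := by
      have := Int.toNat_of_nonneg (show 0 ≤ k by omega)
      exact_mod_cast congrArg (Int.cast (R := ℂ)) this
    rw [this]

lemma sinh_expSM_ne_zero_of_abs_im_le (ha : 0 < a) (hab : a < b) {w : ℂ}
    (hw : |w.im| ≤ Real.pi / 2) : Complex.sinh (expSM a b w) ≠ 0 := by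
  intro h
  have hpi := Real.pi_pos
  obtain ⟨n, _, h1 | h1⟩ := exists_eq_of_sinh_expSM_eq_zero ha hab (by linarith) h
  · have := (poleLog_im_mem ha hab n).1
    rw [← h1] at this
    linarith [le_abs_self w.im]
  · have := (poleLog_im_mem ha hab n).1
    rw [← h1, Complex.conj_im] at this
    linarith [neg_le_abs w.im]

lemma sinh_expSM_ne_zero_of_im_eq (ha : 0 < a) (hab : a < b) {w : ℂ}
    (hw : |w.im| = Real.pi) : Complex.sinh (expSM a b w) ≠ 0 := by
  intro h
  have hpi := Real.pi_pos
  obtain ⟨n, _, h1 | h1⟩ := exists_eq_of_sinh_expSM_eq_zero ha hab hw.le h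
  · have := abs_im_poleLog_lt ha hab n
    rw [← h1] at this
    linarith
  · have := abs_im_poleLog_lt ha hab n
    rw [← h1, Complex.conj_im, abs_neg] at this
    linarith

lemma hasDerivAt_expSM (a b : ℝ) {w : ℂ} (hw : |w.im| ≤ Real.pi) :
    HasDerivAt (expSM a b) (expSM a b w * logSMDeriv a b w) w := (hasDerivAt_logSM a b hw).cexp

lemma analyticAt_expMean (w : ℂ) : AnalyticAt ℂ expMean w := differentiable_expMean.analyticAt w

lemma analyticAt_expSM (a b : ℝ) {w : ℂ} (hw : |w.im| ≤ Real.pi) :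
    AnalyticAt ℂ (expSM a b) w := by
  have h : ∀ r : ℝ, AnalyticAt ℂ (fun w => Complex.log (expMean (r + w))) w := fun r =>
    AnalyticAt.clog (AnalyticAt.fun_comp (analyticAt_expMean _) (analyticAt_const.add analyticAt_id))
      (expMean_mem_slitPlane (by simpa using hw))
  exact AnalyticAt.cexp (analyticAt_id.sub (((h _).sub (h _)).div_const))

lemma analyticAt_sinh_expSM (a b : ℝ) (x : ℝ) {w : ℂ} (hw : |w.im| ≤ Real.pi) :
    AnalyticAt ℂ (fun w => Complex.sinh (x * expSM a b w)) w :=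
  AnalyticAt.fun_comp (Complex.differentiable_sinh.analyticAt _)
    (analyticAt_const.mul (analyticAt_expSM a b hw))

lemma analyticAt_sinhRatio_expSM (x : ℝ) {w : ℂ} (hw : |w.im| ≤ Real.pi)
    (h : Complex.sinh (expSM a b w) ≠ 0) :
    AnalyticAt ℂ (fun w => sinhRatio x (expSM a b w)) w := by
  have := analyticAt_sinh_expSM a b 1 hw
  simp only [Complex.ofReal_one, one_mul] at this
  exact (analyticAt_sinh_expSM a b x hw).div this h

/-! ### The residues -/

/-- `(-1)ⁿ sₙ / (n π φ'(ln sₙ))`, where `φ(w) = ln (e^w M(e^w))`. -/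
def poleCoef (a b : ℝ) (n : ℕ) : ℂ :=
  (-1) ^ n * pole a b n / (n * Real.pi * logSMDeriv a b (poleLog a b n))

/-- The residue of the transform times `e^{st}` at the `n`-th pole. -/
def poleTerm (a b x t : ℝ) (n : ℕ) : ℂ :=
  poleCoef a b n * Real.sin (n * Real.pi * x) * Complex.exp (pole a b n * t)

lemma logSMDeriv_ne_zero (a b : ℝ) {w : ℂ} (hw : |w.im| ≤ Real.pi) : logSMDeriv a b w ≠ 0 := by
  intro h
  have := (logSMDeriv_re_mem a b hw).1
  rw [h] at this
  norm_num at this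

lemma cosh_nat_mul_pi_mul_I (n : ℕ) : Complex.cosh (n * Real.pi * Complex.I) = (-1) ^ n := by
  rw [Complex.cosh_mul_I]
  exact_mod_cast congrArg (Complex.ofReal) (Real.cos_nat_mul_pi n)

lemma sinh_nat_mul_pi_mul_I (n : ℕ) : Complex.sinh (n * Real.pi * Complex.I) = 0 := by
  rw [Complex.sinh_mul_I]
  have := congrArg (Complex.ofReal) (Real.sin_nat_mul_pi n)
  push_cast at this
  rw [this, zero_mul]

lemma hasDerivAt_sinh_expSM (a b : ℝ) {w : ℂ} (hw : |w.im| ≤ Real.pi) :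
    HasDerivAt (fun w => Complex.sinh (expSM a b w))
      (Complex.cosh (expSM a b w) * (expSM a b w * logSMDeriv a b w)) w :=
  (hasDerivAt_expSM a b hw).csinh

lemma poleTerm_eq_div (ha : 0 < a) (hab : a < b) (x t : ℝ) {n : ℕ} (hn : 1 ≤ n) :
    Complex.sinh (x * (n * Real.pi * Complex.I)) /
      (Complex.cosh (n * Real.pi * Complex.I) * (n * Real.pi * Complex.I *
        logSMDeriv a b (poleLog a b n)) / pole a b n) * Complex.exp (pole a b n * t) =
    poleTerm a b x t n := by
  have h1 : (n : ℂ) ≠ 0 := by exact_mod_cast (by omega : n ≠ 0)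
  have h2 : (Real.pi : ℂ) ≠ 0 := by exact_mod_cast Real.pi_ne_zero
  have h3 := logSMDeriv_ne_zero a b (abs_im_poleLog_lt ha hab n).le
  have h4 : pole a b n ≠ 0 := Complex.exp_ne_zero _
  have h5 : ((-1 : ℂ) ^ n) * (-1) ^ n = 1 := by rw [← mul_pow]; simp
  have h6 : (-1 : ℂ) ^ n ≠ 0 := pow_ne_zero _ (by norm_num)
  rw [cosh_nat_mul_pi_mul_I, poleTerm, poleCoef,
    show (x : ℂ) * (n * Real.pi * Complex.I) = ((n * Real.pi * x : ℝ) : ℂ) * Complex.I by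
      push_cast; ring, Complex.sinh_mul_I, ← Complex.ofReal_sin]
  have h7 := Complex.I_ne_zero
  field_simp
  linear_combination (-(Real.sin (n * Real.pi * x) : ℂ)) * h5

lemma hasSimplePole_poleLog (ha : 0 < a) (hab : a < b) (x t : ℝ) {n : ℕ} (hn : 1 ≤ n) :
    HasSimplePole (fun w => sinhRatio x (expSM a b w) * Complex.exp (Complex.exp w * t) *
      Complex.exp w) (poleLog a b n) (poleTerm a b x t n) := by
  have hw := (abs_im_poleLog_lt ha hab n).le
  have hd := (hasDerivAt_sinh_expSM a b hw).deriv
  have h3 := logSMDeriv_ne_zero a b hw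
  have h1 : (n : ℂ) ≠ 0 := by exact_mod_cast (by omega : n ≠ 0)
  have h2 : (Real.pi : ℂ) ≠ 0 := by exact_mod_cast Real.pi_ne_zero
  have hexp : AnalyticAt ℂ (fun w => Complex.exp (Complex.exp w * t) * Complex.exp w)
      (poleLog a b n) :=
    (by fun_prop : Differentiable ℂ fun w : ℂ =>
      Complex.exp (Complex.exp w * t) * Complex.exp w).analyticAt _
  have h := hasSimplePole_div (p := poleLog a b n)
    (N := fun w => Complex.sinh (x * expSM a b w) *
      (Complex.exp (Complex.exp w * t) * Complex.exp w))
    (D := fun w => Complex.sinh (expSM a b w))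
    ((analyticAt_sinh_expSM a b x hw).mul hexp)
    (by simpa using analyticAt_sinh_expSM a b 1 hw)
    (by rw [expSM_poleLog ha hab hn, sinh_nat_mul_pi_mul_I])
    (by
      rw [hd, expSM_poleLog ha hab hn, cosh_nat_mul_pi_mul_I]
      have : (-1 : ℂ) ^ n ≠ 0 := pow_ne_zero _ (by norm_num)
      have := Complex.I_ne_zero
      positivity)
  convert h using 1
  · funext w
    rw [sinhRatio]
    ring
  · rw [hd, expSM_poleLog ha hab hn, ← poleTerm_eq_div ha hab x t hn]
    have : Complex.exp (poleLog a b n) = pole a b n := rfl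
    rw [this]
    have h4 : pole a b n ≠ 0 := Complex.exp_ne_zero _
    field_simp

lemma hasDerivAt_sinh_mul_M (a b : ℝ) {s : ℂ} (hs : s ∈ Complex.slitPlane) :
    HasDerivAt (fun s => Complex.sinh (s * M a b s)) (Complex.cosh (s * M a b s) *
      (s * M a b s * logSMDeriv a b (Complex.log s)) / s) s := by
  have hw : |(Complex.log s).im| ≤ Real.pi := by rw [Complex.log_im]; exact Complex.abs_arg_le_pi s
  have h := (hasDerivAt_sinh_expSM a b hw).comp s (Complex.hasDerivAt_log hs)
  rw [← mul_M_eq (Complex.slitPlane_ne_zero hs)] at h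
  refine (h.congr_of_eventuallyEq ?_).congr_deriv (by rw [div_eq_mul_inv])
  filter_upwards [Complex.isOpen_slitPlane.mem_nhds hs] with z hz
  simp only [Function.comp]
  rw [mul_M_eq (Complex.slitPlane_ne_zero hz)]

lemma analyticAt_comp_log {f : ℂ → ℂ} {s : ℂ} (hs : s ∈ Complex.slitPlane)
    (hf : AnalyticAt ℂ f (Complex.log s)) : AnalyticAt ℂ (fun s => f (Complex.log s)) s :=
  AnalyticAt.fun_comp hf (analyticAt_clog hs)

lemma analyticAt_mul_M (a b : ℝ) {s : ℂ} (hs : s ∈ Complex.slitPlane) :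
    AnalyticAt ℂ (fun s => s * M a b s) s := by
  refine (analyticAt_comp_log hs (analyticAt_expSM a b
    (by rw [Complex.log_im]; exact Complex.abs_arg_le_pi s))).congr ?_
  filter_upwards [Complex.isOpen_slitPlane.mem_nhds hs] with z hz
  rw [mul_M_eq (Complex.slitPlane_ne_zero hz)]

lemma residueP_eq (a b x t : ℝ) {s : ℂ} (hs : s ∈ Complex.slitPlane)
    (h0 : Complex.sinh (s * M a b s) = 0)
    (h1 : deriv (fun s => Complex.sinh (s * M a b s)) s ≠ 0) :
    residueP a b x t s = Complex.sinh (x * s * M a b s) /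
      deriv (fun s => Complex.sinh (s * M a b s)) s * Complex.exp (s * t) := by
  have hM := analyticAt_mul_M a b hs
  have h := hasSimplePole_div (p := s)
    (N := fun s => Complex.sinh (x * s * M a b s) * Complex.exp (s * t))
    (D := fun s => Complex.sinh (s * M a b s))
    (by
      refine AnalyticAt.mul ?_ ((by fun_prop :
        Differentiable ℂ fun s : ℂ => Complex.exp (s * t)).analyticAt _)
      simp only [mul_assoc]
      exact AnalyticAt.fun_comp (Complex.differentiable_sinh.analyticAt _) (analyticAt_const.mul hM))
    (AnalyticAt.fun_comp (Complex.differentiable_sinh.analyticAt _) hM) h0 h1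
  have e : (fun s => Ptilde a b x s * Complex.exp (s * t)) = fun s =>
      Complex.sinh (x * s * M a b s) * Complex.exp (s * t) / Complex.sinh (s * M a b s) := by
    funext z
    rw [Ptilde]
    ring
  rw [residueP, e, h.residueAt_eq]
  ring

lemma deriv_sinh_mul_M_conj (a b : ℝ) {s : ℂ} (hs : s ∈ Complex.slitPlane) :
    deriv (fun s => Complex.sinh (s * M a b s)) ((starRingEnd ℂ) s) =
      (starRingEnd ℂ) (deriv (fun s => Complex.sinh (s * M a b s)) s) := by
  have h := (hasDerivAt_sinh_mul_M a b hs).differentiableAt.hasDerivAt.conj_conj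
  refine (h.congr_of_eventuallyEq ?_).deriv
  filter_upwards [Complex.isOpen_slitPlane.mem_nhds (conj_mem_slitPlane hs)] with z hz
  have := M_conj (a := a) (b := b) (conj_mem_slitPlane hz)
  rw [Complex.conj_conj] at this
  simp only [Function.comp]
  rw [this, Complex.sinh_conj]

lemma deriv_sinh_mul_M_pole (ha : 0 < a) (hab : a < b) {n : ℕ} (hn : 1 ≤ n) :
    deriv (fun s => Complex.sinh (s * M a b s)) (pole a b n) =
      Complex.cosh (n * Real.pi * Complex.I) * (n * Real.pi * Complex.I *
        logSMDeriv a b (poleLog a b n)) / pole a b n ∧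
    deriv (fun s => Complex.sinh (s * M a b s)) (pole a b n) ≠ 0 := by
  have h := (hasDerivAt_sinh_mul_M a b (pole_mem_slitPlane ha hab n)).deriv
  rw [pole_mul_M ha hab hn, log_pole ha hab] at h
  refine ⟨h, ?_⟩
  rw [h, cosh_nat_mul_pi_mul_I]
  have h1 : (n : ℂ) ≠ 0 := by exact_mod_cast (by omega : n ≠ 0)
  have h2 : (Real.pi : ℂ) ≠ 0 := by exact_mod_cast Real.pi_ne_zero
  have h3 := logSMDeriv_ne_zero a b (abs_im_poleLog_lt ha hab n).le
  have h4 : pole a b n ≠ 0 := Complex.exp_ne_zero _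
  have h6 : (-1 : ℂ) ^ n ≠ 0 := pow_ne_zero _ (by norm_num)
  have h7 := Complex.I_ne_zero
  positivity

lemma residueP_pole (ha : 0 < a) (hab : a < b) (x t : ℝ) {n : ℕ} (hn : 1 ≤ n) :
    residueP a b x t (pole a b n) = poleTerm a b x t n := by
  obtain ⟨h1, h2⟩ := deriv_sinh_mul_M_pole ha hab hn
  rw [residueP_eq a b x t (pole_mem_slitPlane ha hab n)
    (by rw [pole_mul_M ha hab hn, sinh_nat_mul_pi_mul_I]) h2, h1, mul_assoc,
    pole_mul_M ha hab hn, poleTerm_eq_div ha hab x t hn]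

lemma residueP_conj_pole (ha : 0 < a) (hab : a < b) (x t : ℝ) {n : ℕ} (hn : 1 ≤ n) :
    residueP a b x t ((starRingEnd ℂ) (pole a b n)) = (starRingEnd ℂ) (poleTerm a b x t n) := by
  obtain ⟨h1, h2⟩ := deriv_sinh_mul_M_pole ha hab hn
  have hs := pole_mem_slitPlane ha hab n
  have h0 : Complex.sinh (pole a b n * M a b (pole a b n)) = 0 := by
    rw [pole_mul_M ha hab hn, sinh_nat_mul_pi_mul_I]
  rw [residueP_eq a b x t (conj_mem_slitPlane hs)
    (by rw [M_conj hs, Complex.sinh_conj, h0, map_zero])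
    (by rw [deriv_sinh_mul_M_conj a b hs]; simpa using h2), deriv_sinh_mul_M_conj a b hs,
    ← residueP_pole ha hab x t hn, residueP_eq a b x t hs h0 h2, mul_assoc, M_conj hs]
  simp only [map_mul, map_div₀, ← Complex.sinh_conj, ← Complex.exp_conj, Complex.conj_ofReal,
    mul_assoc]

/-! ### Bounds for the poles and the residues -/

lemma re_poleLog_ge (ha : 0 < a) (hab : a < b) (n : ℕ) :
    Real.log (n * Real.pi) - (Real.log b - Real.log a) ≤ (poleLog a b n).re := by
  have := (abs_le.1 (abs_re_critPt_sub_le ha hab (Real.log (n * Real.pi)))).1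
  rw [poleLog]
  linarith

lemma norm_pole_le (ha : 0 < a) (hab : a < b) {n : ℕ} (hn : 1 ≤ n) :
    ‖pole a b n‖ ≤ b / a * Real.pi * n := by
  have h := (abs_le.1 (abs_re_critPt_sub_le ha hab (Real.log (n * Real.pi)))).2
  rw [pole, Complex.norm_exp, poleLog]
  have hb := ha.trans hab
  calc _ ≤ Real.exp ((Real.log b - Real.log a) + Real.log (n * Real.pi)) :=
        Real.exp_le_exp.2 (by linarith)
    _ = _ := by
      rw [Real.exp_add, Real.exp_sub, Real.exp_log hb, Real.exp_log ha,
        Real.exp_log (natCast_mul_pi_pos hn)]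
      ring

lemma norm_poleCoef_le (ha : 0 < a) (hab : a < b) {n : ℕ} (hn : 1 ≤ n) :
    ‖poleCoef a b n‖ ≤ 5 * (b / a) := by
  have hb := ha.trans hab
  have hpi := Real.pi_pos
  have hn0 : (0 : ℝ) < n := by exact_mod_cast hn
  have h1 : 1 / 5 ≤ ‖logSMDeriv a b (poleLog a b n)‖ :=
    (logSMDeriv_re_mem a b (abs_im_poleLog_lt ha hab n).le).1.trans
      ((le_abs_self _).trans (Complex.abs_re_le_norm _))
  rw [poleCoef, norm_div, norm_mul, norm_mul, norm_mul, norm_pow, norm_neg, norm_one, one_pow,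
    one_mul, Complex.norm_natCast, Complex.norm_real, Real.norm_of_nonneg hpi.le]
  calc _ ≤ b / a * Real.pi * n / (n * Real.pi * (1 / 5)) := by
        gcongr
        exact norm_pole_le ha hab hn
    _ = _ := by field_simp

lemma exp_three_quarters_le {u₀ K : ℝ} (hK : 0 < K)
    (h : ∀ u : ℝ, u₀ ≤ u → 1 + u ^ 2 ≤ K * Real.exp (u / 4)) {u : ℝ} (hu : u₀ ≤ u) :
    K⁻¹ * Real.exp (3 / 4 * u) ≤ Real.exp u / (1 + u ^ 2) := by
  rw [← div_eq_inv_mul, div_le_div_iff₀ hK (by positivity)]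
  calc _ ≤ Real.exp (3 / 4 * u) * (K * Real.exp (u / 4)) := by gcongr; exact h _ hu
    _ = K * (Real.exp (3 / 4 * u) * Real.exp (u / 4)) := by ring
    _ = _ := by rw [← Real.exp_add, mul_comm]; ring_nf

/-- The angular gap between the critical curve and the imaginary axis gives `-Re s_n ≥ c |s_n| / (1
+ log² |s_n|)`, and `|s_n|` is comparable with `n`. This yields convergence of the residue series
for each `t > 0`. -/
lemma exists_pole_re_le (ha : 0 < a) (hab : a < b) :
    ∃ c : ℝ, 0 < c ∧ ∀ n : ℕ, 1 ≤ n → (pole a b n).re ≤ -(c * (n : ℝ) ^ (3 / 4 : ℝ)) := by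
  obtain ⟨c, hc, h⟩ := exists_re_exp_critPt_le ha hab
  obtain ⟨K, hK, hK'⟩ := exists_one_add_sq_le_exp (-(Real.log b - Real.log a))
  refine ⟨c * (K⁻¹ * Real.exp (3 / 4 * -(Real.log b - Real.log a))), by positivity, fun n hn => ?_⟩
  have hn0 : (0 : ℝ) < n := by exact_mod_cast hn
  have hn1 : (1 : ℝ) ≤ n := by exact_mod_cast hn
  have h1 : Real.log n - (Real.log b - Real.log a) ≤ (poleLog a b n).re := by
    refine le_trans ?_ (re_poleLog_ge ha hab n)
    gcongr
    nlinarith [Real.pi_gt_three]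
  have h2 := exp_three_quarters_le hK hK' (u := (poleLog a b n).re)
    (by linarith [Real.log_nonneg hn1])
  refine (h (Real.log (n * Real.pi))).trans (neg_le_neg ?_)
  rw [Real.rpow_def_of_pos hn0, mul_assoc, mul_assoc, ← Real.exp_add]
  gcongr
  refine le_trans ?_ h2
  gcongr
  linarith

lemma summable_pow_mul_exp_neg {c : ℝ} (hc : 0 < c) (k : ℕ) :
    Summable fun n : ℕ => ((n : ℝ) + 1) ^ k * Real.exp (-(c * ((n : ℝ) + 1) ^ (3 / 4 : ℝ))) := by
  -- The `m`-th Taylor term of the exponential is a power `N^{3m/4} = N^{3(k+2)}`, enough to beat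
  -- `N^k` and leave `N^{-2}`.
  set m := 4 * (k + 2) with hm
  have hs : Summable fun n : ℕ => (m.factorial / c ^ m : ℝ) * (1 / ((n : ℝ) + 1) ^ 2) := by
    apply Summable.mul_left
    have := (summable_nat_add_iff 1).2 (Real.summable_one_div_nat_pow.2 one_lt_two)
    simpa using this
  refine Summable.of_nonneg_of_le (fun n => by positivity) (fun n => ?_) hs
  set N : ℝ := (n : ℝ) + 1 with hN
  have hN1 : 1 ≤ N := by rw [hN]; linarith [Nat.cast_nonneg (α := ℝ) n]
  have hN0 : 0 < N := by linarith
  have h1 := Real.pow_div_factorial_le_exp (c * N ^ (3 / 4 : ℝ)) (by positivity) m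
  have h2 : (c * N ^ (3 / 4 : ℝ)) ^ m = c ^ m * N ^ (3 * (k + 2)) := by
    rw [mul_pow, ← Real.rpow_natCast (N ^ (3 / 4 : ℝ)), ← Real.rpow_mul hN0.le,
      ← Real.rpow_natCast N]
    congr 2
    rw [hm]; push_cast; ring
  rw [h2] at h1
  have hf : (0 : ℝ) < m.factorial := by exact_mod_cast m.factorial_pos
  rw [Real.exp_neg, ← div_eq_mul_inv]
  calc N ^ k / Real.exp (c * N ^ (3 / 4 : ℝ)) ≤
        N ^ k / (c ^ m * N ^ (3 * (k + 2)) / m.factorial) := by gcongr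
    _ = (m.factorial / c ^ m) * (N ^ k / N ^ (3 * (k + 2))) := by field_simp
    _ ≤ _ := by
      refine mul_le_mul_of_nonneg_left ?_ (by positivity)
      rw [div_le_div_iff₀ (by positivity) (by positivity), one_mul, ← pow_add]
      exact pow_le_pow_right₀ hN1 (by omega)

lemma norm_poleTerm_le (ha : 0 < a) (hab : a < b) (x t : ℝ) {n : ℕ} (hn : 1 ≤ n) :
    ‖poleTerm a b x t n‖ ≤
      5 * (b / a) * |Real.sin (n * Real.pi * x)| * Real.exp ((pole a b n).re * t) := by
  rw [poleTerm, norm_mul, norm_mul, Complex.norm_exp, Complex.norm_real, Real.norm_eq_abs]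
  have : (pole a b n * t).re = (pole a b n).re * t := Complex.re_mul_ofReal _ _
  rw [this]
  gcongr
  exact norm_poleCoef_le ha hab hn

lemma summable_norm_poleTerm (ha : 0 < a) (hab : a < b) (x : ℝ) {t : ℝ} (ht : 0 < t) :
    Summable fun n : ℕ => ‖poleTerm a b x t (n + 1)‖ := by
  obtain ⟨c, hc, h⟩ := exists_pole_re_le ha hab
  have hb := ha.trans hab
  refine Summable.of_nonneg_of_le (fun n => norm_nonneg _) (fun n => ?_)
    ((summable_pow_mul_exp_neg (mul_pos hc ht) 0).mul_left (5 * (b / a)))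
  refine (norm_poleTerm_le ha hab x t (Nat.le_add_left 1 n)).trans ?_
  have h1 := h (n + 1) (Nat.le_add_left 1 n)
  push_cast at h1 ⊢
  calc _ ≤ 5 * (b / a) * 1 * Real.exp (-(c * ((n : ℝ) + 1) ^ (3 / 4 : ℝ)) * t) := by
        gcongr
        exact Real.abs_sin_le_one _
    _ = _ := by ring_nf

/-! ### Arcs between the poles -/

/-- The logarithm of the radius of an arc passing between the poles `k` and `k + 1`. -/
def arcLog (a b : ℝ) (k : ℕ) : ℝ := (critPt a b (Real.log ((k + 1 / 2) * Real.pi))).re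

lemma arcLog_ge (ha : 0 < a) (hab : a < b) (k : ℕ) :
    Real.log ((k + 1 / 2) * Real.pi) - (Real.log b - Real.log a) ≤ arcLog a b k := by
  have := (abs_le.1 (abs_re_critPt_sub_le ha hab (Real.log ((k + 1 / 2) * Real.pi)))).1
  rw [arcLog]
  linarith

lemma tendsto_arcLog (ha : 0 < a) (hab : a < b) : Tendsto (arcLog a b) atTop atTop := by
  refine tendsto_atTop_mono (arcLog_ge ha hab) ?_
  apply tendsto_atTop_add_const_right
  refine Real.tendsto_log_atTop.comp ?_
  apply Tendsto.atTop_mul_const Real.pi_pos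
  exact tendsto_atTop_add_const_right _ _ tendsto_natCast_atTop_atTop

lemma norm_expSM_sub_le (ha : 0 < a) (hab : a < b) {H : ℝ}
    (hH : ∀ a b : ℝ, ∀ w : ℂ, |w.im| ≤ Real.pi → ‖logSMDeriv a b w‖ ≤ H) (u : ℝ) {y₁ y₂ : ℝ}
    (h₁ : |y₁| ≤ Real.pi) (h₂ : |y₂| ≤ Real.pi) :
    ‖expSM a b (u + y₂ * Complex.I) - expSM a b (u + y₁ * Complex.I)‖ ≤
      b / a * Real.exp u * H * |y₂ - y₁| := by
  set s : Set ℂ := {w | |w.im| ≤ Real.pi ∧ w.re = u} with hs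
  have hconv : Convex ℝ s := by
    have : s = Complex.imLm ⁻¹' (Icc (-Real.pi) Real.pi) ∩ Complex.reLm ⁻¹' {u} := by
      ext w; simp [hs, abs_le]
    rw [this]
    exact ((convex_Icc _ _).linear_preimage _).inter ((convex_singleton _).linear_preimage _)
  have h := hconv.norm_image_sub_le_of_norm_hasDerivWithin_le (f := expSM a b)
    (f' := fun w => expSM a b w * logSMDeriv a b w) (C := b / a * Real.exp u * H)
    (x := u + y₁ * Complex.I) (y := u + y₂ * Complex.I)
    (fun w hw => (hasDerivAt_expSM a b hw.1).hasDerivWithinAt) (fun w hw => by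
      rw [norm_mul]
      have h3 := (norm_exp_logSM_mem ha hab hw.1).2
      rw [hw.2] at h3
      have hb := ha.trans hab
      exact mul_le_mul h3 (hH a b w hw.1) (norm_nonneg _) (by positivity))
    ⟨by simpa using h₁, by simp⟩ ⟨by simpa using h₂, by simp⟩
  refine h.trans_eq ?_
  have : (u + y₂ * Complex.I - (u + y₁ * Complex.I) : ℂ) = ((y₂ - y₁ : ℝ) : ℂ) * Complex.I := by
    push_cast; ring
  rw [this, norm_mul, Complex.norm_I, mul_one, Complex.norm_real, Real.norm_eq_abs]

/-- At `y = v` the value `s M` is purely imaginary. Its argument moves away from `π/2` with slope at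
least `1/5`, so `|Re (s M)|` grows at least linearly in `|y - v|` along the arc. -/
lemma abs_re_expSM_ge (ha : 0 < a) (hab : a < b) {u y v : ℝ} (hy : y ∈ Icc (Real.pi / 2) Real.pi)
    (hv : v ∈ Icc (Real.pi / 2) Real.pi)
    (h : (logSM a b (u + v * Complex.I)).im = Real.pi / 2) :
    a / b * Real.exp u * (2 / (5 * Real.pi) * |y - v|) ≤ |(expSM a b (u + y * Complex.I)).re| := by
  have hpi := Real.pi_pos
  have hb := ha.trans hab
  have hyabs : |y| ≤ Real.pi := by rw [abs_of_nonneg (by linarith [hy.1])]; exact hy.2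
  have hvabs : |v| ≤ Real.pi := by rw [abs_of_nonneg (by linarith [hv.1])]; exact hv.2
  have him : ((u : ℂ) + y * Complex.I).im = y := by simp
  have hre : ((u : ℂ) + y * Complex.I).re = u := by simp
  have h1 := (norm_exp_logSM_mem ha hab (w := u + y * Complex.I) (by rwa [him])).1
  rw [hre] at h1
  set θ := (logSM a b (u + y * Complex.I)).im with hθ
  have hθ0 : y / 5 ≤ θ := by
    have := im_logSM_ge (a := a) (b := b) (w := u + y * Complex.I) (by rw [him]; linarith [hy.1])
      (by rw [him]; exact hy.2)
    rwa [him] at this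
  have hθ1 : θ ≤ y := by
    have := im_logSM_le ha hab (w := u + y * Complex.I) (by rw [him]; linarith [hy.1])
      (by rw [him]; exact hy.2)
    rwa [him] at this
  have hslope : |y - v| / 5 ≤ |θ - Real.pi / 2| := by
    rcases le_total v y with hle | hle
    · have := (im_logSM_sub_mem a b u hvabs hyabs hle).1
      rw [h] at this
      rw [abs_of_nonneg (sub_nonneg.2 hle)]
      exact this.trans (le_abs_self _)
    · have := (im_logSM_sub_mem a b u hyabs hvabs hle).1
      rw [h] at this
      rw [abs_sub_comm, abs_of_nonneg (sub_nonneg.2 hle), abs_sub_comm]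
      exact this.trans (le_abs_self _)
  have hcos : 2 / Real.pi * |θ - Real.pi / 2| ≤ |Real.cos θ| := by
    have h3 : |Real.cos θ| = Real.sin |θ - Real.pi / 2| := by
      rw [← abs_neg, ← Real.sin_sub_pi_div_two, Real.abs_sin_eq_sin_abs_of_abs_le_pi]
      rw [abs_le]; constructor <;> linarith [hy.1, hy.2]
    rw [h3]
    apply Real.mul_le_sin (abs_nonneg _)
    rw [abs_le]; constructor <;> linarith [hy.1, hy.2]
  have e : (expSM a b (u + y * Complex.I)).re =
      Real.exp (logSM a b (u + y * Complex.I)).re * Real.cos θ := Complex.exp_re _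
  rw [Complex.norm_exp] at h1
  rw [e, abs_mul, abs_of_pos (Real.exp_pos _)]
  calc _ ≤ Real.exp (logSM a b (u + y * Complex.I)).re * (2 / (5 * Real.pi) * |y - v|) := by gcongr
    _ = Real.exp (logSM a b (u + y * Complex.I)).re * (2 / Real.pi * (|y - v| / 5)) := by
      field_simp
    _ ≤ Real.exp (logSM a b (u + y * Complex.I)).re * (2 / Real.pi * |θ - Real.pi / 2|) := by
      gcongr
    _ ≤ _ := by gcongr

/-- The arc passes through the point where `s M = (k + 1/2)πi`, midway between two zeros of `sinh`.
Near that point the sine keeps the denominator large, elsewhere the real part does. For decay there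
are two sources, `e^{st}` and the factor `e^{-(1-x)|Re (s M)|}`, and at each point of the arc one of
them is effective; this is the reason for `min t (1 - x)`. -/
lemma exists_norm_sinhRatio_arc_le (ha : 0 < a) (hab : a < b) : ∃ κ C : ℝ, 0 < κ ∧ 1 ≤ C ∧
    ∀ k : ℕ, ∀ y ∈ Icc (Real.pi / 2) Real.pi, ∀ x ∈ Icc (0 : ℝ) 1, ∀ t : ℝ, 0 < t →
      ‖sinhRatio x (expSM a b (arcLog a b k + y * Complex.I)) *
        Complex.exp (Complex.exp (arcLog a b k + y * Complex.I) * t)‖ ≤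
      C * Real.exp (-(κ * min t (1 - x) * Real.exp (3 / 4 * arcLog a b k))) := by
  have hpi := Real.pi_pos
  have hb := ha.trans hab
  obtain ⟨H, hH1, hH⟩ := exists_norm_logSMDeriv_le
  obtain ⟨c, hc, hcrit⟩ := exists_re_exp_critPt_le ha hab
  obtain ⟨K, hK, hK'⟩ := exists_one_add_sq_le_exp
    (Real.log ((1 / 2) * Real.pi) - (Real.log b - Real.log a))
  -- If `e^u |y - v| < ρ`, then `s M` has moved by at most `π/3` from `(k + 1/2)πi`, so `|sin Im (s
  -- M)| ≥ cos (π/3) = 1/2`.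
  set ρ := Real.pi / 3 * (a / b) / H with hρ
  have hρ0 : 0 < ρ := by positivity
  obtain ⟨C, hC1, hC⟩ := exists_norm_ratio_le (η := a / b * (2 / (5 * Real.pi) * ρ))
    (by positivity)
  set κ := c * K⁻¹ * (a / b / (5 * Real.pi)) with hκ
  have hab1 : a / b ≤ 1 := (div_le_one hb).2 hab.le
  refine ⟨κ, C, by positivity, hC1, fun k y hy x hx t ht => ?_⟩
  obtain ⟨hv, hlog⟩ := critPt_spec ha hab (Real.log ((k + 1 / 2) * Real.pi))
  have hcr := hcrit (Real.log ((k + 1 / 2) * Real.pi))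
  have hz := exp_critPt_mul_Mlog ha hab (Real.log ((k + 1 / 2) * Real.pi))
  rw [← exp_logSM a b (abs_im_critPt_lt ha hab _).le, Real.exp_log (by positivity)] at hz
  change _ ≤ -(c * (Real.exp (arcLog a b k) / (1 + arcLog a b k ^ 2))) at hcr
  set v := (critPt a b (Real.log ((k + 1 / 2) * Real.pi))).im with hvdef
  have hw : critPt a b (Real.log ((k + 1 / 2) * Real.pi)) = arcLog a b k + v * Complex.I :=
    (Complex.re_add_im _).symm
  have huge : Real.log ((1 / 2) * Real.pi) - (Real.log b - Real.log a) ≤ arcLog a b k := by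
    refine le_trans ?_ (arcLog_ge ha hab k)
    gcongr
    linarith [Nat.cast_nonneg (α := ℝ) k]
  set u := arcLog a b k with hu
  rw [hw] at hcr hz hlog
  have hv' : v ∈ Icc (Real.pi / 2) Real.pi := ⟨hv.1.le, hv.2.le⟩
  have hvim : (logSM a b (u + v * Complex.I)).im = Real.pi / 2 := by rw [hlog]; simp
  have hge := abs_re_expSM_ge ha hab hy hv' hvim
  have hyabs : |y| ≤ Real.pi := by rw [abs_of_nonneg (by linarith [hy.1])]; exact hy.2
  have hvabs : |v| ≤ Real.pi := by rw [abs_of_nonneg (by linarith [hv.1])]; exact hv.2.le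
  have hratio : a / b * (2 / (5 * Real.pi) * ρ) ≤ |(expSM a b (u + y * Complex.I)).re| ∨
      1 / 2 ≤ |Real.sin (expSM a b (u + y * Complex.I)).im| := by
    rcases le_or_gt ρ (Real.exp u * |y - v|) with hcase | hcase
    · left
      refine le_trans ?_ hge
      calc _ ≤ a / b * (2 / (5 * Real.pi) * (Real.exp u * |y - v|)) := by gcongr
        _ = _ := by ring
    · right
      have h1 := norm_expSM_sub_le ha hab hH u hvabs hyabs
      have h2 : ‖expSM a b (u + y * Complex.I) - expSM a b (u + v * Complex.I)‖ ≤ Real.pi / 3 := by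
        refine h1.trans ?_
        calc _ = b / a * H * (Real.exp u * |y - v|) := by ring
          _ ≤ b / a * H * ρ := by gcongr
          _ = _ := by rw [hρ]; field_simp
      have h3 := (Complex.abs_im_le_norm _).trans h2
      have h4 : (expSM a b (u + v * Complex.I)).im = (k + 1 / 2) * Real.pi := by
        rw [expSM, hz]; simp
      rw [Complex.sub_im, h4] at h3
      set τ := (expSM a b (u + y * Complex.I)).im - (k + 1 / 2) * Real.pi with hτ
      have h5 : (expSM a b (u + y * Complex.I)).im = τ + Real.pi / 2 + k * Real.pi := by
        rw [hτ]; ring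
      rw [h5, Real.sin_add_nat_mul_pi, abs_mul, abs_pow, abs_neg, abs_one, one_pow, one_mul,
        Real.sin_add_pi_div_two, ← Real.cos_abs]
      refine le_trans ?_ (le_abs_self _)
      rw [← Real.cos_pi_div_three]
      exact Real.cos_le_cos_of_nonneg_of_le_pi (abs_nonneg _) (by linarith) h3
  have h6 := (hC _ hratio x).1
  rw [abs_of_nonneg hx.1] at h6
  have hbeta : c * K⁻¹ * Real.exp (3 / 4 * u) ≤ Real.exp u * (v - Real.pi / 2) := by
    have h7 := exp_three_quarters_le hK hK' huge
    have h8 : (Complex.exp (u + v * Complex.I)).re = Real.exp u * Real.cos v := by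
      rw [Complex.exp_re]; simp
    rw [h8] at hcr
    have h9 : -Real.cos v ≤ v - Real.pi / 2 := by
      rw [← Real.sin_sub_pi_div_two]
      exact Real.sin_le (by linarith [hv.1])
    calc _ = c * (K⁻¹ * Real.exp (3 / 4 * u)) := by ring
      _ ≤ c * (Real.exp u / (1 + u ^ 2)) := by gcongr
      _ ≤ Real.exp u * (-Real.cos v) := by linarith
      _ ≤ _ := by gcongr
  set m := min t (1 - x) with hm
  have hm0 : 0 ≤ m := le_min ht.le (sub_nonneg.2 hx.2)
  have key : κ * m * Real.exp (3 / 4 * u) ≤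
      (1 - x) * |(expSM a b (u + y * Complex.I)).re| + t * (Real.exp u * (-Real.cos y)) := by
    have hcosy : 2 / Real.pi * (y - Real.pi / 2) ≤ - Real.cos y := by
      rw [← Real.sin_sub_pi_div_two]
      exact Real.mul_le_sin (by linarith [hy.1]) (by linarith [hy.2])
    have hcosy0 : 0 ≤ - Real.cos y :=
      le_trans (mul_nonneg (by positivity) (by linarith [hy.1])) hcosy
    have h1x := sub_nonneg.2 hx.2
    have hbase : κ * m * Real.exp (3 / 4 * u) ≤
        m * (a / b / (5 * Real.pi)) * (Real.exp u * (v - Real.pi / 2)) := by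
      calc _ = m * (a / b / (5 * Real.pi)) * (c * K⁻¹ * Real.exp (3 / 4 * u)) := by rw [hκ]; ring
        _ ≤ _ := by gcongr
    refine hbase.trans ?_
    have hv0 : 0 ≤ v - Real.pi / 2 := by linarith [hv.1]
    -- The critical height `v` is itself at least of order `1 / (1 + u²)` above `π/2`. If `y` has
    -- climbed at least half of the way to `v`, then `Re s` is negative enough and `e^{st}` decays;
    -- if not, `|y - v|` is at least half of that height and `|Re (s M)|` is large.
    rcases le_or_gt (v - Real.pi / 2) (2 * (y - Real.pi / 2)) with hcase | hcase
    · have h10 : (1 / Real.pi) * (v - Real.pi / 2) ≤ -Real.cos y := by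
        refine le_trans ?_ hcosy
        calc _ ≤ 1 / Real.pi * (2 * (y - Real.pi / 2)) := by gcongr
          _ = _ := by ring
      have h11 : a / b / (5 * Real.pi) ≤ 1 / Real.pi := by
        rw [div_le_div_iff₀ (by positivity) (by positivity)]
        nlinarith
      calc _ ≤ t * (1 / Real.pi) * (Real.exp u * (v - Real.pi / 2)) := by
            gcongr
            exact min_le_left _ _
        _ = t * (Real.exp u * ((1 / Real.pi) * (v - Real.pi / 2))) := by ring
        _ ≤ t * (Real.exp u * (-Real.cos y)) := by gcongr
        _ ≤ _ := le_add_of_nonneg_left (by positivity)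
    · have h12 : (v - Real.pi / 2) / 2 ≤ |y - v| := by
        rw [abs_sub_comm]
        refine le_trans ?_ (le_abs_self _)
        linarith
      calc _ ≤ (1 - x) * (a / b / (5 * Real.pi)) * (Real.exp u * (v - Real.pi / 2)) := by
            gcongr
            exact min_le_right _ _
        _ = (1 - x) * (a / b * Real.exp u * (2 / (5 * Real.pi) * ((v - Real.pi / 2) / 2))) := by
          field_simp
        _ ≤ (1 - x) * (a / b * Real.exp u * (2 / (5 * Real.pi) * |y - v|)) := by gcongr
        _ ≤ (1 - x) * |(expSM a b (u + y * Complex.I)).re| := by gcongr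
        _ ≤ _ := le_add_of_nonneg_right (by positivity)
  rw [norm_mul, Complex.norm_exp]
  have h13 : (Complex.exp (u + y * Complex.I) * t).re = -(t * (Real.exp u * (-Real.cos y))) := by
    rw [Complex.re_mul_ofReal, Complex.exp_re]
    simp
    ring
  rw [h13]
  calc _ ≤ C * Real.exp (-((1 - x) * |(expSM a b (u + y * Complex.I)).re|)) *
        Real.exp (-(t * (Real.exp u * (-Real.cos y)))) := by gcongr
    _ = C * Real.exp (-((1 - x) * |(expSM a b (u + y * Complex.I)).re| +
        t * (Real.exp u * (-Real.cos y)))) := by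
      rw [mul_assoc, ← Real.exp_add]; ring_nf
    _ ≤ _ := by gcongr

/-! ### Logarithmic change of variables -/

section LogVariable

variable {E : Type*} [NormedAddCommGroup E] [NormedSpace ℝ E]

lemma integral_Ioi_eq_integral_exp (g : ℝ → E) :
    ∫ q in Ioi (0 : ℝ), g q = ∫ u, Real.exp u • g (Real.exp u) := by
  have h := integral_image_eq_integral_abs_deriv_smul (s := univ) (f := Real.exp)
    MeasurableSet.univ (fun u _ => (Real.hasDerivAt_exp u).hasDerivWithinAt)
    Real.exp_injective.injOn g
  rw [image_univ, Real.range_exp] at h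
  simpa using h

lemma integrableOn_Ioi_iff_integrable_exp (g : ℝ → E) :
    IntegrableOn g (Ioi 0) ↔ Integrable fun u => Real.exp u • g (Real.exp u) := by
  have h := integrableOn_image_iff_integrableOn_abs_deriv_smul (s := univ) (f := Real.exp)
    MeasurableSet.univ (fun u _ => (Real.hasDerivAt_exp u).hasDerivWithinAt)
    Real.exp_injective.injOn g
  rw [image_univ, Real.range_exp] at h
  simpa using h

end LogVariable

lemma integrableOn_exp_neg_rpow {c p : ℝ} (hc : 0 < c) (hp : 0 < p) :
    IntegrableOn (fun q : ℝ => Real.exp (-(c * q ^ p))) (Ioi 0) := by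
  have := integrableOn_rpow_mul_exp_neg_mul_rpow (s := 0) (p := p) (b := c) (by norm_num) hp hc
  simpa using this

/-! ### The integrands on the imaginary axis and on the cut -/

lemma log_ofReal_mul_I {q : ℝ} (hq : 0 < q) :
    Complex.log (q * Complex.I) = Real.log q + (Real.pi / 2 : ℝ) * Complex.I := by
  rw [Complex.log_ofReal_mul hq Complex.I_ne_zero, Complex.log_I]
  push_cast
  rfl

lemma continuousOn_cutRatio (ha : 0 < a) (hab : a < b) (x : ℝ) :
    ContinuousOn (fun q : ℝ => cutRatio a b x Real.pi q) (Ioi 0) := by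
  have h : ContinuousOn (fun q : ℝ => sinhRatio x (expSM a b (Real.log q + Real.pi * Complex.I)))
      (Ioi 0) := by
    intro q hq
    have him : |((Real.log q : ℂ) + Real.pi * Complex.I).im| = Real.pi := by
      simp [abs_of_pos Real.pi_pos]
    have h1 := (analyticAt_sinhRatio_expSM x him.le
      (sinh_expSM_ne_zero_of_im_eq ha hab him)).continuousAt
    have h2 : ContinuousAt (fun q : ℝ => ((Real.log q : ℂ) + Real.pi * Complex.I)) q :=
      (Complex.continuous_ofReal.continuousAt.comp
        (Real.continuousAt_log (ne_of_gt hq))).add continuousAt_const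
    exact (ContinuousAt.comp (f := fun q : ℝ => ((Real.log q : ℂ) + Real.pi * Complex.I)) h1
      h2).continuousWithinAt
  exact h.congr fun q hq => cutRatio_eq hq x (abs_of_pos Real.pi_pos)

lemma exists_norm_cutRatio_pi_le (ha : 0 < a) (hab : a < b) : ∃ c C : ℝ, 0 < c ∧ 1 ≤ C ∧
    ∀ x ∈ Icc (0 : ℝ) 1, ∀ q : ℝ, 0 < q →
      ‖cutRatio a b x Real.pi q‖ ≤ C * Real.exp (-((1 - x) * c * q)) := by
  obtain ⟨c, C, hc, hC, h, -⟩ := exists_norm_cutRatio_le ha hab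
  refine ⟨c, C, hc, hC, fun x hx q hq => ?_⟩
  have := h (Real.log q) x (by rw [abs_of_nonneg hx.1]; exact hx.2)
  rw [Real.exp_log hq, abs_of_nonneg hx.1] at this
  rw [cutRatio_eq hq x (abs_of_pos Real.pi_pos), mul_assoc]
  exact this

lemma integrableOn_exp_neg_mul {c : ℝ} (hc : 0 < c) :
    IntegrableOn (fun q : ℝ => Real.exp (-(c * q))) (Ioi 0) := by
  simpa using exp_neg_integrableOn_Ioi 0 hc

lemma integrableOn_cutRatio (ha : 0 < a) (hab : a < b) {x t : ℝ} (hx : x ∈ Icc (0 : ℝ) 1)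
    (ht : 0 < t) :
    IntegrableOn (fun q : ℝ => cutRatio a b x Real.pi q * Complex.exp (-q * t)) (Ioi 0) := by
  obtain ⟨c, C, hc, hC, h⟩ := exists_norm_cutRatio_pi_le ha hab
  refine Integrable.mono' ((integrableOn_exp_neg_mul ht).const_mul C)
    (((continuousOn_cutRatio ha hab x).mul (by fun_prop)).aestronglyMeasurable measurableSet_Ioi) ?_
  rw [ae_restrict_iff' measurableSet_Ioi]
  refine ae_of_all _ fun q hq => ?_
  rw [norm_mul, Complex.norm_exp]
  have h1 : (-(q : ℂ) * t).re = -(t * q) := by simp [mul_comm]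
  rw [h1]
  gcongr
  refine (h x hx q hq).trans ?_
  have h2 : Real.exp (-((1 - x) * c * q)) ≤ 1 := by
    apply Real.exp_le_one_iff.2
    have := sub_nonneg.2 hx.2
    have : 0 ≤ (1 - x) * c * q := mul_nonneg (mul_nonneg this hc.le) (le_of_lt hq)
    linarith
  nlinarith

lemma continuousOn_Ptilde_slitPlane (ha : 0 < a) (hab : a < b) (x : ℝ) {s : ℂ} (hs : s ≠ 0)
    (hre : 0 ≤ s.re) : ContinuousAt (Ptilde a b x) s := by
  have hsl : s ∈ Complex.slitPlane := by
    by_contra h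
    rw [Complex.mem_slitPlane_iff, not_or, not_lt, not_not] at h
    exact hs (Complex.ext (le_antisymm h.1 hre) h.2)
  have him : |(Complex.log s).im| ≤ Real.pi / 2 := by
    rw [Complex.log_im]
    exact Complex.abs_arg_le_pi_div_two_iff.2 hre
  have h1 := analyticAt_comp_log hsl (analyticAt_sinhRatio_expSM (a := a) (b := b) x
    (by linarith [Real.pi_pos]) (sinh_expSM_ne_zero_of_abs_im_le ha hab him))
  refine h1.continuousAt.congr ?_
  filter_upwards [isOpen_ne.mem_nhds hs] with z hz
  exact (Ptilde_eq hz x).symm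

lemma exists_norm_Ptilde_le (ha : 0 < a) (hab : a < b) : ∃ c C : ℝ, 0 < c ∧ 1 ≤ C ∧
    ∀ x : ℝ, |x| ≤ 1 → ∀ s : ℂ, 0 ≤ s.re →
      ‖Ptilde a b x s‖ ≤ C * Real.exp (-((1 - |x|) * c * ‖s‖ ^ (3 / 4 : ℝ))) := by
  obtain ⟨c, C, hc, hC, h, -⟩ := exists_norm_sinhRatio_right_le ha hab
  refine ⟨c, C, hc, hC, fun x hx s hre => ?_⟩
  rcases eq_or_ne s 0 with rfl | hs
  · simp [Ptilde]
    positivity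
  · rw [Ptilde_eq hs]
    refine (h (Complex.log s) (by
      rw [Complex.log_im]; exact Complex.abs_arg_le_pi_div_two_iff.2 hre) x hx).trans_eq ?_
    rw [Complex.log_re, Real.rpow_def_of_pos (norm_pos_iff.2 hs), mul_assoc (1 - |x|),
      mul_comm (3 / 4 : ℝ)]

lemma integrableOn_Ptilde_axis (ha : 0 < a) (hab : a < b) {x : ℝ} (hx : x ∈ Ico (0 : ℝ) 1)
    (t : ℝ) : IntegrableOn (fun q : ℝ => Ptilde a b x (q * Complex.I) *
      Complex.exp (q * Complex.I * t)) (Ioi 0) := by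
  obtain ⟨c, C, hc, hC, h⟩ := exists_norm_Ptilde_le ha hab
  have h1x : 0 < 1 - x := sub_pos.2 hx.2
  refine Integrable.mono' ((integrableOn_exp_neg_rpow (mul_pos h1x hc)
    (p := 3 / 4) (by norm_num)).const_mul C) ?_ ?_
  · refine ContinuousOn.aestronglyMeasurable ?_ measurableSet_Ioi
    refine ContinuousOn.mul (fun q hq => ?_) (by fun_prop)
    have hq0 : (q : ℂ) * Complex.I ≠ 0 :=
      mul_ne_zero (by exact_mod_cast (ne_of_gt hq)) Complex.I_ne_zero
    exact (ContinuousAt.comp (f := fun q : ℝ => (q : ℂ) * Complex.I)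
      (continuousOn_Ptilde_slitPlane ha hab x hq0 (by simp)) (by fun_prop)).continuousWithinAt
  · rw [ae_restrict_iff' measurableSet_Ioi]
    refine ae_of_all _ fun q hq => ?_
    have h1 : ((q : ℂ) * Complex.I * t).re = 0 := by simp
    rw [norm_mul, Complex.norm_exp, h1, Real.exp_zero, mul_one]
    have := h x (by rw [abs_of_nonneg hx.1]; exact hx.2.le) (q * Complex.I) (by simp)
    rwa [norm_mul, Complex.norm_I, mul_one, Complex.norm_real, Real.norm_of_nonneg (le_of_lt hq),
      abs_of_nonneg hx.1] at this

/-! ### The contour integral in the logarithmic variable -/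

/-- The integrand `P̃(x, s) e^{st} ds/dw` with `s = e^w`. -/
def contourFun (a b x t : ℝ) (w : ℂ) : ℂ :=
  sinhRatio x (expSM a b w) * Complex.exp (Complex.exp w * t) * Complex.exp w

lemma contourFun_axis (a b x t u : ℝ) : contourFun a b x t (u + (Real.pi / 2 : ℝ) * Complex.I) =
    Real.exp u • (Ptilde a b x (Real.exp u * Complex.I) *
      Complex.exp (Real.exp u * Complex.I * t) * Complex.I) := by
  have h1 : Complex.exp (u + (Real.pi / 2 : ℝ) * Complex.I) = Real.exp u * Complex.I := by
    rw [Complex.exp_add, ← Complex.ofReal_exp]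
    push_cast
    rw [Complex.exp_pi_div_two_mul_I]
  rw [contourFun, Ptilde_eq (mul_ne_zero (by exact_mod_cast (Real.exp_pos u).ne')
    Complex.I_ne_zero), log_ofReal_mul_I (Real.exp_pos u), Real.log_exp, h1, Complex.real_smul]
  ring

lemma contourFun_cut (a b x t u : ℝ) : contourFun a b x t (u + Real.pi * Complex.I) =
    Real.exp u • (-(cutRatio a b x Real.pi (Real.exp u) *
      Complex.exp (-(Real.exp u : ℝ) * t))) := by
  have h1 : Complex.exp (u + Real.pi * Complex.I) = -Real.exp u := by
    rw [Complex.exp_add, ← Complex.ofReal_exp, Complex.exp_pi_mul_I, mul_neg_one]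
  rw [contourFun, cutRatio_eq (Real.exp_pos u) x (abs_of_pos Real.pi_pos), Real.log_exp, h1,
    Complex.real_smul]
  ring

lemma differentiableAt_contourFun (x t : ℝ) {w : ℂ} (hw : |w.im| ≤ Real.pi)
    (h : Complex.sinh (expSM a b w) ≠ 0) : DifferentiableAt ℂ (contourFun a b x t) w := by
  refine ((analyticAt_sinhRatio_expSM x hw h).differentiableAt.mul ?_).mul ?_ <;> fun_prop

/-- The left end of the rectangle of integration. -/
def leftLog (a b : ℝ) (k : ℕ) : ℝ := -(k : ℝ) - (Real.log b - Real.log a)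

lemma leftLog_lt_poleLog_re (ha : 0 < a) (hab : a < b) (k : ℕ) {n : ℕ} (hn : 1 ≤ n) :
    leftLog a b k < (poleLog a b n).re := by
  have h1 := re_poleLog_ge ha hab n
  have hn1 : (1 : ℝ) ≤ n := by exact_mod_cast hn
  have h2 : 0 < Real.log (n * Real.pi) := Real.log_pos (by nlinarith [Real.pi_gt_three])
  have := Nat.cast_nonneg (α := ℝ) k
  rw [leftLog]
  linarith

lemma leftLog_lt_arcLog (ha : 0 < a) (hab : a < b) (k : ℕ) : leftLog a b k < arcLog a b k := by
  have h1 := arcLog_ge ha hab k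
  have hk := Nat.cast_nonneg (α := ℝ) k
  have h2 : 0 < Real.log ((k + 1 / 2) * Real.pi) := Real.log_pos (by nlinarith [Real.pi_gt_three])
  rw [leftLog]
  linarith

lemma poleLog_re_lt_arcLog_iff (ha : 0 < a) (hab : a < b) (n k : ℕ) (hn : 1 ≤ n) :
    ((poleLog a b n).re < arcLog a b k ↔ n ≤ k) ∧ ((poleLog a b n).re ≤ arcLog a b k ↔ n ≤ k) := by
  have hpi := Real.pi_pos
  have hn0 : (0 : ℝ) < n := by exact_mod_cast hn
  have h1 : n ≤ k → (poleLog a b n).re < arcLog a b k := by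
    intro h
    have : (n : ℝ) ≤ k := by exact_mod_cast h
    apply critPt_re_lt ha hab
    apply Real.log_lt_log (by positivity)
    gcongr
    linarith
  have h2 : ¬ n ≤ k → arcLog a b k < (poleLog a b n).re := by
    intro h
    have : (k : ℝ) + 1 ≤ n := by exact_mod_cast not_le.1 h
    apply critPt_re_lt ha hab
    apply Real.log_lt_log (by positivity)
    gcongr
    linarith
  refine ⟨⟨fun h => ?_, h1⟩, ⟨fun h => ?_, fun h => (h1 h).le⟩⟩ <;>
  · by_contra hc
    linarith [h2 hc]

/-- In the variable `w` the part of the second quadrant between two circles is a rectangle,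
holomorphic up to and including its sides. By the interlacing of moduli exactly the poles with `n ≤
k` lie inside; conjugate poles have negative `Im w` and do not occur. -/
lemma rectIntegral_contourFun (ha : 0 < a) (hab : a < b) (x t : ℝ) (k : ℕ) :
    rectIntegral (contourFun a b x t) (leftLog a b k + (Real.pi / 2 : ℝ) * Complex.I)
      (arcLog a b k + Real.pi * Complex.I) =
    2 * Real.pi * Complex.I * ∑ n ∈ Finset.range k, poleTerm a b x t (n + 1) := by
  classical
  have hpi := Real.pi_pos
  set z : ℂ := leftLog a b k + (Real.pi / 2 : ℝ) * Complex.I with hz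
  set w : ℂ := arcLog a b k + Real.pi * Complex.I with hw
  have zre : z.re = leftLog a b k := by simp [hz]
  have zim : z.im = Real.pi / 2 := by simp [hz]
  have wre : w.re = arcLog a b k := by simp [hw]
  have wim : w.im = Real.pi := by simp [hw]
  have hinj : Set.InjOn (fun n : ℕ => poleLog a b (n + 1)) (Finset.range k) := by
    intro m _ n _ h
    have h1 := expSM_poleLog ha hab (Nat.le_add_left 1 m)
    have h2 := expSM_poleLog ha hab (Nat.le_add_left 1 n)
    simp only at h
    rw [h, h2] at h1
    have h3 := mul_right_cancel₀ Complex.I_ne_zero h1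
    have h4 := mul_right_cancel₀ (by exact_mod_cast Real.pi_ne_zero) h3
    have h5 : n + 1 = m + 1 := by exact_mod_cast h4
    omega
  have hpole : ∀ n : ℕ, HasSimplePole (contourFun a b x t) (poleLog a b (n + 1))
      (poleTerm a b x t (n + 1)) := fun n =>
    hasSimplePole_poleLog ha hab x t (Nat.le_add_left 1 n)
  have h := rectIntegral_eq_sum_residues (f := contourFun a b x t) (z := z) (w := w)
    (by rw [zre, wre]; exact leftLog_lt_arcLog ha hab k) (by rw [zim, wim]; linarith)
    ((Finset.range k).image fun n => poleLog a b (n + 1)) (residueAt (contourFun a b x t))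
    (by
      intro p hp
      obtain ⟨n, hn, rfl⟩ := Finset.mem_image.1 hp
      rw [zre, wre, zim, wim]
      exact ⟨⟨leftLog_lt_poleLog_re ha hab k (Nat.le_add_left 1 n),
        (poleLog_re_lt_arcLog_iff ha hab (n + 1) k (Nat.le_add_left 1 n)).1.2
          (Finset.mem_range.1 hn)⟩, poleLog_im_mem ha hab (n + 1)⟩)
    (by
      intro ξ hξ hS
      rw [zre, wre, zim, wim] at hξ
      obtain ⟨h1, h2⟩ := hξ
      have him : |ξ.im| ≤ Real.pi := by
        rw [abs_of_nonneg (by linarith [h2.1])]; exact h2.2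
      apply differentiableAt_contourFun x t him
      intro h0
      obtain ⟨n, hn, h3 | h3⟩ := exists_eq_of_sinh_expSM_eq_zero ha hab him h0
      · apply hS
        have h4 : n ≤ k := by
          rw [← (poleLog_re_lt_arcLog_iff ha hab n k hn).2, ← h3]
          exact h1.2
        exact Finset.mem_image.2 ⟨n - 1, Finset.mem_range.2 (by omega), by
          rw [Nat.sub_add_cancel hn, h3]⟩
      · have := (poleLog_im_mem ha hab n).1
        rw [← h3, Complex.conj_im] at this
        have h5 : Real.pi / 2 ≤ ξ.im := h2.1
        linarith)
    (by
      intro p hp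
      obtain ⟨n, hn, rfl⟩ := Finset.mem_image.1 hp
      rw [(hpole n).residueAt_eq]
      exact hpole n)
  rw [h, Finset.sum_image hinj]
  congr 1
  exact Finset.sum_congr rfl fun n _ => (hpole n).residueAt_eq

lemma tendsto_leftLog (a b : ℝ) : Tendsto (leftLog a b) atTop atBot := by
  unfold leftLog
  apply tendsto_atBot_add_const_right
  exact tendsto_neg_atTop_atBot.comp tendsto_natCast_atTop_atTop

lemma tendsto_exp_mul_exp_neg {c : ℝ} (hc : 0 < c) :
    Tendsto (fun u : ℝ => Real.exp u * Real.exp (-(c * Real.exp (3 / 4 * u)))) atTop (𝓝 0) := by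
  have h1 := tendsto_rpow_mul_exp_neg_mul_atTop_nhds_zero (4 / 3) c hc
  have h2 : Tendsto (fun u : ℝ => Real.exp (3 / 4 * u)) atTop atTop :=
    Real.tendsto_exp_atTop.comp (tendsto_id.const_mul_atTop (by norm_num))
  refine (h1.comp h2).congr fun u => ?_
  simp only [Function.comp]
  rw [← Real.exp_mul]
  ring_nf

/-- Deformation of the half line `s ∈ i (0, ∞)` to the upper side of the cut. -/
theorem axis_integral_add_cut_integral (ha : 0 < a) (hab : a < b) {x t : ℝ}
    (hx : x ∈ Ico (0 : ℝ) 1) (ht : 0 < t) :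
    (∫ q in Ioi (0 : ℝ), Ptilde a b x (q * Complex.I) * Complex.exp (q * Complex.I * t)) *
        Complex.I +
      ∫ q in Ioi (0 : ℝ), cutRatio a b x Real.pi q * Complex.exp (-q * t) =
    2 * Real.pi * Complex.I * ∑' n : ℕ, poleTerm a b x t (n + 1) := by
  have hpi := Real.pi_pos
  have hxx : x ∈ Icc (0 : ℝ) 1 := ⟨hx.1, hx.2.le⟩
  have hIb := (integrableOn_Ptilde_axis ha hab hx t).mul_const Complex.I
  have hIt := (integrableOn_cutRatio ha hab hxx ht).neg
  have hb := (integrableOn_Ioi_iff_integrable_exp _).1 hIb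
  have htp := (integrableOn_Ioi_iff_integrable_exp _).1 hIt
  have lim_b := intervalIntegral_tendsto_integral hb (tendsto_leftLog a b)
    (tendsto_arcLog ha hab)
  have lim_t := intervalIntegral_tendsto_integral htp (tendsto_leftLog a b)
    (tendsto_arcLog ha hab)
  rw [← integral_Ioi_eq_integral_exp (fun q : ℝ => Ptilde a b x (q * Complex.I) *
    Complex.exp (q * Complex.I * t) * Complex.I), integral_mul_const] at lim_b
  rw [← integral_Ioi_eq_integral_exp
    (-fun q : ℝ => cutRatio a b x Real.pi q * Complex.exp (-q * t))] at lim_t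
  simp only [Pi.neg_apply] at lim_t
  rw [integral_neg] at lim_t
  -- On the large arc the root-exponential decay beats the factor `e^w` coming from `ds = e^w dw`.
  have lim_r : Tendsto (fun k : ℕ => Complex.I • ∫ y : ℝ in (Real.pi / 2)..Real.pi,
      contourFun a b x t (arcLog a b k + y * Complex.I)) atTop (𝓝 0) := by
    obtain ⟨κ, C, hκ, hC, h⟩ := exists_norm_sinhRatio_arc_le ha hab
    have hm : 0 < min t (1 - x) := lt_min ht (sub_pos.2 hx.2)
    have h0 := ((tendsto_exp_mul_exp_neg (mul_pos hκ hm)).comp (tendsto_arcLog ha hab)).const_mul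
      (C * (Real.pi / 2))
    rw [mul_zero] at h0
    refine squeeze_zero_norm (fun k => ?_) h0
    rw [norm_smul, Complex.norm_I, one_mul]
    have h1 := intervalIntegral.norm_integral_le_of_norm_le_const (a := Real.pi / 2)
      (b := Real.pi) (f := fun y : ℝ => contourFun a b x t (arcLog a b k + y * Complex.I))
      (C := C * Real.exp (-(κ * min t (1 - x) * Real.exp (3 / 4 * arcLog a b k))) *
        Real.exp (arcLog a b k)) (by
        intro y hy
        rw [uIoc_of_le (by linarith)] at hy
        have h2 := h k y ⟨hy.1.le, hy.2⟩ x hxx t ht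
        rw [contourFun, norm_mul, Complex.norm_exp (_ + _)]
        have h3 : ((arcLog a b k : ℂ) + y * Complex.I).re = arcLog a b k := by simp
        rw [h3]
        gcongr)
    refine h1.trans_eq ?_
    rw [abs_of_nonneg (by linarith)]
    simp only [Function.comp]
    ring
  -- On the small arc `|s M| ≤ 1`, so the ratio is at most `1`, and the factor `e^w` of `ds` tends
  -- to `0`.
  have lim_l : Tendsto (fun k : ℕ => Complex.I • ∫ y : ℝ in (Real.pi / 2)..Real.pi,
      contourFun a b x t (leftLog a b k + y * Complex.I)) atTop (𝓝 0) := by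
    have hb0 := ha.trans hab
    have h0 : Tendsto (fun k : ℕ => (Real.exp t * Real.exp (leftLog a b k)) * (Real.pi / 2)) atTop
        (𝓝 0) := by
      have := ((Real.tendsto_exp_atBot.comp (tendsto_leftLog a b)).const_mul
        (Real.exp t)).mul_const (Real.pi / 2)
      simpa using this
    refine squeeze_zero_norm (fun k => ?_) h0
    rw [norm_smul, Complex.norm_I, one_mul]
    have h1 := intervalIntegral.norm_integral_le_of_norm_le_const (a := Real.pi / 2)
      (b := Real.pi) (f := fun y : ℝ => contourFun a b x t (leftLog a b k + y * Complex.I))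
      (C := Real.exp t * Real.exp (leftLog a b k)) (by
        intro y hy
        rw [uIoc_of_le (by linarith)] at hy
        have hre : ((leftLog a b k : ℂ) + y * Complex.I).re = leftLog a b k := by simp
        have him : ((leftLog a b k : ℂ) + y * Complex.I).im = y := by simp
        have hle : Real.exp (leftLog a b k) ≤ a / b := by
          rw [← Real.exp_log (div_pos ha hb0), Real.log_div ha.ne' hb0.ne', leftLog]
          apply Real.exp_le_exp.2
          linarith [Nat.cast_nonneg (α := ℝ) k]
        have h5 : ‖expSM a b (leftLog a b k + y * Complex.I)‖ ≤ Real.pi / 2 := by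
          refine (norm_exp_logSM_mem ha hab (by
            rw [him, abs_of_pos (by linarith [hy.1])]; exact hy.2)).2.trans ?_
          rw [hre]
          calc b / a * Real.exp (leftLog a b k) ≤ b / a * (a / b) := by gcongr
            _ = 1 := by field_simp
            _ ≤ _ := by linarith [Real.pi_gt_three]
        have h6 := norm_sinhRatio_le_one ((Complex.abs_im_le_norm _).trans h5)
          (x := x) (by rw [abs_of_nonneg hx.1]; exact hx.2.le)
        have h7 : ‖Complex.exp (Complex.exp (leftLog a b k + y * Complex.I) * t)‖ ≤
            Real.exp t := by
          rw [Complex.norm_exp]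
          apply Real.exp_le_exp.2
          rw [Complex.re_mul_ofReal]
          have h8 : (Complex.exp (leftLog a b k + y * Complex.I)).re ≤ 1 := by
            refine (Complex.re_le_norm _).trans ?_
            rw [Complex.norm_exp, hre]
            exact hle.trans ((div_le_one hb0).2 hab.le)
          nlinarith
        rw [contourFun, norm_mul, norm_mul, Complex.norm_exp (_ + _), hre]
        calc _ ≤ 1 * Real.exp t * Real.exp (leftLog a b k) := by gcongr
          _ = _ := by ring)
    refine h1.trans_eq ?_
    rw [abs_of_nonneg (by linarith)]
    ring
  have hrect := ((lim_b.sub lim_t).add lim_r).sub lim_l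
  have hsum := ((summable_norm_poleTerm ha hab x ht).of_norm.hasSum.tendsto_sum_nat).const_mul
    (2 * Real.pi * Complex.I)
  have heq : ∀ k : ℕ, (∫ u in leftLog a b k..arcLog a b k, Real.exp u •
        (Ptilde a b x (Real.exp u * Complex.I) * Complex.exp (Real.exp u * Complex.I * t) *
          Complex.I)) - (∫ u in leftLog a b k..arcLog a b k, Real.exp u •
        (-(cutRatio a b x Real.pi (Real.exp u) * Complex.exp (-(Real.exp u : ℝ) * t)))) +
      (Complex.I • ∫ y : ℝ in (Real.pi / 2)..Real.pi,
        contourFun a b x t (arcLog a b k + y * Complex.I)) -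
      (Complex.I • ∫ y : ℝ in (Real.pi / 2)..Real.pi,
        contourFun a b x t (leftLog a b k + y * Complex.I)) =
      2 * Real.pi * Complex.I * ∑ n ∈ Finset.range k, poleTerm a b x t (n + 1) := by
    intro k
    rw [← rectIntegral_contourFun ha hab, rectIntegral]
    have zre : (leftLog a b k + (Real.pi / 2 : ℝ) * Complex.I : ℂ).re = leftLog a b k := by simp
    have zim : (leftLog a b k + (Real.pi / 2 : ℝ) * Complex.I : ℂ).im = Real.pi / 2 := by simp
    have wre : (arcLog a b k + Real.pi * Complex.I : ℂ).re = arcLog a b k := by simp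
    have wim : (arcLog a b k + Real.pi * Complex.I : ℂ).im = Real.pi := by simp
    rw [zre, zim, wre, wim]
    simp only [contourFun_axis, contourFun_cut]
  have := tendsto_nhds_unique (hrect.congr heq) hsum
  rw [← this]
  simp only [neg_mul, sub_neg_eq_add, add_zero, sub_zero]

/-! ### Inversion of the Laplace transform -/

/-- The weight `exp (-κ |ν|^{3/4})`. -/
def expRoot (κ ν : ℝ) : ℝ := Real.exp (-(κ * |ν| ^ (3 / 4 : ℝ)))

lemma expRoot_pos (κ ν : ℝ) : 0 < expRoot κ ν := Real.exp_pos _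

lemma integrable_expRoot {κ : ℝ} (hκ : 0 < κ) : Integrable (expRoot κ) := by
  have h1 : IntegrableOn (expRoot κ) (Ioi 0) := by
    refine (integrableOn_exp_neg_rpow hκ (p := 3 / 4) (by norm_num)).congr_fun (fun x hx => ?_)
      measurableSet_Ioi
    simp only [expRoot, abs_of_pos (mem_Ioi.1 hx)]
  have h2 : IntegrableOn (expRoot κ) (Iic 0) := by
    rw [← Measure.map_neg_eq_self (volume : Measure ℝ)]
    have m : MeasurableEmbedding fun x : ℝ => -x := (Homeomorph.neg ℝ).measurableEmbedding
    rw [m.integrableOn_map_iff]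
    have : (expRoot κ ∘ fun x : ℝ => -x) = expRoot κ := by
      funext x
      simp [expRoot]
    rw [this]
    simp_rw [neg_preimage, neg_Iic, neg_zero]
    exact Iff.mpr integrableOn_Ici_iff_integrableOn_Ioi h1
  rw [← integrableOn_univ, ← Iic_union_Ioi (a := (0 : ℝ)), integrableOn_union]
  exact ⟨h2, h1⟩

/-- Half of the exponent is given up to pay for a linear factor, since `r ≤ 1 + (r^{3/4})²`. -/
lemma one_add_mul_exp_neg_le {κ : ℝ} (hκ : 0 < κ) {r : ℝ} (hr : 0 ≤ r) :
    (1 + r) * Real.exp (-(κ * r ^ (3 / 4 : ℝ))) ≤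
      (2 + 8 / κ ^ 2) * Real.exp (-(κ / 2 * r ^ (3 / 4 : ℝ))) := by
  set y := r ^ (3 / 4 : ℝ) with hy
  have hy0 : 0 ≤ y := Real.rpow_nonneg hr _
  have h1 : r ≤ 1 + y ^ 2 := by
    rcases le_total r 1 with h | h
    · nlinarith [sq_nonneg y]
    · have : r ≤ y ^ 2 := by
        rw [hy, ← Real.rpow_natCast, ← Real.rpow_mul hr]
        norm_num
        calc r = r ^ (1 : ℝ) := (Real.rpow_one r).symm
          _ ≤ _ := Real.rpow_le_rpow_of_exponent_le h (by norm_num)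
      linarith
  have h2 := Real.quadratic_le_exp_of_nonneg (x := κ / 2 * y) (by positivity)
  have h3 : Real.exp (-(κ * y)) = Real.exp (-(κ / 2 * y)) * (Real.exp (κ / 2 * y))⁻¹ := by
    rw [← Real.exp_neg, ← Real.exp_add]
    ring_nf
  rw [h3, mul_comm (Real.exp (-(κ / 2 * y))), ← mul_assoc]
  gcongr
  rw [← div_eq_mul_inv, div_le_iff₀ (Real.exp_pos _)]
  have h4 : (2 + 8 / κ ^ 2) * (1 + (κ / 2 * y) ^ 2 / 2) =
      2 + y ^ 2 + (8 / κ ^ 2 + κ ^ 2 * y ^ 2 / 4) := by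
    field_simp
    ring
  have h5 : 0 ≤ 8 / κ ^ 2 + κ ^ 2 * y ^ 2 / 4 := by positivity
  have h6 : (2 + 8 / κ ^ 2) * (1 + (κ / 2 * y) ^ 2 / 2) ≤
      (2 + 8 / κ ^ 2) * Real.exp (κ / 2 * y) := by
    gcongr
    have : 0 ≤ κ / 2 * y := by positivity
    linarith
  linarith

/-- Holomorphic functions on `d < Re s` of size `O (exp (-κ |s|^{3/4}))`. -/
structure RootDecay (d : ℝ) (F : ℂ → ℂ) : Prop where
  diff : ∀ s : ℂ, d < s.re → DifferentiableAt ℂ F s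
  bound : ∃ κ C : ℝ, 0 < κ ∧ 0 ≤ C ∧ ∀ s : ℂ, d < s.re →
    ‖F s‖ ≤ C * Real.exp (-(κ * ‖s‖ ^ (3 / 4 : ℝ)))

/-- The Bromwich integral over the line `Re s = c`. -/
def bromwich (c : ℝ) (F : ℂ → ℂ) (t : ℝ) : ℂ :=
  (1 / (2 * Real.pi)) * ∫ ν : ℝ, F (c + ν * Complex.I) * Complex.exp ((c + ν * Complex.I) * t)

lemma line_re (c ν : ℝ) : ((c : ℂ) + ν * Complex.I).re = c := by simp

lemma line_im (c ν : ℝ) : ((c : ℂ) + ν * Complex.I).im = ν := by simp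

lemma abs_le_norm_line (c ν : ℝ) : |ν| ≤ ‖(c : ℂ) + ν * Complex.I‖ := by
  have := Complex.abs_im_le_norm ((c : ℂ) + ν * Complex.I)
  rwa [line_im] at this

lemma norm_exp_line (c ν t : ℝ) :
    ‖Complex.exp (((c : ℂ) + ν * Complex.I) * t)‖ = Real.exp (c * t) := by
  rw [Complex.norm_exp, Complex.re_mul_ofReal, line_re]

lemma exp_neg_norm_rpow_le {κ : ℝ} (hκ : 0 ≤ κ) (c ν : ℝ) :
    Real.exp (-(κ * ‖(c : ℂ) + ν * Complex.I‖ ^ (3 / 4 : ℝ))) ≤ expRoot κ ν := by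
  unfold expRoot
  gcongr
  exact abs_le_norm_line c ν

section

variable {d c : ℝ} {F : ℂ → ℂ}

/-- The class is stable under multipliers of linear growth. Multiplication by `s` is time
differentiation, so iterating it gives smoothness of the Bromwich integrals. -/
lemma RootDecay.mul {G : ℂ → ℂ} (hF : RootDecay d F)
    (hG : ∀ s : ℂ, d < s.re → DifferentiableAt ℂ G s) {K : ℝ}
    (hK : ∀ s : ℂ, d < s.re → ‖G s‖ ≤ K * (1 + ‖s‖)) : RootDecay d fun s => G s * F s := by
  obtain ⟨κ, C, hκ, hC, h⟩ := hF.bound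
  have hK0 : 0 ≤ K := by
    have h1 := hK ((d + 1 : ℝ) : ℂ) (by rw [Complex.ofReal_re]; linarith)
    by_contra hn
    have h2 : K * (1 + ‖((d + 1 : ℝ) : ℂ)‖) < 0 :=
      mul_neg_of_neg_of_pos (not_le.1 hn) (by positivity)
    linarith [norm_nonneg (G ((d + 1 : ℝ) : ℂ))]
  refine ⟨fun s hs => (hG s hs).mul (hF.diff s hs), κ / 2, K * C * (2 + 8 / κ ^ 2), by positivity,
    by positivity, fun s hs => ?_⟩
  rw [norm_mul]
  calc ‖G s‖ * ‖F s‖ ≤ (K * (1 + ‖s‖)) * (C * Real.exp (-(κ * ‖s‖ ^ (3 / 4 : ℝ)))) := by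
        gcongr
        · exact hK s hs
        · exact h s hs
    _ = K * C * ((1 + ‖s‖) * Real.exp (-(κ * ‖s‖ ^ (3 / 4 : ℝ)))) := by ring
    _ ≤ K * C * ((2 + 8 / κ ^ 2) * Real.exp (-(κ / 2 * ‖s‖ ^ (3 / 4 : ℝ)))) := by
        exact mul_le_mul_of_nonneg_left (one_add_mul_exp_neg_le hκ (norm_nonneg s))
          (by positivity)
    _ = _ := by ring

lemma RootDecay.id_mul (hF : RootDecay d F) : RootDecay d fun s => s * F s :=
  hF.mul (G := fun s => s) (fun _ _ => differentiableAt_id) (K := 1) (fun s _ => by linarith)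

lemma RootDecay.continuous_line (hF : RootDecay d F) (hc : d < c) :
    Continuous fun ν : ℝ => F (c + ν * Complex.I) := by
  rw [continuous_iff_continuousAt]
  intro ν
  exact ContinuousAt.comp (f := fun ν : ℝ => (c : ℂ) + ν * Complex.I)
    (hF.diff _ (by rwa [line_re])).continuousAt (by fun_prop)

lemma RootDecay.integrable (hF : RootDecay d F) (hc : d < c) :
    Integrable fun ν : ℝ => F (c + ν * Complex.I) := by
  obtain ⟨κ, C, hκ, hC, h⟩ := hF.bound
  refine ((integrable_expRoot hκ).const_mul C).mono'
    (hF.continuous_line hc).aestronglyMeasurable (ae_of_all _ fun ν => ?_)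
  refine (h _ (by rwa [line_re])).trans ?_
  gcongr
  exact exp_neg_norm_rpow_le hκ.le c ν

lemma RootDecay.integrable_mul_exp (hF : RootDecay d F) (hc : d < c) (t : ℝ) :
    Integrable fun ν : ℝ => F (c + ν * Complex.I) *
      Complex.exp ((c + ν * Complex.I) * t) := by
  refine ((hF.integrable hc).norm.mul_const (Real.exp (c * t))).mono'
    ((hF.continuous_line hc).mul (by fun_prop)).aestronglyMeasurable (ae_of_all _ fun ν => ?_)
  rw [norm_mul, norm_exp_line]

lemma norm_bromwich_le (c : ℝ) (F : ℂ → ℂ) (t : ℝ) :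
    ‖bromwich c F t‖ ≤
      (1 / (2 * Real.pi) * ∫ ν : ℝ, ‖F (c + ν * Complex.I)‖) * Real.exp (c * t) := by
  rw [bromwich, norm_mul, mul_assoc, ← integral_mul_const]
  have h1 : ‖(1 / (2 * Real.pi) : ℂ)‖ = 1 / (2 * Real.pi) := by
    rw [norm_div, norm_mul, Complex.norm_real, Real.norm_of_nonneg Real.pi_pos.le]
    simp
  rw [h1]
  gcongr
  refine (norm_integral_le_integral_norm _).trans_eq ?_
  simp_rw [norm_mul, norm_exp_line]

lemma RootDecay.hasDerivAt_bromwich (hF : RootDecay d F) (hc : d < c) (t : ℝ) :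
    HasDerivAt (bromwich c F) (bromwich c (fun s => s * F s) t) t := by
  have h := (hasDerivAt_integral_of_dominated_loc_of_deriv_le (μ := volume)
    (F := fun (t : ℝ) (ν : ℝ) => F (c + ν * Complex.I) * Complex.exp ((c + ν * Complex.I) * t))
    (F' := fun (t : ℝ) (ν : ℝ) => (c + ν * Complex.I) * F (c + ν * Complex.I) *
      Complex.exp ((c + ν * Complex.I) * t)) (x₀ := t) (s := Metric.ball t 1)
    (bound := fun ν : ℝ => ‖(c + ν * Complex.I) * F (c + ν * Complex.I)‖ *
      Real.exp (|c| * (|t| + 1))) (Metric.ball_mem_nhds t one_pos)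
    (Eventually.of_forall fun t' => (hF.integrable_mul_exp hc t').aestronglyMeasurable)
    (hF.integrable_mul_exp hc t) (hF.id_mul.integrable_mul_exp hc t).aestronglyMeasurable
    (ae_of_all _ fun ν t' ht' => ?_) ((hF.id_mul.integrable hc).norm.mul_const _)
    (ae_of_all _ fun ν t' _ => ?_)).2
  · exact h.const_mul _
  · rw [norm_mul, norm_exp_line]
    have h2 : c * t' ≤ |c| * (|t| + 1) := by
      refine (le_abs_self _).trans ?_
      rw [abs_mul]
      gcongr
      rw [Metric.mem_ball, Real.dist_eq] at ht'
      have := abs_sub_abs_le_abs_sub t' t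
      linarith
    gcongr
  · have h1 : HasDerivAt (fun t : ℝ => ((c : ℂ) + ν * Complex.I) * t)
        ((c : ℂ) + ν * Complex.I) t' := by
      simpa using (Complex.ofRealCLM.hasDerivAt (x := t')).const_mul ((c : ℂ) + ν * Complex.I)
    exact (h1.cexp.const_mul (F (c + ν * Complex.I))).congr_deriv (by ring)

lemma RootDecay.contDiff_bromwich_nat (hc : d < c) (n : ℕ) :
    ∀ {F : ℂ → ℂ}, RootDecay d F → ContDiff ℝ n (bromwich c F) := by
  induction n with
  | zero =>
    intro F hF
    exact contDiff_zero.2 (continuous_iff_continuousAt.2 fun t =>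
      (hF.hasDerivAt_bromwich hc t).continuousAt)
  | succ n ih =>
    intro F hF
    push_cast
    rw [contDiff_succ_iff_deriv]
    refine ⟨fun t => (hF.hasDerivAt_bromwich hc t).differentiableAt, by simp, ?_⟩
    have : deriv (bromwich c F) = bromwich c (fun s => s * F s) :=
      funext fun t => (hF.hasDerivAt_bromwich hc t).deriv
    rw [this]
    exact ih hF.id_mul

lemma RootDecay.contDiff_bromwich (hF : RootDecay d F) (hc : d < c) :
    ContDiff ℝ ∞ (bromwich c F) :=
  contDiff_infty.2 fun n => RootDecay.contDiff_bromwich_nat hc n hF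

lemma RootDecay.bromwich_shift (hF : RootDecay d F) {c' : ℝ} (hc : d < c) (hcc : c ≤ c') (t : ℝ) :
    bromwich c F t = bromwich c' F t := by
  obtain ⟨κ, C, hκ, hC, h⟩ := hF.bound
  set f : ℂ → ℂ := fun s => F s * Complex.exp (s * t)
  have hlim : ∀ e : ℝ, d < e → Tendsto (fun R : ℝ => ∫ y : ℝ in (-R)..R, f (e + y * Complex.I))
      atTop (𝓝 (∫ y : ℝ, f (e + y * Complex.I))) := fun e he =>
    intervalIntegral_tendsto_integral (hF.integrable_mul_exp he t) tendsto_neg_atTop_atBot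
      tendsto_id
  have hside : ∀ ρ : ℝ → ℝ, (∀ R, |ρ R| = |R|) →
      Tendsto (fun R : ℝ => ∫ x : ℝ in c..c', f (x + ρ R * Complex.I)) atTop (𝓝 0) := by
    intro ρ hρ
    have h0 : Tendsto (fun R : ℝ => C * Real.exp (-(κ * R ^ (3 / 4 : ℝ))) *
        Real.exp (|c'| * |t| + |c| * |t|) * |c' - c|) atTop (𝓝 0) := by
      have h1 : Tendsto (fun R : ℝ => Real.exp (-(κ * R ^ (3 / 4 : ℝ)))) atTop (𝓝 0) :=
        Real.tendsto_exp_atBot.comp (tendsto_neg_atTop_atBot.comp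
          ((tendsto_rpow_atTop (by norm_num)).const_mul_atTop hκ))
      simpa using ((h1.const_mul C).mul_const (Real.exp (|c'| * |t| + |c| * |t|))).mul_const
        |c' - c|
    refine squeeze_zero_norm' ?_ h0
    filter_upwards [eventually_ge_atTop 0] with R hR
    apply intervalIntegral.norm_integral_le_of_norm_le_const
    intro x hx
    rw [uIoc_of_le hcc] at hx
    have h2 : d < ((x : ℂ) + ρ R * Complex.I).re := by rw [line_re]; linarith [hx.1]
    rw [norm_mul, norm_exp_line]
    gcongr
    · refine (h _ h2).trans ?_
      gcongr
      have := abs_le_norm_line x (ρ R)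
      rwa [hρ, abs_of_nonneg hR] at this
    · have hxc : |x| ≤ |c'| + |c| := by
        rw [abs_le]
        constructor
        · linarith [hx.1, neg_abs_le c, abs_nonneg c']
        · linarith [hx.2, le_abs_self c', abs_nonneg c]
      calc x * t ≤ |x * t| := le_abs_self _
        _ = |x| * |t| := abs_mul _ _
        _ ≤ (|c'| + |c|) * |t| := by gcongr
        _ = _ := by ring
  have hrect : ∀ R : ℝ, (∫ x : ℝ in c..c', f (x + (-R : ℝ) * Complex.I)) -
      (∫ x : ℝ in c..c', f (x + R * Complex.I)) +
      Complex.I • (∫ y : ℝ in (-R)..R, f (c' + y * Complex.I)) -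
      Complex.I • (∫ y : ℝ in (-R)..R, f (c + y * Complex.I)) = 0 := by
    intro R
    have := Complex.integral_boundary_rect_eq_zero_of_differentiableOn f
      ((c : ℂ) + (-R : ℝ) * Complex.I) ((c' : ℂ) + R * Complex.I) (by
        intro s hs
        rw [Complex.mem_reProdIm, line_re, line_re, uIcc_of_le hcc] at hs
        exact ((hF.diff s (hc.trans_le hs.1.1)).mul (by fun_prop)).differentiableWithinAt)
    rw [line_re, line_re, line_im, line_im] at this
    exact this
  have hl := (((hside (fun R => -R) (fun R => abs_neg R)).sub (hside (fun R => R)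
    (fun R => rfl))).add ((hlim c' (hc.trans_le hcc)).const_smul Complex.I)).sub
    ((hlim c hc).const_smul Complex.I)
  have h0 := tendsto_nhds_unique (tendsto_const_nhds.congr fun R => (hrect R).symm) hl
  have h1 : (∫ y : ℝ, f (c + y * Complex.I)) = ∫ y : ℝ, f (c' + y * Complex.I) := by
    have h2 : Complex.I * ((∫ y : ℝ, f (c' + y * Complex.I)) -
        ∫ y : ℝ, f (c + y * Complex.I)) = 0 := by
      rw [mul_sub]
      simpa using h0.symm
    rcases mul_eq_zero.1 h2 with h3 | h3
    · exact absurd h3 Complex.I_ne_zero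
    · exact (sub_eq_zero.1 h3).symm
  rw [bromwich, bromwich]
  exact congrArg _ h1

lemma RootDecay.bromwich_eq (hF : RootDecay d F) {c' : ℝ} (hc : d < c) (hc' : d < c') (t : ℝ) :
    bromwich c F t = bromwich c' F t := by
  rcases le_total c c' with h | h
  · exact hF.bromwich_shift hc h t
  · exact (hF.bromwich_shift hc' h t).symm

/-- For `t ≤ 0` the factor `e^{st}` is bounded by `1` on the half plane, so the line can be pushed
to `+∞`, where the decay of `F` makes the integral vanish. As `t = 0` is included, these smooth
functions satisfy homogeneous initial conditions automatically. -/
lemma RootDecay.bromwich_eq_zero (hF : RootDecay d F) (hd : 0 ≤ d) (hc : d < c) {t : ℝ}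
    (ht : t ≤ 0) : bromwich c F t = 0 := by
  obtain ⟨κ, C, hκ, hC, h⟩ := hF.bound
  have hle : ∀ e : ℝ, c ≤ e → ‖bromwich c F t‖ ≤ 1 / (2 * Real.pi) *
      (C * (∫ ν, expRoot (κ / 2) ν)) * Real.exp (-(κ / 2 * e ^ (3 / 4 : ℝ))) := by
    intro e hce
    have hde := hc.trans_le hce
    have he : 0 ≤ e := hd.trans hde.le
    rw [hF.bromwich_shift hc hce]
    refine (norm_bromwich_le e F t).trans ?_
    have h1 : Real.exp (e * t) ≤ 1 := Real.exp_le_one_iff.2 (mul_nonpos_of_nonneg_of_nonpos he ht)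
    -- The exponent is split in halves: one provides integrability in `ν`, the other decay in the
    -- abscissa `e`.
    have h2 : (∫ ν : ℝ, ‖F (e + ν * Complex.I)‖) ≤
        ∫ ν : ℝ, C * expRoot (κ / 2) ν * Real.exp (-(κ / 2 * e ^ (3 / 4 : ℝ))) := by
      refine integral_mono (hF.integrable hde).norm
        (((integrable_expRoot (half_pos hκ)).const_mul C).mul_const _) fun ν => ?_
      refine (h _ (by rwa [line_re])).trans ?_
      rw [mul_assoc, expRoot, ← Real.exp_add]
      gcongr
      have h3 := abs_le_norm_line e ν
      have h4 : e ≤ ‖(e : ℂ) + ν * Complex.I‖ := by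
        have := Complex.re_le_norm ((e : ℂ) + ν * Complex.I)
        rwa [line_re] at this
      have h5 : |ν| ^ (3 / 4 : ℝ) ≤ ‖(e : ℂ) + ν * Complex.I‖ ^ (3 / 4 : ℝ) := by gcongr
      have h6 : e ^ (3 / 4 : ℝ) ≤ ‖(e : ℂ) + ν * Complex.I‖ ^ (3 / 4 : ℝ) := by gcongr
      nlinarith
    rw [integral_mul_const, integral_const_mul] at h2
    have h3 : 0 ≤ ∫ ν : ℝ, ‖F (e + ν * Complex.I)‖ := integral_nonneg fun _ => norm_nonneg _
    calc _ ≤ (1 / (2 * Real.pi) * ∫ ν : ℝ, ‖F (e + ν * Complex.I)‖) * 1 := by gcongr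
      _ ≤ _ := by
        rw [mul_one, mul_assoc]
        gcongr
  have hlim : Tendsto (fun e : ℝ => 1 / (2 * Real.pi) *
      (C * (∫ ν, expRoot (κ / 2) ν)) * Real.exp (-(κ / 2 * e ^ (3 / 4 : ℝ)))) atTop (𝓝 0) := by
    have h1 : Tendsto (fun R : ℝ => Real.exp (-(κ / 2 * R ^ (3 / 4 : ℝ)))) atTop (𝓝 0) :=
      Real.tendsto_exp_atBot.comp (tendsto_neg_atTop_atBot.comp
        ((tendsto_rpow_atTop (by norm_num)).const_mul_atTop (half_pos hκ)))
    simpa using h1.const_mul (1 / (2 * Real.pi) * (C * (∫ ν, expRoot (κ / 2) ν)))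
  have := ge_of_tendsto hlim (eventually_atTop.2 ⟨c, hle⟩)
  exact norm_le_zero_iff.1 this

lemma RootDecay.integrable_bromwich_mul_exp (hF : RootDecay d F) (hd : 0 ≤ d) (hc : d < c)
    {s : ℂ} (hs : d < s.re) : Integrable fun t : ℝ => bromwich c F t * Complex.exp (-s * t) := by
  obtain ⟨e, he, hes⟩ := exists_between hs
  set K := 1 / (2 * Real.pi) * ∫ ν : ℝ, ‖F (e + ν * Complex.I)‖
  have h1 : IntegrableOn (fun t : ℝ => bromwich c F t * Complex.exp (-s * t)) (Ioi 0) := by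
    refine ((integrableOn_exp_neg_mul (sub_pos.2 hes)).const_mul K).mono'
      (((hF.contDiff_bromwich hc).continuous.mul (by fun_prop)).aestronglyMeasurable)
      (ae_of_all _ fun t => ?_)
    rw [norm_mul, Complex.norm_exp, hF.bromwich_eq hc he, Complex.re_mul_ofReal, Complex.neg_re]
    calc _ ≤ K * Real.exp (e * t) * Real.exp (-s.re * t) := by
          gcongr
          exact norm_bromwich_le e F t
      _ = _ := by
        rw [mul_assoc, ← Real.exp_add]
        ring_nf
  refine (integrableOn_iff_integrable_of_support_subset ?_).1 h1
  intro t ht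
  by_contra hn
  exact ht (by simp [hF.bromwich_eq_zero hd hc (not_lt.1 hn)])

open scoped FourierTransform in
-- On the vertical line through `s` the Bromwich integral times `e^{-t Re s}` is an inverse Fourier
-- transform, so the statement is Fourier inversion at frequency `Im s / 2π`.
lemma RootDecay.laplace_bromwich (hF : RootDecay d F) (hd : 0 ≤ d) (hc : d < c)
    {s : ℂ} (hs : d < s.re) :
    ∫ t in Ioi (0 : ℝ), bromwich c F t * Complex.exp (-s * t) = F s := by
  set e := s.re with he
  have hpi := Real.pi_pos
  set g : ℝ → ℂ := fun v => F (e + (2 * Real.pi * v : ℝ) * Complex.I) with hg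
  have hgc : Continuous g := (hF.continuous_line hs).comp (continuous_const.mul continuous_id)
  have hgi : Integrable g := (hF.integrable hs).comp_mul_left' (R := 2 * Real.pi) (by positivity)
  have hinv : ∀ t : ℝ, 𝓕⁻ g t = bromwich c F t * Complex.exp (-e * t) := by
    intro t
    rw [Real.fourierInv_eq', hF.bromwich_eq hc hs, bromwich]
    have h1 := Measure.integral_comp_mul_left (fun ν : ℝ => F (e + ν * Complex.I) *
      Complex.exp (ν * t * Complex.I)) (2 * Real.pi)
    have h2 : ∀ v : ℝ, Complex.exp (((2 * Real.pi * inner ℝ v t : ℝ) : ℂ) * Complex.I) • g v =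
        F (e + (2 * Real.pi * v : ℝ) * Complex.I) *
          Complex.exp ((2 * Real.pi * v : ℝ) * t * Complex.I) := by
      intro v
      rw [smul_eq_mul, mul_comm, hg]
      simp only [RCLike.inner_apply, conj_trivial]
      congr 2
      push_cast
      ring
    simp_rw [h2]
    rw [h1, mul_assoc, ← integral_mul_const, abs_of_pos (by positivity)]
    have h3 : ∀ ν : ℝ, F (e + ν * Complex.I) * Complex.exp ((e + ν * Complex.I) * t) *
        Complex.exp (-e * t) = F (e + ν * Complex.I) * Complex.exp (ν * t * Complex.I) := by
      intro ν
      rw [mul_assoc, ← Complex.exp_add]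
      ring_nf
    simp_rw [h3]
    rw [Complex.real_smul]
    congr 1
    push_cast
    ring
  -- Inversion needs both sides integrable. Shifting the line to an abscissa strictly between `d`
  -- and `Re s` gives exponential decay for `t > 0`, and for `t ≤ 0` the function vanishes.
  have hfi : Integrable (𝓕 g) := by
    have h1 : Integrable (𝓕⁻ g) := by
      rw [show 𝓕⁻ g = fun t : ℝ => bromwich c F t * Complex.exp (-(e : ℂ) * t) from funext hinv]
      exact hF.integrable_bromwich_mul_exp hd hc (s := e) (by simpa using hs)
    have h2 : 𝓕 g = fun t => 𝓕⁻ g (-t) := by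
      funext t
      rw [Real.fourierInv_eq_fourier_neg, neg_neg]
    rw [h2]
    exact h1.comp_neg
  have h := congrFun (hgc.fourier_fourierInv_eq hgi hfi) (s.im / (2 * Real.pi))
  rw [Real.fourier_eq'] at h
  have hgs : g (s.im / (2 * Real.pi)) = F s := by
    simp only [hg]
    congr 1
    rw [mul_div_cancel₀ _ (by positivity : (2 * Real.pi) ≠ 0)]
    exact Complex.re_add_im s
  rw [hgs] at h
  refine Eq.trans ?_ ((setIntegral_eq_integral_of_forall_compl_eq_zero (s := Ioi (0 : ℝ))
    ?_).trans h)
  · refine setIntegral_congr_fun measurableSet_Ioi fun t _ => ?_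
    simp only [hinv, smul_eq_mul, RCLike.inner_apply, conj_trivial]
    have h4 : ((-2 * Real.pi * (s.im / (2 * Real.pi) * t) : ℝ) : ℂ) = -(s.im * t) := by
      rw [← Complex.ofReal_mul, ← Complex.ofReal_neg, Complex.ofReal_inj]
      field_simp
    rw [h4, mul_left_comm, ← Complex.exp_add]
    congr 2
    conv_lhs => rw [← Complex.re_add_im s]
    rw [he]
    ring
  · intro t ht
    rw [hinv, hF.bromwich_eq_zero hd hc (not_lt.1 ht)]
    simp

lemma bromwich_conj (hreal : ∀ s : ℂ, d < s.re →
    F ((starRingEnd ℂ) s) = (starRingEnd ℂ) (F s)) (hc : d < c) (t : ℝ) :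
    (starRingEnd ℂ) (bromwich c F t) = bromwich c F t := by
  have h1 : ∀ ν : ℝ, (starRingEnd ℂ) (F (c + ν * Complex.I) *
      Complex.exp ((c + ν * Complex.I) * t)) = F (c + (-ν : ℝ) * Complex.I) *
      Complex.exp ((c + (-ν : ℝ) * Complex.I) * t) := by
    intro ν
    have h2 : (starRingEnd ℂ) ((c : ℂ) + ν * Complex.I) = c + (-ν : ℝ) * Complex.I := by
      simp
    rw [map_mul, ← hreal _ (by rwa [line_re]), h2, ← Complex.exp_conj, map_mul, h2,
      Complex.conj_ofReal]
  rw [bromwich, map_mul, ← integral_conj]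
  simp_rw [h1]
  rw [integral_neg_eq_self (fun ν : ℝ => F (c + ν * Complex.I) *
    Complex.exp ((c + ν * Complex.I) * t))]
  simp [Complex.conj_ofReal, map_ofNat]

end

open scoped FourierTransform in
/-- Uniqueness for the Laplace transform of continuous functions on the line. -/
lemma eq_zero_of_laplace_eq_zero {f : ℝ → ℂ} (hf : Continuous f) (p : ℝ)
    (hi : Integrable fun t : ℝ => f t * Complex.exp (-p * t))
    (h0 : ∀ ν : ℝ, ∫ t : ℝ, f t * Complex.exp (-((p : ℂ) + ν * Complex.I) * t) = 0) (t : ℝ) :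
    f t = 0 := by
  set g : ℝ → ℂ := fun t => f t * Complex.exp (-p * t) with hg
  have hF : 𝓕 g = 0 := by
    funext v
    rw [Real.fourier_eq', Pi.zero_apply, ← h0 (2 * Real.pi * v)]
    refine integral_congr_ae (ae_of_all _ fun t => ?_)
    simp only [hg, smul_eq_mul, RCLike.inner_apply, conj_trivial]
    rw [mul_comm, mul_assoc, ← Complex.exp_add]
    congr 2
    push_cast
    ring
  have h := hi.fourierInv_fourier_eq (by rw [hF]; exact integrable_zero _ _ _)
    (v := t) (by fun_prop)
  rw [hF] at h
  have h1 : g t = 0 := by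
    rw [← h, Real.fourierInv_eq']
    simp
  exact (mul_eq_zero.1 h1).resolve_right (Complex.exp_ne_zero _)

/-! ### The Laplace transform of powers -/

lemma integrableOn_rpow_mul_exp_neg {β r : ℝ} (hβ : -1 < β) (hr : 0 < r) :
    IntegrableOn (fun v : ℝ => v ^ β * Real.exp (-(r * v))) (Ioi 0) := by
  have := integrableOn_rpow_mul_exp_neg_mul_rpow (s := β) (p := 1) (b := r) hβ one_pos hr
  simpa using this

lemma norm_rpow_mul_exp {β v : ℝ} (hv : 0 < v) (s : ℂ) :
    ‖((v ^ β : ℝ) : ℂ) * Complex.exp (-s * v)‖ = v ^ β * Real.exp (-(s.re * v)) := by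
  rw [norm_mul, Complex.norm_exp, Complex.norm_real, Real.norm_of_nonneg (Real.rpow_nonneg hv.le _),
    Complex.re_mul_ofReal, Complex.neg_re, neg_mul]

lemma aestronglyMeasurable_rpow_mul_exp (β : ℝ) (s : ℂ) (μ : Measure ℝ) :
    AEStronglyMeasurable (fun v : ℝ => ((v ^ β : ℝ) : ℂ) * Complex.exp (-s * v)) μ :=
  (Measurable.mul (by fun_prop) (by fun_prop)).aestronglyMeasurable

lemma integrableOn_rpow_mul_cexp {β : ℝ} (hβ : -1 < β) {s : ℂ} (hs : 0 < s.re) :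
    IntegrableOn (fun v : ℝ => ((v ^ β : ℝ) : ℂ) * Complex.exp (-s * v)) (Ioi 0) := by
  refine (integrableOn_rpow_mul_exp_neg hβ hs).mono' (aestronglyMeasurable_rpow_mul_exp β s _) ?_
  rw [ae_restrict_iff' measurableSet_Ioi]
  exact ae_of_all _ fun v hv => (norm_rpow_mul_exp hv s).le

/-- The Laplace transform of `v ^ (-α)`. -/
lemma integral_rpow_mul_cexp {α : ℝ} (hα : α < 1) {s : ℂ} (hs : 0 < s.re) :
    ∫ v in Ioi (0 : ℝ), ((v ^ (-α) : ℝ) : ℂ) * Complex.exp (-s * v) =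
      Real.Gamma (1 - α) * s ^ ((α : ℂ) - 1) := by
  set U : Set ℂ := {s | 0 < s.re}
  have hU : IsOpen U := isOpen_lt continuous_const Complex.continuous_re
  have hd1 : DifferentiableOn ℂ (fun s : ℂ => ∫ v in Ioi (0 : ℝ),
      ((v ^ (-α) : ℝ) : ℂ) * Complex.exp (-s * v)) U := by
    intro z hz
    have hz2 : 0 < z.re / 2 := half_pos hz
    have h := (hasDerivAt_integral_of_dominated_loc_of_deriv_le (μ := volume.restrict (Ioi 0))
      (F := fun (s : ℂ) (v : ℝ) => ((v ^ (-α) : ℝ) : ℂ) * Complex.exp (-s * v))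
      (F' := fun (s : ℂ) (v : ℝ) => ((v ^ (-α) : ℝ) : ℂ) * (Complex.exp (-s * v) * -v))
      (x₀ := z) (s := {s : ℂ | z.re / 2 < s.re})
      (bound := fun v : ℝ => v ^ (1 - α) * Real.exp (-(z.re / 2 * v)))
      ((isOpen_lt continuous_const Complex.continuous_re).mem_nhds
        (show z.re / 2 < z.re from half_lt_self hz))
      (Eventually.of_forall fun s => aestronglyMeasurable_rpow_mul_exp _ s _)
      (integrableOn_rpow_mul_cexp (by linarith) hz)
      (Measurable.mul (by fun_prop) (by fun_prop)).aestronglyMeasurable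
      ((ae_restrict_iff' measurableSet_Ioi).2 (ae_of_all _ fun v hv s hs => ?_))
      (integrableOn_rpow_mul_exp_neg (by linarith) hz2)
      (ae_of_all _ fun v s _ => ?_)).2
    · exact h.differentiableAt.differentiableWithinAt
    · have hv0 : (0 : ℝ) < v := hv
      rw [← mul_assoc, norm_mul, norm_rpow_mul_exp hv0, norm_neg, Complex.norm_real,
        Real.norm_of_nonneg hv0.le]
      have h1 : v ^ (1 - α) = v ^ (-α) * v := by
        rw [sub_eq_neg_add, Real.rpow_add hv0, Real.rpow_one]
      rw [h1, mul_right_comm]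
      gcongr
      exact le_of_lt hs
    · have h1 : HasDerivAt (fun s : ℂ => -s * v) (-(v : ℂ)) s := by
        simpa using ((hasDerivAt_id s).neg).mul_const (v : ℂ)
      exact h1.cexp.const_mul _
  have hd2 : DifferentiableOn ℂ (fun s : ℂ => (Real.Gamma (1 - α) : ℂ) * s ^ ((α : ℂ) - 1)) U :=
    fun z hz => ((differentiableAt_id.cpow_const (Or.inl hz)).const_mul _).differentiableWithinAt
  have hpre : IsPreconnected U := (convex_halfSpace_re_gt 0).isPreconnected
  have h1U : (1 : ℂ) ∈ U := by simp [U]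
  -- Identity theorem: both sides are holomorphic in the right half plane and agree at real points
  -- accumulating at `1`, where the formula is Euler's integral.
  refine (hd1.analyticOnNhd hU).eqOn_of_preconnected_of_frequently_eq (hd2.analyticOnNhd hU)
    hpre h1U ?_ hs
  have hfreq : ∃ᶠ r : ℝ in 𝓝[≠] 1, (r : ℂ) ∈ {z : ℂ | (∫ v in Ioi (0 : ℝ),
      ((v ^ (-α) : ℝ) : ℂ) * Complex.exp (-z * v)) =
        (Real.Gamma (1 - α) : ℂ) * z ^ ((α : ℂ) - 1)} := by
    apply Eventually.frequently
    filter_upwards [nhdsWithin_le_nhds (Ioi_mem_nhds (zero_lt_one' ℝ))] with r hr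
    have hr0 : (0 : ℝ) < r := hr
    have h := Complex.integral_cpow_mul_exp_neg_mul_Ioi (a := ((1 - α : ℝ) : ℂ)) (r := r)
      (by rw [Complex.ofReal_re]; linarith) hr0
    change (∫ v in Ioi (0 : ℝ), ((v ^ (-α) : ℝ) : ℂ) * Complex.exp (-(r : ℂ) * v)) = _
    rw [← Complex.Gamma_ofReal, mul_comm]
    have h2 : (r : ℂ) ^ ((α : ℂ) - 1) = (1 / r : ℂ) ^ (((1 - α : ℝ) : ℂ)) := by
      rw [one_div, Complex.inv_cpow _ _ (by
        rw [Complex.arg_ofReal_of_nonneg hr0.le]; exact Real.pi_pos.ne), ← Complex.cpow_neg]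
      congr 1
      push_cast
      ring
    rw [h2, ← h]
    refine setIntegral_congr_fun measurableSet_Ioi fun v hv => ?_
    rw [Complex.ofReal_cpow (le_of_lt hv)]
    congr 2
    · push_cast; ring
    · ring
  have htend : Tendsto (fun r : ℝ => (r : ℂ)) (𝓝[≠] 1) (𝓝[≠] 1) := by
    refine tendsto_nhdsWithin_iff.2 ⟨?_, ?_⟩
    · exact (Complex.continuous_ofReal.tendsto' 1 1 (by simp)).mono_left nhdsWithin_le_nhds
    · filter_upwards [self_mem_nhdsWithin] with r hr
      exact fun h => hr (Complex.ofReal_eq_one.1 h)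
  exact htend.frequently hfreq

/-! ### Riemann-Liouville derivatives of causal functions -/

/-- The derivative of `y` on `(0, ∞)`, extended by zero. -/
def causalDeriv (y : ℝ → ℝ) (t : ℝ) : ℝ := if 0 < t then deriv y t else 0

/-- Causal functions, continuously differentiable on `[0, ∞)` and vanishing at `0`, with
derivative of exponential growth. -/
structure CausalC1 (c C : ℝ) (y : ℝ → ℝ) : Prop where
  zero : ∀ t ≤ 0, y t = 0
  smooth : ContDiffOn ℝ 1 y (Ici 0)
  growth : ∀ t, 0 < t → |deriv y t| ≤ C * Real.exp (c * t)

lemma measurable_causalDeriv (y : ℝ → ℝ) : Measurable (causalDeriv y) :=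
  Measurable.ite measurableSet_Ioi (measurable_deriv y) measurable_const

section

variable {c C : ℝ} {y : ℝ → ℝ}

lemma CausalC1.const_nonneg (hy : CausalC1 c C y) : 0 ≤ C := by
  have h := (abs_nonneg _).trans (hy.growth 1 one_pos)
  exact nonneg_of_mul_nonneg_left h (Real.exp_pos _)

lemma CausalC1.hasDerivAt (hy : CausalC1 c C y) {t : ℝ} (ht : t ≠ 0) :
    HasDerivAt y (causalDeriv y t) t := by
  rcases lt_or_gt_of_ne ht with h | h
  · rw [causalDeriv, if_neg (not_lt.2 h.le)]
    refine (hasDerivAt_const t (0 : ℝ)).congr_of_eventuallyEq ?_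
    filter_upwards [Iio_mem_nhds h] with r hr
    exact hy.zero r (le_of_lt hr)
  · rw [causalDeriv, if_pos h]
    exact ((hy.smooth.differentiableOn one_ne_zero).differentiableAt
      (Ici_mem_nhds h)).hasDerivAt

lemma CausalC1.abs_causalDeriv_le (hy : CausalC1 c C y) (t : ℝ) :
    |causalDeriv y t| ≤ C * Real.exp (c * t) := by
  unfold causalDeriv
  split_ifs with h
  · exact hy.growth t h
  · rw [abs_zero]
    have := hy.const_nonneg
    positivity

lemma CausalC1.abs_causalDeriv_le_of_le (hy : CausalC1 c C y) (hc : 0 < c) {t T : ℝ}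
    (h : t ≤ T) : |causalDeriv y t| ≤ C * Real.exp (c * T) := by
  refine (hy.abs_causalDeriv_le t).trans ?_
  have := hy.const_nonneg
  gcongr

lemma CausalC1.continuous (hy : CausalC1 c C y) : Continuous y := by
  have h : y = fun t => if t ≤ 0 then 0 else y t := by
    funext t
    split_ifs with h
    · exact hy.zero t h
    · rfl
  rw [h]
  refine continuous_if_le continuous_id continuous_const continuousOn_const ?_ ?_
  · exact hy.smooth.continuousOn
  · intro t ht
    exact (hy.zero t ht.le).symm

lemma CausalC1.intervalIntegrable (hy : CausalC1 c C y) (hc : 0 < c) (r r' : ℝ) :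
    IntervalIntegrable (causalDeriv y) volume r r' := by
  rw [intervalIntegrable_iff]
  refine Measure.integrableOn_of_bounded (M := C * Real.exp (c * max r r')) (by simp)
    (measurable_causalDeriv y).aestronglyMeasurable ?_
  rw [ae_restrict_iff' measurableSet_uIoc]
  exact ae_of_all _ fun t ht => hy.abs_causalDeriv_le_of_le hc ht.2

lemma CausalC1.eq_integral (hy : CausalC1 c C y) (hc : 0 < c) (r r' : ℝ) :
    ∫ τ in r..r', causalDeriv y τ = y r' - y r := by
  have key : ∀ T : ℝ, ∫ τ in (0 : ℝ)..T, causalDeriv y τ = y T := by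
    intro T
    rcases le_total 0 T with h | h
    · rw [intervalIntegral.integral_eq_sub_of_hasDerivAt_of_le h hy.continuous.continuousOn
        (fun t ht => hy.hasDerivAt ht.1.ne') (hy.intervalIntegrable hc 0 T), hy.zero 0 le_rfl,
        sub_zero]
    · rw [hy.zero T h, intervalIntegral.integral_congr (g := fun _ => (0 : ℝ))]
      · simp
      · intro t ht
        rw [uIcc_of_ge h] at ht
        simp [causalDeriv, not_lt.2 ht.2]
  rw [← intervalIntegral.integral_interval_sub_left (hy.intervalIntegrable hc 0 r')
    (hy.intervalIntegrable hc 0 r), key, key]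

lemma CausalC1.abs_sub_le (hy : CausalC1 c C y) (hc : 0 < c) {r r' T : ℝ} (hr : r ≤ T)
    (hr' : r' ≤ T) : |y r - y r'| ≤ C * Real.exp (c * T) * |r - r'| := by
  rw [← hy.eq_integral hc r' r]
  refine intervalIntegral.norm_integral_le_of_norm_le_const (f := causalDeriv y) fun t ht => ?_
  exact hy.abs_causalDeriv_le_of_le hc (ht.2.trans (max_le hr' hr))

lemma CausalC1.abs_le (hy : CausalC1 c C y) (hc : 0 < c) {t : ℝ} (ht : 0 ≤ t) :
    |y t| ≤ C / c * Real.exp (c * t) := by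
  have h0 : y t = ∫ τ in (0 : ℝ)..t, causalDeriv y τ := by
    rw [hy.eq_integral hc, hy.zero 0 le_rfl, sub_zero]
  rw [h0]
  refine (intervalIntegral.norm_integral_le_of_norm_le (μ := volume) (f := causalDeriv y)
    (g := fun τ => C * Real.exp (c * τ)) ht (ae_of_all _ fun τ _ => hy.abs_causalDeriv_le τ)
    (by apply Continuous.intervalIntegrable; fun_prop)).trans ?_
  rw [intervalIntegral.integral_const_mul,
    intervalIntegral.integral_comp_mul_left (f := Real.exp) hc.ne', integral_exp, smul_eq_mul,
    div_eq_mul_inv, mul_assoc]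
  have := hy.const_nonneg
  gcongr
  linarith [Real.exp_pos (c * 0)]

lemma CausalC1.lipschitzOnWith (hy : CausalC1 c C y) (hc : 0 < c) {T v β : ℝ} (hv : 0 < v) :
    LipschitzOnWith (Real.nnabs (C * Real.exp (c * T) * v ^ β))
      (fun r : ℝ => y (r - v) * v ^ β) (Iio T) := by
  refine LipschitzOnWith.of_dist_le_mul fun r hr r' hr' => ?_
  have hC := hy.const_nonneg
  have hvβ := Real.rpow_nonneg hv.le β
  rw [Real.coe_nnabs, abs_of_nonneg (by positivity), Real.dist_eq, Real.dist_eq, ← sub_mul, abs_mul,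
    abs_of_nonneg hvβ]
  have := hy.abs_sub_le hc (r := r - v) (r' := r' - v) (T := T) (by linarith [mem_Iio.1 hr])
    (by linarith [mem_Iio.1 hr'])
  rw [sub_sub_sub_cancel_right] at this
  calc _ ≤ C * Real.exp (c * T) * |r - r'| * v ^ β := by gcongr
    _ = _ := by ring

/-- The Riemann-Liouville derivative of a causal `C¹` function is a causal convolution. -/
lemma CausalC1.rlDeriv_eq (hy : CausalC1 c C y) (hc : 0 < c) {α : ℝ} (hα : α < 1) {t : ℝ}
    (ht : 0 < t) : rlDeriv α y t = (1 / Real.Gamma (1 - α)) *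
      ∫ v in Ioi (0 : ℝ), causalDeriv y (t - v) * v ^ (-α) := by
  set T := t + 1
  have hint : IntegrableOn (fun v : ℝ => v ^ (-α)) (Ioc 0 T) := by
    rw [← intervalIntegrable_iff_integrableOn_Ioc_of_le (by simp only [T]; linarith)]
    exact intervalIntegral.intervalIntegrable_rpow' (by linarith)
  have hbd : Integrable (fun v : ℝ => C * Real.exp (c * T) * v ^ (-α))
      (volume.restrict (Ioc 0 T)) := hint.const_mul _
  have hmeas : ∀ r : ℝ, AEStronglyMeasurable (fun v : ℝ => y (r - v) * v ^ (-α))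
      (volume.restrict (Ioc 0 T)) := fun r =>
    (Measurable.mul (hy.continuous.measurable.comp (by fun_prop))
      (by fun_prop)).aestronglyMeasurable
  -- After `τ = r - v` the fixed domain `(0, t + 1]` serves all `r` near `t`, as `y` vanishes for
  -- negative arguments. The derivative of `y` may jump at `0`, so a Lipschitz bound is used, with
  -- differentiability required only for `v ≠ t`.
  have h := (hasDerivAt_integral_of_dominated_loc_of_lip (μ := volume.restrict (Ioc 0 T))
    (F := fun (r v : ℝ) => y (r - v) * v ^ (-α))
    (F' := fun v : ℝ => causalDeriv y (t - v) * v ^ (-α)) (x₀ := t) (s := Iio T)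
    (bound := fun v : ℝ => C * Real.exp (c * T) * v ^ (-α))
    (Iio_mem_nhds (by simp only [T]; linarith)) (Eventually.of_forall hmeas) ?_
    (Measurable.mul ((measurable_causalDeriv y).comp (by fun_prop))
      (by fun_prop)).aestronglyMeasurable
    ((ae_restrict_iff' measurableSet_Ioc).2 (ae_of_all _ fun v hv =>
      hy.lipschitzOnWith hc hv.1)) hbd ?_).2
  · have heq : (fun r : ℝ => ∫ τ in (0 : ℝ)..r, y τ / (r - τ) ^ α) =ᶠ[𝓝 t]
        fun r => ∫ v in Ioc 0 T, y (r - v) * v ^ (-α) := by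
      filter_upwards [Ioo_mem_nhds ht (show t < T by simp only [T]; linarith)] with r hr
      have h1 := intervalIntegral.integral_comp_sub_left (a := 0) (b := r)
        (fun v : ℝ => y (r - v) * v ^ (-α)) r
      simp only [sub_sub_cancel, sub_self, sub_zero] at h1
      have h2 : (∫ τ in (0 : ℝ)..r, y τ / (r - τ) ^ α) =
          ∫ τ in (0 : ℝ)..r, y τ * (r - τ) ^ (-α) := by
        refine intervalIntegral.integral_congr fun τ hτ => ?_
        rw [uIcc_of_le hr.1.le] at hτ
        rw [Real.rpow_neg (by linarith [hτ.2]), div_eq_mul_inv]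
      rw [h2, h1, intervalIntegral.integral_of_le hr.1.le]
      symm
      refine setIntegral_eq_of_subset_of_forall_sdiff_eq_zero measurableSet_Ioc
        (Ioc_subset_Ioc_right hr.2.le) fun v hv => ?_
      have hvr : r < v := by
        by_contra hn
        exact hv.2 ⟨hv.1.1, not_lt.1 hn⟩
      rw [hy.zero _ (by linarith), zero_mul]
    rw [rlDeriv, heq.deriv_eq, h.deriv]
    congr 1
    symm
    refine setIntegral_eq_of_subset_of_forall_sdiff_eq_zero measurableSet_Ioi
      Ioc_subset_Ioi_self fun v hv => ?_
    have hvr : T < v := by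
      by_contra hn
      exact hv.2 ⟨hv.1, not_lt.1 hn⟩
    rw [causalDeriv, if_neg (by simp only [T] at hvr; linarith), zero_mul]
  · refine (hint.const_mul (C * Real.exp (c * T) * T)).mono' (hmeas t) ?_
    rw [ae_restrict_iff' measurableSet_Ioc]
    refine ae_of_all _ fun v hv => ?_
    have hC := hy.const_nonneg
    have hvβ := Real.rpow_nonneg hv.1.le (-α)
    have hT : 0 < T := by simp only [T]; linarith
    rw [Real.norm_eq_abs, abs_mul, abs_of_nonneg hvβ]
    gcongr
    have h1 := hy.abs_sub_le hc (r := t - v) (r' := t - v - T) (T := T)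
      (by simp only [T]; linarith [hv.1]) (by simp only [T]; linarith [hv.1])
    rw [hy.zero (t - v - T) (by simp only [T]; linarith [hv.1]), sub_zero, sub_sub_cancel,
      abs_of_pos hT] at h1
    exact h1
  · have hne : ∀ᵐ v : ℝ ∂(volume.restrict (Ioc 0 T)), v ≠ t :=
      ae_restrict_of_ae (by simp [ae_iff])
    filter_upwards [hne] with v hv
    have h1 := (hy.hasDerivAt (t := t - v) (sub_ne_zero.2 hv.symm)).comp_sub_const t v
    exact h1.mul_const _

end

section

variable {c C : ℝ} {y : ℝ → ℝ}

/-! ### The Laplace transform of the distributed-order operator -/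

lemma CausalC1.integrable_causalDeriv_mul (hy : CausalC1 c C y) {s : ℂ} (hs : c < s.re) :
    Integrable fun t : ℝ => (causalDeriv y t : ℂ) * Complex.exp (-s * t) := by
  have h1 : IntegrableOn (fun t : ℝ => (causalDeriv y t : ℂ) * Complex.exp (-s * t)) (Ioi 0) := by
    refine ((integrableOn_exp_neg_mul (sub_pos.2 hs)).const_mul C).mono'
      (Measurable.mul (Complex.measurable_ofReal.comp (measurable_causalDeriv y))
        (by fun_prop)).aestronglyMeasurable (ae_of_all _ fun t => ?_)
    rw [norm_mul, Complex.norm_exp, Complex.norm_real, Complex.re_mul_ofReal, Complex.neg_re]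
    calc _ ≤ C * Real.exp (c * t) * Real.exp (-s.re * t) := by
          gcongr
          exact hy.abs_causalDeriv_le t
      _ = _ := by
        rw [mul_assoc, ← Real.exp_add]
        ring_nf
  refine (integrableOn_iff_integrable_of_support_subset ?_).1 h1
  intro t ht
  by_contra hn
  exact ht (by simp [causalDeriv, show ¬ 0 < t from hn])

lemma CausalC1.rlDeriv_mul_exp_eq (hy : CausalC1 c C y) (hc : 0 < c) {α : ℝ} (hα : α < 1) {t : ℝ}
    (ht : 0 < t) (s : ℂ) : (Real.Gamma (1 - α) : ℂ) * (rlDeriv α y t * Complex.exp (-s * t)) =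
      ∫ v in Ioi (0 : ℝ), ((v ^ (-α) : ℝ) : ℂ) * Complex.exp (-s * v) *
        ((causalDeriv y (t - v) : ℂ) * Complex.exp (-s * (t - v : ℝ))) := by
  have hG : (Real.Gamma (1 - α) : ℂ) ≠ 0 := by
    exact_mod_cast (Real.Gamma_pos_of_pos (by linarith)).ne'
  have h1 : (∫ v in Ioi (0 : ℝ), ((v ^ (-α) : ℝ) : ℂ) * Complex.exp (-s * v) *
      ((causalDeriv y (t - v) : ℂ) * Complex.exp (-s * (t - v : ℝ)))) =
      ∫ v in Ioi (0 : ℝ), ((causalDeriv y (t - v) * v ^ (-α) : ℝ) : ℂ) * Complex.exp (-s * t) := by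
    refine setIntegral_congr_fun measurableSet_Ioi fun v _ => ?_
    have h2 : Complex.exp (-s * t) = Complex.exp (-s * v) * Complex.exp (-s * (t - v : ℝ)) := by
      rw [← Complex.exp_add]
      push_cast
      ring_nf
    rw [h2]
    push_cast
    ring
  rw [h1, integral_mul_const, integral_complex_ofReal, hy.rlDeriv_eq hc hα ht]
  push_cast
  field_simp

/-- The weight `1 / Γ(1 - α)` cancels exactly the Gamma function from `∫ v^{-α} e^{-cv} dv`, so the
bound is uniform in `α ∈ [0, 1)`; this uniformity is needed for Fubini in `(α, t)`. -/
lemma CausalC1.abs_rlDeriv_le (hy : CausalC1 c C y) (hc : 0 < c) {α : ℝ} (h0 : 0 ≤ α) (hα : α < 1)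
    {t : ℝ} (ht : 0 < t) : |rlDeriv α y t| ≤ C * (1 + 1 / c) * Real.exp (c * t) := by
  have hG := Real.Gamma_pos_of_pos (show 0 < 1 - α by linarith)
  have hC := hy.const_nonneg
  rw [hy.rlDeriv_eq hc hα ht, abs_mul, abs_of_pos (by positivity), one_div, inv_mul_le_iff₀ hG]
  have h1 := Real.integral_rpow_mul_exp_neg_mul_Ioi (a := 1 - α) (r := c) (by linarith) hc
  have h2 := integrableOn_rpow_mul_exp_neg (β := -α) (r := c) (by linarith) hc
  rw [show 1 - α - 1 = -α by ring] at h1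
  have h3 : |∫ v in Ioi (0 : ℝ), causalDeriv y (t - v) * v ^ (-α)| ≤
      ∫ v in Ioi (0 : ℝ), C * Real.exp (c * t) * (v ^ (-α) * Real.exp (-(c * v))) := by
    refine norm_integral_le_of_norm_le (f := fun v => causalDeriv y (t - v) * v ^ (-α))
      (h2.const_mul _) ?_
    rw [ae_restrict_iff' measurableSet_Ioi]
    refine ae_of_all _ fun v hv => ?_
    rw [Real.norm_eq_abs, abs_mul, abs_of_nonneg (Real.rpow_nonneg (le_of_lt hv) _)]
    calc _ ≤ C * Real.exp (c * (t - v)) * v ^ (-α) := by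
          have := Real.rpow_nonneg (le_of_lt hv : (0 : ℝ) ≤ v) (-α)
          gcongr
          exact hy.abs_causalDeriv_le _
      _ = _ := by
        rw [show c * (t - v) = c * t + -(c * v) by ring, Real.exp_add]
        ring
  refine h3.trans ?_
  rw [integral_const_mul, h1]
  have h4 : (1 / c) ^ (1 - α) ≤ 1 + 1 / c := by
    have hc1 : 0 ≤ 1 / c := by positivity
    calc (1 / c) ^ (1 - α) ≤ (1 + 1 / c) ^ (1 - α) :=
          Real.rpow_le_rpow hc1 (by linarith) (by linarith)
      _ ≤ (1 + 1 / c) ^ (1 : ℝ) := Real.rpow_le_rpow_of_exponent_le (by linarith) (by linarith)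
      _ = _ := Real.rpow_one _
  calc C * Real.exp (c * t) * ((1 / c) ^ (1 - α) * Real.Gamma (1 - α)) ≤
      C * Real.exp (c * t) * ((1 + 1 / c) * Real.Gamma (1 - α)) := by gcongr
    _ = _ := by ring

/-- The derivative is the convolution of `v^{-α} / Γ(1 - α)` with `y'`, and the integral of a
convolution is the product of the integrals. -/
lemma CausalC1.laplace_rlDeriv (hy : CausalC1 c C y) (hc : 0 < c) {α : ℝ} (hα : α < 1) {s : ℂ}
    (hs : c < s.re) : ∫ t in Ioi (0 : ℝ), (rlDeriv α y t : ℂ) * Complex.exp (-s * t) =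
      s ^ ((α : ℂ) - 1) * ∫ t : ℝ, (causalDeriv y t : ℂ) * Complex.exp (-s * t) := by
  have hs0 := hc.trans hs
  have hG : (Real.Gamma (1 - α) : ℂ) ≠ 0 := by
    exact_mod_cast (Real.Gamma_pos_of_pos (by linarith)).ne'
  set f : ℝ → ℂ := (Ioi 0).indicator fun v => ((v ^ (-α) : ℝ) : ℂ) * Complex.exp (-s * v)
  set g : ℝ → ℂ := fun t => (causalDeriv y t : ℂ) * Complex.exp (-s * t)
  have hf : Integrable f := (integrable_indicator_iff measurableSet_Ioi).2
    (integrableOn_rpow_mul_cexp (by linarith) hs0)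
  have hg : Integrable g := hy.integrable_causalDeriv_mul hs
  have h := integral_convolution (L := ContinuousLinearMap.mul ℝ ℂ) hf hg
  have hfi : ∫ v, f v = Real.Gamma (1 - α) * s ^ ((α : ℂ) - 1) := by
    rw [integral_indicator measurableSet_Ioi, integral_rpow_mul_cexp hα hs0]
  rw [ContinuousLinearMap.mul_apply', hfi, mul_assoc] at h
  apply mul_left_cancel₀ hG
  rw [← h, ← integral_const_mul]
  have hconv : ∀ t, convolution f g (ContinuousLinearMap.mul ℝ ℂ) volume t =
      ∫ v in Ioi (0 : ℝ), ((v ^ (-α) : ℝ) : ℂ) * Complex.exp (-s * v) * g (t - v) := by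
    intro t
    rw [convolution_def, ← integral_indicator measurableSet_Ioi]
    congr 1
    funext v
    rw [ContinuousLinearMap.mul_apply']
    simp only [f]
    by_cases hv : v ∈ Ioi (0 : ℝ)
    · rw [indicator_of_mem hv, indicator_of_mem hv]
    · rw [indicator_of_notMem hv, indicator_of_notMem hv, zero_mul]
  rw [← setIntegral_eq_integral_of_forall_compl_eq_zero (s := Ioi (0 : ℝ))
    (f := convolution f g (ContinuousLinearMap.mul ℝ ℂ) volume)]
  · refine setIntegral_congr_fun measurableSet_Ioi fun t ht => ?_
    rw [hconv]
    exact hy.rlDeriv_mul_exp_eq hc hα ht s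
  · intro t ht
    rw [hconv]
    refine setIntegral_eq_zero_of_forall_eq_zero fun v hv => ?_
    have : ¬ 0 < t - v := by
      have := mem_Ioi.1 hv
      have := notMem_Ioi.1 ht
      linarith
    simp [g, causalDeriv, this]

lemma CausalC1.integrable_distributed (hy : CausalC1 c C y) (hc : 0 < c) {m : ℝ} (hm : 0 < m)
    {s : ℂ} (hs : c < s.re) : Integrable (Function.uncurry fun (α t : ℝ) =>
      ((m ^ α * rlDeriv α y t : ℝ) : ℂ) * Complex.exp (-s * t))
      ((volume.restrict (Ioc (0 : ℝ) 1)).prod (volume.restrict (Ioi (0 : ℝ)))) := by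
  have hC := hy.const_nonneg
  -- The representation as a convolution needs `α < 1`, so the null endpoint is removed.
  rw [← restrict_Ioo_eq_restrict_Ioc]
  have hmem : ∀ᵐ z : ℝ × ℝ ∂((volume.restrict (Ioo (0 : ℝ) 1)).prod (volume.restrict (Ioi 0))),
      z ∈ Ioo (0 : ℝ) 1 ×ˢ Ioi (0 : ℝ) := by
    rw [Measure.prod_restrict]
    exact ae_restrict_mem (measurableSet_Ioo.prod measurableSet_Ioi)
  -- Joint measurability is proved for the explicit formula; its prefactor is handled through `1/Γ`,
  -- which is entire.
  have hGam : Measurable fun α : ℝ => ((Complex.Gamma ((1 - α : ℝ) : ℂ))⁻¹).re :=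
    Complex.measurable_re.comp (Complex.differentiable_one_div_Gamma.continuous.measurable.comp
      (by fun_prop))
  have hI : StronglyMeasurable fun z : ℝ × ℝ =>
      ∫ v in Ioi (0 : ℝ), causalDeriv y (z.2 - v) * v ^ (-z.1) := by
    refine StronglyMeasurable.integral_prod_right' (ν := volume.restrict (Ioi (0 : ℝ)))
      (f := fun w : (ℝ × ℝ) × ℝ => causalDeriv y (w.1.2 - w.2) * w.2 ^ (-w.1.1))
      (Measurable.stronglyMeasurable ?_)
    exact ((measurable_causalDeriv y).comp (by fun_prop)).mul (by fun_prop)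
  have hmeas : AEStronglyMeasurable (Function.uncurry fun (α t : ℝ) =>
      ((m ^ α * rlDeriv α y t : ℝ) : ℂ) * Complex.exp (-s * t))
      ((volume.restrict (Ioo (0 : ℝ) 1)).prod (volume.restrict (Ioi (0 : ℝ)))) := by
    have h1 : Measurable fun z : ℝ × ℝ => ((m ^ z.1 * (((Complex.Gamma ((1 - z.1 : ℝ) : ℂ))⁻¹).re *
        ∫ v in Ioi (0 : ℝ), causalDeriv y (z.2 - v) * v ^ (-z.1)) : ℝ) : ℂ) *
        Complex.exp (-s * z.2) := by
      refine Measurable.mul (Complex.measurable_ofReal.comp (Measurable.mul (by fun_prop)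
        (Measurable.mul (hGam.comp measurable_fst) hI.measurable))) (by fun_prop)
    refine h1.aestronglyMeasurable.congr ?_
    filter_upwards [hmem] with z hz
    simp only [Function.uncurry]
    rw [hy.rlDeriv_eq hc hz.1.2 hz.2, Complex.Gamma_ofReal, ← Complex.ofReal_inv, Complex.ofReal_re,
      one_div]
  have hbd : Integrable (fun z : ℝ × ℝ => (1 : ℝ) * ((1 + m) * (C * (1 + 1 / c)) *
      Real.exp (-((s.re - c) * z.2))))
      ((volume.restrict (Ioo (0 : ℝ) 1)).prod (volume.restrict (Ioi (0 : ℝ)))) :=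
    Integrable.mul_prod (f := fun _ : ℝ => (1 : ℝ)) (integrableOn_const (by simp))
      ((integrableOn_exp_neg_mul (sub_pos.2 hs)).const_mul _)
  refine hbd.mono' hmeas ?_
  filter_upwards [hmem] with z hz
  simp only [Function.uncurry]
  have hmα : m ^ z.1 ≤ 1 + m := by
    calc m ^ z.1 ≤ (1 + m) ^ z.1 := Real.rpow_le_rpow hm.le (by linarith) hz.1.1.le
      _ ≤ (1 + m) ^ (1 : ℝ) := Real.rpow_le_rpow_of_exponent_le (by linarith) hz.1.2.le
      _ = _ := Real.rpow_one _
  have hmα0 := Real.rpow_nonneg hm.le z.1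
  rw [norm_mul, Complex.norm_exp, Complex.norm_real, Complex.re_mul_ofReal, Complex.neg_re,
    Real.norm_eq_abs, abs_mul, abs_of_nonneg hmα0]
  have h2 := hy.abs_rlDeriv_le hc hz.1.1.le hz.1.2 hz.2
  have hc1 : 0 ≤ C * (1 + 1 / c) := by positivity
  calc _ ≤ (1 + m) * (C * (1 + 1 / c) * Real.exp (c * z.2)) * Real.exp (-s.re * z.2) := by
        gcongr
    _ = _ := by
      rw [show (-((s.re - c) * z.2)) = c * z.2 + -s.re * z.2 by ring, Real.exp_add]
      ring

lemma rpow_mul_cpow_eq {m : ℝ} (hm : 0 < m) {s : ℂ} (hs : s ≠ 0) (α : ℝ) :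
    ((m ^ α : ℝ) : ℂ) * s ^ (α : ℂ) = Complex.exp (α * (Real.log m + Complex.log s)) := by
  rw [Real.rpow_def_of_pos hm, Complex.cpow_def_of_ne_zero hs, Complex.ofReal_exp,
    ← Complex.exp_add]
  push_cast
  ring_nf

/-- After Fubini the order `α` contributes `m^α s^{α-1} = e^{α (log m + log s)} / s`, and the mean
over `α` is `expMean`. This is the origin of the logarithms in `M`. -/
lemma CausalC1.laplace_distributed (hy : CausalC1 c C y) (hc : 0 < c) {m : ℝ} (hm : 0 < m) {s : ℂ}
    (hs : c < s.re) : ∫ t in Ioi (0 : ℝ), ((∫ α in (0 : ℝ)..1, m ^ α * rlDeriv α y t : ℝ) : ℂ) *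
      Complex.exp (-s * t) = expMean (Real.log m + Complex.log s) / s *
        ∫ t : ℝ, (causalDeriv y t : ℂ) * Complex.exp (-s * t) := by
  have hs0 : s ≠ 0 := by
    rintro rfl
    rw [Complex.zero_re] at hs
    linarith
  have h1 : ∀ t : ℝ, ((∫ α in (0 : ℝ)..1, m ^ α * rlDeriv α y t : ℝ) : ℂ) * Complex.exp (-s * t) =
      ∫ α in (0 : ℝ)..1, ((m ^ α * rlDeriv α y t : ℝ) : ℂ) * Complex.exp (-s * t) := by
    intro t
    rw [intervalIntegral.integral_mul_const, intervalIntegral.integral_ofReal]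
  simp_rw [h1]
  rw [← intervalIntegral_integral_swap (by
    rw [uIoc_of_le zero_le_one]; exact hy.integrable_distributed hc hm hs)]
  rw [expMean_eq_integral, ← intervalIntegral.integral_div, ← intervalIntegral.integral_mul_const]
  rw [intervalIntegral.integral_of_le zero_le_one, intervalIntegral.integral_of_le zero_le_one,
    ← restrict_Ioo_eq_restrict_Ioc]
  refine setIntegral_congr_fun measurableSet_Ioo fun α hα => ?_
  have h2 : ∀ t : ℝ, ((m ^ α * rlDeriv α y t : ℝ) : ℂ) * Complex.exp (-s * t) =
      ((m ^ α : ℝ) : ℂ) * ((rlDeriv α y t : ℂ) * Complex.exp (-s * t)) := fun t => by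
    push_cast
    ring
  simp_rw [h2]
  rw [integral_const_mul, hy.laplace_rlDeriv hc hα.2 hs, ← rpow_mul_cpow_eq hm hs0,
    Complex.cpow_sub _ _ hs0, Complex.cpow_one]
  ring

end

section

variable {d c : ℝ} {F : ℂ → ℂ}

/-! ### The distributed-order operator on inverse Laplace transforms -/

lemma RootDecay.hasDerivAt_re_bromwich (hF : RootDecay d F) (hc : d < c) (t : ℝ) :
    HasDerivAt (fun t => (bromwich c F t).re) (bromwich c (fun s => s * F s) t).re t :=
  (Complex.reCLM.hasFDerivAt.comp_hasDerivAt t (hF.hasDerivAt_bromwich hc t))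

lemma RootDecay.contDiff_re_bromwich (hF : RootDecay d F) (hc : d < c) :
    ContDiff ℝ ∞ fun t => (bromwich c F t).re :=
  Complex.reCLM.contDiff.comp (hF.contDiff_bromwich hc)

lemma RootDecay.causalC1 (hF : RootDecay d F) (hd : 0 ≤ d) (hc : d < c) :
    CausalC1 c (1 / (2 * Real.pi) * ∫ ν : ℝ, ‖((c : ℂ) + ν * Complex.I) *
      F (c + ν * Complex.I)‖) fun t => (bromwich c F t).re where
  zero t ht := by rw [hF.bromwich_eq_zero hd hc ht, Complex.zero_re]
  smooth := ((hF.contDiff_re_bromwich hc).of_le (by norm_num)).contDiffOn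
  growth t _ := by
    rw [(hF.hasDerivAt_re_bromwich hc t).deriv]
    exact (Complex.abs_re_le_norm _).trans (norm_bromwich_le c _ t)

lemma RootDecay.causalDeriv_eq (hF : RootDecay d F) (hd : 0 ≤ d) (hc : d < c) (t : ℝ) :
    causalDeriv (fun t => (bromwich c F t).re) t = (bromwich c (fun s => s * F s) t).re := by
  unfold causalDeriv
  split_ifs with h
  · exact (hF.hasDerivAt_re_bromwich hc t).deriv
  · rw [hF.id_mul.bromwich_eq_zero hd hc (not_lt.1 h), Complex.zero_re]

lemma line_ne_zero (hc : 0 < c) (ν : ℝ) : (c : ℂ) + ν * Complex.I ≠ 0 := by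
  intro h
  have := congrArg Complex.re h
  rw [line_re, Complex.zero_re] at this
  linarith

/-- By Fubini the kernel `v^{-α}` acts under the Bromwich integral, where `∫ v^{-α} e^{-sv} dv = Γ(1
- α) s^{α-1}` turns the factor `s` of the derivative into `s^α`. -/
lemma RootDecay.rlDeriv_bromwich (hF : RootDecay d F) (hd : 0 ≤ d) (hc : d < c) {α : ℝ}
    (hα : α < 1) {t : ℝ} (ht : 0 < t) : rlDeriv α (fun t => (bromwich c F t).re) t =
      (bromwich c (fun s => s ^ (α : ℂ) * F s) t).re := by
  have hc0 : 0 < c := hd.trans_lt hc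
  have hG : Real.Gamma (1 - α) ≠ 0 := (Real.Gamma_pos_of_pos (by linarith)).ne'
  have hcont := hF.id_mul.continuous_line hc
  have hmeas : Measurable fun z : ℝ × ℝ => ((z.1 ^ (-α) : ℝ) : ℂ) *
      (((c : ℂ) + z.2 * Complex.I) * F (c + z.2 * Complex.I) *
        Complex.exp ((c + z.2 * Complex.I) * (t - z.1 : ℝ))) :=
    Measurable.mul (by fun_prop) ((hcont.measurable.comp measurable_snd).mul (by fun_prop))
  have hint : Integrable (Function.uncurry fun (v ν : ℝ) => ((v ^ (-α) : ℝ) : ℂ) *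
      (((c : ℂ) + ν * Complex.I) * F (c + ν * Complex.I) *
        Complex.exp ((c + ν * Complex.I) * (t - v : ℝ))))
      ((volume.restrict (Ioi (0 : ℝ))).prod volume) := by
    have h1 := Integrable.mul_prod (integrableOn_rpow_mul_exp_neg (β := -α) (by linarith) hc0)
      ((hF.id_mul.integrable_mul_exp hc t).norm)
    refine h1.mono' hmeas.aestronglyMeasurable ?_
    have hmem : ∀ᵐ z : ℝ × ℝ ∂((volume.restrict (Ioi (0 : ℝ))).prod volume), z.1 ∈ Ioi (0 : ℝ) := by
      have : (volume.restrict (Ioi (0 : ℝ))).prod (volume : Measure ℝ) =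
          ((volume : Measure ℝ).prod volume).restrict (Ioi (0 : ℝ) ×ˢ univ) := by
        rw [← Measure.prod_restrict, Measure.restrict_univ]
      rw [this]
      filter_upwards [ae_restrict_mem (measurableSet_Ioi.prod MeasurableSet.univ)] with z hz
      exact hz.1
    filter_upwards [hmem] with z hz
    simp only [Function.uncurry]
    rw [norm_mul, norm_mul, norm_exp_line, norm_mul _ (Complex.exp _), norm_exp_line,
      Complex.norm_real, Real.norm_of_nonneg (Real.rpow_nonneg (le_of_lt hz) _)]
    rw [mul_sub, sub_eq_add_neg, Real.exp_add]
    apply le_of_eq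
    ring
  have hswap := integral_integral_swap hint
  have hin : ∀ ν : ℝ, (∫ v in Ioi (0 : ℝ), ((v ^ (-α) : ℝ) : ℂ) *
      (((c : ℂ) + ν * Complex.I) * F (c + ν * Complex.I) *
        Complex.exp ((c + ν * Complex.I) * (t - v : ℝ)))) = Real.Gamma (1 - α) *
      ((c + ν * Complex.I) ^ (α : ℂ) * F (c + ν * Complex.I) *
        Complex.exp ((c + ν * Complex.I) * t)) := by
    intro ν
    set s : ℂ := (c : ℂ) + ν * Complex.I with hs
    have hs0 : s ≠ 0 := line_ne_zero hc0 ν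
    have h1 : ∀ v : ℝ, ((v ^ (-α) : ℝ) : ℂ) * (s * F s * Complex.exp (s * (t - v : ℝ))) =
        ((v ^ (-α) : ℝ) : ℂ) * Complex.exp (-s * v) * (s * F s * Complex.exp (s * t)) := by
      intro v
      have : Complex.exp (s * (t - v : ℝ)) = Complex.exp (-s * v) * Complex.exp (s * t) := by
        rw [← Complex.exp_add]
        push_cast
        ring_nf
      rw [this]
      ring
    simp_rw [h1]
    rw [integral_mul_const, integral_rpow_mul_cexp hα (by rwa [hs, line_re]),
      Complex.cpow_sub _ _ hs0, Complex.cpow_one]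
    field_simp
  simp_rw [hin] at hswap
  rw [integral_const_mul] at hswap
  have hkey : ∫ v in Ioi (0 : ℝ), ((v ^ (-α) : ℝ) : ℂ) * bromwich c (fun s => s * F s) (t - v) =
      Real.Gamma (1 - α) * bromwich c (fun s => s ^ (α : ℂ) * F s) t := by
    unfold bromwich
    rw [mul_left_comm, ← hswap, ← integral_const_mul]
    congr 1
    funext v
    rw [integral_const_mul]
    ring
  rw [(hF.causalC1 hd hc).rlDeriv_eq hc0 hα ht]
  simp_rw [hF.causalDeriv_eq hd hc]
  have hre : ∫ v in Ioi (0 : ℝ), (bromwich c (fun s => s * F s) (t - v)).re * v ^ (-α) =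
      (∫ v in Ioi (0 : ℝ), ((v ^ (-α) : ℝ) : ℂ) * bromwich c (fun s => s * F s) (t - v)).re := by
    have hi : Integrable (fun v : ℝ => ((v ^ (-α) : ℝ) : ℂ) *
        bromwich c (fun s => s * F s) (t - v)) (volume.restrict (Ioi 0)) := by
      refine (hint.integral_prod_left.const_mul (1 / (2 * Real.pi) : ℂ)).congr
        (ae_of_all _ fun v => ?_)
      simp only [Function.uncurry]
      rw [integral_const_mul]
      unfold bromwich
      ring
    have := Complex.reCLM.integral_comp_comm hi
    simp only [Complex.reCLM_apply, Complex.re_ofReal_mul] at this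
    rw [← this]
    simp_rw [mul_comm]
  rw [hre, hkey, Complex.re_ofReal_mul]
  field_simp

lemma norm_cpow_le {α : ℝ} (h0 : 0 ≤ α) (h1 : α ≤ 1) (s : ℂ) : ‖s ^ (α : ℂ)‖ ≤ 1 + ‖s‖ := by
  refine (Complex.norm_cpow_le _ _).trans ?_
  rw [Complex.ofReal_re, Complex.ofReal_im, mul_zero, Real.exp_zero, div_one]
  calc ‖s‖ ^ α ≤ (1 + ‖s‖) ^ α := Real.rpow_le_rpow (norm_nonneg _) (by linarith) h0
    _ ≤ (1 + ‖s‖) ^ (1 : ℝ) := Real.rpow_le_rpow_of_exponent_le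
      (by linarith [norm_nonneg s]) h1
    _ = _ := Real.rpow_one _

/-- A second application of Fubini, over `α`. It is justified by `|s^α| ≤ 1 + |s|` for `0 ≤ α ≤ 1`,
a linear growth which the root-exponential decay absorbs. -/
lemma RootDecay.distributed_bromwich (hF : RootDecay d F) (hd : 0 ≤ d) (hc : d < c) {m : ℝ}
    (hm : 0 < m) {t : ℝ} (ht : 0 < t) :
    ∫ α in (0 : ℝ)..1, m ^ α * rlDeriv α (fun t => (bromwich c F t).re) t =
      (bromwich c (fun s => expMean (Real.log m + Complex.log s) * F s) t).re := by
  have hc0 : 0 < c := hd.trans_lt hc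
  set f : ℝ → ℝ → ℂ := fun α ν => Complex.exp (α * (Real.log m +
    Complex.log ((c : ℂ) + ν * Complex.I))) * (F (c + ν * Complex.I) *
      Complex.exp ((c + ν * Complex.I) * t)) with hf
  have hmeas : Measurable (Function.uncurry f) := by
    refine Measurable.mul ?_ (((hF.continuous_line hc).measurable.mul
      (by fun_prop : Measurable fun ν : ℝ => Complex.exp (((c : ℂ) + ν * Complex.I) * t))).comp
      measurable_snd)
    fun_prop
  have hG : RootDecay d fun s => (1 + s) * F s := hF.mul (G := fun s => 1 + s)
    (fun s _ => by fun_prop) (K := 1) (fun s _ => by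
      rw [one_mul]; exact (norm_add_le _ _).trans (by rw [norm_one]))
  have hbound : ∀ α ∈ Ioc (0 : ℝ) 1, ∀ ν : ℝ, ‖f α ν‖ ≤ (1 + m) * ((‖F (c + ν * Complex.I) *
      Complex.exp ((c + ν * Complex.I) * t)‖ + ‖((c : ℂ) + ν * Complex.I) *
      F (c + ν * Complex.I) * Complex.exp ((c + ν * Complex.I) * t)‖)) := by
    intro α hα ν
    have hmα0 := Real.rpow_nonneg hm.le α
    have hmα : m ^ α ≤ 1 + m := by
      calc m ^ α ≤ (1 + m) ^ α := Real.rpow_le_rpow hm.le (by linarith) hα.1.le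
        _ ≤ (1 + m) ^ (1 : ℝ) := Real.rpow_le_rpow_of_exponent_le (by linarith) hα.2
        _ = _ := Real.rpow_one _
    simp only [hf]
    rw [← rpow_mul_cpow_eq hm (line_ne_zero hc0 ν), mul_assoc ((c : ℂ) + ν * Complex.I),
      norm_mul, norm_mul, norm_mul ((c : ℂ) + ν * Complex.I), Complex.norm_real,
      Real.norm_of_nonneg hmα0]
    have h1 := norm_cpow_le hα.1.le hα.2 ((c : ℂ) + ν * Complex.I)
    calc _ ≤ (1 + m) * (1 + ‖(c : ℂ) + ν * Complex.I‖) * ‖F (c + ν * Complex.I) *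
          Complex.exp ((c + ν * Complex.I) * t)‖ := by gcongr
      _ = _ := by ring
  have hint : Integrable (Function.uncurry f)
      ((volume.restrict (uIoc (0 : ℝ) 1)).prod volume) := by
    rw [uIoc_of_le zero_le_one]
    have h1 := Integrable.mul_prod (f := fun _ : ℝ => (1 + m)) (μ := volume.restrict (Ioc (0 : ℝ) 1))
      (integrableOn_const (by simp)) ((hF.integrable_mul_exp hc t).norm.add
        (hF.id_mul.integrable_mul_exp hc t).norm)
    refine h1.mono' hmeas.aestronglyMeasurable ?_
    have hmem : ∀ᵐ z : ℝ × ℝ ∂((volume.restrict (Ioc (0 : ℝ) 1)).prod volume),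
        z.1 ∈ Ioc (0 : ℝ) 1 := by
      have : (volume.restrict (Ioc (0 : ℝ) 1)).prod (volume : Measure ℝ) =
          ((volume : Measure ℝ).prod volume).restrict (Ioc (0 : ℝ) 1 ×ˢ univ) := by
        rw [← Measure.prod_restrict, Measure.restrict_univ]
      rw [this]
      filter_upwards [ae_restrict_mem (measurableSet_Ioc.prod MeasurableSet.univ)] with z hz
      exact hz.1
    filter_upwards [hmem] with z hz
    exact hbound z.1 hz z.2
  have hswap := intervalIntegral_integral_swap hint
  have h1 : ∀ ν : ℝ, ∫ α in (0 : ℝ)..1, f α ν = expMean (Real.log m +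
      Complex.log ((c : ℂ) + ν * Complex.I)) * F (c + ν * Complex.I) *
        Complex.exp ((c + ν * Complex.I) * t) := by
    intro ν
    simp only [hf]
    rw [intervalIntegral.integral_mul_const, ← expMean_eq_integral, mul_assoc]
  simp_rw [h1] at hswap
  have h2 : ∀ α ∈ Ioo (0 : ℝ) 1, m ^ α * rlDeriv α (fun t => (bromwich c F t).re) t =
      ((1 / (2 * Real.pi) : ℂ) * ∫ ν : ℝ, f α ν).re := by
    intro α hα
    rw [hF.rlDeriv_bromwich hd hc hα.2 ht, ← Complex.re_ofReal_mul]
    congr 1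
    rw [bromwich, mul_left_comm, ← integral_const_mul]
    congr 2
    funext ν
    simp only [hf]
    rw [← rpow_mul_cpow_eq hm (line_ne_zero hc0 ν)]
    ring
  have hi : IntegrableOn (fun α => (1 / (2 * Real.pi) : ℂ) * ∫ ν : ℝ, f α ν) (Ioo 0 1) := by
    rw [uIoc_of_le zero_le_one] at hint
    exact (hint.integral_prod_left.const_mul _).mono_measure
      (Measure.restrict_mono Ioo_subset_Ioc_self le_rfl)
  rw [intervalIntegral.integral_of_le zero_le_one, ← restrict_Ioo_eq_restrict_Ioc,
    setIntegral_congr_fun measurableSet_Ioo h2]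
  have h3 := Complex.reCLM.integral_comp_comm hi
  simp only [Complex.reCLM_apply] at h3
  rw [h3, integral_const_mul, bromwich]
  congr 2
  rw [← hswap, intervalIntegral.integral_of_le zero_le_one, restrict_Ioo_eq_restrict_Ioc]

end

/-! ### Laplace transforms of solutions -/

/-- The Laplace transform of a real function on `(0, ∞)`. -/
def laplace (y : ℝ → ℝ) (s : ℂ) : ℂ := ∫ t in Ioi (0 : ℝ), (y t : ℂ) * Complex.exp (-s * t)

lemma norm_ofReal_mul_cexp (r t : ℝ) (s : ℂ) :
    ‖(r : ℂ) * Complex.exp (-s * t)‖ = |r| * Real.exp (-(s.re * t)) := by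
  rw [norm_mul, Complex.norm_exp, Complex.norm_real, Real.norm_eq_abs, Complex.re_mul_ofReal,
    Complex.neg_re, neg_mul]

lemma exp_mul_exp_neg_mul (c p t : ℝ) :
    Real.exp (c * t) * Real.exp (-(p * t)) = Real.exp (-((p - c) * t)) := by
  rw [← Real.exp_add]
  ring_nf

lemma integrableOn_ofReal_mul_cexp {y : ℝ → ℝ} {c K : ℝ} (hy : ContinuousOn y (Ioi 0))
    (h : ∀ t, 0 < t → |y t| ≤ K * Real.exp (c * t)) {s : ℂ} (hs : c < s.re) :
    IntegrableOn (fun t : ℝ => (y t : ℂ) * Complex.exp (-s * t)) (Ioi 0) := by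
  refine ((integrableOn_exp_neg_mul (sub_pos.2 hs)).const_mul K).mono'
    (((Complex.continuous_ofReal.comp_continuousOn hy).mul
      (by fun_prop : Continuous fun t : ℝ => Complex.exp (-s * t)).continuousOn).aestronglyMeasurable
      measurableSet_Ioi) ?_
  rw [ae_restrict_iff' measurableSet_Ioi]
  refine ae_of_all _ fun t ht => ?_
  rw [norm_ofReal_mul_cexp, ← exp_mul_exp_neg_mul, ← mul_assoc]
  gcongr
  exact h t ht

lemma norm_laplace_le {y : ℝ → ℝ} {c K : ℝ} (h : ∀ t, 0 < t → |y t| ≤ K * Real.exp (c * t)) {s : ℂ}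
    (hs : c < s.re) : ‖laplace y s‖ ≤ K / (s.re - c) := by
  have h1 := integral_exp_mul_Ioi (a := -(s.re - c)) (by linarith) 0
  have h2 : ‖laplace y s‖ ≤ ∫ t in Ioi (0 : ℝ), K * Real.exp (-((s.re - c) * t)) := by
    refine norm_integral_le_of_norm_le ((integrableOn_exp_neg_mul (sub_pos.2 hs)).const_mul K) ?_
    rw [ae_restrict_iff' measurableSet_Ioi]
    refine ae_of_all _ fun t ht => ?_
    rw [norm_ofReal_mul_cexp, ← exp_mul_exp_neg_mul, ← mul_assoc]
    gcongr
    exact h t ht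
  refine h2.trans_eq ?_
  simp_rw [← neg_mul]
  rw [integral_const_mul, h1]
  have : s.re - c ≠ 0 := (sub_pos.2 hs).ne'
  simp only [mul_zero, Real.exp_zero]
  field_simp

section

variable {c C : ℝ} {y : ℝ → ℝ}

lemma CausalC1.continuousOn_causalDeriv (hy : CausalC1 c C y) :
    ContinuousOn (causalDeriv y) (Ioi 0) := by
  refine ((hy.smooth.mono Ioi_subset_Ici_self).continuousOn_deriv_of_isOpen isOpen_Ioi
    le_rfl).congr fun t ht => ?_
  rw [causalDeriv, if_pos (mem_Ioi.1 ht)]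

lemma CausalC1.integrableOn (hy : CausalC1 c C y) (hc : 0 < c) {s : ℂ} (hs : c < s.re) :
    IntegrableOn (fun t : ℝ => (y t : ℂ) * Complex.exp (-s * t)) (Ioi 0) :=
  integrableOn_ofReal_mul_cexp hy.continuous.continuousOn
    (fun _ ht => hy.abs_le hc (le_of_lt ht)) hs

lemma CausalC1.integral_causalDeriv (s : ℂ) (y : ℝ → ℝ) :
    ∫ t : ℝ, (causalDeriv y t : ℂ) * Complex.exp (-s * t) = laplace (causalDeriv y) s := by
  refine (setIntegral_eq_integral_of_forall_compl_eq_zero fun t ht => ?_).symm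
  simp [causalDeriv, show ¬ 0 < t from ht]

lemma CausalC1.laplace_causalDeriv (hy : CausalC1 c C y) (hc : 0 < c) {s : ℂ} (hs : c < s.re) :
    laplace (causalDeriv y) s = s * laplace y s := by
  have h1 := hy.integrableOn hc hs
  have h2 := integrableOn_ofReal_mul_cexp hy.continuousOn_causalDeriv
    (fun t _ => hy.abs_causalDeriv_le t) hs
  have hlim : Tendsto (fun t : ℝ => (y t : ℂ) * Complex.exp (-s * t)) atTop (𝓝 0) := by
    have h0 : Tendsto (fun t : ℝ => C / c * Real.exp (-((s.re - c) * t))) atTop (𝓝 0) := by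
      have : Tendsto (fun t : ℝ => Real.exp (-((s.re - c) * t))) atTop (𝓝 0) :=
        Real.tendsto_exp_atBot.comp (tendsto_neg_atTop_atBot.comp
          (tendsto_id.const_mul_atTop (sub_pos.2 hs)))
      simpa using this.const_mul (C / c)
    refine squeeze_zero_norm' ?_ h0
    filter_upwards [eventually_ge_atTop 0] with t ht
    rw [norm_ofReal_mul_cexp, ← exp_mul_exp_neg_mul, ← mul_assoc]
    gcongr
    exact hy.abs_le hc ht
  have h := integral_Ioi_of_hasDerivAt_of_tendsto (a := 0)
    (f := fun t : ℝ => (y t : ℂ) * Complex.exp (-s * t))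
    (f' := fun t : ℝ => (causalDeriv y t : ℂ) * Complex.exp (-s * t) -
      s * ((y t : ℂ) * Complex.exp (-s * t)))
    ((Complex.continuous_ofReal.comp hy.continuous).mul (by fun_prop)).continuousWithinAt
    (fun t ht => ?_) (h2.sub (h1.const_mul s)) hlim
  · rw [integral_sub h2 (h1.const_mul s), integral_const_mul] at h
    simp only [hy.zero 0 le_rfl, Complex.ofReal_zero, zero_mul, sub_zero] at h
    exact sub_eq_zero.1 h
  · have h3 := (hy.hasDerivAt (ne_of_gt ht)).ofReal_comp
    have h4 : HasDerivAt (fun t : ℝ => -s * (t : ℂ)) (-s) t := by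
      simpa using (Complex.ofRealCLM.hasDerivAt (x := t)).const_mul (-s)
    exact (h3.mul h4.cexp).congr_deriv (by ring)

end

lemma hasDerivAt_laplace {f g : ℝ → ℝ → ℝ} {s : ℂ} {x₁ : ℝ} {γ K : ℝ} (hs : γ < s.re)
    (hfc : ∀ x ∈ Ioo 0 x₁, ContinuousOn (f x) (Ioi 0))
    (hgc : ∀ x ∈ Ioo 0 x₁, ContinuousOn (g x) (Ioi 0))
    (hfb : ∀ x ∈ Ioo 0 x₁, ∀ t, 0 < t → |f x t| ≤ K * Real.exp (γ * t))
    (hgb : ∀ x ∈ Ioo 0 x₁, ∀ t, 0 < t → |g x t| ≤ K * Real.exp (γ * t))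
    (hd : ∀ x ∈ Ioo 0 x₁, ∀ t, 0 < t → HasDerivAt (fun x => f x t) (g x t) x) {x : ℝ}
    (hx : x ∈ Ioo 0 x₁) : HasDerivAt (fun x => laplace (f x) s) (laplace (g x) s) x := by
  refine (hasDerivAt_integral_of_dominated_loc_of_deriv_le (μ := volume.restrict (Ioi 0))
    (F := fun (x t : ℝ) => (f x t : ℂ) * Complex.exp (-s * t))
    (F' := fun (x t : ℝ) => (g x t : ℂ) * Complex.exp (-s * t)) (x₀ := x) (s := Ioo 0 x₁)
    (bound := fun t => K * Real.exp (-((s.re - γ) * t))) (isOpen_Ioo.mem_nhds hx) ?_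
    (integrableOn_ofReal_mul_cexp (hfc x hx) (hfb x hx) hs)
    (integrableOn_ofReal_mul_cexp (hgc x hx) (hgb x hx) hs).aestronglyMeasurable ?_
    ((integrableOn_exp_neg_mul (sub_pos.2 hs)).const_mul K) ?_).2
  · filter_upwards [isOpen_Ioo.mem_nhds hx] with y hy
    exact (integrableOn_ofReal_mul_cexp (hfc y hy) (hfb y hy) hs).aestronglyMeasurable
  · rw [ae_restrict_iff' measurableSet_Ioi]
    refine ae_of_all _ fun t ht y hy => ?_
    rw [norm_ofReal_mul_cexp, ← exp_mul_exp_neg_mul, ← mul_assoc]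
    gcongr
    exact hgb y hy t ht
  · rw [ae_restrict_iff' measurableSet_Ioi]
    exact ae_of_all _ fun t ht y hy => (hd y hy t ht).ofReal_comp.mul_const _

/-! ### The transformed system -/

lemma M_sq (a b : ℝ) (s : ℂ) : expMean (Real.log b + Complex.log s) * M a b s ^ 2 =
    expMean (Real.log a + Complex.log s) := by
  have him : ∀ r : ℝ, |((r : ℂ) + Complex.log s).im| ≤ Real.pi := fun r => by
    rw [Complex.add_im, Complex.ofReal_im, zero_add, Complex.log_im]
    exact Complex.abs_arg_le_pi s
  have hb := expMean_ne_zero (him (Real.log b))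
  have h2 : (1 / 2 : ℂ) = ((2 : ℕ) : ℂ)⁻¹ := by norm_num
  rw [M, Mlog, h2, Complex.cpow_nat_inv_pow _ two_ne_zero, logQuot_eq_inv, logQuot_eq_inv]
  field_simp

lemma mul_M_ne_zero {s : ℂ} (hs : s ≠ 0) : s * M a b s ≠ 0 := by
  rw [mul_M_eq hs]
  exact Complex.exp_ne_zero _

lemma M_ne_zero {s : ℂ} (hs : s ≠ 0) : M a b s ≠ 0 := right_ne_zero_of_mul (mul_M_ne_zero hs)

lemma abs_im_log_le {s : ℂ} (hs : 0 ≤ s.re) : |(Complex.log s).im| ≤ Real.pi / 2 := by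
  rw [Complex.log_im]
  exact Complex.abs_arg_le_pi_div_two_iff.2 hs

lemma sinh_mul_M_ne_zero (ha : 0 < a) (hab : a < b) {s : ℂ} (hs : 0 < s.re) :
    Complex.sinh (s * M a b s) ≠ 0 := by
  have h0 : s ≠ 0 := by
    rintro rfl
    simp at hs
  rw [mul_M_eq h0]
  exact sinh_expSM_ne_zero_of_abs_im_le ha hab (abs_im_log_le hs.le)

/-- Solutions of `U' = E`, `E' = z² U` which vanish at `0` and tend to `l` at `1`. -/
lemma eq_of_wave_system {U E : ℝ → ℂ} {z l : ℂ} {K : ℝ} (hz : z ≠ 0) (hsinh : Complex.sinh z ≠ 0)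
    (hU : ∀ x ∈ Ioo (0 : ℝ) 1, HasDerivAt U (E x) x)
    (hE : ∀ x ∈ Ioo (0 : ℝ) 1, HasDerivAt E (z ^ 2 * U x) x)
    (h0 : Tendsto U (𝓝[>] 0) (𝓝 0)) (hb : ∀ x ∈ Ioo (0 : ℝ) (1 / 2), ‖E x‖ ≤ K)
    (h1 : Tendsto U (𝓝[<] 1) (𝓝 l)) {x : ℝ} (hx : x ∈ Ioo (0 : ℝ) 1) :
    U x = l * (Complex.sinh (x * z) / Complex.sinh z) := by
  have hlin : ∀ x : ℝ, HasDerivAt (fun x : ℝ => (x : ℂ) * z) z x := fun x => by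
    simpa using (Complex.ofRealCLM.hasDerivAt (x := x)).mul_const z
  have hs : ∀ x : ℝ, HasDerivAt (fun x : ℝ => Complex.sinh (x * z))
      (Complex.cosh (x * z) * z) x := fun x =>
    (Complex.hasDerivAt_sinh _).comp x (hlin x)
  have hc : ∀ x : ℝ, HasDerivAt (fun x : ℝ => Complex.cosh (x * z))
      (Complex.sinh (x * z) * z) x := fun x =>
    (Complex.hasDerivAt_cosh _).comp x (hlin x)
  -- `V` and `W` are first integrals of the system: the vector `(z U, E)` transported back by the
  -- hyperbolic rotation through `x z`. The condition at `0` makes `V` vanish, where boundedness of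
  -- `E` suffices because `sinh (x z) → 0`; the condition at `1` fixes `W`.
  set V : ℝ → ℂ := fun x => z * U x * Complex.cosh (x * z) - E x * Complex.sinh (x * z) with hV
  set W : ℝ → ℂ := fun x => E x * Complex.cosh (x * z) - z * U x * Complex.sinh (x * z) with hW
  have hVd : ∀ x ∈ Ioo (0 : ℝ) 1, HasDerivAt V 0 x := fun x hx =>
    ((((hU x hx).const_mul z).mul (hc x)).sub ((hE x hx).mul (hs x))).congr_deriv (by ring)
  have hWd : ∀ x ∈ Ioo (0 : ℝ) 1, HasDerivAt W 0 x := fun x hx =>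
    (((hE x hx).mul (hc x)).sub (((hU x hx).const_mul z).mul (hs x))).congr_deriv (by ring)
  have hconst : ∀ f : ℝ → ℂ, (∀ x ∈ Ioo (0 : ℝ) 1, HasDerivAt f 0 x) →
      ∀ x ∈ Ioo (0 : ℝ) 1, f x = f (1 / 2) := fun f hf x hx =>
    isOpen_Ioo.is_const_of_deriv_eq_zero isPreconnected_Ioo
      (fun y hy => (hf y hy).differentiableAt.differentiableWithinAt)
      (fun y hy => (hf y hy).deriv) hx ⟨by norm_num, by norm_num⟩
  have hV0 : Tendsto V (𝓝[>] 0) (𝓝 0) := by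
    have hs0 : Tendsto (fun x : ℝ => Complex.sinh (x * z)) (𝓝[>] 0) (𝓝 0) := by
      have := (hs 0).continuousAt.tendsto
      simp only [Complex.ofReal_zero, zero_mul, Complex.sinh_zero] at this
      exact this.mono_left nhdsWithin_le_nhds
    have hc0 : Tendsto (fun x : ℝ => Complex.cosh (x * z)) (𝓝[>] 0) (𝓝 1) := by
      have := (hc 0).continuousAt.tendsto
      simp only [Complex.ofReal_zero, zero_mul, Complex.cosh_zero] at this
      exact this.mono_left nhdsWithin_le_nhds
    have t1 : Tendsto (fun x => z * U x * Complex.cosh (x * z)) (𝓝[>] 0) (𝓝 0) := by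
      simpa using (h0.const_mul z).mul hc0
    have t2 : Tendsto (fun x => E x * Complex.sinh (x * z)) (𝓝[>] 0) (𝓝 0) := by
      have h3 : Tendsto (fun x : ℝ => K * ‖Complex.sinh (x * z)‖) (𝓝[>] 0) (𝓝 0) := by
        simpa using hs0.norm.const_mul K
      refine squeeze_zero_norm' ?_ h3
      filter_upwards [Ioo_mem_nhdsGT (show (0 : ℝ) < 1 / 2 by norm_num)] with x hx
      rw [norm_mul]
      gcongr
      exact hb x hx
    simpa using t1.sub t2
  have hVz : V (1 / 2) = 0 := by
    refine tendsto_nhds_unique (tendsto_const_nhds.congr' ?_) hV0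
    filter_upwards [Ioo_mem_nhdsGT (zero_lt_one' ℝ)] with x hx
    exact (hconst V hVd x hx).symm
  set k := W (1 / 2) with hk
  have hUk : ∀ x ∈ Ioo (0 : ℝ) 1, U x = k / z * Complex.sinh (x * z) := by
    intro x hx
    have e1 := (hconst V hVd x hx).trans hVz
    have e2 := hconst W hWd x hx
    have e3 := Complex.cosh_sq_sub_sinh_sq (x * z)
    simp only [hV] at e1
    simp only [hW] at e2
    rw [div_mul_eq_mul_div, eq_div_iff hz, hk]
    simp only [hW]
    linear_combination Complex.cosh (x * z) * e1 + Complex.sinh (x * z) * e2 - U x * z * e3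
  have hl : k / z * Complex.sinh z = l := by
    have t1 : Tendsto (fun x : ℝ => k / z * Complex.sinh (x * z)) (𝓝[<] 1)
        (𝓝 (k / z * Complex.sinh z)) := by
      have := ((hs 1).continuousAt.tendsto.const_mul (k / z)).mono_left
        (nhdsWithin_le_nhds (s := Iio (1 : ℝ)))
      simpa using this
    refine tendsto_nhds_unique t1 (h1.congr' ?_)
    filter_upwards [Ioo_mem_nhdsLT (zero_lt_one' ℝ)] with x hx
    exact hUk x hx
  rw [hUk x hx, ← hl]
  field_simp

/-! ### Uniqueness -/

lemma contDiffOn_causalDeriv {y : ℝ → ℝ} (hy : ContDiffOn ℝ 2 y (Ici 0))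
    (h0 : HasDerivWithinAt y 0 (Ici 0) 0) : ContDiffOn ℝ 1 (causalDeriv y) (Ici 0) := by
  refine (hy.derivWithin (uniqueDiffOn_Ici 0) (m := 1) (by norm_num)).congr fun t ht => ?_
  rcases (mem_Ici.1 ht).eq_or_lt with rfl | h
  · rw [h0.derivWithin (uniqueDiffOn_Ici 0 0 self_mem_Ici)]
    simp [causalDeriv]
  · rw [causalDeriv, if_pos h, derivWithin_of_mem_nhds (Ici_mem_nhds h)]

lemma deriv_causalDeriv (y : ℝ → ℝ) {t : ℝ} (ht : 0 < t) :
    deriv (causalDeriv y) t = iteratedDeriv 2 y t := by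
  rw [iteratedDeriv_succ, iteratedDeriv_one]
  refine Filter.EventuallyEq.deriv_eq ?_
  filter_upwards [Ioi_mem_nhds ht] with r hr
  rw [causalDeriv, if_pos (mem_Ioi.1 hr)]

section

variable {Υ : ℝ → ℝ} {u σ ε : ℝ → ℝ → ℝ} {c : ℝ}

/-- The growth hypothesis concerns only the highest time derivatives; integrating from the zero
initial data transfers it to `∂ₜu` and `u`, with a factor `1/c` at each step. -/
lemma IsSolution.causalC1 (h : IsSolution a b Υ u σ ε) (hc : 0 < c)
    (hg : ∀ x₀ ∈ Ico (0 : ℝ) 1, ∃ C : ℝ, ∀ x ∈ Icc 0 x₀, ∀ t : ℝ, 0 < t →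
      |iteratedDeriv 2 (u x) t| ≤ C * Real.exp (c * t) ∧
      |deriv (σ x) t| ≤ C * Real.exp (c * t) ∧
      |deriv (ε x) t| ≤ C * Real.exp (c * t)) {x₀ : ℝ} (hx₀ : x₀ ∈ Ico (0 : ℝ) 1) :
    ∃ C : ℝ, ∀ x ∈ Icc 0 x₀, CausalC1 c (C / c) (u x) ∧ CausalC1 c C (causalDeriv (u x)) ∧
      CausalC1 c C (σ x) ∧ CausalC1 c C (ε x) := by
  obtain ⟨C, hC⟩ := hg x₀ hx₀
  refine ⟨C, fun x hx => ?_⟩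
  have hx1 : x ∈ Ico (0 : ℝ) 1 := ⟨hx.1, hx.2.trans_lt hx₀.2⟩
  have hx2 : x ∈ Icc (0 : ℝ) 1 := ⟨hx1.1, hx1.2.le⟩
  obtain ⟨i1, i2, i3, i4⟩ := h.initial x hx1
  obtain ⟨r1, r2, r3⟩ := h.regular x hx1
  have hz : ∀ t ≤ 0, u x t = 0 ∧ σ x t = 0 ∧ ε x t = 0 := by
    intro t ht
    rcases ht.eq_or_lt with rfl | ht
    · exact ⟨i1, i3, i4⟩
    · exact h.causal x hx2 t ht
  have hv : CausalC1 c C (causalDeriv (u x)) :=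
    ⟨fun t ht => by rw [causalDeriv, if_neg (not_lt.2 ht)], contDiffOn_causalDeriv r1 i2,
      fun t ht => by rw [deriv_causalDeriv _ ht]; exact (hC x hx t ht).1⟩
  refine ⟨⟨fun t ht => (hz t ht).1, r1.of_le (by norm_num), fun t ht => ?_⟩, hv,
    ⟨fun t ht => (hz t ht).2.1, r2, fun t ht => (hC x hx t ht).2.1⟩,
    ⟨fun t ht => (hz t ht).2.2, r3, fun t ht => (hC x hx t ht).2.2⟩⟩
  have := hv.abs_le hc ht.le
  rwa [causalDeriv, if_pos ht] at this

lemma laplace_heaviside (k : ℝ) {s : ℂ} (hs : 0 < s.re) :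
    laplace (fun t => k * heaviside t) s = k / s := by
  have h1 := integral_exp_mul_complex_Ioi (a := -s) (by simpa using hs) 0
  rw [laplace]
  have h2 : ∀ t ∈ Ioi (0 : ℝ), ((k * heaviside t : ℝ) : ℂ) * Complex.exp (-s * t) =
      (k : ℂ) * Complex.exp (-s * t) := fun t ht => by
    rw [heaviside, if_pos (mem_Ioi.1 ht), mul_one]
  rw [setIntegral_congr_fun measurableSet_Ioi h2, integral_const_mul, h1]
  simp [div_eq_mul_inv]

/-- The constitutive law becomes `Ê = M² σ̂`, strain and momentum become `U' = Ê` and `σ̂' = s² U`,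
so `U'' = (s M)² U`. Only the open interval and limits at its ends are used. -/
lemma IsSolution.laplace_eq {Υ₀ : ℝ} (ha : 0 < a) (hab : a < b)
    (h : IsSolution a b (fun t => Υ₀ * heaviside t) u σ ε) (hc : 0 < c)
    (hg : ∀ x₀ ∈ Ico (0 : ℝ) 1, ∃ C : ℝ, ∀ x ∈ Icc 0 x₀, ∀ t : ℝ, 0 < t →
      |iteratedDeriv 2 (u x) t| ≤ C * Real.exp (c * t) ∧
      |deriv (σ x) t| ≤ C * Real.exp (c * t) ∧
      |deriv (ε x) t| ≤ C * Real.exp (c * t))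
    (ht : Tendsto (fun x => ∫⁻ t in Ioi (0 : ℝ),
      ENNReal.ofReal (|u x t - Υ₀ * heaviside t| * Real.exp (-c * t))) (𝓝[<] 1) (𝓝 0))
    {s : ℂ} (hs : c < s.re) {x : ℝ} (hx : x ∈ Ioo (0 : ℝ) 1) :
    laplace (u x) s = Υ₀ / s * Ptilde a b x s := by
  have hs0 : 0 < s.re := hc.trans hs
  have hsne : s ≠ 0 := by
    rintro rfl
    simp at hs0
  have hE : ∀ x ∈ Ico (0 : ℝ) 1,
      laplace (ε x) s = M a b s ^ 2 * laplace (σ x) s := by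
    intro x hx
    obtain ⟨C, hC⟩ := h.causalC1 hc hg hx
    obtain ⟨-, -, hσ, hε⟩ := hC x ⟨hx.1, le_rfl⟩
    have l1 := hσ.laplace_distributed hc ha hs
    have l2 := hε.laplace_distributed hc (ha.trans hab) hs
    have heq : (∫ t in Ioi (0 : ℝ), ((∫ α in (0 : ℝ)..1, a ^ α * rlDeriv α (σ x) t : ℝ) : ℂ) *
        Complex.exp (-s * t)) = ∫ t in Ioi (0 : ℝ),
        ((∫ α in (0 : ℝ)..1, b ^ α * rlDeriv α (ε x) t : ℝ) : ℂ) * Complex.exp (-s * t) :=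
      setIntegral_congr_fun measurableSet_Ioi fun t ht => by
        simp only [h.constitutive x hx t ht]
    rw [CausalC1.integral_causalDeriv, hσ.laplace_causalDeriv hc hs] at l1
    rw [CausalC1.integral_causalDeriv, hε.laplace_causalDeriv hc hs] at l2
    rw [heq, l2, ← M_sq a b s] at l1
    have hne : expMean (Real.log b + Complex.log s) ≠ 0 := expMean_ne_zero (by
      rw [Complex.add_im, Complex.ofReal_im, zero_add, Complex.log_im]
      exact Complex.abs_arg_le_pi s)
    field_simp at l1
    exact l1
  have hUd : ∀ x ∈ Ioo (0 : ℝ) 1,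
      HasDerivAt (fun x => laplace (u x) s) (laplace (ε x) s) x ∧
      HasDerivAt (fun x => laplace (σ x) s) (s ^ 2 * laplace (u x) s) x := by
    intro x hx
    obtain ⟨x₁, hx₁, hx₁'⟩ := exists_between hx.2
    obtain ⟨C, hC⟩ := h.causalC1 hc hg (x₀ := x₁) ⟨hx.1.le.trans hx₁.le, hx₁'⟩
    have hI : ∀ y ∈ Ioo 0 x₁, y ∈ Icc 0 x₁ := fun y hy => Ioo_subset_Icc_self hy
    have hnhds : ∀ y ∈ Ioo 0 x₁, Icc (0 : ℝ) 1 ∈ 𝓝 y := fun y hy =>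
      Icc_mem_nhds hy.1 (hy.2.trans hx₁')
    have hI1 : ∀ y ∈ Ioo 0 x₁, y ∈ Icc (0 : ℝ) 1 := fun y hy =>
      ⟨hy.1.le, (hy.2.trans hx₁').le⟩
    have hC0 : 0 ≤ C := (hC x (hI x ⟨hx.1, hx₁⟩)).2.1.const_nonneg
    have hle1 : ∀ t, C / c * Real.exp (c * t) ≤ (C + C / c + C / c / c) * Real.exp (c * t) := by
      intro t
      gcongr
      have h1 : 0 ≤ C / c / c := by positivity
      linarith
    have hle2 : ∀ t, C / c / c * Real.exp (c * t) ≤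
        (C + C / c + C / c / c) * Real.exp (c * t) := by
      intro t
      gcongr
      have h1 : 0 ≤ C / c := by positivity
      linarith
    have hle3 : ∀ t, C * Real.exp (c * t) ≤ (C + C / c + C / c / c) * Real.exp (c * t) := by
      intro t
      gcongr
      have h1 : 0 ≤ C / c := by positivity
      have h2 : 0 ≤ C / c / c := by positivity
      linarith
    constructor
    · refine hasDerivAt_laplace (f := u) (g := ε) (x₁ := x₁) (γ := c)
        (K := C + C / c + C / c / c) hs
        (fun y hy => (hC y (hI y hy)).1.continuous.continuousOn)
        (fun y hy => (hC y (hI y hy)).2.2.2.continuous.continuousOn)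
        (fun y hy t ht => ((hC y (hI y hy)).1.abs_le hc ht.le).trans (hle2 t))
        (fun y hy t ht => ((hC y (hI y hy)).2.2.2.abs_le hc ht.le).trans (hle1 t))
        (fun y hy t ht => (h.strain y (hI1 y hy) t ht).hasDerivAt (hnhds y hy)) ⟨hx.1, hx₁⟩
    · have h2 := hasDerivAt_laplace (f := σ) (g := fun y => causalDeriv (causalDeriv (u y)))
        (x₁ := x₁) (γ := c) (K := C + C / c + C / c / c) hs
        (fun y hy => (hC y (hI y hy)).2.2.1.continuous.continuousOn)
        (fun y hy => (hC y (hI y hy)).2.1.continuousOn_causalDeriv)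
        (fun y hy t ht => ((hC y (hI y hy)).2.2.1.abs_le hc ht.le).trans (hle1 t))
        (fun y hy t ht => ((hC y (hI y hy)).2.1.abs_causalDeriv_le t).trans (hle3 t))
        (fun y hy t ht => by
          have h3 := (h.momentum y (hI1 y hy) t ht).hasDerivAt (hnhds y hy)
          rwa [← deriv_causalDeriv _ ht, ← show causalDeriv (causalDeriv (u y)) t =
            deriv (causalDeriv (u y)) t by rw [causalDeriv, if_pos ht]] at h3) ⟨hx.1, hx₁⟩
      obtain ⟨c1, c2, -, -⟩ := hC x (hI x ⟨hx.1, hx₁⟩)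
      rw [c2.laplace_causalDeriv hc hs, c1.laplace_causalDeriv hc hs, ← mul_assoc, ← pow_two] at h2
      exact h2
  have hzne := mul_M_ne_zero (a := a) (b := b) hsne
  obtain ⟨C, hC⟩ := h.causalC1 hc hg (x₀ := 1 / 2) ⟨by norm_num, by norm_num⟩
  -- The boundary value at `x = 0` enters the transform through the mean value inequality: `u`
  -- vanishes there and the strain is exponentially bounded uniformly in `x`, so the transform tends
  -- to `0` with `x`.
  have hub : ∀ x ∈ Ioo (0 : ℝ) (1 / 2), ∀ t, 0 < t → |u x t| ≤ C / c * x * Real.exp (c * t) := by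
    intro x hx t ht
    have h1 := (convex_Icc (0 : ℝ) (1 / 2)).norm_image_sub_le_of_norm_hasDerivWithin_le
      (f := fun y => u y t) (f' := fun y => ε y t) (C := C / c * Real.exp (c * t))
      (x := 0) (y := x)
      (fun y hy => (h.strain y ⟨hy.1, hy.2.trans (by norm_num)⟩ t ht).mono
        (Icc_subset_Icc_right (by norm_num)))
      (fun y hy => (hC y hy).2.2.2.abs_le hc ht.le) ⟨le_rfl, by norm_num⟩ ⟨hx.1.le, hx.2.le⟩
    simp only [h.boundary_left, sub_zero, Real.norm_eq_abs, abs_of_pos hx.1] at h1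
    linarith
  have h0 : Tendsto (fun x => laplace (u x) s) (𝓝[>] 0) (𝓝 0) := by
    have h1 : Tendsto (fun x : ℝ => C / c * x / (s.re - c)) (𝓝[>] 0) (𝓝 0) := by
      have : Tendsto (fun x : ℝ => C / c * x / (s.re - c)) (𝓝 0)
          (𝓝 (C / c * 0 / (s.re - c))) := (Continuous.tendsto (by fun_prop) 0)
      rw [mul_zero, zero_div] at this
      exact this.mono_left nhdsWithin_le_nhds
    refine squeeze_zero_norm' ?_ h1
    filter_upwards [Ioo_mem_nhdsGT (show (0 : ℝ) < 1 / 2 by norm_num)] with x hx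
    exact norm_laplace_le (hub x hx) hs
  -- At the driven end no uniform bound is available; the weighted `L¹` attainment of the datum
  -- dominates the difference of the transforms, because `Re s > c`.
  have h1 : Tendsto (fun x => laplace (u x) s) (𝓝[<] 1) (𝓝 (Υ₀ / s)) := by
    rw [← laplace_heaviside Υ₀ hs0, tendsto_iff_norm_sub_tendsto_zero,
      ← tendsto_zero_iff_norm_tendsto_zero, tendsto_zero_iff_enorm_tendsto_zero]
    refine tendsto_of_tendsto_of_tendsto_of_le_of_le' tendsto_const_nhds ht
      (Eventually.of_forall fun _ => zero_le) ?_
    filter_upwards [Ioo_mem_nhdsLT (zero_lt_one' ℝ)] with x hx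
    obtain ⟨C, hC⟩ := h.causalC1 hc hg (x₀ := x) ⟨hx.1.le, hx.2⟩
    have hi := (hC x ⟨hx.1.le, le_rfl⟩).1.integrableOn hc hs
    have hi2 : IntegrableOn (fun t : ℝ => ((Υ₀ * heaviside t : ℝ) : ℂ) * Complex.exp (-s * t))
        (Ioi 0) := by
      refine integrableOn_ofReal_mul_cexp (c := 0) (K := |Υ₀|) ?_ (fun t ht => ?_) hs0
      · refine continuousOn_const.congr (f := fun _ => Υ₀) fun t ht => ?_
        rw [heaviside, if_pos (mem_Ioi.1 ht), mul_one]
      · rw [heaviside, if_pos ht, mul_one, zero_mul, Real.exp_zero, mul_one]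
    rw [laplace, laplace, ← integral_sub hi hi2]
    refine (enorm_integral_le_lintegral_enorm _).trans ?_
    refine setLIntegral_mono_ae' measurableSet_Ioi (ae_of_all _ fun t ht => ?_)
    rw [← ofReal_norm]
    apply ENNReal.ofReal_le_ofReal
    rw [← sub_mul, ← Complex.ofReal_sub, norm_ofReal_mul_cexp]
    have : (0 : ℝ) < t := ht
    gcongr
    nlinarith
  rw [eq_of_wave_system hzne (sinh_mul_M_ne_zero ha hab hs0)
    (U := fun x => laplace (u x) s) (E := fun x => laplace (ε x) s) (K := C / c / (s.re - c))
    (fun x hx => (hUd x hx).1) (fun x hx => ?_) h0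
    (fun x hx => norm_laplace_le (fun t ht => (hC x ⟨hx.1.le, hx.2.le⟩).2.2.2.abs_le hc ht.le) hs)
    h1 hx, Ptilde, mul_assoc]
  have h3 := ((hUd x hx).2.const_mul (M a b s ^ 2))
  refine (h3.congr_of_eventuallyEq ?_).congr_deriv (by ring)
  filter_upwards [isOpen_Ioo.mem_nhds hx] with y hy
  exact hE y ⟨hy.1.le, hy.2⟩

end

/-- The two solutions may have different growth rates, so the transforms are compared on a line to
the right of both; there they coincide, and Fourier uniqueness applies. At the ends the boundary
data decide. -/
lemma IsSolution.unique {Υ₀ : ℝ} (ha : 0 < a) (hab : a < b) {u σ ε u' σ' ε' : ℝ → ℝ → ℝ}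
    (h : IsSolution a b (fun t => Υ₀ * heaviside t) u σ ε)
    (h' : IsSolution a b (fun t => Υ₀ * heaviside t) u' σ' ε') {x : ℝ} (hx : x ∈ Icc (0 : ℝ) 1)
    (t : ℝ) : u' x t = u x t := by
  rcases hx.1.eq_or_lt with rfl | hx0
  · rw [h.boundary_left, h'.boundary_left]
  rcases hx.2.eq_or_lt with rfl | hx1
  · rw [h.boundary_right, h'.boundary_right]
  obtain ⟨c, hc, hg, ht⟩ := h.growth
  obtain ⟨c', hc', hg', ht'⟩ := h'.growth
  set p := max c c' + 1 with hp
  have hcp : c < p := by linarith [le_max_left c c']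
  have hcp' : c' < p := by linarith [le_max_right c c']
  obtain ⟨C, hC⟩ := h.causalC1 hc hg (x₀ := x) ⟨hx0.le, hx1⟩
  obtain ⟨C', hC'⟩ := h'.causalC1 hc' hg' (x₀ := x) ⟨hx0.le, hx1⟩
  have hu := (hC x ⟨hx0.le, le_rfl⟩).1
  have hu' := (hC' x ⟨hx0.le, le_rfl⟩).1
  have hsupp : ∀ s : ℂ, Function.support (fun t : ℝ => ((u' x t : ℂ) - u x t) *
      Complex.exp (-s * t)) ⊆ Ioi 0 := by
    intro s t ht
    by_contra hn
    exact ht (by simp [hu.zero t (not_lt.1 hn), hu'.zero t (not_lt.1 hn)])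
  have hint : ∀ s : ℂ, s.re = p → IntegrableOn (fun t : ℝ => ((u' x t : ℂ) - u x t) *
      Complex.exp (-s * t)) (Ioi 0) := by
    intro s hs
    simp_rw [sub_mul]
    exact (hu'.integrableOn hc' (by rwa [hs])).sub (hu.integrableOn hc (by rwa [hs]))
  have h0 := eq_zero_of_laplace_eq_zero (f := fun t => (u' x t : ℂ) - u x t)
    ((Complex.continuous_ofReal.comp hu'.continuous).sub
      (Complex.continuous_ofReal.comp hu.continuous)) p
    ((integrableOn_iff_integrable_of_support_subset (hsupp p)).1 (hint p (Complex.ofReal_re p)))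
    (fun ν => ?_) t
  · exact_mod_cast sub_eq_zero.1 h0
  · set s : ℂ := (p : ℂ) + ν * Complex.I with hs
    have hsr : s.re = p := line_re p ν
    rw [← setIntegral_eq_integral_of_forall_compl_eq_zero (s := Ioi (0 : ℝ)) (fun t ht => by
      by_contra hn
      exact ht (hsupp s hn))]
    simp_rw [sub_mul]
    rw [integral_sub (hu'.integrableOn hc' (by rwa [hsr])) (hu.integrableOn hc (by rwa [hsr]))]
    have e1 := h.laplace_eq ha hab hc hg ht (s := s) (by rwa [hsr]) ⟨hx0, hx1⟩
    have e2 := h'.laplace_eq ha hab hc' hg' ht' (s := s) (by rwa [hsr]) ⟨hx0, hx1⟩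
    rw [laplace] at e1 e2
    rw [e1, e2, sub_self]

/-! ### The impulse response and the unit step response inside the rod -/

/-- `cosh (x s M) / sinh (s M)`. -/
def coshTilde (a b x : ℝ) (s : ℂ) : ℂ := coshRatio x (s * M a b s)

/-- The transform of the displacement for a unit step. -/
def dispHat (a b x : ℝ) (s : ℂ) : ℂ := s⁻¹ * Ptilde a b x s

/-- The transform of the strain for a unit step. -/
def strainHat (a b x : ℝ) (s : ℂ) : ℂ := M a b s * coshTilde a b x s

/-- The transform of the stress for a unit step. -/
def stressHat (a b x : ℝ) (s : ℂ) : ℂ := (M a b s)⁻¹ * coshTilde a b x s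

lemma ne_zero_of_re_pos {s : ℂ} (hs : 0 < s.re) : s ≠ 0 := by
  rintro rfl
  simp at hs

lemma differentiableAt_mul_M {s : ℂ} (hs : 0 < s.re) :
    DifferentiableAt ℂ (fun s => s * M a b s) s :=
  (analyticAt_mul_M a b (Or.inl hs)).differentiableAt

lemma differentiableAt_M {s : ℂ} (hs : 0 < s.re) : DifferentiableAt ℂ (M a b) s := by
  have h0 := ne_zero_of_re_pos hs
  refine ((differentiableAt_mul_M (a := a) (b := b) hs).div differentiableAt_id h0).congr_of_eventuallyEq ?_
  filter_upwards [isOpen_ne.mem_nhds h0] with z hz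
  exact (mul_div_cancel_left₀ _ hz).symm

lemma norm_M_le (ha : 0 < a) (hab : a < b) {s : ℂ} (hs : 0 < s.re) :
    ‖M a b s‖ ≤ b / a ∧ ‖(M a b s)⁻¹‖ ≤ b / a := by
  have hb := ha.trans hab
  have h0 := ne_zero_of_re_pos hs
  have hn := norm_pos_iff.2 h0
  have h1 := norm_exp_logSM_mem ha hab (w := Complex.log s) (by
    rw [Complex.log_im]; exact Complex.abs_arg_le_pi s)
  have h2 : Complex.exp (logSM a b (Complex.log s)) = s * M a b s := (mul_M_eq h0).symm
  rw [h2, norm_mul, Complex.log_re, Real.exp_log hn] at h1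
  have h3 := (mem_Icc.1 h1)
  constructor
  · by_contra hc
    nlinarith [not_le.1 hc]
  · rw [norm_inv, ← inv_div]
    apply inv_anti₀ (by positivity)
    by_contra hc
    nlinarith [not_le.1 hc]

lemma differentiableAt_Ptilde (ha : 0 < a) (hab : a < b) (x : ℝ) {s : ℂ} (hs : 0 < s.re) :
    DifferentiableAt ℂ (Ptilde a b x) s := by
  have h1 : DifferentiableAt ℂ (fun s => Complex.sinh (x * (s * M a b s)) /
      Complex.sinh (s * M a b s)) s :=
    ((differentiableAt_mul_M hs).const_mul (x : ℂ)).csinh.div (differentiableAt_mul_M hs).csinh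
      (sinh_mul_M_ne_zero ha hab hs)
  refine h1.congr_of_eventuallyEq (Eventually.of_forall fun z => ?_)
  rw [Ptilde, mul_assoc]

lemma differentiableAt_coshTilde (ha : 0 < a) (hab : a < b) (x : ℝ) {s : ℂ} (hs : 0 < s.re) :
    DifferentiableAt ℂ (coshTilde a b x) s :=
  ((differentiableAt_mul_M hs).const_mul (x : ℂ)).ccosh.div (differentiableAt_mul_M hs).csinh
      (sinh_mul_M_ne_zero ha hab hs)

lemma exists_norm_coshTilde_le (ha : 0 < a) (hab : a < b) : ∃ c C : ℝ, 0 < c ∧ 1 ≤ C ∧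
    ∀ x : ℝ, |x| ≤ 1 → ∀ s : ℂ, 1 < s.re →
      ‖coshTilde a b x s‖ ≤ C * Real.exp (-((1 - |x|) * c * ‖s‖ ^ (3 / 4 : ℝ))) := by
  obtain ⟨c, C, hc, hC, -, h⟩ := exists_norm_sinhRatio_right_le ha hab
  refine ⟨c, C, hc, hC, fun x hx s hre => ?_⟩
  have hs := ne_zero_of_re_pos (one_pos.trans hre)
  have h1 : 1 ≤ ‖s‖ := hre.le.trans (Complex.re_le_norm s)
  rw [coshTilde, mul_M_eq hs]
  refine (h (Complex.log s) (abs_im_log_le (one_pos.trans hre).le)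
    (by rw [Complex.log_re]; exact Real.log_nonneg h1) x hx).trans_eq ?_
  rw [Complex.log_re, Real.rpow_def_of_pos (norm_pos_iff.2 hs), mul_assoc (1 - |x|),
    mul_comm (3 / 4 : ℝ)]

lemma rootDecay_Ptilde (ha : 0 < a) (hab : a < b) {x : ℝ} (hx : |x| < 1) :
    RootDecay 0 (Ptilde a b x) := by
  obtain ⟨c, C, hc, hC, h⟩ := exists_norm_Ptilde_le ha hab
  exact ⟨fun s hs => differentiableAt_Ptilde ha hab x hs, (1 - |x|) * c, C,
    mul_pos (sub_pos.2 hx) hc, by linarith, fun s hs => h x hx.le s hs.le⟩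

lemma RootDecay.mono {d d' : ℝ} {F : ℂ → ℂ} (hF : RootDecay d F) (h : d ≤ d') :
    RootDecay d' F := by
  obtain ⟨κ, C, hκ, hC, hb⟩ := hF.bound
  exact ⟨fun s hs => hF.diff s (h.trans_lt hs), κ, C, hκ, hC, fun s hs => hb s (h.trans_lt hs)⟩

/-- The abscissa is `1` rather than `0` because the estimate of `cosh (x z) / sinh z` requires `s`
away from `0`. All unit-step quantities are then defined on the line `Re s = 2`. -/
lemma rootDecay_coshTilde (ha : 0 < a) (hab : a < b) {x : ℝ} (hx : |x| < 1) :
    RootDecay 1 (coshTilde a b x) := by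
  obtain ⟨c, C, hc, hC, h⟩ := exists_norm_coshTilde_le ha hab
  exact ⟨fun s hs => differentiableAt_coshTilde ha hab x (one_pos.trans hs), (1 - |x|) * c, C,
    mul_pos (sub_pos.2 hx) hc, by linarith, fun s hs => h x hx.le s hs⟩

lemma one_lt_norm_of_re {s : ℂ} (hs : 1 < s.re) : 1 < ‖s‖ := hs.trans_le (Complex.re_le_norm s)

lemma rootDecay_dispHat (ha : 0 < a) (hab : a < b) {x : ℝ} (hx : |x| < 1) :
    RootDecay 1 (dispHat a b x) :=
  ((rootDecay_Ptilde ha hab hx).mono zero_le_one).mul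
    (fun _ hs => differentiableAt_inv (ne_zero_of_re_pos (one_pos.trans hs))) (K := 1)
    (fun s hs => by
      rw [norm_inv, one_mul]
      have := inv_le_one_of_one_le₀ (one_lt_norm_of_re hs).le
      linarith [norm_nonneg s])

lemma rootDecay_strainHat (ha : 0 < a) (hab : a < b) {x : ℝ} (hx : |x| < 1) :
    RootDecay 1 (strainHat a b x) :=
  (rootDecay_coshTilde ha hab hx).mul (fun _ hs => differentiableAt_M (one_pos.trans hs))
    (K := b / a) (fun s hs => (norm_M_le ha hab (one_pos.trans hs)).1.trans (by
      have : 0 < b / a := div_pos (ha.trans hab) ha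
      nlinarith [norm_nonneg s]))

lemma rootDecay_stressHat (ha : 0 < a) (hab : a < b) {x : ℝ} (hx : |x| < 1) :
    RootDecay 1 (stressHat a b x) :=
  (rootDecay_coshTilde ha hab hx).mul (fun s hs => (differentiableAt_M (one_pos.trans hs)).inv
    (M_ne_zero (ne_zero_of_re_pos (one_pos.trans hs))))
    (K := b / a) (fun s hs => (norm_M_le ha hab (one_pos.trans hs)).2.trans (by
      have : 0 < b / a := div_pos (ha.trans hab) ha
      nlinarith [norm_nonneg s]))

/-- The displacement for a unit step, for `|x| < 1`. -/
def unitDisp (a b x t : ℝ) : ℝ := (bromwich 2 (dispHat a b x) t).re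

/-- The strain for a unit step, for `|x| < 1`. -/
def unitStrain (a b x t : ℝ) : ℝ := (bromwich 2 (strainHat a b x) t).re

/-- The stress for a unit step, for `|x| < 1`. -/
def unitStress (a b x t : ℝ) : ℝ := (bromwich 2 (stressHat a b x) t).re

/-- The displacement for a unit impulse, for `|x| < 1`. -/
def impulse (a b x t : ℝ) : ℝ := (bromwich 2 (Ptilde a b x) t).re

/-- The time derivative of `impulse`. -/
def impulseDeriv (a b x t : ℝ) : ℝ := (bromwich 2 (fun s => s * Ptilde a b x s) t).re

lemma hasDerivAt_impulse (ha : 0 < a) (hab : a < b) {x : ℝ} (hx : |x| < 1) (t : ℝ) :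
    HasDerivAt (impulse a b x) (impulseDeriv a b x t) t :=
  (rootDecay_Ptilde ha hab hx).hasDerivAt_re_bromwich two_pos t

lemma contDiff_impulse (ha : 0 < a) (hab : a < b) {x : ℝ} (hx : |x| < 1) :
    ContDiff ℝ ∞ (impulse a b x) :=
  (rootDecay_Ptilde ha hab hx).contDiff_re_bromwich two_pos

lemma impulse_eq_zero (ha : 0 < a) (hab : a < b) {x : ℝ} (hx : |x| < 1) {t : ℝ} (ht : t ≤ 0) :
    impulse a b x t = 0 := by
  rw [impulse, (rootDecay_Ptilde ha hab hx).bromwich_eq_zero le_rfl two_pos ht, Complex.zero_re]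

lemma bromwich_congr_line {c : ℝ} {F G : ℂ → ℂ} (h : ∀ s : ℂ, s.re = c → F s = G s) (t : ℝ) :
    bromwich c F t = bromwich c G t := by
  unfold bromwich
  congr 2
  funext ν
  rw [h _ (line_re c ν)]

lemma hasDerivAt_unitDisp (ha : 0 < a) (hab : a < b) {x : ℝ} (hx : |x| < 1) (t : ℝ) :
    HasDerivAt (unitDisp a b x) (impulse a b x t) t := by
  refine ((rootDecay_dispHat ha hab hx).hasDerivAt_re_bromwich one_lt_two t).congr_deriv ?_
  rw [impulse]
  congr 1
  refine bromwich_congr_line (fun s hs => ?_) t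
  have : s ≠ 0 := ne_zero_of_re_pos (by rw [hs]; exact two_pos)
  rw [dispHat, mul_inv_cancel_left₀ this]

lemma contDiff_unitDisp (ha : 0 < a) (hab : a < b) {x : ℝ} (hx : |x| < 1) :
    ContDiff ℝ ∞ (unitDisp a b x) :=
  (rootDecay_dispHat ha hab hx).contDiff_re_bromwich one_lt_two

lemma contDiff_unitStress (ha : 0 < a) (hab : a < b) {x : ℝ} (hx : |x| < 1) :
    ContDiff ℝ ∞ (unitStress a b x) :=
  (rootDecay_stressHat ha hab hx).contDiff_re_bromwich one_lt_two

lemma contDiff_unitStrain (ha : 0 < a) (hab : a < b) {x : ℝ} (hx : |x| < 1) :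
    ContDiff ℝ ∞ (unitStrain a b x) :=
  (rootDecay_strainHat ha hab hx).contDiff_re_bromwich one_lt_two

lemma unit_eq_zero (ha : 0 < a) (hab : a < b) {x : ℝ} (hx : |x| < 1) {t : ℝ} (ht : t ≤ 0) :
    unitDisp a b x t = 0 ∧ unitStress a b x t = 0 ∧ unitStrain a b x t = 0 := by
  refine ⟨?_, ?_, ?_⟩
  · rw [unitDisp, (rootDecay_dispHat ha hab hx).bromwich_eq_zero zero_le_one one_lt_two ht,
      Complex.zero_re]
  · rw [unitStress, (rootDecay_stressHat ha hab hx).bromwich_eq_zero zero_le_one one_lt_two ht,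
      Complex.zero_re]
  · rw [unitStrain, (rootDecay_strainHat ha hab hx).bromwich_eq_zero zero_le_one one_lt_two ht,
      Complex.zero_re]

lemma iteratedDeriv_two_unitDisp (ha : 0 < a) (hab : a < b) {x : ℝ} (hx : |x| < 1) (t : ℝ) :
    iteratedDeriv 2 (unitDisp a b x) t = impulseDeriv a b x t := by
  rw [iteratedDeriv_succ, iteratedDeriv_one,
    show deriv (unitDisp a b x) = impulse a b x from
      funext fun t => (hasDerivAt_unitDisp ha hab hx t).deriv]
  exact (hasDerivAt_impulse ha hab hx t).deriv

lemma unitDisp_zero (a b t : ℝ) : unitDisp a b 0 t = 0 := by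
  have : dispHat a b 0 = fun _ => 0 := by
    funext s
    simp [dispHat, Ptilde]
  rw [unitDisp, this]
  simp [bromwich]

/-- Both sides are Bromwich integrals of the same function: multiplying the symbol at `b` by `M`
equals multiplying the symbol at `a` by `1/M`, which is the definition of `M²`. -/
lemma unit_constitutive (ha : 0 < a) (hab : a < b) {x : ℝ} (hx : |x| < 1) {t : ℝ} (ht : 0 < t) :
    ∫ α in (0 : ℝ)..1, a ^ α * rlDeriv α (unitStress a b x) t =
      ∫ α in (0 : ℝ)..1, b ^ α * rlDeriv α (unitStrain a b x) t := by
  have h1 := (rootDecay_stressHat ha hab hx).distributed_bromwich zero_le_one one_lt_two ha ht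
  have h2 := (rootDecay_strainHat ha hab hx).distributed_bromwich zero_le_one one_lt_two
    (ha.trans hab) ht
  refine h1.trans (Eq.trans ?_ h2.symm)
  congr 1
  refine bromwich_congr_line (fun s hs => ?_) t
  have hM := M_ne_zero (a := a) (b := b)
    (ne_zero_of_re_pos (s := s) (by rw [hs]; exact two_pos))
  rw [stressHat, strainHat, ← M_sq a b s]
  field_simp

/-! ### Uniform bounds and dependence on the position -/

lemma exists_uniform_bound (ha : 0 < a) (hab : a < b) {x₁ : ℝ} (hx₁ : x₁ < 1) :
    ∃ κ C : ℝ, 0 < κ ∧ 0 ≤ C ∧ ∀ x : ℝ, |x| ≤ x₁ → ∀ s : ℂ, 1 < s.re →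
      (1 + ‖s‖) * ‖Ptilde a b x s‖ ≤ C * Real.exp (-(κ * ‖s‖ ^ (3 / 4 : ℝ))) ∧
      (1 + ‖s‖) * ‖strainHat a b x s‖ ≤ C * Real.exp (-(κ * ‖s‖ ^ (3 / 4 : ℝ))) ∧
      (1 + ‖s‖) * ‖stressHat a b x s‖ ≤ C * Real.exp (-(κ * ‖s‖ ^ (3 / 4 : ℝ))) := by
  obtain ⟨c, C, hc, hC, h⟩ := exists_norm_Ptilde_le ha hab
  obtain ⟨c', C', hc', hC', h'⟩ := exists_norm_coshTilde_le ha hab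
  have hba : 0 < b / a := div_pos (ha.trans hab) ha
  set κ := (1 - x₁) * min c c' with hκdef
  have hκ : 0 < κ := mul_pos (sub_pos.2 hx₁) (lt_min hc hc')
  have hexp : ∀ e : ℝ, min c c' ≤ e → ∀ x : ℝ, |x| ≤ x₁ → ∀ s : ℂ,
      Real.exp (-((1 - |x|) * e * ‖s‖ ^ (3 / 4 : ℝ))) ≤
        Real.exp (-(κ * ‖s‖ ^ (3 / 4 : ℝ))) := by
    intro e he x hx s
    rw [hκdef]
    have h1 : 0 ≤ 1 - x₁ := by linarith
    have h2 : 0 ≤ min c c' := (lt_min hc hc').le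
    have h3 : 0 ≤ 1 - |x| := by linarith
    gcongr
  refine ⟨κ / 2, (C + b / a * C') * (2 + 8 / κ ^ 2), by positivity, by positivity,
    fun x hx s hs => ?_⟩
  have hx1 : |x| ≤ 1 := hx.trans hx₁.le
  have hs0 := one_pos.trans hs
  have key : ∀ v K : ℝ, 0 ≤ K → v ≤ K * Real.exp (-(κ * ‖s‖ ^ (3 / 4 : ℝ))) →
      K ≤ C + b / a * C' → (1 + ‖s‖) * v ≤ (C + b / a * C') * (2 + 8 / κ ^ 2) *
        Real.exp (-(κ / 2 * ‖s‖ ^ (3 / 4 : ℝ))) := by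
    intro v K hK hv hKC
    calc (1 + ‖s‖) * v ≤ (1 + ‖s‖) * (K * Real.exp (-(κ * ‖s‖ ^ (3 / 4 : ℝ)))) := by gcongr
      _ = K * ((1 + ‖s‖) * Real.exp (-(κ * ‖s‖ ^ (3 / 4 : ℝ)))) := by ring
      _ ≤ (C + b / a * C') * ((2 + 8 / κ ^ 2) * Real.exp (-(κ / 2 * ‖s‖ ^ (3 / 4 : ℝ)))) := by
        have := one_add_mul_exp_neg_le hκ (norm_nonneg s)
        have h0 : 0 ≤ C + b / a * C' := by positivity
        exact mul_le_mul hKC this (by positivity) h0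
      _ = _ := by ring
  have hcosh := (h' x hx1 s hs).trans (mul_le_mul_of_nonneg_left
    (hexp c' (min_le_right _ _) x hx s) (by linarith : (0 : ℝ) ≤ C'))
  obtain ⟨m1, m2⟩ := norm_M_le ha hab hs0
  refine ⟨key _ C (by linarith) ((h x hx1 s hs0.le).trans (mul_le_mul_of_nonneg_left
    (hexp c (min_le_left _ _) x hx s) (by linarith))) ?_,
    key _ (b / a * C') (by positivity) ?_ (by linarith),
    key _ (b / a * C') (by positivity) ?_ (by linarith)⟩
  · have : 0 ≤ b / a * C' := by positivity
    linarith
  · rw [strainHat, norm_mul, mul_assoc]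
    gcongr
  · rw [stressHat, norm_mul, mul_assoc]
    gcongr

lemma hasDerivAt_bromwich_param {F G : ℝ → ℂ → ℂ} {d c x₁ κ C : ℝ} (hc : d < c)
    (hF : ∀ x, |x| < x₁ → RootDecay d (F x)) (hG : ∀ x, |x| < x₁ → RootDecay d (G x)) (hκ : 0 < κ)
    (hC : 0 ≤ C) (hb : ∀ x, |x| < x₁ → ∀ s : ℂ, d < s.re →
      ‖G x s‖ ≤ C * Real.exp (-(κ * ‖s‖ ^ (3 / 4 : ℝ))))
    (hFG : ∀ x s, d < s.re → HasDerivAt (fun x => F x s) (G x s) x) {x : ℝ} (hx : |x| < x₁)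
    (t : ℝ) : HasDerivAt (fun x => (bromwich c (F x) t).re) (bromwich c (G x) t).re x := by
  have hS : {y : ℝ | |y| < x₁} ∈ 𝓝 x := (isOpen_lt continuous_abs continuous_const).mem_nhds hx
  have h := (hasDerivAt_integral_of_dominated_loc_of_deriv_le (μ := volume)
    (F := fun (x ν : ℝ) => F x (c + ν * Complex.I) * Complex.exp ((c + ν * Complex.I) * t))
    (F' := fun (x ν : ℝ) => G x (c + ν * Complex.I) * Complex.exp ((c + ν * Complex.I) * t))
    (x₀ := x) (s := {y : ℝ | |y| < x₁}) (bound := fun ν : ℝ => C * expRoot κ ν * Real.exp (c * t))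
    hS ?_ ((hF x hx).integrable_mul_exp hc t)
    ((hG x hx).integrable_mul_exp hc t).aestronglyMeasurable (ae_of_all _ fun ν y hy => ?_)
    (((integrable_expRoot hκ).const_mul C).mul_const _) (ae_of_all _ fun ν y _ => ?_)).2
  · exact Complex.reCLM.hasFDerivAt.comp_hasDerivAt x (h.const_mul (1 / (2 * Real.pi) : ℂ))
  · filter_upwards [hS] with y hy
    exact ((hF y hy).integrable_mul_exp hc t).aestronglyMeasurable
  · rw [norm_mul, norm_exp_line]
    gcongr
    refine (hb y hy _ (by rwa [line_re])).trans ?_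
    gcongr
    exact exp_neg_norm_rpow_le hκ.le c ν
  · exact (hFG y _ (by rwa [line_re])).mul_const _

lemma hasDerivAt_ofReal_mul (z : ℂ) (x : ℝ) : HasDerivAt (fun x : ℝ => (x : ℂ) * z) z x := by
  simpa using (Complex.ofRealCLM.hasDerivAt (x := x)).mul_const z

lemma hasDerivAt_sinhRatio (z : ℂ) (x : ℝ) :
    HasDerivAt (fun x : ℝ => sinhRatio x z) (z * coshRatio x z) x :=
  (((Complex.hasDerivAt_sinh _).comp x (hasDerivAt_ofReal_mul z x)).div_const _).congr_deriv
    (by rw [coshRatio]; ring)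

lemma hasDerivAt_coshRatio (z : ℂ) (x : ℝ) :
    HasDerivAt (fun x : ℝ => coshRatio x z) (z * sinhRatio x z) x :=
  (((Complex.hasDerivAt_cosh _).comp x (hasDerivAt_ofReal_mul z x)).div_const _).congr_deriv
    (by rw [sinhRatio]; ring)

lemma Ptilde_eq_sinhRatio (a b x : ℝ) (s : ℂ) : Ptilde a b x s = sinhRatio x (s * M a b s) := by
  rw [Ptilde, sinhRatio, mul_assoc]

/-- Differentiation under the Bromwich integral, with a bound uniform on `|y| ≤ x₁ < 1`. Allowing
negative positions makes `x = 0` an interior point, so no one-sided derivative is needed there. -/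
lemma hasDerivAt_unitDisp_left (ha : 0 < a) (hab : a < b) {x : ℝ} (hx : |x| < 1) (t : ℝ) :
    HasDerivAt (fun x => unitDisp a b x t) (unitStrain a b x t) x := by
  obtain ⟨x₁, h1, h2⟩ := exists_between hx
  obtain ⟨κ, C, hκ, hC, h⟩ := exists_uniform_bound ha hab h2
  refine hasDerivAt_bromwich_param one_lt_two
    (fun y hy => rootDecay_dispHat ha hab (hy.trans h2))
    (fun y hy => rootDecay_strainHat ha hab (hy.trans h2)) hκ hC (fun y hy s hs => ?_)
    (fun y s hs => ?_) h1 t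
  · refine le_trans ?_ (h y hy.le s hs).2.1
    nlinarith [norm_nonneg s, norm_nonneg (strainHat a b y s)]
  · simp only [dispHat, Ptilde_eq_sinhRatio]
    refine ((hasDerivAt_sinhRatio _ y).const_mul s⁻¹).congr_deriv ?_
    rw [strainHat, coshTilde, mul_assoc, inv_mul_cancel_left₀
      (ne_zero_of_re_pos (one_pos.trans hs))]

lemma hasDerivAt_unitStress_left (ha : 0 < a) (hab : a < b) {x : ℝ} (hx : |x| < 1) (t : ℝ) :
    HasDerivAt (fun x => unitStress a b x t) (impulseDeriv a b x t) x := by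
  obtain ⟨x₁, h1, h2⟩ := exists_between hx
  obtain ⟨κ, C, hκ, hC, h⟩ := exists_uniform_bound ha hab h2
  refine hasDerivAt_bromwich_param one_lt_two
    (fun y hy => rootDecay_stressHat ha hab (hy.trans h2))
    (fun y hy => ((rootDecay_Ptilde ha hab (hy.trans h2)).mono zero_le_one).id_mul) hκ hC
    (fun y hy s hs => ?_) (fun y s hs => ?_) h1 t
  · refine le_trans ?_ (h y hy.le s hs).1
    rw [norm_mul]
    nlinarith [norm_nonneg s, norm_nonneg (Ptilde a b y s)]
  · simp only [Ptilde_eq_sinhRatio]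
    refine ((hasDerivAt_coshRatio _ y).const_mul (M a b s)⁻¹).congr_deriv ?_
    have := M_ne_zero (a := a) (b := b) (ne_zero_of_re_pos (one_pos.trans hs))
    field_simp

lemma norm_bromwich_le_of_bound {F : ℂ → ℂ} {d c κ C : ℝ} (hF : RootDecay d F) (hc : d < c)
    (hκ : 0 < κ) (hC : 0 ≤ C) (hb : ∀ s : ℂ, d < s.re →
      ‖F s‖ ≤ C * Real.exp (-(κ * ‖s‖ ^ (3 / 4 : ℝ)))) (t : ℝ) :
    ‖bromwich c F t‖ ≤ 1 / (2 * Real.pi) * (C * ∫ ν, expRoot κ ν) * Real.exp (c * t) := by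
  refine (norm_bromwich_le c F t).trans ?_
  have hpi := Real.pi_pos
  gcongr
  rw [← integral_const_mul]
  refine integral_mono (hF.integrable hc).norm ((integrable_expRoot hκ).const_mul C) fun ν => ?_
  refine (hb _ (by rwa [line_re])).trans ?_
  gcongr
  exact exp_neg_norm_rpow_le hκ.le c ν

lemma exists_unit_growth (ha : 0 < a) (hab : a < b) {x₁ : ℝ} (hx₁ : x₁ < 1) :
    ∃ K : ℝ, 0 ≤ K ∧ ∀ x : ℝ, |x| ≤ x₁ → ∀ t : ℝ,
      |impulseDeriv a b x t| ≤ K * Real.exp (2 * t) ∧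
      |deriv (unitStress a b x) t| ≤ K * Real.exp (2 * t) ∧
      |deriv (unitStrain a b x) t| ≤ K * Real.exp (2 * t) := by
  obtain ⟨κ, C, hκ, hC, h⟩ := exists_uniform_bound ha hab hx₁
  refine ⟨1 / (2 * Real.pi) * (C * ∫ ν, expRoot κ ν), ?_, fun x hx t => ?_⟩
  · have : 0 ≤ ∫ ν, expRoot κ ν := integral_nonneg fun ν => (expRoot_pos κ ν).le
    have := Real.pi_pos
    positivity
  have hx1 : |x| < 1 := hx.trans_lt hx₁
  have key : ∀ F : ℂ → ℂ, RootDecay 1 F → (∀ s : ℂ, 1 < s.re →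
      (1 + ‖s‖) * ‖F s‖ ≤ C * Real.exp (-(κ * ‖s‖ ^ (3 / 4 : ℝ)))) →
      |(bromwich 2 (fun s => s * F s) t).re| ≤
        1 / (2 * Real.pi) * (C * ∫ ν, expRoot κ ν) * Real.exp (2 * t) := by
    intro F hF hb
    refine (Complex.abs_re_le_norm _).trans
      (norm_bromwich_le_of_bound hF.id_mul one_lt_two hκ hC (fun s hs => ?_) t)
    refine le_trans ?_ (hb s hs)
    rw [norm_mul]
    nlinarith [norm_nonneg s, norm_nonneg (F s)]
  refine ⟨key _ ((rootDecay_Ptilde ha hab hx1).mono zero_le_one) fun s hs => (h x hx s hs).1,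
    ?_, ?_⟩
  · have := ((rootDecay_stressHat ha hab hx1).hasDerivAt_re_bromwich one_lt_two t).deriv
    rw [show unitStress a b x = fun t => (bromwich 2 (stressHat a b x) t).re from rfl, this]
    exact key _ (rootDecay_stressHat ha hab hx1) fun s hs => (h x hx s hs).2.2
  · have := ((rootDecay_strainHat ha hab hx1).hasDerivAt_re_bromwich one_lt_two t).deriv
    rw [show unitStrain a b x = fun t => (bromwich 2 (strainHat a b x) t).re from rfl, this]
    exact key _ (rootDecay_strainHat ha hab hx1) fun s hs => (h x hx s hs).2.1

/-! ### The Laplace transform of the impulse response -/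

lemma Ptilde_conj (a b x : ℝ) {s : ℂ} (hs : s ∈ Complex.slitPlane) :
    Ptilde a b x ((starRingEnd ℂ) s) = (starRingEnd ℂ) (Ptilde a b x s) := by
  rw [Ptilde_eq_sinhRatio, Ptilde_eq_sinhRatio, M_conj hs, sinhRatio_conj]

lemma ofReal_impulse (x t : ℝ) : (impulse a b x t : ℂ) = bromwich 2 (Ptilde a b x) t :=
  Complex.conj_eq_iff_re.1 (bromwich_conj (d := 0) (fun _ hs => Ptilde_conj a b x (Or.inl hs))
    two_pos t)

lemma laplace_impulse (ha : 0 < a) (hab : a < b) {x : ℝ} (hx : |x| < 1) {s : ℂ} (hs : 0 < s.re) :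
    IntegrableOn (fun t : ℝ => (impulse a b x t : ℂ) * Complex.exp (-s * t)) (Ioi 0) ∧
      ∫ t in Ioi (0 : ℝ), (impulse a b x t : ℂ) * Complex.exp (-s * t) = Ptilde a b x s := by
  simp_rw [ofReal_impulse]
  have h := rootDecay_Ptilde ha hab hx
  exact ⟨(h.integrable_bromwich_mul_exp le_rfl two_pos hs).integrableOn,
    h.laplace_bromwich le_rfl two_pos hs⟩

lemma unitDisp_eq_integral (ha : 0 < a) (hab : a < b) {x : ℝ} (hx : |x| < 1) (t : ℝ) :
    unitDisp a b x t = ∫ τ in (0 : ℝ)..t, impulse a b x τ := by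
  rw [intervalIntegral.integral_eq_sub_of_hasDerivAt
    (fun τ _ => hasDerivAt_unitDisp ha hab hx τ)
    ((contDiff_impulse ha hab hx).continuous.intervalIntegrable _ _),
    (unit_eq_zero ha hab hx le_rfl).1, sub_zero]

/-! ### The explicit form of the impulse response -/

/-- The decay bound for `P̃` holds in the closed right half plane, so the line may be moved to `Re s
= 0` by dominated convergence. Reflection symmetry then makes the lower half of the axis the
conjugate of the upper half. -/
lemma impulse_eq_axis (ha : 0 < a) (hab : a < b) {x : ℝ} (hx : x ∈ Ico (0 : ℝ) 1) (t : ℝ) :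
    impulse a b x t = 1 / Real.pi * (∫ q in Ioi (0 : ℝ), Ptilde a b x (q * Complex.I) *
      Complex.exp (q * Complex.I * t)).re := by
  have hxa : |x| < 1 := by rw [abs_of_nonneg hx.1]; exact hx.2
  have hF := rootDecay_Ptilde ha hab hxa
  obtain ⟨c, C, hc, hC, h⟩ := exists_norm_Ptilde_le ha hab
  set κ := (1 - |x|) * c with hκdef
  have hκ : 0 < κ := mul_pos (sub_pos.2 hxa) hc
  have hbd : ∀ e : ℝ, 0 ≤ e → ∀ ν : ℝ, ‖Ptilde a b x (e + ν * Complex.I)‖ ≤ C * expRoot κ ν :=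
    fun e he ν => (h x hxa.le _ (by rwa [line_re])).trans (by
      gcongr
      exact exp_neg_norm_rpow_le hκ.le e ν)
  have hlim : Tendsto (fun e : ℝ => ∫ ν : ℝ, Ptilde a b x (e + ν * Complex.I) *
      Complex.exp ((e + ν * Complex.I) * t)) (𝓝[>] 0)
      (𝓝 (∫ ν : ℝ, Ptilde a b x (ν * Complex.I) * Complex.exp (ν * Complex.I * t))) := by
    refine tendsto_integral_filter_of_dominated_convergence
      (fun ν => C * expRoot κ ν * Real.exp |t|) ?_ ?_
      (((integrable_expRoot hκ).const_mul C).mul_const _) ?_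
    · filter_upwards [self_mem_nhdsWithin] with e he
      exact (hF.integrable_mul_exp he t).aestronglyMeasurable
    · filter_upwards [Ioo_mem_nhdsGT (zero_lt_one' ℝ)] with e he
      refine ae_of_all _ fun ν => ?_
      rw [norm_mul, norm_exp_line]
      have h1 := hbd e he.1.le ν
      have h2 : e * t ≤ |t| := by
        nlinarith [le_abs_self t, abs_nonneg t, he.1, he.2]
      have := expRoot_pos κ ν
      gcongr
    -- Pointwise continuity up to the axis is used only off `s = 0`, where the quotient defining
    -- `P̃` degenerates.
    · have hne : ∀ᵐ ν : ℝ, ν ≠ 0 := by simp [ae_iff]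
      filter_upwards [hne] with ν hν
      have h1 : ContinuousAt (fun s => Ptilde a b x s * Complex.exp (s * t)) (ν * Complex.I) :=
        (continuousOn_Ptilde_slitPlane ha hab x
          (mul_ne_zero (by exact_mod_cast hν) Complex.I_ne_zero) (by simp)).mul (by fun_prop)
      have h2 : Tendsto (fun e : ℝ => (e : ℂ) + ν * Complex.I) (𝓝[>] 0) (𝓝 (ν * Complex.I)) := by
        have : Continuous fun e : ℝ => (e : ℂ) + ν * Complex.I := by fun_prop
        exact (this.tendsto' 0 _ (by simp)).mono_left nhdsWithin_le_nhds
      exact h1.tendsto.comp h2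
  have h0 : (∫ ν : ℝ, Ptilde a b x (ν * Complex.I) * Complex.exp (ν * Complex.I * t)) =
      ∫ ν : ℝ, Ptilde a b x ((2 : ℝ) + ν * Complex.I) *
        Complex.exp (((2 : ℝ) + ν * Complex.I) * t) := by
    refine tendsto_nhds_unique hlim (tendsto_const_nhds.congr' ?_)
    filter_upwards [self_mem_nhdsWithin] with e he
    have h1 := hF.bromwich_eq (c := 2) (c' := e) two_pos he t
    have hpi := Real.pi_pos
    exact mul_left_cancel₀ (by simp [Real.pi_ne_zero]) h1
  have hint := integrableOn_Ptilde_axis ha hab hx t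
  have hneg : ∀ q : ℝ, q ∈ Ioi (0 : ℝ) → Ptilde a b x ((-q : ℝ) * Complex.I) *
      Complex.exp ((-q : ℝ) * Complex.I * t) = (starRingEnd ℂ)
      (Ptilde a b x (q * Complex.I) * Complex.exp (q * Complex.I * t)) := by
    intro q hq
    have h1 : ((-q : ℝ) : ℂ) * Complex.I = (starRingEnd ℂ) (q * Complex.I) := by simp
    have h2 : Complex.exp ((starRingEnd ℂ) (q * Complex.I) * t) =
        (starRingEnd ℂ) (Complex.exp (q * Complex.I * t)) := by
      rw [← Complex.exp_conj]
      simp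
    rw [h1, Ptilde_conj a b x (Or.inr (by simpa using (ne_of_gt hq))), h2, map_mul]
  have hIic : IntegrableOn (fun ν : ℝ => Ptilde a b x (ν * Complex.I) *
      Complex.exp (ν * Complex.I * t)) (Iic 0) := by
    rw [← Measure.map_neg_eq_self (volume : Measure ℝ)]
    have m : MeasurableEmbedding fun x : ℝ => -x := (Homeomorph.neg ℝ).measurableEmbedding
    rw [m.integrableOn_map_iff]
    simp_rw [neg_preimage, neg_Iic, neg_zero]
    refine Iff.mpr integrableOn_Ici_iff_integrableOn_Ioi ?_
    refine IntegrableOn.congr_fun (f := fun q : ℝ => (starRingEnd ℂ)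
      (Ptilde a b x (q * Complex.I) * Complex.exp (q * Complex.I * t))) ?_
      (fun q hq => (hneg q hq).symm) measurableSet_Ioi
    exact (Complex.conjLIE.toContinuousLinearEquiv.toContinuousLinearMap.integrable_comp hint)
  have hsplit : (∫ ν : ℝ, Ptilde a b x (ν * Complex.I) * Complex.exp (ν * Complex.I * t)) =
      (starRingEnd ℂ) (∫ q in Ioi (0 : ℝ), Ptilde a b x (q * Complex.I) *
        Complex.exp (q * Complex.I * t)) + ∫ q in Ioi (0 : ℝ), Ptilde a b x (q * Complex.I) *
        Complex.exp (q * Complex.I * t) := by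
    rw [← setIntegral_univ, ← Iic_union_Ioi (a := (0 : ℝ)),
      setIntegral_union (Iic_disjoint_Ioi le_rfl) measurableSet_Ioi hIic hint, ← integral_conj]
    congr 1
    have := integral_comp_neg_Ioi (0 : ℝ) fun ν : ℝ => Ptilde a b x (ν * Complex.I) *
      Complex.exp (ν * Complex.I * t)
    rw [neg_zero] at this
    rw [← this]
    exact setIntegral_congr_fun measurableSet_Ioi hneg
  rw [impulse, bromwich]
  rw [← h0, hsplit]
  have hpi := Real.pi_ne_zero
  set A := ∫ q in Ioi (0 : ℝ), Ptilde a b x (q * Complex.I) * Complex.exp (q * Complex.I * t)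
  have h2 : (1 / (2 * Real.pi) : ℂ) = ((1 / (2 * Real.pi) : ℝ) : ℂ) := by push_cast; rfl
  rw [h2, Complex.re_ofReal_mul, Complex.add_re, Complex.conj_re]
  field_simp
  ring

/-- The imaginary part of `P̃` on the upper side of the cut. -/
def cutIm (a b x q : ℝ) : ℝ := (cutRatio a b x Real.pi q).im

lemma integrableOn_cutIm (ha : 0 < a) (hab : a < b) {x t : ℝ} (hx : x ∈ Icc (0 : ℝ) 1)
    (ht : 0 < t) : IntegrableOn (fun q : ℝ => cutIm a b x q * Real.exp (-q * t)) (Ioi 0) := by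
  refine (Complex.imCLM.integrable_comp (integrableOn_cutRatio ha hab hx ht)).congr
    (ae_of_all _ fun q => ?_)
  have : Complex.exp (-(q : ℂ) * t) = (Real.exp (-q * t) : ℝ) := by push_cast; rfl
  simp only [Complex.imCLM_apply, this, cutIm]
  rw [mul_comm, Complex.im_ofReal_mul, mul_comm]

lemma im_integral_cutRatio (ha : 0 < a) (hab : a < b) {x t : ℝ} (hx : x ∈ Icc (0 : ℝ) 1)
    (ht : 0 < t) :
    (∫ q in Ioi (0 : ℝ), cutRatio a b x Real.pi q * Complex.exp (-q * t)).im =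
      ∫ q in Ioi (0 : ℝ), cutIm a b x q * Real.exp (-q * t) := by
  have h := Complex.imCLM.integral_comp_comm (integrableOn_cutRatio ha hab hx ht)
  simp only [Complex.imCLM_apply] at h
  rw [← h]
  congr 1
  funext q
  have : Complex.exp (-(q : ℂ) * t) = (Real.exp (-q * t) : ℝ) := by push_cast; rfl
  rw [this, mul_comm, Complex.im_ofReal_mul, mul_comm, cutIm]

/-- The imaginary part of the contour identity: multiplication by `i` turns the real part of the
axis integral, which is `π P`, into the imaginary part, the cut contributes `cutIm`, and the sum of
residues its real part. -/
lemma impulse_eq (ha : 0 < a) (hab : a < b) {x t : ℝ} (hx : x ∈ Ico (0 : ℝ) 1) (ht : 0 < t) :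
    impulse a b x t = (∑' n : ℕ, 2 * (poleTerm a b x t (n + 1)).re) -
      1 / Real.pi * ∫ q in Ioi (0 : ℝ), cutIm a b x q * Real.exp (-q * t) := by
  have hpi := Real.pi_ne_zero
  have h := axis_integral_add_cut_integral ha hab hx ht
  have hs := (summable_norm_poleTerm ha hab x ht).of_norm
  rw [impulse_eq_axis ha hab hx, tsum_mul_left, ← Complex.re_tsum hs,
    ← im_integral_cutRatio ha hab ⟨hx.1, hx.2.le⟩ ht]
  have h1 := congrArg Complex.im h
  have h2 : (2 * Real.pi * Complex.I * ∑' n : ℕ, poleTerm a b x t (n + 1) : ℂ) =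
      ((2 * Real.pi : ℝ) : ℂ) * (Complex.I * ∑' n : ℕ, poleTerm a b x t (n + 1)) := by
    push_cast
    ring
  rw [h2, Complex.im_ofReal_mul, Complex.I_mul_im, Complex.add_im, Complex.mul_I_im] at h1
  generalize (∫ q in Ioi (0 : ℝ), Ptilde a b x (q * Complex.I) *
    Complex.exp (q * Complex.I * t)).re = A at h1 ⊢
  generalize (∑' n : ℕ, poleTerm a b x t (n + 1)).re = S at h1 ⊢
  generalize (∫ q in Ioi (0 : ℝ), cutRatio a b x Real.pi q * Complex.exp (-q * t)).im = D at h1 ⊢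
  field_simp
  linarith

/-! ### Bounds for the terms of the explicit form -/

/-- The factor `z` removes the pole at `0`, since `|sinh z| ≥ |z| / 2` for `|z| ≤ 1`. It controls
the `x`-derivative of the ratio on the cut near `q = 0`. -/
lemma norm_mul_coshRatio_le {x : ℝ} (hx : |x| ≤ 1) {z : ℂ} (hz : ‖z‖ ≤ 1) :
    ‖z * coshRatio x z‖ ≤ 6 := by
  rcases eq_or_ne z 0 with rfl | h0
  · simp
  have h1 : ‖z‖ / 2 ≤ ‖Complex.sinh z‖ := by
    apply le_of_sq_le_sq _ (norm_nonneg _)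
    rw [normSq_sinh, div_pow, ← Complex.normSq_eq_norm_sq, Complex.normSq_apply]
    have hre : z.re ^ 2 ≤ Real.sinh z.re ^ 2 := by
      rw [sq_le_sq, Real.abs_sinh]
      exact Real.self_le_sinh_iff.2 (abs_nonneg _)
    have him : (1 / 2 * |z.im|) ^ 2 ≤ Real.sin z.im ^ 2 := by
      rw [← sq_abs (Real.sin _)]
      have hle : |z.im| ≤ Real.pi / 2 :=
        (Complex.abs_im_le_norm z).trans (hz.trans (by linarith [Real.pi_gt_three]))
      have h2 := Real.mul_abs_le_abs_sin hle
      have h3 : 1 / 2 ≤ 2 / Real.pi := by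
        rw [div_le_div_iff₀ two_pos Real.pi_pos]
        linarith [Real.pi_lt_four]
      have : 1 / 2 * |z.im| ≤ 2 / Real.pi * |z.im| := by gcongr
      gcongr
      linarith
    rw [mul_pow, sq_abs] at him
    nlinarith [sq_nonneg z.re]
  have hzp := norm_pos_iff.2 h0
  have h2 : ‖Complex.cosh (x * z)‖ ≤ 3 := by
    refine (norm_cosh_le _).trans ?_
    have h3 : |(x * z : ℂ).re| ≤ 1 := by
      rw [Complex.re_ofReal_mul, abs_mul]
      have := (Complex.abs_re_le_norm z).trans hz
      nlinarith [abs_nonneg x, abs_nonneg z.re]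
    have := Real.exp_le_exp.2 h3
    linarith [Real.exp_one_lt_d9]
  rw [coshRatio, norm_mul, norm_div, ← mul_div_assoc, div_le_iff₀ (by linarith)]
  nlinarith

lemma exists_cut_derivative_bound (ha : 0 < a) (hab : a < b) : ∃ B : ℝ, 0 ≤ B ∧
    ∀ x ∈ Icc (0 : ℝ) 1, ∀ q : ℝ, 0 < q →
      ‖expSM a b (Real.log q + Real.pi * Complex.I) *
        coshRatio x (expSM a b (Real.log q + Real.pi * Complex.I))‖ ≤ B * (1 + q) := by
  obtain ⟨c, C, hc, hC, -, h⟩ := exists_norm_cutRatio_le ha hab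
  have hb := ha.trans hab
  have hba : 0 < b / a := div_pos hb ha
  refine ⟨6 + b / a * C, by positivity, fun x hx q hq => ?_⟩
  set z := expSM a b (Real.log q + Real.pi * Complex.I) with hz
  have hxa : |x| ≤ 1 := by rw [abs_of_nonneg hx.1]; exact hx.2
  have hzn : ‖z‖ ≤ b / a * q := by
    have := (norm_exp_logSM_mem ha hab (w := Real.log q + Real.pi * Complex.I) (by
      rw [line_im, abs_of_pos Real.pi_pos])).2
    rwa [line_re, Real.exp_log hq] at this
  rcases le_total q (a / b) with hqa | hqa
  · have h1 : ‖z‖ ≤ 1 := by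
      calc ‖z‖ ≤ b / a * (a / b) := hzn.trans (by gcongr)
        _ = 1 := by field_simp
    have := norm_mul_coshRatio_le hxa h1
    have h2 : 0 ≤ b / a * C := by positivity
    nlinarith
  · have h1 := h (Real.log q) (Real.log_le_log (by positivity) hqa) x hxa
    rw [norm_mul]
    calc ‖z‖ * ‖coshRatio x z‖ ≤ b / a * q * C := by gcongr
      _ ≤ _ := by
        have h2 : 0 ≤ b / a * C := by positivity
        nlinarith

lemma cutIm_eq {q : ℝ} (hq : 0 < q) (x : ℝ) : cutIm a b x q =
    (sinhRatio x (expSM a b (Real.log q + Real.pi * Complex.I))).im := by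
  rw [cutIm, cutRatio_eq hq x (abs_of_pos Real.pi_pos)]

lemma sinhRatio_one {z : ℂ} (hz : Complex.sinh z ≠ 0) : sinhRatio 1 z = 1 := by
  rw [sinhRatio, Complex.ofReal_one, one_mul, div_self hz]

lemma sinh_cut_ne_zero (ha : 0 < a) (hab : a < b) (u : ℝ) :
    Complex.sinh (expSM a b (u + Real.pi * Complex.I)) ≠ 0 :=
  sinh_expSM_ne_zero_of_im_eq ha hab (by rw [line_im, abs_of_pos Real.pi_pos])

lemma cutIm_one (ha : 0 < a) (hab : a < b) {q : ℝ} (hq : 0 < q) : cutIm a b 1 q = 0 := by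
  rw [cutIm_eq hq, sinhRatio_one (sinh_cut_ne_zero ha hab _), Complex.one_im]

lemma hasDerivAt_cutIm {q : ℝ} (hq : 0 < q) (x : ℝ) :
    HasDerivAt (fun x => cutIm a b x q) (expSM a b (Real.log q + Real.pi * Complex.I) *
      coshRatio x (expSM a b (Real.log q + Real.pi * Complex.I))).im x := by
  have h := Complex.imCLM.hasFDerivAt.comp_hasDerivAt x
    (hasDerivAt_sinhRatio (expSM a b (Real.log q + Real.pi * Complex.I)) x)
  refine h.congr_of_eventuallyEq (Eventually.of_forall fun y => ?_)
  exact cutIm_eq hq y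

/-- At `x = 1` the ratio is identically `1`, so its imaginary part vanishes and the mean value
inequality gains a factor `1 - x`; the cost is the factor `1 + q` from the derivative. -/
lemma exists_abs_cutIm_le (ha : 0 < a) (hab : a < b) : ∃ B : ℝ, 0 ≤ B ∧
    ∀ x ∈ Icc (0 : ℝ) 1, ∀ q : ℝ, 0 < q →
      |cutIm a b x q| ≤ B ∧ |cutIm a b x q| ≤ B * (1 - x) * (1 + q) := by
  obtain ⟨c, C, hc, hC, h⟩ := exists_norm_cutRatio_pi_le ha hab
  obtain ⟨B, hB, h'⟩ := exists_cut_derivative_bound ha hab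
  refine ⟨C + B, by linarith, fun x hx q hq => ⟨?_, ?_⟩⟩
  · refine (Complex.abs_im_le_norm _).trans ((h x hx q hq).trans ?_)
    have h1 : Real.exp (-((1 - x) * c * q)) ≤ 1 := by
      apply Real.exp_le_one_iff.2
      have := mul_nonneg (mul_nonneg (sub_nonneg.2 hx.2) hc.le) hq.le
      linarith
    nlinarith
  · have h1 := (convex_Icc (0 : ℝ) 1).norm_image_sub_le_of_norm_hasDerivWithin_le
      (f := fun y => cutIm a b y q) (C := B * (1 + q)) (x := x) (y := 1)
      (fun y _ => (hasDerivAt_cutIm hq y).hasDerivWithinAt)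
      (fun y hy => (Complex.abs_im_le_norm _).trans (h' y hy q hq)) hx ⟨zero_le_one, le_rfl⟩
    rw [cutIm_one ha hab hq, zero_sub, norm_neg, Real.norm_eq_abs, Real.norm_eq_abs,
      abs_of_nonneg (sub_nonneg.2 hx.2)] at h1
    have h2 : 0 ≤ C * ((1 - x) * (1 + q)) :=
      mul_nonneg (by linarith) (mul_nonneg (sub_nonneg.2 hx.2) (by linarith))
    linarith

lemma integral_exp_neg_mul {t : ℝ} (ht : 0 < t) :
    ∫ q in Ioi (0 : ℝ), Real.exp (-(t * q)) = 1 / t := by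
  have := integral_exp_mul_Ioi (a := -t) (by linarith) 0
  simp_rw [neg_mul] at this
  rw [this]
  simp

lemma integral_mul_exp_neg_mul {t : ℝ} (ht : 0 < t) :
    IntegrableOn (fun q : ℝ => q * Real.exp (-(t * q))) (Ioi 0) ∧
      ∫ q in Ioi (0 : ℝ), q * Real.exp (-(t * q)) = 1 / t ^ 2 := by
  have h1 := integrableOn_rpow_mul_exp_neg (β := 1) (by norm_num) ht
  have h2 := Real.integral_rpow_mul_exp_neg_mul_Ioi (a := 2) two_pos ht
  simp only [Real.rpow_one] at h1
  refine ⟨h1, ?_⟩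
  norm_num at h2
  rw [h2]
  simp

lemma exists_abs_cut_integral_le (ha : 0 < a) (hab : a < b) : ∃ B : ℝ, 0 ≤ B ∧
    ∀ x ∈ Icc (0 : ℝ) 1, ∀ t : ℝ, 0 < t →
      |∫ q in Ioi (0 : ℝ), cutIm a b x q * Real.exp (-q * t)| ≤ B * (1 / t) ∧
      |∫ q in Ioi (0 : ℝ), cutIm a b x q * Real.exp (-q * t)| ≤
        B * (1 - x) * (1 / t + 1 / t ^ 2) := by
  obtain ⟨B, hB, h⟩ := exists_abs_cutIm_le ha hab
  refine ⟨B, hB, fun x hx t ht => ?_⟩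
  obtain ⟨i1, e1⟩ := integral_mul_exp_neg_mul ht
  have i0 := integrableOn_exp_neg_mul ht
  have hexp : ∀ q : ℝ, Real.exp (-q * t) = Real.exp (-(t * q)) := fun q => by ring_nf
  simp_rw [hexp]
  constructor
  · rw [← integral_exp_neg_mul ht, ← integral_const_mul]
    refine norm_integral_le_of_norm_le (f := fun q => cutIm a b x q * Real.exp (-(t * q)))
      (i0.const_mul B) ?_
    rw [ae_restrict_iff' measurableSet_Ioi]
    refine ae_of_all _ fun q hq => ?_
    rw [norm_mul, Real.norm_eq_abs, Real.norm_eq_abs, Real.abs_exp]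
    gcongr
    exact (h x hx q hq).1
  · rw [← integral_exp_neg_mul ht, ← e1, ← integral_add i0 i1, ← integral_const_mul]
    refine norm_integral_le_of_norm_le (f := fun q => cutIm a b x q * Real.exp (-(t * q)))
      (g := fun q => B * (1 - x) * (Real.exp (-(t * q)) + q * Real.exp (-(t * q))))
      ((i0.add i1).const_mul _) ?_
    rw [ae_restrict_iff' measurableSet_Ioi]
    refine ae_of_all _ fun q hq => ?_
    rw [norm_mul, Real.norm_eq_abs, Real.norm_eq_abs, Real.abs_exp]
    have := (h x hx q hq).2
    calc _ ≤ B * (1 - x) * (1 + q) * Real.exp (-(t * q)) := by gcongr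
      _ = _ := by ring

lemma abs_sin_natCast_mul_pi_mul_le (n : ℕ) {x : ℝ} (hx : x ≤ 1) :
    |Real.sin (n * Real.pi * x)| ≤ n * Real.pi * (1 - x) := by
  have h := Real.abs_sin_sub_sin_le (n * Real.pi * x) (n * Real.pi)
  rw [Real.sin_nat_mul_pi, sub_zero] at h
  refine h.trans_eq ?_
  rw [← abs_neg, abs_of_nonneg] <;> nlinarith [mul_nonneg (Nat.cast_nonneg (α := ℝ) n)
    Real.pi_pos.le]

lemma exp_neg_le_three {y : ℝ} (hy : 0 < y) : Real.exp (-y) ≤ 6 * y ^ (-3 : ℝ) := by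
  have h1 := Real.pow_div_factorial_le_exp y hy.le 3
  norm_num at h1
  rw [Real.rpow_neg hy.le, Real.exp_neg, ← div_eq_mul_inv,
    show (3 : ℝ) = ((3 : ℕ) : ℝ) by norm_num, Real.rpow_natCast]
  rw [inv_le_comm₀ (Real.exp_pos _) (by positivity)]
  rw [inv_div]
  exact h1

/-- The square root of the cubic bound taken at `2y`. -/
lemma exp_neg_le_three_halves {y : ℝ} (hy : 0 < y) :
    Real.exp (-y) ≤ y ^ (-(3 / 2) : ℝ) := by
  have h1 := exp_neg_le_three (y := 2 * y) (by linarith)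
  have h2 : (0 : ℝ) < y ^ (-(3 / 2) : ℝ) := Real.rpow_pos_of_pos hy _
  have h3 : y ^ (-3 : ℝ) = (y ^ (-(3 / 2) : ℝ)) ^ 2 := by
    rw [← Real.rpow_natCast, ← Real.rpow_mul hy.le]
    norm_num
  have h4 : Real.exp (-(2 * y)) = Real.exp (-y) ^ 2 := by
    rw [← Real.exp_nat_mul]
    ring_nf
  rw [h4, Real.mul_rpow two_pos.le hy.le, h3] at h1
  have h5 : (2 : ℝ) ^ (-3 : ℝ) = 1 / 8 := by
    rw [Real.rpow_neg two_pos.le, show (3 : ℝ) = ((3 : ℕ) : ℝ) by norm_num, Real.rpow_natCast]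
    norm_num
  rw [h5] at h1
  refine le_of_sq_le_sq ?_ h2.le
  nlinarith

/-! ### Bounds for the impulse response near the driven end -/

lemma norm_poleTerm (x t : ℝ) (n : ℕ) : ‖poleTerm a b x t n‖ =
    ‖poleCoef a b n‖ * |Real.sin (n * Real.pi * x)| * Real.exp ((pole a b n).re * t) := by
  rw [poleTerm, norm_mul, norm_mul, Complex.norm_real, Real.norm_eq_abs, Complex.norm_exp,
    mul_comm _ (t : ℂ), Complex.re_ofReal_mul, mul_comm t]

lemma summable_rpow_neg {p : ℝ} (hp : 1 < p) : Summable fun n : ℕ => ((n : ℝ) + 1) ^ (-p) := by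
  have := (summable_nat_add_iff 1).2 (Real.summable_nat_rpow.2 (neg_lt_neg hp))
  simpa using this

/-- With `y = c t n^{3/4}` the bound `y^{-3/2}` gives `n^{-9/8}`, which is summable. The bound
`y^{-3}` gives `n^{-9/4}`, which after the factor `n (1 - x)` from `|sin nπx|` leaves the summable
`n^{-5/4}`. -/
lemma exists_pole_sum_le (ha : 0 < a) (hab : a < b) : ∃ B : ℝ, 0 ≤ B ∧
    ∀ x ∈ Icc (0 : ℝ) 1, ∀ t : ℝ, 0 < t →
      |∑' n : ℕ, 2 * (poleTerm a b x t (n + 1)).re| ≤ B * t ^ (-(3 / 2) : ℝ) ∧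
      |∑' n : ℕ, 2 * (poleTerm a b x t (n + 1)).re| ≤ B * (1 - x) * t ^ (-3 : ℝ) := by
  obtain ⟨c, hc, h⟩ := exists_pole_re_le ha hab
  have hpi := Real.pi_pos
  have hba : 0 < b / a := div_pos (ha.trans hab) ha
  have s1 := summable_rpow_neg (p := 9 / 8) (by norm_num)
  have s2 := summable_rpow_neg (p := 5 / 4) (by norm_num)
  set S1 := ∑' n : ℕ, ((n : ℝ) + 1) ^ (-(9 / 8) : ℝ)
  set S2 := ∑' n : ℕ, ((n : ℝ) + 1) ^ (-(5 / 4) : ℝ)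
  have hS1 : 0 ≤ S1 := tsum_nonneg fun n => by positivity
  have hS2 : 0 ≤ S2 := tsum_nonneg fun n => by positivity
  have hexp : ∀ t : ℝ, 0 < t → ∀ n : ℕ, Real.exp ((pole a b (n + 1)).re * t) ≤
      Real.exp (-(c * t * ((n : ℝ) + 1) ^ (3 / 4 : ℝ))) := fun t ht n => by
    have := h (n + 1) (Nat.le_add_left 1 n)
    push_cast at this
    exact Real.exp_le_exp.2 (by nlinarith)
  have hy : ∀ t : ℝ, 0 < t → ∀ n : ℕ, 0 < c * t * ((n : ℝ) + 1) ^ (3 / 4 : ℝ) :=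
    fun t ht n => by positivity
  have hpow : ∀ t : ℝ, 0 < t → ∀ n : ℕ, ∀ p : ℝ, (c * t * ((n : ℝ) + 1) ^ (3 / 4 : ℝ)) ^ p =
      c ^ p * t ^ p * ((n : ℝ) + 1) ^ (3 / 4 * p) := fun t ht n p => by
    rw [Real.mul_rpow (by positivity) (by positivity), Real.mul_rpow hc.le ht.le,
      ← Real.rpow_mul (by positivity)]
  refine ⟨2 * (5 * (b / a)) * c ^ (-(3 / 2) : ℝ) * S1 +
    2 * (5 * (b / a)) * Real.pi * (6 * c ^ (-3 : ℝ)) * S2, by positivity,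
    fun x hx t ht => ⟨?_, ?_⟩⟩
  · have hle : ∀ n : ℕ, ‖2 * (poleTerm a b x t (n + 1)).re‖ ≤
        2 * (5 * (b / a)) * c ^ (-(3 / 2) : ℝ) * t ^ (-(3 / 2) : ℝ) *
          ((n : ℝ) + 1) ^ (-(9 / 8) : ℝ) := fun n => by
      have h1 := (hexp t ht n).trans (exp_neg_le_three_halves (hy t ht n))
      rw [hpow t ht] at h1
      norm_num at h1
      have h2 := norm_poleCoef_le ha hab (Nat.le_add_left 1 n)
      have h3 := Complex.abs_re_le_norm (poleTerm a b x t (n + 1))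
      rw [norm_poleTerm] at h3
      rw [norm_mul, Real.norm_eq_abs, Real.norm_eq_abs, abs_two]
      calc _ ≤ 2 * (5 * (b / a) * 1 * (c ^ (-(3 / 2) : ℝ) * t ^ (-(3 / 2) : ℝ) *
            ((n : ℝ) + 1) ^ (-(9 / 8) : ℝ))) := by
            refine mul_le_mul_of_nonneg_left (h3.trans ?_) two_pos.le
            gcongr
            exact Real.abs_sin_le_one _
        _ = _ := by ring
    have := tsum_of_norm_bounded (s1.hasSum.mul_left _) hle
    rw [Real.norm_eq_abs] at this
    refine this.trans ?_
    have : 0 ≤ 2 * (5 * (b / a)) * Real.pi * (6 * c ^ (-3 : ℝ)) * S2 * t ^ (-(3 / 2) : ℝ) := by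
      positivity
    linarith
  · have hx1 := sub_nonneg.2 hx.2
    have hle : ∀ n : ℕ, ‖2 * (poleTerm a b x t (n + 1)).re‖ ≤
        2 * (5 * (b / a)) * Real.pi * (6 * c ^ (-3 : ℝ)) * (1 - x) * t ^ (-3 : ℝ) *
          ((n : ℝ) + 1) ^ (-(5 / 4) : ℝ) := fun n => by
      have h1 := (hexp t ht n).trans (exp_neg_le_three (hy t ht n))
      rw [hpow t ht] at h1
      have h2 := norm_poleCoef_le ha hab (Nat.le_add_left 1 n)
      have h3 := Complex.abs_re_le_norm (poleTerm a b x t (n + 1))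
      have h4 := abs_sin_natCast_mul_pi_mul_le (n + 1) hx.2
      have h5 : ((n : ℝ) + 1) ^ (-(5 / 4) : ℝ) = ((n : ℝ) + 1) ^ (3 / 4 * (-3) : ℝ) * (n + 1) := by
        rw [← Real.rpow_add_one (by positivity)]
        norm_num
      rw [norm_poleTerm] at h3
      rw [norm_mul, Real.norm_eq_abs, Real.norm_eq_abs, abs_two, h5]
      calc _ ≤ 2 * (5 * (b / a) * (((n + 1 : ℕ) : ℝ) * Real.pi * (1 - x)) *
            (6 * (c ^ (-3 : ℝ) * t ^ (-3 : ℝ) * ((n : ℝ) + 1) ^ (3 / 4 * (-3) : ℝ)))) := by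
            refine mul_le_mul_of_nonneg_left (h3.trans ?_) two_pos.le
            gcongr
        _ = _ := by
          push_cast
          ring
    have := tsum_of_norm_bounded (s2.hasSum.mul_left _) hle
    rw [Real.norm_eq_abs] at this
    refine this.trans ?_
    have : 0 ≤ 2 * (5 * (b / a)) * c ^ (-(3 / 2) : ℝ) * S1 * ((1 - x) * t ^ (-3 : ℝ)) := by
      have := Real.rpow_nonneg ht.le (-3)
      positivity
    linarith

/-- These replace the decay in `s`, which degenerates as `x → 1`. The first, uniform in `x`, serves
to dominate the displacement; the second, `O(1 - x)`, gives differentiability at the driven end. -/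
lemma exists_abs_impulse_le (ha : 0 < a) (hab : a < b) : ∃ K : ℝ, 0 ≤ K ∧
    ∀ x ∈ Ico (0 : ℝ) 1, ∀ t : ℝ, 0 < t →
      |impulse a b x t| ≤ K * (1 + t ^ (-(3 / 2) : ℝ)) ∧
      |impulse a b x t| ≤ K * (1 - x) * (1 + t ^ (-3 : ℝ)) := by
  obtain ⟨B, hB, h⟩ := exists_pole_sum_le ha hab
  obtain ⟨B', hB', h'⟩ := exists_abs_cut_integral_le ha hab
  refine ⟨B + 2 * B', by positivity, fun x hx t ht => ?_⟩
  obtain ⟨p1, p2⟩ := h x ⟨hx.1, hx.2.le⟩ t ht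
  obtain ⟨q1, q2⟩ := h' x ⟨hx.1, hx.2.le⟩ t ht
  rw [impulse_eq ha hab hx ht]
  set S := ∑' n : ℕ, 2 * (poleTerm a b x t (n + 1)).re
  set D := ∫ q in Ioi (0 : ℝ), cutIm a b x q * Real.exp (-q * t)
  have hsum : |S - 1 / Real.pi * D| ≤ |S| + |D| := by
    refine (abs_sub _ _).trans ?_
    rw [abs_mul, abs_of_pos (by positivity : 0 < 1 / Real.pi)]
    have : 1 / Real.pi ≤ 1 := by
      rw [div_le_one Real.pi_pos]
      linarith [Real.pi_gt_three]
    have := mul_le_mul_of_nonneg_right this (abs_nonneg D)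
    linarith
  have hx1 : 0 ≤ 1 - x := by linarith [hx.2]
  have hr1 : 0 < t ^ (-(3 / 2) : ℝ) := Real.rpow_pos_of_pos ht _
  have hr3 : 0 < t ^ (-3 : ℝ) := Real.rpow_pos_of_pos ht _
  have hpow : ∀ m : ℕ, (t⁻¹) ^ m = t ^ (-(m : ℝ)) := fun m => by
    rw [Real.rpow_neg ht.le, Real.rpow_natCast, inv_pow]
  have ht1 : 0 < t⁻¹ := inv_pos.2 ht
  have e3 : t ^ (-3 : ℝ) = t⁻¹ ^ 3 := by rw [hpow]; norm_num
  constructor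
  · have : 1 / t ≤ 1 + t ^ (-(3 / 2) : ℝ) := by
      rcases le_total t 1 with h1 | h1
      · have := Real.rpow_le_rpow_of_exponent_ge ht h1 (show (-(3 / 2) : ℝ) ≤ -1 by norm_num)
        rw [Real.rpow_neg_one] at this
        rw [one_div]
        linarith
      · have : 1 / t ≤ 1 := by
          rw [div_le_one ht]
          exact h1
        linarith
    have := mul_le_mul_of_nonneg_left this hB'
    have := mul_nonneg hB' hr1.le
    nlinarith
  · have : 1 / t + 1 / t ^ 2 ≤ 2 * (1 + t ^ (-3 : ℝ)) := by
      rw [e3, one_div, one_div, ← inv_pow]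
      generalize t⁻¹ = r at ht1
      nlinarith [sq_nonneg (r - 1), mul_nonneg ht1.le (sq_nonneg (r - 1))]
    have := mul_le_mul_of_nonneg_left this (mul_nonneg hB' hx1)
    have := mul_nonneg hB hx1
    nlinarith

/-- The impulse response on the closed rod; at the driven end it vanishes as a function. -/
def impulseExt (a b x t : ℝ) : ℝ := if x < 1 then impulse a b x t else 0

lemma impulseExt_of_lt {x : ℝ} (hx : x < 1) : impulseExt a b x = impulse a b x := by
  funext t
  rw [impulseExt, if_pos hx]

lemma impulseExt_one (a b t : ℝ) : impulseExt a b 1 t = 0 := by simp [impulseExt]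

lemma poleTerm_one (a b t : ℝ) (n : ℕ) : poleTerm a b 1 t n = 0 := by
  rw [poleTerm, mul_one, Real.sin_nat_mul_pi]
  simp

lemma impulseExt_eq (ha : 0 < a) (hab : a < b) {x t : ℝ} (hx : x ∈ Icc (0 : ℝ) 1) (ht : 0 < t) :
    impulseExt a b x t = (∑' n : ℕ, 2 * (poleTerm a b x t (n + 1)).re) -
      1 / Real.pi * ∫ q in Ioi (0 : ℝ), cutIm a b x q * Real.exp (-q * t) := by
  rcases hx.2.lt_or_eq with h1 | rfl
  · rw [impulseExt_of_lt h1, impulse_eq ha hab ⟨hx.1, h1⟩ ht]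
  · have : (∫ q in Ioi (0 : ℝ), cutIm a b 1 q * Real.exp (-q * t)) = 0 := by
      rw [setIntegral_congr_fun (g := fun _ => (0 : ℝ)) measurableSet_Ioi fun q hq => by
        rw [cutIm_one ha hab hq, zero_mul]]
      simp
    rw [this, impulseExt_one]
    simp [poleTerm_one]

lemma exists_hasDerivAt_pole_sum (ha : 0 < a) (hab : a < b) {t : ℝ} (ht : 0 < t) (x : ℝ) :
    ∃ d : ℝ, HasDerivAt (fun x => ∑' n : ℕ, 2 * (poleTerm a b x t (n + 1)).re) d x := by
  obtain ⟨c, hc, h⟩ := exists_pole_re_le ha hab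
  have hpi := Real.pi_pos
  have hba : 0 < b / a := div_pos (ha.trans hab) ha
  have hterm : ∀ n : ℕ, ∀ y : ℝ, (poleTerm a b y t n).re =
      (poleCoef a b n * Complex.exp (pole a b n * t)).re * Real.sin (n * Real.pi * y) :=
    fun n y => by
      rw [poleTerm, mul_right_comm, mul_comm _ ((Real.sin _ : ℝ) : ℂ), Complex.re_ofReal_mul,
        mul_comm]
  refine ⟨_, hasDerivAt_tsum
    (g' := fun n y => 2 * ((poleCoef a b (n + 1) * Complex.exp (pole a b (n + 1) * t)).re *
      (Real.cos ((n + 1 : ℕ) * Real.pi * y) * ((n + 1 : ℕ) * Real.pi))))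
    ((summable_pow_mul_exp_neg (mul_pos hc ht) 1).mul_left (2 * (5 * (b / a)) * Real.pi))
    (fun n y => ?_) (fun n y => ?_) (y₀ := 1) ?_ x⟩
  · simp_rw [hterm]
    have h1 : HasDerivAt (fun y : ℝ => ((n + 1 : ℕ) : ℝ) * Real.pi * y)
        (((n + 1 : ℕ) : ℝ) * Real.pi) y := by
      simpa using (hasDerivAt_id y).const_mul (((n + 1 : ℕ) : ℝ) * Real.pi)
    exact (h1.sin.const_mul _).const_mul 2
  · have h1 := h (n + 1) (Nat.le_add_left 1 n)
    push_cast at h1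
    have h2 := norm_poleCoef_le ha hab (Nat.le_add_left 1 n)
    have h3 : |(poleCoef a b (n + 1) * Complex.exp (pole a b (n + 1) * t)).re| ≤
        5 * (b / a) * Real.exp (-(c * t * ((n : ℝ) + 1) ^ (3 / 4 : ℝ))) := by
      refine (Complex.abs_re_le_norm _).trans ?_
      rw [norm_mul, Complex.norm_exp, mul_comm _ (t : ℂ), Complex.re_ofReal_mul]
      gcongr
      nlinarith
    have h4 := Real.abs_cos_le_one ((n + 1 : ℕ) * Real.pi * y)
    rw [Real.norm_eq_abs, abs_mul, abs_mul, abs_mul, abs_two,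
      abs_of_nonneg (by positivity : (0 : ℝ) ≤ ((n + 1 : ℕ) : ℝ) * Real.pi)]
    calc _ ≤ 2 * (5 * (b / a) * Real.exp (-(c * t * ((n : ℝ) + 1) ^ (3 / 4 : ℝ))) *
          (1 * (((n + 1 : ℕ) : ℝ) * Real.pi))) := by gcongr
      _ = _ := by
        push_cast
        ring
  -- Termwise differentiation needs convergence at one point; at `x = 1` every term is zero.
  · simp only [poleTerm_one, Complex.zero_re, mul_zero]
    exact summable_zero

/-- Differentiability from the left at `1` of an integral depending on a parameter, from that of
the integrand and a bound for its difference quotients. -/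
lemma hasDerivWithinAt_integral_one {μ : Measure ℝ} {F : ℝ → ℝ → ℝ} {d g : ℝ → ℝ}
    (hF : ∀ x ∈ Icc (0 : ℝ) 1, Integrable (F x) μ)
    (hd : ∀ᵐ q ∂μ, HasDerivWithinAt (fun x => F x q) (d q) (Icc 0 1) 1)
    (hg : Integrable g μ) (hbd : ∀ x ∈ Ico (0 : ℝ) 1, ∀ᵐ q ∂μ, |F x q - F 1 q| ≤ (1 - x) * g q) :
    HasDerivWithinAt (fun x => ∫ q, F x q ∂μ) (∫ q, d q ∂μ) (Icc 0 1) 1 := by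
  rw [hasDerivWithinAt_iff_tendsto_slope]
  have h1 : (1 : ℝ) ∈ Icc (0 : ℝ) 1 := ⟨zero_le_one, le_rfl⟩
  have hmem : ∀ᶠ x in 𝓝[Icc (0 : ℝ) 1 \ {1}] 1, x ∈ Ico (0 : ℝ) 1 := by
    filter_upwards [self_mem_nhdsWithin] with x hx
    exact ⟨hx.1.1, lt_of_le_of_ne hx.1.2 hx.2⟩
  have hlim := tendsto_integral_filter_of_dominated_convergence (μ := μ)
    (F := fun x q => slope (fun x => F x q) 1 x) (l := 𝓝[Icc (0 : ℝ) 1 \ {1}] 1) (f := d) g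
    (by
      filter_upwards [hmem] with x hx
      simp only [slope_def_field]
      exact (((hF x ⟨hx.1, hx.2.le⟩).sub (hF 1 h1)).div_const _).aestronglyMeasurable)
    (by
      filter_upwards [hmem] with x hx
      filter_upwards [hbd x hx] with q hq
      have h2 : 0 < 1 - x := by linarith [hx.2]
      rw [slope_def_field, norm_div, Real.norm_eq_abs, Real.norm_eq_abs, abs_sub_comm x 1,
        abs_of_pos h2, div_le_iff₀ h2]
      linarith)
    hg (by
      filter_upwards [hd] with q hq
      exact hasDerivWithinAt_iff_tendsto_slope.1 hq)
  refine hlim.congr' ?_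
  filter_upwards [hmem] with x hx
  simp only [slope_def_field]
  rw [integral_div, integral_sub (hF x ⟨hx.1, hx.2.le⟩) (hF 1 h1)]

lemma exists_hasDerivWithinAt_impulseExt (ha : 0 < a) (hab : a < b) {t : ℝ} (ht : 0 < t) :
    ∃ d : ℝ, HasDerivWithinAt (fun x => impulseExt a b x t) d (Icc 0 1) 1 := by
  obtain ⟨d, hd⟩ := exists_hasDerivAt_pole_sum ha hab ht 1
  obtain ⟨B, hB, h⟩ := exists_abs_cutIm_le ha hab
  have hcut := hasDerivWithinAt_integral_one (μ := volume.restrict (Ioi (0 : ℝ)))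
    (F := fun x q => cutIm a b x q * Real.exp (-q * t))
    (g := fun q => B * (Real.exp (-(t * q)) + q * Real.exp (-(t * q))))
    (fun x hx => integrableOn_cutIm ha hab hx ht)
    ((ae_restrict_iff' measurableSet_Ioi).2 (ae_of_all _ fun q hq =>
      ((hasDerivAt_cutIm hq 1).mul_const _).hasDerivWithinAt))
    (((integrableOn_exp_neg_mul ht).add (integral_mul_exp_neg_mul ht).1).const_mul _)
    (fun x hx => (ae_restrict_iff' measurableSet_Ioi).2 (ae_of_all _ fun q hq => by
      have h1 := (h x ⟨hx.1, hx.2.le⟩ q hq).2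
      rw [cutIm_one ha hab hq, zero_mul, sub_zero, abs_mul, Real.abs_exp,
        show -q * t = -(t * q) by ring]
      calc _ ≤ B * (1 - x) * (1 + q) * Real.exp (-(t * q)) := by gcongr
        _ = _ := by ring))
  exact ⟨_, (hd.hasDerivWithinAt.sub (hcut.const_mul (1 / Real.pi))).congr
    (fun x hx => impulseExt_eq ha hab hx ht)
    (impulseExt_eq ha hab ⟨zero_le_one, le_rfl⟩ ht)⟩

/-! ### The displacement near the driven end -/

/-- The unit step on `(0, t]`, up to a combination of exponentials that cancels it to third order
at `0`. -/
def stepKernel (t ρ : ℝ) : ℝ :=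
  (Iic t).indicator 1 ρ - (1 - (1 - Real.exp (-ρ)) ^ 3)

lemma abs_stepKernel_le_of_le {t ρ : ℝ} (hρ : 0 < ρ) (h : ρ ≤ t) :
    |stepKernel t ρ| ≤ 1 ∧ |stepKernel t ρ| ≤ ρ ^ 3 := by
  have h1 : stepKernel t ρ = (1 - Real.exp (-ρ)) ^ 3 := by
    rw [stepKernel, indicator_of_mem (mem_Iic.2 h), Pi.one_apply]
    ring
  have h2 : Real.exp (-ρ) ≤ 1 := Real.exp_le_one_iff.2 (by linarith)
  have h3 := Real.exp_pos (-ρ)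
  have h4 := Real.add_one_le_exp (-ρ)
  rw [h1, abs_of_nonneg (by have := sub_nonneg.2 h2; positivity)]
  exact ⟨pow_le_one₀ (by linarith) (by linarith),
    pow_le_pow_left₀ (by linarith) (by linarith) 3⟩

lemma abs_stepKernel_le_of_lt {t ρ : ℝ} (hρ : 0 < ρ) (h : t < ρ) :
    |stepKernel t ρ| ≤ 3 * Real.exp (-ρ) := by
  have h1 : stepKernel t ρ =
      -(Real.exp (-ρ) * (3 - 3 * Real.exp (-ρ) + Real.exp (-ρ) ^ 2)) := by
    rw [stepKernel, indicator_of_notMem (by simpa using h)]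
    ring
  have h2 : Real.exp (-ρ) ≤ 1 := Real.exp_le_one_iff.2 (by linarith)
  have h3 := Real.exp_pos (-ρ)
  generalize Real.exp (-ρ) = E at *
  rw [h1, abs_neg, abs_of_nonneg (mul_nonneg h3.le (by nlinarith))]
  nlinarith

lemma stepKernel_mul_one_add_le {t ρ p : ℝ} (hρ : 0 < ρ) (h : ρ ≤ t) (hp : 0 ≤ p) (hp3 : p ≤ 3) :
    |stepKernel t ρ| * (1 + ρ ^ (-p)) ≤ 2 := by
  obtain ⟨h1, h2⟩ := abs_stepKernel_le_of_le hρ h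
  have h3 : |stepKernel t ρ| * ρ ^ (-p) ≤ 1 := by
    have h0 : 0 < ρ ^ (-p) := Real.rpow_pos_of_pos hρ _
    rcases le_total ρ 1 with h4 | h4
    · calc |stepKernel t ρ| * ρ ^ (-p) ≤ ρ ^ 3 * ρ ^ (-p) := by gcongr
        _ = ρ ^ (3 - p) := by
          rw [← Real.rpow_natCast, ← Real.rpow_add hρ]
          norm_num
          ring_nf
        _ ≤ 1 := Real.rpow_le_one hρ.le h4 (by linarith)
    · calc |stepKernel t ρ| * ρ ^ (-p) ≤ 1 * 1 := by
            gcongr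
            exact Real.rpow_le_one_of_one_le_of_nonpos h4 (by linarith)
        _ = 1 := one_mul 1
  nlinarith

lemma stepKernel_mul_le_three {t ρ : ℝ} (ht : 0 < t) (hρ : 0 < ρ) :
    |stepKernel t ρ| * (1 + ρ ^ (-3 : ℝ)) ≤
      (Iic t).indicator (fun _ => 2) ρ + 3 * (1 + t ^ (-3 : ℝ)) * Real.exp (-(1 * ρ)) := by
  have ht3 : 0 < t ^ (-3 : ℝ) := Real.rpow_pos_of_pos ht _
  rw [one_mul]
  rcases le_or_gt ρ t with h | h
  · rw [indicator_of_mem (mem_Iic.2 h)]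
    have := stepKernel_mul_one_add_le hρ h (p := 3) (by norm_num) le_rfl
    have : 0 ≤ 3 * (1 + t ^ (-3 : ℝ)) * Real.exp (-ρ) := by positivity
    linarith
  · rw [indicator_of_notMem (by simpa using h), zero_add]
    have h1 : ρ ^ (-3 : ℝ) ≤ t ^ (-3 : ℝ) :=
      Real.rpow_le_rpow_of_nonpos ht h.le (by norm_num)
    have h2 := abs_stepKernel_le_of_lt hρ h
    have : 0 < ρ ^ (-3 : ℝ) := Real.rpow_pos_of_pos hρ _
    calc _ ≤ 3 * Real.exp (-ρ) * (1 + t ^ (-3 : ℝ)) := by gcongr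
      _ = _ := by ring

/-- For `ρ > t` half of the singularity `ρ^{-3/2}` is estimated by `t^{-3/4}`. What remains is
integrable in `ρ`, and the resulting bound is integrable in `t` at `0`. -/
lemma stepKernel_mul_le_three_halves {t ρ : ℝ} (ht : 0 < t) (hρ : 0 < ρ) :
    |stepKernel t ρ| * (1 + ρ ^ (-(3 / 2) : ℝ)) ≤ (Iic t).indicator (fun _ => 2) ρ +
      3 * (1 + t ^ (-(3 / 4) : ℝ)) *
        (Real.exp (-(1 * ρ)) + ρ ^ (-(3 / 4) : ℝ) * Real.exp (-(1 * ρ))) := by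
  have ht3 : 0 < t ^ (-(3 / 4) : ℝ) := Real.rpow_pos_of_pos ht _
  have hρ3 : 0 < ρ ^ (-(3 / 4) : ℝ) := Real.rpow_pos_of_pos hρ _
  rw [one_mul]
  rcases le_or_gt ρ t with h | h
  · rw [indicator_of_mem (mem_Iic.2 h)]
    have := stepKernel_mul_one_add_le hρ h (p := 3 / 2) (by norm_num) (by norm_num)
    have : 0 ≤ 3 * (1 + t ^ (-(3 / 4) : ℝ)) *
      (Real.exp (-ρ) + ρ ^ (-(3 / 4) : ℝ) * Real.exp (-ρ)) := by positivity
    linarith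
  · rw [indicator_of_notMem (by simpa using h), zero_add]
    have h1 : ρ ^ (-(3 / 4) : ℝ) ≤ t ^ (-(3 / 4) : ℝ) :=
      Real.rpow_le_rpow_of_nonpos ht h.le (by norm_num)
    have h2 := abs_stepKernel_le_of_lt hρ h
    have h3 : ρ ^ (-(3 / 2) : ℝ) = ρ ^ (-(3 / 4) : ℝ) * ρ ^ (-(3 / 4) : ℝ) := by
      rw [← Real.rpow_add hρ]
      norm_num
    have h4 : 1 + ρ ^ (-(3 / 2) : ℝ) ≤ (1 + t ^ (-(3 / 4) : ℝ)) * (1 + ρ ^ (-(3 / 4) : ℝ)) := by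
      rw [h3]
      nlinarith
    have : 0 < ρ ^ (-(3 / 2) : ℝ) := Real.rpow_pos_of_pos hρ _
    calc _ ≤ 3 * Real.exp (-ρ) * ((1 + t ^ (-(3 / 4) : ℝ)) * (1 + ρ ^ (-(3 / 4) : ℝ))) := by
          gcongr
      _ = _ := by ring

lemma integral_indicator_Iic_two {t : ℝ} (ht : 0 < t) :
    IntegrableOn (fun ρ : ℝ => (Iic t).indicator (fun _ => (2 : ℝ)) ρ) (Ioi 0) ∧
      ∫ ρ in Ioi (0 : ℝ), (Iic t).indicator (fun _ => (2 : ℝ)) ρ = 2 * t := by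
  constructor
  · rw [IntegrableOn, integrable_indicator_iff measurableSet_Iic, IntegrableOn,
      Measure.restrict_restrict measurableSet_Iic, inter_comm, Ioi_inter_Iic]
    exact integrableOn_const (by simp)
  · rw [integral_indicator measurableSet_Iic, Measure.restrict_restrict measurableSet_Iic,
      inter_comm, Ioi_inter_Iic, setIntegral_const]
    simp [ht.le, mul_comm]

lemma laplace_impulse_re (ha : 0 < a) (hab : a < b) {x : ℝ} (hx : |x| < 1) {m : ℝ} (hm : 0 < m) :
    IntegrableOn (fun t : ℝ => impulse a b x t * Real.exp (-(m * t))) (Ioi 0) ∧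
      ∫ t in Ioi (0 : ℝ), impulse a b x t * Real.exp (-(m * t)) = (Ptilde a b x m).re := by
  obtain ⟨h1, h2⟩ := laplace_impulse ha hab hx (s := m) (by simpa using hm)
  have h3 : ∀ t : ℝ, (impulse a b x t : ℂ) * Complex.exp (-(m : ℂ) * t) =
      ((impulse a b x t * Real.exp (-(m * t)) : ℝ) : ℂ) := fun t => by
    push_cast
    ring_nf
  simp_rw [h3] at h1 h2
  refine ⟨h1.re, ?_⟩
  rw [← h2, integral_complex_ofReal, Complex.ofReal_re]

/-- The transform of the impulse response paired with the exponentials in `stepKernel`. -/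
def stepCorrection (a b x : ℝ) : ℝ :=
  3 * (Ptilde a b x (1 : ℝ)).re - 3 * (Ptilde a b x (2 : ℝ)).re + (Ptilde a b x (3 : ℝ)).re

/-- `∫₀ᵗ P` cannot be estimated directly from bounds such as `t^{-3}`. The combination `3e^{-ρ} -
3e^{-2ρ} + e^{-3ρ}` agrees with the step up to `ρ³` at `0`, and its pairing with `P` is an explicit
combination of `P̃(x, 1)`, `P̃(x, 2)`, `P̃(x, 3)`, smooth in `x` up to the end. -/
lemma unitDisp_eq_stepKernel (ha : 0 < a) (hab : a < b) {x : ℝ} (hx : |x| < 1) {t : ℝ}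
    (ht : 0 < t) : IntegrableOn (fun ρ => stepKernel t ρ * impulse a b x ρ) (Ioi 0) ∧
      unitDisp a b x t = stepCorrection a b x +
        ∫ ρ in Ioi (0 : ℝ), stepKernel t ρ * impulse a b x ρ := by
  obtain ⟨i1, e1⟩ := laplace_impulse_re ha hab hx one_pos
  obtain ⟨i2, e2⟩ := laplace_impulse_re ha hab hx two_pos
  obtain ⟨i3, e3⟩ := laplace_impulse_re ha hab hx three_pos
  have hc := (contDiff_impulse ha hab hx).continuous
  have i0 : IntegrableOn (fun ρ => (Iic t).indicator (impulse a b x) ρ) (Ioi 0) := by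
    rw [IntegrableOn, integrable_indicator_iff measurableSet_Iic, IntegrableOn,
      Measure.restrict_restrict measurableSet_Iic, inter_comm, Ioi_inter_Iic]
    exact (hc.integrableOn_Icc (a := 0) (b := t)).mono_set Ioc_subset_Icc_self
  have e0 : unitDisp a b x t = ∫ ρ in Ioi (0 : ℝ), (Iic t).indicator (impulse a b x) ρ := by
    rw [integral_indicator measurableSet_Iic, Measure.restrict_restrict measurableSet_Iic,
      inter_comm, Ioi_inter_Iic, unitDisp_eq_integral ha hab hx,
      intervalIntegral.integral_of_le ht.le]
  have hk : ∀ ρ : ℝ, stepKernel t ρ * impulse a b x ρ = (Iic t).indicator (impulse a b x) ρ -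
      (3 * (impulse a b x ρ * Real.exp (-(1 * ρ))) - 3 * (impulse a b x ρ * Real.exp (-(2 * ρ))) +
        impulse a b x ρ * Real.exp (-(3 * ρ))) := fun ρ => by
    have h1 : (Iic t).indicator (impulse a b x) ρ =
        (Iic t).indicator 1 ρ * impulse a b x ρ := by
      by_cases h : ρ ∈ Iic t <;> simp [h]
    have h2 : Real.exp (-(2 * ρ)) = Real.exp (-ρ) ^ 2 := by
      rw [← Real.exp_nat_mul]
      ring_nf
    have h3 : Real.exp (-(3 * ρ)) = Real.exp (-ρ) ^ 3 := by
      rw [← Real.exp_nat_mul]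
      ring_nf
    rw [stepKernel, h1, h2, h3, one_mul]
    ring
  have i5 : IntegrableOn (fun ρ => 3 * (impulse a b x ρ * Real.exp (-(1 * ρ))) -
      3 * (impulse a b x ρ * Real.exp (-(2 * ρ)))) (Ioi 0) := (i1.const_mul 3).sub (i2.const_mul 3)
  have i4 : IntegrableOn (fun ρ => 3 * (impulse a b x ρ * Real.exp (-(1 * ρ))) -
      3 * (impulse a b x ρ * Real.exp (-(2 * ρ))) + impulse a b x ρ * Real.exp (-(3 * ρ)))
      (Ioi 0) := i5.add i3
  have hfun : (fun ρ => stepKernel t ρ * impulse a b x ρ) = _ := funext hk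
  rw [hfun]
  refine ⟨i0.sub i4, ?_⟩
  rw [integral_sub i0 i4, integral_add i5 i3,
    integral_sub (i1.const_mul 3) (i2.const_mul 3), integral_const_mul, integral_const_mul,
    e1, e2, e3, ← e0, stepCorrection]
  ring

lemma Ptilde_one (ha : 0 < a) (hab : a < b) {s : ℂ} (hs : 0 < s.re) : Ptilde a b 1 s = 1 := by
  rw [Ptilde_eq_sinhRatio, sinhRatio_one (sinh_mul_M_ne_zero ha hab hs)]

lemma stepCorrection_one (ha : 0 < a) (hab : a < b) : stepCorrection a b 1 = 1 := by
  rw [stepCorrection, Ptilde_one ha hab (by simp), Ptilde_one ha hab (by simp),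
    Ptilde_one ha hab (by simp)]
  norm_num

lemma hasDerivAt_Ptilde_re (s : ℂ) (x : ℝ) :
    HasDerivAt (fun x : ℝ => (Ptilde a b x s).re)
      (s * M a b s * coshRatio x (s * M a b s)).re x := by
  simp_rw [Ptilde_eq_sinhRatio]
  exact Complex.reCLM.hasFDerivAt.comp_hasDerivAt x (hasDerivAt_sinhRatio (s * M a b s) x)

lemma exists_hasDerivAt_stepCorrection (x : ℝ) :
    ∃ d : ℝ, HasDerivAt (stepCorrection a b) d x :=
  ⟨_, (((hasDerivAt_Ptilde_re _ x).const_mul 3).sub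
    ((hasDerivAt_Ptilde_re _ x).const_mul 3)).add (hasDerivAt_Ptilde_re _ x)⟩

/-- The correction term is differentiable in `x`, and the kernel cancels the `ρ^{-3}` singularity in
the `O(1 - x)` bound for `P`, so difference quotients at `x = 1` pass to the limit under the
integral. The value at the end is `stepCorrection = 3 - 3 + 1 = 1`. -/
lemma exists_hasDerivWithinAt_unitDisp_one (ha : 0 < a) (hab : a < b) {t : ℝ} (ht : 0 < t) :
    ∃ d : ℝ, HasDerivWithinAt (fun x => if x < 1 then unitDisp a b x t else 1) d (Icc 0 1) 1 := by
  obtain ⟨K, hK, h⟩ := exists_abs_impulse_le ha hab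
  obtain ⟨d, hd⟩ := exists_hasDerivAt_stepCorrection (a := a) (b := b) 1
  have hder : ∀ ρ : ℝ, ∃ d : ℝ, 0 < ρ →
      HasDerivWithinAt (fun x => impulseExt a b x ρ) d (Icc 0 1) 1 := fun ρ => by
    by_cases hρ : 0 < ρ
    · obtain ⟨d, hd⟩ := exists_hasDerivWithinAt_impulseExt ha hab hρ
      exact ⟨d, fun _ => hd⟩
    · exact ⟨0, fun h => absurd h hρ⟩
  choose D hD using hder
  have habs : ∀ x ∈ Ico (0 : ℝ) 1, |x| < 1 := fun x hx => by rw [abs_of_nonneg hx.1]; exact hx.2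
  have hint := hasDerivWithinAt_integral_one (μ := volume.restrict (Ioi (0 : ℝ)))
    (F := fun x ρ => stepKernel t ρ * impulseExt a b x ρ)
    (d := fun ρ => stepKernel t ρ * D ρ)
    (g := fun ρ => K * ((Iic t).indicator (fun _ => 2) ρ +
      3 * (1 + t ^ (-3 : ℝ)) * Real.exp (-(1 * ρ))))
    (fun x hx => by
      rcases hx.2.lt_or_eq with h1 | rfl
      · simp_rw [impulseExt_of_lt h1]
        exact (unitDisp_eq_stepKernel ha hab (habs x ⟨hx.1, h1⟩) ht).1
      · simp [impulseExt_one])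
    ((ae_restrict_iff' measurableSet_Ioi).2 (ae_of_all _ fun ρ hρ => (hD ρ hρ).const_mul _))
    (((integral_indicator_Iic_two ht).1.add
      ((integrableOn_exp_neg_mul one_pos).const_mul _)).const_mul K)
    (fun x hx => (ae_restrict_iff' measurableSet_Ioi).2 (ae_of_all _ fun ρ hρ => by
      have h1 := (h x hx ρ hρ).2
      have h2 := stepKernel_mul_le_three ht hρ
      have h3 : 0 ≤ 1 - x := by linarith [hx.2]
      rw [impulseExt_one, mul_zero, sub_zero, impulseExt_of_lt hx.2, abs_mul]
      calc |stepKernel t ρ| * |impulse a b x ρ| ≤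
            |stepKernel t ρ| * (K * (1 - x) * (1 + ρ ^ (-3 : ℝ))) := by gcongr
        _ = (1 - x) * (K * (|stepKernel t ρ| * (1 + ρ ^ (-3 : ℝ)))) := by ring
        _ ≤ _ := by gcongr))
  refine ⟨_, (hd.hasDerivWithinAt.add hint).congr (fun x hx => ?_) ?_⟩
  · rcases hx.2.lt_or_eq with h1 | rfl
    · refine (if_pos h1).trans ?_
      simp only [Pi.add_apply, impulseExt_of_lt h1]
      exact (unitDisp_eq_stepKernel ha hab (habs x ⟨hx.1, h1⟩) ht).2
    · simp [impulseExt_one, stepCorrection_one ha hab]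
  · simp [impulseExt_one, stepCorrection_one ha hab]

lemma tendsto_unitDisp_one (ha : 0 < a) (hab : a < b) {t : ℝ} (ht : 0 < t) :
    Tendsto (fun x => unitDisp a b x t) (𝓝[<] 1) (𝓝 1) := by
  obtain ⟨d, hd⟩ := exists_hasDerivWithinAt_unitDisp_one ha hab ht
  have h1 := hd.continuousWithinAt.tendsto
  simp only [lt_irrefl, if_false] at h1
  have h2 : 𝓝[<] (1 : ℝ) ≤ 𝓝[Icc 0 1] 1 := by
    rw [← nhdsWithin_Ico_eq_nhdsLT (zero_lt_one' ℝ)]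
    exact nhdsWithin_mono _ Ico_subset_Icc_self
  refine (h1.mono_left h2).congr' ?_
  filter_upwards [self_mem_nhdsWithin] with x hx
  exact if_pos hx

/-- Uniform in `x < 1` and integrable in `t` against an exponential weight: this is the majorant for
the attainment of the datum in weighted `L¹`. -/
lemma exists_abs_unitDisp_le (ha : 0 < a) (hab : a < b) : ∃ K : ℝ, 0 ≤ K ∧
    ∀ x ∈ Ico (0 : ℝ) 1, ∀ t : ℝ, 0 < t →
      |unitDisp a b x t| ≤ K * (1 + t + t ^ (-(3 / 4) : ℝ)) := by
  obtain ⟨K, hK, h⟩ := exists_abs_impulse_le ha hab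
  obtain ⟨c, C, hc, hC, hP⟩ := exists_norm_Ptilde_le ha hab
  have iΓ : IntegrableOn (fun ρ : ℝ =>
      Real.exp (-(1 * ρ)) + ρ ^ (-(3 / 4) : ℝ) * Real.exp (-(1 * ρ))) (Ioi 0) :=
    (integrableOn_exp_neg_mul one_pos).add
    (integrableOn_rpow_mul_exp_neg (β := -(3 / 4)) (r := 1) (by norm_num) one_pos)
  set G : ℝ := ∫ ρ in Ioi (0 : ℝ),
    (Real.exp (-(1 * ρ)) + ρ ^ (-(3 / 4) : ℝ) * Real.exp (-(1 * ρ))) with hG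
  have hG0 : 0 ≤ G := setIntegral_nonneg measurableSet_Ioi fun ρ hρ => by
    have := Real.rpow_nonneg (le_of_lt hρ) (-(3 / 4))
    positivity
  refine ⟨7 * C + K * (2 + 3 * G), by positivity, fun x hx t ht => ?_⟩
  have hxa : |x| < 1 := by rw [abs_of_nonneg hx.1]; exact hx.2
  have hPle : ∀ m : ℝ, 0 < m → |(Ptilde a b x m).re| ≤ C := fun m hm => by
    refine (Complex.abs_re_le_norm _).trans ((hP x hxa.le m (by simpa using hm.le)).trans ?_)
    refine mul_le_of_le_one_right (by linarith) (Real.exp_le_one_iff.2 ?_)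
    have := sub_nonneg.2 hxa.le
    have := Real.rpow_nonneg (norm_nonneg (m : ℂ)) (3 / 4)
    have : 0 ≤ (1 - |x|) * c * ‖(m : ℂ)‖ ^ (3 / 4 : ℝ) := by positivity
    linarith
  have hΛ : |stepCorrection a b x| ≤ 7 * C := by
    have h1 := abs_le.1 (hPle 1 one_pos)
    have h2 := abs_le.1 (hPle 2 two_pos)
    have h3 := abs_le.1 (hPle 3 three_pos)
    rw [stepCorrection, abs_le]
    constructor <;> linarith
  obtain ⟨i2, e2⟩ := integral_indicator_Iic_two ht
  have hint : |∫ ρ in Ioi (0 : ℝ), stepKernel t ρ * impulse a b x ρ| ≤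
      K * (2 * t + 3 * (1 + t ^ (-(3 / 4) : ℝ)) * G) := by
    rw [hG, ← e2, ← integral_const_mul, ← integral_add i2 (iΓ.const_mul _), ← integral_const_mul]
    refine norm_integral_le_of_norm_le (f := fun ρ => stepKernel t ρ * impulse a b x ρ)
      (g := fun ρ => K * ((Iic t).indicator (fun _ => 2) ρ + 3 * (1 + t ^ (-(3 / 4) : ℝ)) *
        (Real.exp (-(1 * ρ)) + ρ ^ (-(3 / 4) : ℝ) * Real.exp (-(1 * ρ)))))
      ((i2.add (iΓ.const_mul _)).const_mul K) ?_
    refine (ae_restrict_iff' measurableSet_Ioi).2 (ae_of_all _ fun ρ hρ => ?_)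
    have h1 := (h x hx ρ hρ).1
    have h2 := stepKernel_mul_le_three_halves ht hρ
    rw [norm_mul, Real.norm_eq_abs, Real.norm_eq_abs]
    calc |stepKernel t ρ| * |impulse a b x ρ| ≤
          |stepKernel t ρ| * (K * (1 + ρ ^ (-(3 / 2) : ℝ))) := by gcongr
      _ = K * (|stepKernel t ρ| * (1 + ρ ^ (-(3 / 2) : ℝ))) := by ring
      _ ≤ _ := by gcongr
  rw [(unitDisp_eq_stepKernel ha hab hxa ht).2]
  refine (abs_add_le _ _).trans ((add_le_add hΛ hint).trans ?_)
  have hr : 0 < t ^ (-(3 / 4) : ℝ) := Real.rpow_pos_of_pos ht _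
  have h1 : 0 ≤ 7 * C * (t + t ^ (-(3 / 4) : ℝ)) := by positivity
  have h2 : 0 ≤ K * (2 + 2 * t ^ (-(3 / 4) : ℝ) + 3 * G * t) := by positivity
  nlinarith

lemma tendsto_lintegral_unitDisp_sub_one (ha : 0 < a) (hab : a < b) (Υ₀ : ℝ) :
    Tendsto (fun x => ∫⁻ t in Ioi (0 : ℝ),
      ENNReal.ofReal (|Υ₀ * unitDisp a b x t - Υ₀| * Real.exp (-2 * t))) (𝓝[<] 1) (𝓝 0) := by
  obtain ⟨K, hK, h⟩ := exists_abs_unitDisp_le ha hab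
  set g : ℝ → ℝ := fun t =>
    |Υ₀| * (K * (1 + t + t ^ (-(3 / 4) : ℝ)) + 1) * Real.exp (-(2 * t)) with hg
  have hgi : IntegrableOn g (Ioi 0) := by
    have i0 := integrableOn_exp_neg_mul two_pos
    have i1 := (integral_mul_exp_neg_mul two_pos).1
    have i2 := integrableOn_rpow_mul_exp_neg (β := -(3 / 4)) (r := 2) (by norm_num) two_pos
    refine ((((i0.add i1).add i2).const_mul (|Υ₀| * K)).add (i0.const_mul |Υ₀|)).congr
      (ae_of_all _ fun t => ?_)
    simp only [Pi.add_apply, hg]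
    ring
  have hIco : ∀ᶠ x : ℝ in 𝓝[<] 1, x ∈ Ico (0 : ℝ) 1 := by
    filter_upwards [Ioo_mem_nhdsLT (zero_lt_one' ℝ)] with x hx using ⟨hx.1.le, hx.2⟩
  rw [show (0 : ENNReal) = ∫⁻ t in Ioi (0 : ℝ), 0 by simp]
  refine tendsto_lintegral_filter_of_dominated_convergence (fun t => ENNReal.ofReal (g t))
    ?_ ?_ ?_ ?_
  · filter_upwards [hIco] with x hx
    have hc := (contDiff_unitDisp ha hab
      (show |x| < 1 by rw [abs_of_nonneg hx.1]; exact hx.2)).continuous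
    exact (Continuous.measurable (by fun_prop)).ennreal_ofReal
  · filter_upwards [hIco] with x hx
    refine (ae_restrict_iff' measurableSet_Ioi).2 (ae_of_all _ fun t ht => ?_)
    refine ENNReal.ofReal_le_ofReal ?_
    have h1 := h x hx t ht
    have h2 : |Υ₀ * unitDisp a b x t - Υ₀| ≤ |Υ₀| * (|unitDisp a b x t| + 1) := by
      rw [show Υ₀ * unitDisp a b x t - Υ₀ = Υ₀ * (unitDisp a b x t - 1) by ring, abs_mul]
      gcongr
      refine (abs_sub _ _).trans_eq ?_
      rw [abs_one]
    rw [hg, show -2 * t = -(2 * t) by ring]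
    refine mul_le_mul_of_nonneg_right (h2.trans ?_) (Real.exp_pos _).le
    gcongr
  · exact ((hasFiniteIntegral_iff_ofReal ((ae_restrict_iff' measurableSet_Ioi).2
      (ae_of_all _ fun t ht => by
        have := Real.rpow_nonneg (le_of_lt ht) (-(3 / 4))
        have ht' : (0 : ℝ) < t := ht
        simp only [hg, Pi.zero_apply]
        positivity))).1 hgi.2).ne
  · refine (ae_restrict_iff' measurableSet_Ioi).2 (ae_of_all _ fun t ht => ?_)
    have h1 : Tendsto (fun x => |Υ₀ * unitDisp a b x t - Υ₀| * Real.exp (-2 * t)) (𝓝[<] 1)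
        (𝓝 (|Υ₀ * 1 - Υ₀| * Real.exp (-2 * t))) :=
      ((((tendsto_unitDisp_one ha hab ht).const_mul Υ₀).sub_const Υ₀).abs).mul_const _
    have h2 := ENNReal.tendsto_ofReal h1
    simpa using h2

/-! ### The stress near the driven end -/

lemma norm_cexp_mul_sub_le {p : ℂ} (hp : p.re ≤ 0) {r τ t : ℝ} (hτ : r ≤ τ) (ht : r ≤ t) :
    ‖Complex.exp (p * τ) - Complex.exp (p * t)‖ ≤ ‖p‖ * Real.exp (p.re * r) * |τ - t| := by
  refine (convex_Ici r).norm_image_sub_le_of_norm_hasDerivWithin_le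
    (f := fun τ : ℝ => Complex.exp (p * τ)) (f' := fun τ : ℝ => Complex.exp (p * τ) * p)
    (fun τ _ => ?_) (fun τ hτ => ?_) ht hτ
  · have h : HasDerivAt (fun τ : ℝ => p * (τ : ℂ)) p τ := by
      simpa using (Complex.ofRealCLM.hasDerivAt (x := τ)).const_mul p
    exact h.cexp.hasDerivWithinAt
  · rw [norm_mul, mul_comm, Complex.norm_exp, Complex.re_mul_ofReal]
    exact mul_le_mul_of_nonneg_left
      (Real.exp_le_exp.2 (mul_le_mul_of_nonpos_left hτ hp)) (norm_nonneg p)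

/-- Stated as a Lipschitz bound in time so that it can be combined with the known differentiability
of `P`, without differentiating the series. The factors `|s_n|` and `n (1 - x)` give `n²`, harmless
against the exponential for `t ≥ r`. -/
lemma exists_pole_sum_lipschitz (ha : 0 < a) (hab : a < b) {r : ℝ} (hr : 0 < r) :
    ∃ B : ℝ, 0 ≤ B ∧ ∀ x ∈ Icc (0 : ℝ) 1, ∀ τ t : ℝ, r ≤ τ → r ≤ t →
      |(∑' n : ℕ, 2 * (poleTerm a b x τ (n + 1)).re) -
        ∑' n : ℕ, 2 * (poleTerm a b x t (n + 1)).re| ≤ B * (1 - x) * |τ - t| := by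
  obtain ⟨c, hc, h⟩ := exists_pole_re_le ha hab
  have hpi := Real.pi_pos
  have hba : 0 < b / a := div_pos (ha.trans hab) ha
  have s := summable_pow_mul_exp_neg (mul_pos hc hr) 2
  refine ⟨2 * (5 * (b / a)) * Real.pi * (b / a * Real.pi) *
    ∑' n : ℕ, ((n : ℝ) + 1) ^ 2 * Real.exp (-(c * r * ((n : ℝ) + 1) ^ (3 / 4 : ℝ))),
    mul_nonneg (by positivity) (tsum_nonneg fun n => by positivity),
    fun x hx τ t hτ ht => ?_⟩
  have hx1 := sub_nonneg.2 hx.2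
  have hsum : ∀ t : ℝ, r ≤ t → Summable fun n : ℕ => 2 * (poleTerm a b x t (n + 1)).re :=
    fun t ht => ((Complex.reCLM.summable
      (summable_norm_poleTerm ha hab x (hr.trans_le ht)).of_norm)).mul_left 2
  rw [← (hsum τ hτ).tsum_sub (hsum t ht)]
  have hle : ∀ n : ℕ, ‖2 * (poleTerm a b x τ (n + 1)).re - 2 * (poleTerm a b x t (n + 1)).re‖ ≤
      2 * (5 * (b / a)) * Real.pi * (b / a * Real.pi) * ((1 - x) * |τ - t|) *
        (((n : ℝ) + 1) ^ 2 * Real.exp (-(c * r * ((n : ℝ) + 1) ^ (3 / 4 : ℝ)))) := fun n => by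
    have h0 := h (n + 1) (Nat.le_add_left 1 n)
    have hn : 0 < ((n + 1 : ℕ) : ℝ) := by positivity
    have hre : (pole a b (n + 1)).re ≤ 0 := by
      have : 0 ≤ c * ((n + 1 : ℕ) : ℝ) ^ (3 / 4 : ℝ) := by positivity
      linarith
    have h1 := norm_cexp_mul_sub_le hre hτ ht
    have h2 := norm_poleCoef_le ha hab (Nat.le_add_left 1 n)
    have h3 := norm_pole_le ha hab (Nat.le_add_left 1 n)
    have h4 := abs_sin_natCast_mul_pi_mul_le (n + 1) hx.2
    have h5 : Real.exp ((pole a b (n + 1)).re * r) ≤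
        Real.exp (-(c * r * ((n : ℝ) + 1) ^ (3 / 4 : ℝ))) := by
      push_cast at h0
      exact Real.exp_le_exp.2 (by nlinarith)
    rw [← mul_sub, ← Complex.sub_re, norm_mul, Real.norm_eq_abs, Real.norm_eq_abs, abs_two]
    have h6 := Complex.abs_re_le_norm (poleTerm a b x τ (n + 1) - poleTerm a b x t (n + 1))
    have h7 : ‖poleTerm a b x τ (n + 1) - poleTerm a b x t (n + 1)‖ = ‖poleCoef a b (n + 1)‖ *
        |Real.sin ((n + 1 : ℕ) * Real.pi * x)| *
        ‖Complex.exp (pole a b (n + 1) * τ) - Complex.exp (pole a b (n + 1) * t)‖ := by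
      rw [poleTerm, poleTerm, ← mul_sub, norm_mul, norm_mul, Complex.norm_real, Real.norm_eq_abs]
    rw [h7] at h6
    calc _ ≤ 2 * (5 * (b / a) * (((n + 1 : ℕ) : ℝ) * Real.pi * (1 - x)) *
          (b / a * Real.pi * ((n + 1 : ℕ) : ℝ) *
            Real.exp (-(c * r * ((n : ℝ) + 1) ^ (3 / 4 : ℝ))) * |τ - t|)) := by
          refine mul_le_mul_of_nonneg_left (h6.trans ?_) two_pos.le
          refine mul_le_mul (by gcongr) (h1.trans ?_) (norm_nonneg _) (by positivity)
          gcongr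
      _ = _ := by
        push_cast
        ring
  have := tsum_of_norm_bounded (s.hasSum.mul_left _) hle
  rw [Real.norm_eq_abs] at this
  refine this.trans_eq ?_
  ring

lemma exists_cut_integral_lipschitz (ha : 0 < a) (hab : a < b) {r : ℝ} (hr : 0 < r) :
    ∃ B : ℝ, 0 ≤ B ∧ ∀ x ∈ Icc (0 : ℝ) 1, ∀ τ t : ℝ, r ≤ τ → r ≤ t →
      |(∫ q in Ioi (0 : ℝ), cutIm a b x q * Real.exp (-q * τ)) -
        ∫ q in Ioi (0 : ℝ), cutIm a b x q * Real.exp (-q * t)| ≤ B * (1 - x) * |τ - t| := by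
  obtain ⟨B, hB, h⟩ := exists_abs_cutIm_le ha hab
  have i1 := (integral_mul_exp_neg_mul hr).1
  have i2 := integrableOn_rpow_mul_exp_neg (β := 2) (by norm_num) hr
  set g : ℝ → ℝ := fun q => q * Real.exp (-(r * q)) + q ^ (2 : ℝ) * Real.exp (-(r * q)) with hg
  have hgi : IntegrableOn g (Ioi 0) := i1.add i2
  refine ⟨B * ∫ q in Ioi (0 : ℝ), g q, mul_nonneg hB (setIntegral_nonneg measurableSet_Ioi
    fun q hq => ?_), fun x hx τ t hτ ht => ?_⟩
  · have hq' : (0 : ℝ) < q := hq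
    have := Real.rpow_nonneg hq'.le 2
    positivity
  have hx1 := sub_nonneg.2 hx.2
  rw [← integral_sub (integrableOn_cutIm ha hab hx (hr.trans_le hτ))
    (integrableOn_cutIm ha hab hx (hr.trans_le ht)),
    show B * (∫ q in Ioi (0 : ℝ), g q) * (1 - x) * |τ - t| =
      B * (1 - x) * |τ - t| * ∫ q in Ioi (0 : ℝ), g q by ring, ← integral_const_mul]
  refine norm_integral_le_of_norm_le
    (f := fun q => cutIm a b x q * Real.exp (-q * τ) - cutIm a b x q * Real.exp (-q * t))
    (g := fun q => B * (1 - x) * |τ - t| * g q) (hgi.const_mul _) ?_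
  refine (ae_restrict_iff' measurableSet_Ioi).2 (ae_of_all _ fun q hq => ?_)
  have hq' : (0 : ℝ) < q := hq
  have h1 := (h x hx q hq).2
  have h2 := norm_cexp_mul_sub_le (p := (-q : ℝ)) (by simpa using hq'.le) hτ ht
  rw [← Complex.ofReal_mul, ← Complex.ofReal_mul, ← Complex.ofReal_exp, ← Complex.ofReal_exp,
    ← Complex.ofReal_sub, Complex.norm_real, Complex.norm_real, Complex.ofReal_re, norm_neg,
    Real.norm_eq_abs q, abs_of_pos hq', show -q * r = -(r * q) by ring] at h2
  rw [← mul_sub, norm_mul, Real.norm_eq_abs]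
  calc _ ≤ B * (1 - x) * (1 + q) * (q * Real.exp (-(r * q)) * |τ - t|) := by gcongr
    _ = _ := by
      rw [hg]
      simp only [Real.rpow_two]
      ring

/-- A derivative is bounded by a local Lipschitz constant, here on `t > t₀/2` for the given time
`t₀`. Since this is also the `x`-derivative of the stress, the stress extends to `x = 1` with
derivative zero there. -/
lemma exists_abs_impulseDeriv_le (ha : 0 < a) (hab : a < b) {t : ℝ} (ht : 0 < t) :
    ∃ B : ℝ, 0 ≤ B ∧ ∀ x ∈ Ico (0 : ℝ) 1, |impulseDeriv a b x t| ≤ B * (1 - x) := by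
  obtain ⟨B, hB, h⟩ := exists_pole_sum_lipschitz ha hab (half_pos ht)
  obtain ⟨B', hB', h'⟩ := exists_cut_integral_lipschitz ha hab (half_pos ht)
  refine ⟨B + 1 / Real.pi * B', by have := Real.pi_pos; positivity, fun x hx => ?_⟩
  have hpi := Real.pi_pos
  have hx1 : 0 ≤ 1 - x := by linarith [hx.2]
  refine (hasDerivAt_impulse ha hab
    (show |x| < 1 by rw [abs_of_nonneg hx.1]; exact hx.2) t).le_of_lip' (by positivity) ?_
  filter_upwards [Ioi_mem_nhds (half_lt_self ht)] with τ hτ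
  have hτ' : t / 2 < τ := hτ
  have h1 := h x ⟨hx.1, hx.2.le⟩ τ t hτ'.le (half_le_self ht.le)
  have h2 := h' x ⟨hx.1, hx.2.le⟩ τ t hτ'.le (half_le_self ht.le)
  rw [impulse_eq ha hab hx ((half_pos ht).trans hτ), impulse_eq ha hab hx ht,
    sub_sub_sub_comm, ← mul_sub, Real.norm_eq_abs, Real.norm_eq_abs]
  refine (abs_sub _ _).trans ?_
  rw [abs_mul, abs_of_pos (by positivity : 0 < 1 / Real.pi)]
  have := mul_le_mul_of_nonneg_left h2 (by positivity : 0 ≤ 1 / Real.pi)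
  linarith

/-- A function on `[0, 1)` whose derivative is `O (1 - x)` extends to `1` with derivative `0`. -/
lemma exists_hasDerivWithinAt_zero_of_deriv_le {f f' : ℝ → ℝ} {B : ℝ} (hB : 0 ≤ B)
    (hf : ∀ x ∈ Ico (0 : ℝ) 1, HasDerivAt f (f' x) x)
    (hf' : ∀ x ∈ Ico (0 : ℝ) 1, |f' x| ≤ B * (1 - x)) :
    ∃ L : ℝ, HasDerivWithinAt (fun x => if x < 1 then f x else L) 0 (Icc 0 1) 1 := by
  -- A Lipschitz extension to the whole line supplies the missing value at `1`; its derivative tends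
  -- to `0` there, which gives the one-sided derivative.
  obtain ⟨g, hg, hfg⟩ := ((convex_Ico (0 : ℝ) 1).lipschitzOnWith_of_nnnorm_hasDerivWithin_le
    (C := B.toNNReal) (fun x hx => (hf x hx).hasDerivWithinAt) fun x hx => by
      refine NNReal.coe_le_coe.1 ?_
      rw [coe_nnnorm, Real.coe_toNNReal B hB]
      refine (hf' x hx).trans ?_
      nlinarith [hx.1]).extend_real
  have hIoo : ∀ x ∈ Ioo (0 : ℝ) 1, HasDerivAt g (f' x) x := fun x hx =>
    (hf x ⟨hx.1.le, hx.2⟩).congr_of_eventuallyEq (by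
      filter_upwards [Ioo_mem_nhds hx.1 hx.2] with y hy using (hfg ⟨hy.1.le, hy.2⟩).symm)
  have hmem : Ioo (0 : ℝ) 1 ∈ 𝓝[<] 1 := Ioo_mem_nhdsLT zero_lt_one
  have h := hasDerivWithinAt_Iic_of_tendsto_deriv (f := g) (e := 0) (s := Ioo 0 1) (a := 1)
    (fun x hx => (hIoo x hx).differentiableAt.differentiableWithinAt)
    hg.continuous.continuousWithinAt hmem (by
      refine squeeze_zero_norm' (a := fun x => B * (1 - x)) ?_ ?_
      · filter_upwards [hmem] with x hx
        rw [(hIoo x hx).deriv]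
        exact hf' x ⟨hx.1.le, hx.2⟩
      · have : Continuous fun x : ℝ => B * (1 - x) := by fun_prop
        exact (this.tendsto' 1 0 (by simp)).mono_left nhdsWithin_le_nhds)
  refine ⟨g 1, (h.mono fun x hx => hx.2).congr (fun x hx => ?_) (by simp)⟩
  rcases hx.2.lt_or_eq with h1 | rfl
  · rw [if_pos h1, hfg ⟨hx.1, h1⟩]
  · simp

lemma exists_hasDerivWithinAt_unitStress_one (ha : 0 < a) (hab : a < b) {t : ℝ} (ht : 0 < t) :
    ∃ L : ℝ, HasDerivWithinAt (fun x => if x < 1 then unitStress a b x t else L) 0 (Icc 0 1) 1 := by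
  obtain ⟨B, hB, h⟩ := exists_abs_impulseDeriv_le ha hab ht
  exact exists_hasDerivWithinAt_zero_of_deriv_le hB (fun x hx => hasDerivAt_unitStress_left ha hab
    (by rw [abs_of_nonneg hx.1]; exact hx.2) t) h

/-! ### Existence -/

lemma rlDeriv_const_mul (α k : ℝ) (y : ℝ → ℝ) (t : ℝ) :
    rlDeriv α (fun τ => k * y τ) t = k * rlDeriv α y t := by
  simp only [rlDeriv, mul_div_assoc, intervalIntegral.integral_const_mul, deriv_const_mul_field]
  ring

/-- The displacement on the closed rod for the unit step datum. -/
def dispExt (a b x t : ℝ) : ℝ := if x < 1 then unitDisp a b x t else heaviside t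

lemma heaviside_of_pos {t : ℝ} (ht : 0 < t) : heaviside t = 1 := if_pos ht

lemma heaviside_of_nonpos {t : ℝ} (ht : t ≤ 0) : heaviside t = 0 := if_neg ht.not_gt

lemma dispExt_of_lt {x : ℝ} (hx : x < 1) : dispExt a b x = unitDisp a b x :=
  funext fun _ => if_pos hx

lemma dispExt_one : dispExt a b 1 = heaviside := funext fun _ => if_neg (lt_irrefl _)

lemma dispExt_eq_zero (ha : 0 < a) (hab : a < b) {x : ℝ} (hx : x ∈ Icc (0 : ℝ) 1) {t : ℝ}
    (ht : t ≤ 0) : dispExt a b x t = 0 := by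
  rcases hx.2.lt_or_eq with h1 | rfl
  · rw [dispExt_of_lt h1, (unit_eq_zero ha hab (by rwa [abs_of_nonneg hx.1]) ht).1]
  · rw [dispExt_one, heaviside_of_nonpos ht]

lemma iteratedDeriv_two_dispExt_one {t : ℝ} (ht : 0 < t) :
    iteratedDeriv 2 (dispExt a b 1) t = 0 := by
  have h : dispExt a b 1 =ᶠ[𝓝 t] fun _ => 1 := by
    filter_upwards [Ioi_mem_nhds ht] with τ hτ
    rw [dispExt_one, heaviside_of_pos hτ]
  rw [h.iteratedDeriv_eq, iteratedDeriv_const, if_neg two_ne_zero]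

lemma HasDerivAt.piecewise_lt_one {f : ℝ → ℝ} {d L x : ℝ} (hf : HasDerivAt f d x) (hx : x < 1) :
    HasDerivAt (fun y => if y < 1 then f y else L) d x :=
  hf.congr_of_eventuallyEq (by
    filter_upwards [Iio_mem_nhds hx] with y hy using if_pos hy)

/-- For `x < 1` the fields are `Υ₀` times the Bromwich integrals. At `x = 1` the displacement is the
step itself, so `∂ₜ²u = 0` for `t > 0`, in agreement with the vanishing one-sided derivative of the
stress. -/
theorem exists_isSolution (ha : 0 < a) (hab : a < b) (Υ₀ : ℝ) : ∃ σ ε : ℝ → ℝ → ℝ,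
    IsSolution a b (fun t => Υ₀ * heaviside t) (fun x t => Υ₀ * dispExt a b x t) σ ε := by
  -- End values of stress and, next, of strain are chosen separately for each time, as limits or
  -- one-sided derivatives when `t > 0` and as `0` otherwise; no regularity in time is demanded at
  -- `x = 1`.
  have hs : ∀ t : ℝ, ∃ L : ℝ, (0 < t → HasDerivWithinAt
      (fun x => if x < 1 then unitStress a b x t else L) 0 (Icc 0 1) 1) ∧ (t < 0 → L = 0) :=
    fun t => by
      rcases lt_or_ge 0 t with ht | ht
      · obtain ⟨L, hL⟩ := exists_hasDerivWithinAt_unitStress_one ha hab ht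
        exact ⟨L, fun _ => hL, fun h => absurd h ht.not_gt⟩
      · exact ⟨0, fun h => absurd h ht.not_gt, fun _ => rfl⟩
  have he : ∀ t : ℝ, ∃ d : ℝ, (0 < t → HasDerivWithinAt
      (fun x => dispExt a b x t) d (Icc 0 1) 1) ∧ (t < 0 → d = 0) :=
    fun t => by
      rcases lt_or_ge 0 t with ht | ht
      · obtain ⟨d, hd⟩ := exists_hasDerivWithinAt_unitDisp_one ha hab ht
        refine ⟨d, fun _ => ?_, fun h => absurd h ht.not_gt⟩
        simpa only [dispExt, heaviside_of_pos ht] using hd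
      · exact ⟨0, fun h => absurd h ht.not_gt, fun _ => rfl⟩
  choose S hS hS0 using hs
  choose E hE hE0 using he
  have habs : ∀ {x : ℝ}, x ∈ Icc (0 : ℝ) 1 → x < 1 → |x| < 1 := fun hx h1 => by
    rwa [abs_of_nonneg hx.1]
  have habs' : ∀ {x : ℝ}, x ∈ Ico (0 : ℝ) 1 → |x| < 1 := fun hx => by
    rw [abs_of_nonneg hx.1]
    exact hx.2
  set σ : ℝ → ℝ → ℝ := fun x t => Υ₀ * if x < 1 then unitStress a b x t else S t with hσ
  set ε : ℝ → ℝ → ℝ := fun x t => Υ₀ * if x < 1 then unitStrain a b x t else E t with hε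
  have hu' : ∀ {x : ℝ}, x < 1 →
      (fun t => Υ₀ * dispExt a b x t) = fun t => Υ₀ * unitDisp a b x t := fun h => by
    rw [dispExt_of_lt h]
  have hσ' : ∀ {x : ℝ}, x < 1 → σ x = fun t => Υ₀ * unitStress a b x t := fun h =>
    funext fun t => by rw [hσ]; simp only [if_pos h]
  have hε' : ∀ {x : ℝ}, x < 1 → ε x = fun t => Υ₀ * unitStrain a b x t := fun h =>
    funext fun t => by rw [hε]; simp only [if_pos h]
  have htwo : ∀ {x : ℝ}, x ∈ Icc (0 : ℝ) 1 → x < 1 → ∀ t : ℝ,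
      iteratedDeriv 2 (fun t => Υ₀ * dispExt a b x t) t = Υ₀ * impulseDeriv a b x t :=
    fun hx h1 t => by
      rw [hu' h1, iteratedDeriv_const_mul_field, iteratedDeriv_two_unitDisp ha hab (habs hx h1)]
  refine ⟨σ, ε, ?_, ?_, ?_, ?_, ?_, ?_, ?_, ?_, ?_⟩
  · intro x hx t ht
    refine ⟨by rw [dispExt_eq_zero ha hab hx ht.le, mul_zero], ?_, ?_⟩
    · rcases hx.2.lt_or_eq with h1 | rfl
      · simp only [hσ' h1, (unit_eq_zero ha hab (habs hx h1) ht.le).2.1, mul_zero]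
      · simp [hσ, hS0 t ht]
    · rcases hx.2.lt_or_eq with h1 | rfl
      · simp only [hε' h1, (unit_eq_zero ha hab (habs hx h1) ht.le).2.2, mul_zero]
      · simp [hε, hE0 t ht]
  · intro x hx
    have hxa := habs' hx
    rw [hu' hx.2, hσ' hx.2, hε' hx.2]
    exact ⟨(contDiff_const.mul (contDiff_infty.1 (contDiff_unitDisp ha hab hxa) 2)).contDiffOn,
      (contDiff_const.mul (contDiff_infty.1 (contDiff_unitStress ha hab hxa) 1)).contDiffOn,
      (contDiff_const.mul (contDiff_infty.1 (contDiff_unitStrain ha hab hxa) 1)).contDiffOn⟩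
  · intro x hx t ht
    rcases hx.2.lt_or_eq with h1 | rfl
    · rw [htwo hx h1]
      exact (((hasDerivAt_unitStress_left ha hab (habs hx h1) t).piecewise_lt_one h1).const_mul
        Υ₀).hasDerivWithinAt
    · rw [iteratedDeriv_const_mul_field, iteratedDeriv_two_dispExt_one ht]
      exact (hS t ht).const_mul Υ₀
  · intro x hx t ht
    rw [hσ' hx.2, hε' hx.2]
    simp_rw [rlDeriv_const_mul, mul_left_comm _ Υ₀, intervalIntegral.integral_const_mul]
    rw [unit_constitutive ha hab (habs' hx) ht]
  · intro x hx t ht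
    rcases hx.2.lt_or_eq with h1 | rfl
    · rw [hε' h1]
      exact (((hasDerivAt_unitDisp_left ha hab (habs hx h1) t).piecewise_lt_one h1).const_mul
        Υ₀).hasDerivWithinAt
    · simp only [hε, lt_irrefl, if_false]
      exact (hE t ht).const_mul Υ₀
  · intro x hx
    obtain ⟨h1, h2, h3⟩ := unit_eq_zero ha hab (habs' hx) le_rfl
    rw [hu' hx.2]
    simp only [hσ' hx.2, hε' hx.2, h2, h3, dispExt_of_lt hx.2, h1]
    refine ⟨mul_zero _, ?_, mul_zero _, mul_zero _⟩
    have := ((hasDerivAt_unitDisp ha hab (habs' hx) 0).const_mul Υ₀).hasDerivWithinAt (s := Ici 0)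
    rwa [impulse_eq_zero ha hab (habs' hx) le_rfl, mul_zero] at this
  · intro t
    rw [dispExt_of_lt zero_lt_one, unitDisp_zero, mul_zero]
  · intro t
    rw [dispExt_one]
  · refine ⟨2, two_pos, fun x₀ hx₀ => ?_, ?_⟩
    · obtain ⟨K, hK, h⟩ := exists_unit_growth ha hab hx₀.2
      refine ⟨|Υ₀| * K, fun x hx t ht => ?_⟩
      have hx1 : x < 1 := hx.2.trans_lt hx₀.2
      obtain ⟨h1, h2, h3⟩ := h x (by rw [abs_of_nonneg hx.1]; exact hx.2) t
      rw [htwo ⟨hx.1, hx1.le⟩ hx1, hσ' hx1, hε' hx1, deriv_const_mul_field, deriv_const_mul_field,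
        abs_mul, abs_mul, abs_mul]
      have h0 := abs_nonneg Υ₀
      simp_rw [mul_assoc]
      exact ⟨by gcongr, by gcongr, by gcongr⟩
    · refine (tendsto_lintegral_unitDisp_sub_one ha hab Υ₀).congr' ?_
      filter_upwards [self_mem_nhdsWithin] with x hx
      refine setLIntegral_congr_fun measurableSet_Ioi fun t ht => ?_
      rw [dispExt_of_lt hx, heaviside_of_pos ht, mul_one]

/-! ### The explicit form of the displacement -/

lemma cutRatio_neg_pi {q : ℝ} (hq : 0 < q) (x : ℝ) :
    cutRatio a b x (-Real.pi) q = (starRingEnd ℂ) (cutRatio a b x Real.pi q) := by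
  rw [cutRatio_eq hq x (by rw [abs_neg, abs_of_pos Real.pi_pos]),
    cutRatio_eq hq x (abs_of_pos Real.pi_pos), ← sinhRatio_conj,
    ← expSM_conj a b (by rw [line_im, abs_of_pos Real.pi_pos])]
  simp

lemma cutJump_eq {q : ℝ} (hq : 0 < q) (x : ℝ) :
    cutJump a b x q = -2 * Complex.I * cutIm a b x q := by
  rw [cutJump, cutRatio_neg_pi hq, cutIm, ← neg_sub, Complex.sub_conj]
  push_cast
  ring

lemma integral_cutJump_mul (x : ℝ) {φ : ℝ → ℝ} {ψ : ℝ → ℂ} (hψ : ∀ q, ψ q = φ q)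
    (h : IntegrableOn (fun q => cutIm a b x q * φ q) (Ioi 0)) :
    IntegrableOn (fun q => cutJump a b x q * ψ q) (Ioi 0) ∧
      1 / (2 * Real.pi * Complex.I) * ∫ q in Ioi (0 : ℝ), cutJump a b x q * ψ q =
        ((-(1 / Real.pi * ∫ q in Ioi (0 : ℝ), cutIm a b x q * φ q) : ℝ) : ℂ) := by
  have he : EqOn (fun q => cutJump a b x q * ψ q)
      (fun q => -2 * Complex.I * ((cutIm a b x q * φ q : ℝ) : ℂ)) (Ioi 0) := fun q hq => by
    simp only [cutJump_eq hq, hψ]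
    push_cast
    ring
  refine ⟨IntegrableOn.congr_fun (h.ofReal.const_mul _) he.symm measurableSet_Ioi, ?_⟩
  rw [setIntegral_congr_fun measurableSet_Ioi he, integral_const_mul, integral_complex_ofReal]
  have : (Real.pi : ℂ) ≠ 0 := by exact_mod_cast Real.pi_ne_zero
  have := Complex.I_ne_zero
  push_cast
  field_simp

lemma residueP_add_residueP_conj (ha : 0 < a) (hab : a < b) (x t : ℝ) (n : ℕ) :
    residueP a b x t (pole a b (n + 1)) +
      residueP a b x t ((starRingEnd ℂ) (pole a b (n + 1))) =
      ((2 * (poleTerm a b x t (n + 1)).re : ℝ) : ℂ) := by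
  rw [residueP_pole ha hab x t (Nat.le_add_left 1 n),
    residueP_conj_pole ha hab x t (Nat.le_add_left 1 n), Complex.add_conj]

lemma residueSeries_eq (ha : 0 < a) (hab : a < b) (x t : ℝ) :
    residueSeries a b (pole a b) (fun n => (starRingEnd ℂ) (pole a b n)) x t =
      ((∑' n : ℕ, 2 * (poleTerm a b x t (n + 1)).re : ℝ) : ℂ) := by
  simp only [residueSeries, residueP_add_residueP_conj ha hab]
  rw [Complex.ofReal_tsum]

lemma integrableOn_cutIm_Ioi (ha : 0 < a) (hab : a < b) {x : ℝ} (hx : x ∈ Ico (0 : ℝ) 1) :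
    IntegrableOn (cutIm a b x) (Ioi 0) := by
  obtain ⟨c, C, hc, hC, h⟩ := exists_norm_cutRatio_pi_le ha hab
  have hm : AEStronglyMeasurable (cutIm a b x) (volume.restrict (Ioi 0)) :=
    (Complex.continuous_im.comp_continuousOn
      (continuousOn_cutRatio ha hab x)).aestronglyMeasurable measurableSet_Ioi
  refine ((integrableOn_exp_neg_mul (mul_pos (sub_pos.2 hx.2) hc)).const_mul C).mono' hm ?_
  exact (ae_restrict_iff' measurableSet_Ioi).2 (ae_of_all _ fun q hq =>
    (Complex.abs_im_le_norm _).trans (h x ⟨hx.1, hx.2.le⟩ q hq))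

lemma integral_exp_neg_mul_interval {q : ℝ} (hq : 0 < q) (t : ℝ) :
    ∫ τ in (0 : ℝ)..t, Real.exp (-q * τ) = (1 - Real.exp (-q * t)) / q := by
  rw [intervalIntegral.integral_comp_mul_left (fun y => Real.exp y) (neg_ne_zero.2 hq.ne'),
    integral_exp, mul_zero, Real.exp_zero, smul_eq_mul]
  field_simp
  ring

lemma integrable_cutIm_prod (ha : 0 < a) (hab : a < b) {x : ℝ} (hx : x ∈ Ico (0 : ℝ) 1) (t : ℝ) :
    Integrable (fun p : ℝ × ℝ => cutIm a b x p.2 * Real.exp (-p.2 * p.1))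
      ((volume.restrict (Ioc 0 t)).prod (volume.restrict (Ioi 0))) := by
  have h0 := integrableOn_cutIm_Ioi ha hab hx
  have h1 : Integrable (fun p : ℝ × ℝ => cutIm a b x p.2)
      ((volume.restrict (Ioc 0 t)).prod (volume.restrict (Ioi 0))) := h0.comp_snd _
  refine h1.norm.mono' (h1.aestronglyMeasurable.mul (by fun_prop)) ?_
  rw [Measure.prod_restrict]
  refine (ae_restrict_iff' (measurableSet_Ioc.prod measurableSet_Ioi)).2
    (ae_of_all _ fun p hp => ?_)
  rw [norm_mul, Real.norm_eq_abs (Real.exp _), Real.abs_exp]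
  refine mul_le_of_le_one_right (norm_nonneg _) (Real.exp_le_one_iff.2 ?_)
  have h2 : (0 : ℝ) < p.1 := hp.1.1
  have h3 : (0 : ℝ) < p.2 := hp.2
  nlinarith

/-- For `x < 1` the density `cutIm` is integrable on the whole cut, so Fubini integrates the cut
part over `(0, t]`. The residue part is then obtained by difference. -/
lemma unitDisp_eq_explicit (ha : 0 < a) (hab : a < b) {x : ℝ} (hx : x ∈ Ico (0 : ℝ) 1) {t : ℝ}
    (ht : 0 < t) :
    IntegrableOn (fun q => cutIm a b x q * ((1 - Real.exp (-q * t)) / q)) (Ioi 0) ∧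
      IntervalIntegrable (fun τ => ∑' n : ℕ, 2 * (poleTerm a b x τ (n + 1)).re) volume 0 t ∧
      unitDisp a b x t = (∫ τ in (0 : ℝ)..t, ∑' n : ℕ, 2 * (poleTerm a b x τ (n + 1)).re) -
        1 / Real.pi * ∫ q in Ioi (0 : ℝ), cutIm a b x q * ((1 - Real.exp (-q * t)) / q) := by
  have hxa : |x| < 1 := by rw [abs_of_nonneg hx.1]; exact hx.2
  have hp := integrable_cutIm_prod ha hab hx t
  have hinner : ∀ q ∈ Ioi (0 : ℝ), (∫ τ in Ioc 0 t, cutIm a b x q * Real.exp (-q * τ)) =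
      cutIm a b x q * ((1 - Real.exp (-q * t)) / q) := fun q hq => by
    rw [integral_const_mul, ← intervalIntegral.integral_of_le ht.le,
      integral_exp_neg_mul_interval hq]
  have hi1 : IntegrableOn (fun q => cutIm a b x q * ((1 - Real.exp (-q * t)) / q)) (Ioi 0) :=
    IntegrableOn.congr_fun hp.integral_prod_right hinner measurableSet_Ioi
  have hi2 : IntervalIntegrable
      (fun τ => ∫ q in Ioi (0 : ℝ), cutIm a b x q * Real.exp (-q * τ)) volume 0 t :=
    (intervalIntegrable_iff_integrableOn_Ioc_of_le ht.le).2 hp.integral_prod_left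
  have hi3 : IntervalIntegrable (impulse a b x) volume 0 t :=
    (contDiff_impulse ha hab hxa).continuous.intervalIntegrable 0 t
  -- The series is not estimated up to `τ = 0`: its sum is the impulse response plus the cut
  -- integral, both integrable on `(0, t]`, and inherits integrability from them.
  have he : EqOn (fun τ => impulse a b x τ +
      1 / Real.pi * ∫ q in Ioi (0 : ℝ), cutIm a b x q * Real.exp (-q * τ))
      (fun τ => ∑' n : ℕ, 2 * (poleTerm a b x τ (n + 1)).re) (Ioc 0 t) := fun τ hτ => by
    simp only [impulse_eq ha hab hx hτ.1]
    ring
  have hi4 := hi3.add (hi2.const_mul (1 / Real.pi))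
  have hsum : (∫ τ in (0 : ℝ)..t, ∑' n : ℕ, 2 * (poleTerm a b x τ (n + 1)).re) =
      (∫ τ in (0 : ℝ)..t, impulse a b x τ) + 1 / Real.pi *
        ∫ τ in (0 : ℝ)..t, ∫ q in Ioi (0 : ℝ), cutIm a b x q * Real.exp (-q * τ) := by
    rw [← intervalIntegral.integral_const_mul,
      ← intervalIntegral.integral_add hi3 (hi2.const_mul _),
      intervalIntegral.integral_of_le ht.le, intervalIntegral.integral_of_le ht.le]
    exact (setIntegral_congr_fun measurableSet_Ioc he).symm
  have hswap : (∫ τ in (0 : ℝ)..t, ∫ q in Ioi (0 : ℝ), cutIm a b x q * Real.exp (-q * τ)) =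
      ∫ q in Ioi (0 : ℝ), cutIm a b x q * ((1 - Real.exp (-q * t)) / q) := by
    rw [intervalIntegral.integral_of_le ht.le, integral_integral_swap hp]
    exact setIntegral_congr_fun measurableSet_Ioi hinner
  refine ⟨hi1, ?_, ?_⟩
  · rw [intervalIntegrable_iff_integrableOn_Ioc_of_le ht.le] at hi4 ⊢
    exact IntegrableOn.congr_fun hi4 he measurableSet_Ioc
  · rw [hsum, hswap, unitDisp_eq_integral ha hab hxa]
    ring

lemma causalConv_heaviside (ha : 0 < a) (hab : a < b) {x : ℝ} (hx : x ∈ Ico (0 : ℝ) 1) (Υ₀ t : ℝ) :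
    causalConv (fun τ => Υ₀ * heaviside τ) (impulse a b x) t = Υ₀ * unitDisp a b x t := by
  have hxa : |x| < 1 := by rw [abs_of_nonneg hx.1]; exact hx.2
  rw [causalConv]
  rcases le_or_gt t 0 with ht | ht
  · rw [(unit_eq_zero ha hab hxa ht).1, intervalIntegral.integral_symm,
      intervalIntegral.integral_of_le ht, setIntegral_congr_fun (g := fun _ => (0 : ℝ))
        measurableSet_Ioc fun τ hτ => by simp [heaviside_of_nonpos hτ.2]]
    simp
  · rw [unitDisp_eq_integral ha hab hxa, ← intervalIntegral.integral_const_mul,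
      intervalIntegral.integral_of_le ht.le,
      setIntegral_congr_fun (g := fun τ => Υ₀ * impulse a b x (t - τ)) measurableSet_Ioc
        fun τ hτ => by simp only [heaviside_of_pos hτ.1, mul_one],
      ← intervalIntegral.integral_of_le ht.le,
      intervalIntegral.integral_comp_sub_left (fun τ => Υ₀ * impulse a b x τ)]
    simp

/-! ### Poles, residues and impulse response in the form of the main statement -/

lemma eq_pole_iff (ha : 0 < a) (hab : a < b) {n : ℕ} (hn : 1 ≤ n) {s : ℂ}
    (hs : s ∈ Complex.slitPlane) :
    s * M a b s = n * Real.pi * Complex.I ↔ s = pole a b n :=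
  ⟨eq_pole ha hab hs hn, fun h => by rw [h, pole_mul_M ha hab hn]⟩

lemma eq_conj_pole_iff (ha : 0 < a) (hab : a < b) {n : ℕ} (hn : 1 ≤ n) {s : ℂ}
    (hs : s ∈ Complex.slitPlane) :
    s * M a b s = -(n * Real.pi * Complex.I) ↔ s = (starRingEnd ℂ) (pole a b n) :=
  ⟨eq_conj_pole ha hab hs hn, fun h => by
    rw [h, M_conj (pole_mem_slitPlane ha hab n), pole_mul_M ha hab hn]
    simp⟩

lemma deriv_sinh_mul_M_conj_pole_ne_zero (ha : 0 < a) (hab : a < b) {n : ℕ} (hn : 1 ≤ n) :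
    deriv (fun s => Complex.sinh (s * M a b s)) ((starRingEnd ℂ) (pole a b n)) ≠ 0 := by
  rw [deriv_sinh_mul_M_conj a b (pole_mem_slitPlane ha hab n)]
  simpa using (deriv_sinh_mul_M_pole ha hab hn).2

lemma residueP_eq_of_pole (ha : 0 < a) (hab : a < b) (x t : ℝ) {n : ℕ} (hn : 1 ≤ n) {z : ℂ}
    (hz : z = pole a b n ∨ z = (starRingEnd ℂ) (pole a b n)) :
    residueP a b x t z = Complex.sinh (x * z * M a b z) /
      deriv (fun s => Complex.sinh (s * M a b s)) z * Complex.exp (z * t) := by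
  have hs := pole_mem_slitPlane ha hab n
  have h0 : Complex.sinh (pole a b n * M a b (pole a b n)) = 0 := by
    rw [pole_mul_M ha hab hn, sinh_nat_mul_pi_mul_I]
  rcases hz with rfl | rfl
  · exact residueP_eq a b x t hs h0 (deriv_sinh_mul_M_pole ha hab hn).2
  · exact residueP_eq a b x t (conj_mem_slitPlane hs)
      (by rw [M_conj hs, Complex.sinh_conj, h0, map_zero])
      (deriv_sinh_mul_M_conj_pole_ne_zero ha hab hn)

lemma impulseExt_explicit (ha : 0 < a) (hab : a < b) {x t : ℝ} (hx : x ∈ Icc (0 : ℝ) 1)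
    (ht : 0 < t) :
    IntegrableOn (fun q : ℝ => cutJump a b x q * Complex.exp (-q * t)) (Ioi 0) ∧
      (impulseExt a b x t : ℂ) = 1 / (2 * Real.pi * Complex.I) *
        (∫ q in Ioi (0 : ℝ), cutJump a b x q * Complex.exp (-q * t)) +
        residueSeries a b (pole a b) (fun n => (starRingEnd ℂ) (pole a b n)) x t := by
  obtain ⟨h1, h2⟩ := integral_cutJump_mul x (ψ := fun q : ℝ => Complex.exp (-q * t))
    (fun q => by push_cast; rfl) (integrableOn_cutIm ha hab hx ht)
  refine ⟨h1, ?_⟩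
  rw [h2, residueSeries_eq ha hab, impulseExt_eq ha hab hx ht, ← Complex.ofReal_add]
  congr 1
  ring

end DistributedOrderRod

end

theorem mainTheorem1 (a b Υ₀ : ℝ) (ha : 0 < a) (hab : a < b) :
    ∃ (sp sm : ℕ → ℂ) (P : ℝ → ℝ → ℝ) (u σ ε : ℝ → ℝ → ℝ),
      -- the poles: `sp n`, `sm n` are the solutions of `s M(s) = ± n i π`, and they are simple
      (∀ n : ℕ, 1 ≤ n →
        sp n ∈ Complex.slitPlane ∧ sm n ∈ Complex.slitPlane ∧
        sm n = (starRingEnd ℂ) (sp n) ∧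
        (∀ s ∈ Complex.slitPlane, s * M a b s = n * Real.pi * Complex.I ↔ s = sp n) ∧
        (∀ s ∈ Complex.slitPlane, s * M a b s = -(n * Real.pi * Complex.I) ↔ s = sm n) ∧
        deriv (fun s => Complex.sinh (s * M a b s)) (sp n) ≠ 0 ∧
        deriv (fun s => Complex.sinh (s * M a b s)) (sm n) ≠ 0) ∧
      -- the residues
      (∀ x ∈ Icc (0 : ℝ) 1, ∀ t : ℝ, 0 < t → ∀ n : ℕ, 1 ≤ n → ∀ z : ℂ, z = sp n ∨ z = sm n →
        residueP a b x t z = Complex.sinh (x * z * M a b z) /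
          deriv (fun s => Complex.sinh (s * M a b s)) z * Complex.exp (z * t)) ∧
      -- the explicit form of `P` for `t > 0`, and `P = 0` for `t < 0`
      (∀ x ∈ Icc (0 : ℝ) 1, ∀ t : ℝ, 0 < t →
        IntegrableOn (fun q : ℝ => cutJump a b x q * Complex.exp (-q * t)) (Ioi 0) ∧
        Summable (fun n : ℕ => residueP a b x t (sp (n + 1)) + residueP a b x t (sm (n + 1))) ∧
        (P x t : ℂ) =
          1 / (2 * Real.pi * Complex.I) *
              (∫ q in Ioi (0 : ℝ), cutJump a b x q * Complex.exp (-q * t)) +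
            residueSeries a b sp sm x t) ∧
      (∀ x ∈ Icc (0 : ℝ) 1, ∀ t : ℝ, t < 0 → P x t = 0) ∧
      -- regularity of `P`
      (∀ x ∈ Icc (0 : ℝ) 1, LocallyIntegrable (P x) ∧ ContDiffOn ℝ ∞ (P x) (Ioi 0)) ∧
      -- the Laplace transform of `P` is `P̃`
      (∀ x ∈ Ico (0 : ℝ) 1, ∀ s : ℂ, 0 < s.re →
        IntegrableOn (fun t : ℝ => (P x t : ℂ) * Complex.exp (-s * t)) (Ioi 0) ∧
        ∫ t in Ioi (0 : ℝ), (P x t : ℂ) * Complex.exp (-s * t) = Ptilde a b x s) ∧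
      -- `u` is the solution, existence and uniqueness
      IsSolution a b (fun t => Υ₀ * heaviside t) u σ ε ∧
      (∀ u' σ' ε' : ℝ → ℝ → ℝ, IsSolution a b (fun t => Υ₀ * heaviside t) u' σ' ε' →
        ∀ x ∈ Icc (0 : ℝ) 1, ∀ t : ℝ, u' x t = u x t) ∧
      -- `u = Υ₀ H ∗ P`
      (∀ x ∈ Ico (0 : ℝ) 1, ∀ t : ℝ, u x t = causalConv (fun τ => Υ₀ * heaviside τ) (P x) t) ∧
      -- the explicit form of `u`
      (∀ x ∈ Ico (0 : ℝ) 1, ∀ t : ℝ, 0 < t →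
        IntegrableOn (fun q : ℝ => cutJump a b x q * ((1 - Complex.exp (-q * t)) / q)) (Ioi 0) ∧
        IntervalIntegrable (fun τ => residueSeries a b sp sm x τ) volume 0 t ∧
        (u x t : ℂ) =
          Υ₀ / (2 * Real.pi * Complex.I) *
              (∫ q in Ioi (0 : ℝ), cutJump a b x q * ((1 - Complex.exp (-q * t)) / q)) +
            Υ₀ * ∫ τ in (0 : ℝ)..t, residueSeries a b sp sm x τ) ∧
      (∀ x ∈ Icc (0 : ℝ) 1, ∀ t : ℝ, t < 0 → u x t = 0) ∧
      (∀ x ∈ Ico (0 : ℝ) 1, ContinuousAt (u x) 0) := by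
  obtain ⟨σ, ε, hsol⟩ := exists_isSolution ha hab Υ₀
  have habs : ∀ x ∈ Ico (0 : ℝ) 1, |x| < 1 := fun x hx => by
    rw [abs_of_nonneg hx.1]
    exact hx.2
  -- At `x = 1` the function chosen for `P` is zero: there `P̃ = 1` is the transform of a Dirac
  -- mass, which leaves no trace for `t > 0`, and both the residues and the cut density vanish.
  refine ⟨pole a b, fun n => (starRingEnd ℂ) (pole a b n), impulseExt a b,
    fun x t => Υ₀ * dispExt a b x t, σ, ε, fun n hn => ?_, fun x _ t _ n hn z hz =>
    residueP_eq_of_pole ha hab x t hn hz, fun x hx t ht => ?_, fun x hx t ht => ?_,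
    fun x hx => ?_, fun x hx s hs => ?_, hsol,
    fun u' σ' ε' h' x hx t => IsSolution.unique ha hab hsol h' hx t,
    fun x hx t => ?_, fun x hx t ht => ?_, fun x hx t ht => ?_, fun x hx => ?_⟩
  · exact ⟨pole_mem_slitPlane ha hab n, conj_mem_slitPlane (pole_mem_slitPlane ha hab n), rfl,
      fun s hs => eq_pole_iff ha hab hn hs, fun s hs => eq_conj_pole_iff ha hab hn hs,
      (deriv_sinh_mul_M_pole ha hab hn).2, deriv_sinh_mul_M_conj_pole_ne_zero ha hab hn⟩
  · obtain ⟨h1, h2⟩ := impulseExt_explicit ha hab hx ht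
    refine ⟨h1, ?_, h2⟩
    simp only [residueP_add_residueP_conj ha hab]
    exact Complex.ofRealCLM.summable ((Complex.reCLM.summable
      (summable_norm_poleTerm ha hab x ht).of_norm).mul_left 2)
  · rcases hx.2.lt_or_eq with h1 | rfl
    · rw [impulseExt_of_lt h1, impulse_eq_zero ha hab (habs x ⟨hx.1, h1⟩) ht.le]
    · exact impulseExt_one a b t
  · rcases hx.2.lt_or_eq with h1 | rfl
    · have h := contDiff_impulse ha hab (habs x ⟨hx.1, h1⟩)
      rw [impulseExt_of_lt h1]
      exact ⟨h.continuous.locallyIntegrable, h.contDiffOn⟩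
    · rw [show impulseExt a b 1 = fun _ => 0 from funext (impulseExt_one a b)]
      exact ⟨continuous_const.locallyIntegrable, contDiffOn_const⟩
  · rw [impulseExt_of_lt hx.2]
    exact laplace_impulse ha hab (habs x hx) hs
  · simp only [impulseExt_of_lt hx.2, causalConv_heaviside ha hab hx, dispExt_of_lt hx.2]
  · obtain ⟨h1, h2, h3⟩ := unitDisp_eq_explicit ha hab hx ht
    obtain ⟨h4, h5⟩ := integral_cutJump_mul x
      (ψ := fun q : ℝ => (1 - Complex.exp (-q * t)) / q) (fun q => by push_cast; rfl) h1
    simp only [residueSeries_eq ha hab]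
    refine ⟨h4, ⟨h2.1.ofReal, h2.2.ofReal⟩, ?_⟩
    rw [intervalIntegral.integral_ofReal, dispExt_of_lt hx.2, h3, Complex.ofReal_mul,
      sub_eq_neg_add, Complex.ofReal_add, ← h5]
    ring
  · simp only [dispExt_eq_zero ha hab hx ht.le, mul_zero]
  · simp only [dispExt_of_lt hx.2]
    exact (continuous_const.mul (contDiff_unitDisp ha hab (habs x hx)).continuous).continuousAt
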